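/- Let $\alpha,\beta\in\mathbb R$ with $\beta\neq 0$, $\gamma\in\mathbb C$, $s>-1/4$ and $7/12<b<11/12$. Consider the initial value problem $$\partial_t u+i\alpha\,\partial_x^2u+\beta\,\partial_x^3u+i\gamma|u|^2u=0,\qquad u(x,0)=u_0(x),\qquad x,t\in\mathbb R, \qquad (*)$$ for complex-valued $u$. Let $X^{s,b}$ be the space of tempered distributions $U$ on $\mathbb R^2$ whose Fourier transform is a function with $\langle\xi\rangle^s\langle\tau-\alpha\xi^2-\beta\xi^3\rangle^b\,\widehat U(\xi,\tau)\in L^2(\mathbb R^2)$, where $\langle y\rangle=1+|y|$, and let $X^{s,b}_T$ be the space of restrictions of its elements to $\{(x,t):|t|<T\}$. A solution of $(*)$ on $[-T,T]$ is a curve $u\in C([-T,T];H^s(\mathbb R))\cap X^{s,b}_T$ with $u(0)=u_0$ that on $\{|t|<T\}$ is a function in $L^3_{\mathrm{loc}}$ and satisfies the equation in the sense of distributions. Then $(*)$ is locally well-posed in $H^s(\mathbb R)$: 1. (Existence, persistence, continuous dependence.) For every $R>0$ there is $T>0$ such that every $u_0\in H^s(\mathbb R)$ with $\|u_0\|_{H^s}\le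 R$ has a solution $u\in C([-T,T];H^s(\mathbb R))\cap X^{s,b}_T$ of $(*)$ on $[-T,T]$, and the map $u_0\mapsto u$ is continuous from $\{u_0\in H^s(\mathbb R):\|u_0\|_{H^s}\le R\}$ to $C([-T,T];H^s(\mathbb R))$. 2. (Uniqueness.) For every $T>0$ and every $u_0\in H^s(\mathbb R)$ there is at most one solution of $(*)$ on $[-T,T]$ in $C([-T,T];H^s(\mathbb R))\cap X^{s,b}_T$. -/

import Mathlib

open MeasureTheory FourierTransform
open scoped SchwartzMap LineDeriv

noncomputable section

/-! ### The Sobolev space `H^s(ℝ)` -/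

/-- The tempered distributions on `ℝ` of class `H^s`, as a complex vector space. -/
def sobolevSubmodule (s : ℝ) : Submodule ℂ 𝓢'(ℝ, ℂ) where
  carrier := {f | TemperedDistribution.MemSobolev s 2 f}
  add_mem' hf hg := hf.add hg
  zero_mem' := TemperedDistribution.memSobolev_fun_zero ℝ ℂ s 2
  smul_mem' c _ hf := hf.smul c

/-- The space `H^s(ℝ)` of complex-valued distributions. It carries the Sobolev norm below (not the
topology induced from the tempered distributions). -/
def Hs (s : ℝ) : Type := sobolevSubmodule s

namespace Hs

variable {s : ℝ}

instance : AddCommGroup (Hs s) := inferInstanceAs (AddCommGroup (sobolevSubmodule s))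

instance : Module ℂ (Hs s) := inferInstanceAs (Module ℂ (sobolevSubmodule s))

/-- The tempered distribution underlying an element of `H^s(ℝ)`. -/
def toDistribution (f : Hs s) : 𝓢'(ℝ, ℂ) := f.1

theorem exists_bessel (f : Hs s) :
    ∃ g : Lp ℂ 2 (volume : Measure ℝ),
      TemperedDistribution.besselPotential ℝ ℂ s f.toDistribution = g := f.2

theorem lp_toTemperedDistribution_injective {g h : Lp ℂ 2 (volume : Measure ℝ)}
    (H : (g : 𝓢'(ℝ, ℂ)) = h) : g = h := by
  have hker := Lp.ker_toTemperedDistributionCLM_eq_bot (F := ℂ) (E := ℝ) (μ := volume) (p := 2)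
  exact (LinearMap.ker_eq_bot.mp hker) H

/-- The `L²` function `⟨D⟩^s f` attached to `f ∈ H^s(ℝ)`, that is, the function whose Fourier
transform is `(1 + |ξ|²)^{s/2}` times that of `f`. -/
def bessel : Hs s →ₗ[ℂ] Lp ℂ 2 (volume : Measure ℝ) where
  toFun f := f.exists_bessel.choose
  map_add' f g := by
    apply lp_toTemperedDistribution_injective
    rw [← (f + g).exists_bessel.choose_spec, ← Lp.toTemperedDistributionCLM_apply, map_add,
      Lp.toTemperedDistributionCLM_apply, Lp.toTemperedDistributionCLM_apply,
      ← f.exists_bessel.choose_spec, ← g.exists_bessel.choose_spec, ← map_add]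
    rfl
  map_smul' c f := by
    apply lp_toTemperedDistribution_injective
    rw [← (c • f).exists_bessel.choose_spec, ← Lp.toTemperedDistributionCLM_apply, map_smul,
      Lp.toTemperedDistributionCLM_apply, RingHom.id_apply,
      ← f.exists_bessel.choose_spec, ← map_smul]
    rfl

theorem bessel_spec (f : Hs s) :
    TemperedDistribution.besselPotential ℝ ℂ s f.toDistribution = (bessel f : 𝓢'(ℝ, ℂ)) :=
  f.exists_bessel.choose_spec

theorem bessel_injective : Function.Injective (bessel : Hs s → Lp ℂ 2 (volume : Measure ℝ)) := by
  intro f g h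
  have h' : TemperedDistribution.besselPotential ℝ ℂ s f.toDistribution =
      TemperedDistribution.besselPotential ℝ ℂ s g.toDistribution := by
    rw [bessel_spec, bessel_spec, h]
  have h2 := congrArg (TemperedDistribution.besselPotential ℝ ℂ (-s)) h'
  simp only [TemperedDistribution.besselPotential_besselPotential_apply, add_neg_cancel,
    TemperedDistribution.besselPotential_zero] at h2
  exact Subtype.ext h2

/-- The norm of `H^s(ℝ)`: `‖f‖ = ‖(1 + |ξ|²)^{s/2} f̂‖_{L²}`. -/
instance : NormedAddCommGroup (Hs s) :=
  NormedAddCommGroup.induced (Hs s) (Lp ℂ 2 (volume : Measure ℝ)) bessel bessel_injective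

instance : NormedSpace ℂ (Hs s) := NormedSpace.induced ℂ (Hs s) (Lp ℂ 2 (volume : Measure ℝ)) bessel

theorem norm_def (f : Hs s) : ‖f‖ = ‖bessel f‖ := rfl

end Hs

/-! ### Space-time -/

/-- The plane; the coordinate `0` is the space variable `x` (or its frequency `ξ`), the coordinate
`1` is the time variable `t` (or its frequency `τ`). -/
abbrev Plane : Type := EuclideanSpace ℝ (Fin 2)

/-- The unit vector in the direction of `x`. -/
def dirX : Plane := EuclideanSpace.single 0 1

/-- The unit vector in the direction of `t`. -/
def dirT : Plane := EuclideanSpace.single 1 1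

/-- The open slab `{(x, t) : -T < t < T}`. -/
def slab (T : ℝ) : Set Plane := {p | -T < p 1 ∧ p 1 < T}

/-- `φ` is a test function on the open slab, i.e. smooth with compact support in it. (A smooth
compactly supported function on the plane is the same as a compactly supported Schwartz function.)
-/
def IsTestOn (T : ℝ) (φ : 𝓢(Plane, ℂ)) : Prop :=
  HasCompactSupport φ ∧ tsupport φ ⊆ slab T

/-! ### Bourgain spaces -/

/-- The weight `⟨ξ⟩^s ⟨τ - φ(ξ)⟩^b` with `⟨y⟩ = 1 + |y|` and `φ(ξ) = α ξ² + β ξ³`. The factors `2π`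
are due to the normalization `∫ e^{-2πi⟨p, ζ⟩} u(p) dp` of the Fourier transform. -/
def bourgainWeight (α β s b : ℝ) (ζ : Plane) : ℝ :=
  let ξ : ℝ := 2 * Real.pi * ζ 0
  let τ : ℝ := 2 * Real.pi * ζ 1
  (1 + |ξ|) ^ s * (1 + |τ - (α * ξ ^ 2 + β * ξ ^ 3)|) ^ b

/-- `U ∈ X^{s,b}`: the Fourier transform of the tempered distribution `U` is a function `f` with
`⟨ξ⟩^s ⟨τ - φ(ξ)⟩^b f ∈ L²(ℝ²)`. -/
def MemBourgain (α β s b : ℝ) (U : 𝓢'(Plane, ℂ)) : Prop :=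
  ∃ f : Plane → ℂ,
    MemLp (fun ζ ↦ (bourgainWeight α β s b ζ : ℂ) * f ζ) 2 volume ∧
    ∀ g : 𝓢(Plane, ℂ), 𝓕 U g = ∫ ζ, f ζ * g ζ

/-- `v ∈ X^{s,b}_T`: on the slab `|t| < T` the function `v` is the restriction of an element of
`X^{s,b}`. -/
def MemBourgainOn (α β s b T : ℝ) (v : Plane → ℂ) : Prop :=
  ∃ U : 𝓢'(Plane, ℂ), MemBourgain α β s b U ∧
    ∀ φ : 𝓢(Plane, ℂ), IsTestOn T φ → U φ = ∫ p, v p * φ p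

/-! ### Solutions -/

/-- `v ∈ L³_loc` of the slab, so that `|v|² v` is a locally integrable function there. -/
def LocL3 (T : ℝ) (v : Plane → ℂ) : Prop :=
  ∀ K : Set Plane, IsCompact K → K ⊆ slab T → MemLp v 3 (volume.restrict K)

/-- `∂_t v + iα ∂_x² v + β ∂_x³ v + iγ |v|² v = 0` in the sense of distributions on the slab. -/
def SolvesEquation (α β : ℝ) (γ : ℂ) (T : ℝ) (v : Plane → ℂ) : Prop :=
  ∀ φ : 𝓢(Plane, ℂ), IsTestOn T φ →
    ∫ p, (v p * (-(∂_{dirT} φ) p + Complex.I * α * (∂_{dirX} (∂_{dirX} φ)) p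
        - β * (∂_{dirX} (∂_{dirX} (∂_{dirX} φ))) p)
      + Complex.I * γ * (‖v p‖ : ℂ) ^ 2 * v p * φ p) = 0

/-- The curve `u` in `H^s(ℝ)` and the space-time function `v` are the same distribution: for almost
every `t`, the distribution `u(t)` is the function `x ↦ v(x, t)`. -/
def Represents {s T : ℝ} (u : C(Set.Icc (-T) T, Hs s)) (v : Plane → ℂ) : Prop :=
  ∀ᵐ t : ℝ, ∀ ht : t ∈ Set.Icc (-T) T, ∀ φ : 𝓢(ℝ, ℂ), HasCompactSupport φ →
    (u ⟨t, ht⟩).toDistribution φ = ∫ x : ℝ, v !₂[x, t] * φ x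

/-- `u ∈ C([-T,T]; H^s) ∩ X^{s,b}_T` is a solution on `[-T, T]` of the initial value problem
`∂_t u + iα ∂_x² u + β ∂_x³ u + iγ |u|² u = 0`, `u(0) = u₀`. -/
def IsIVPSolution (α β : ℝ) (γ : ℂ) (s b T : ℝ) (u₀ : Hs s) (u : C(Set.Icc (-T) T, Hs s)) : Prop :=
  (∀ h : (0 : ℝ) ∈ Set.Icc (-T) T, u ⟨0, h⟩ = u₀) ∧
  ∃ v : Plane → ℂ, LocL3 T v ∧ Represents u v ∧ MemBourgainOn α β s b T v ∧
    SolvesEquation α β γ T v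

end

/-! The proof is Bourgain's Fourier restriction method. A distribution in `X^{s,b}` is encoded by
its weighted Fourier coefficient `h`, a function in L² of the frequencies (η, τ), and Duhamel's
formula becomes the fixed-point equation `picard` on that L² space. The decisive fact is that u ↦
|u|²u maps `X^{s,b}` to `X^{s,b'}` with b' = -1/12, while the Duhamel integral cut off at time T
maps `X^{s,b'}` back to `X^{s,b}` with norm O(T^(1-b+b')). The exponent is positive exactly when b <
11/12, so for small T the map is a contraction on a ball whose radius depends only on the size of
the data.

The trilinear estimate (`triBdd_cubicKer`) is first proved for the phase ξ³. A general phase is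
reduced to it by completing the cube: the affine change of frequencies respects x - y + z, the
combination produced by u ū u. Put k = max(0, -s) < 1/4. If all input frequencies are dominated by
the output frequency, a trilinear L⁶ Strichartz estimate with gain of 1/6 derivative suffices
(`triBdd_sixth`). If one input is dominated by the output but another is much larger, then two
inputs are large and comparable and far from that one, and bilinear smoothing gains a full
derivative (`triBdd_bilKer`). If all inputs exceed the output, the resonance identity makes some
modulation at least a multiple of the product of the three brackets. A large output modulation leads
back to the L⁶ estimate, because 1/4 - 1/12 = 1/6. A large input modulation leaves a two-factor
estimate (`triBdd_pairKer`), which needs 3(b - k)/2 > 1/2; this is where b > 7/12 enters.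

The nonlinearity, defined so far by a convolution integral, must also be identified with the
pointwise cube of a function. The same kernels give `X^{s,b}` × `X^{s,b}` × `X^{1,b}` → L² for u₁ ū₂
u₃ (`exists_embed_bound`). With a Gaussian as third factor this says that u lies in L⁴ with Gaussian
weight, hence in L³ locally even for negative s. Approximation by integrable coefficients then
identifies the distribution, its cube and almost all of its time slices with those of one measurable
function (`exists_physical`).

Existence and Lipschitz dependence are the contraction principle. For uniqueness, a given solution
is the restriction of a distribution with some coefficient `h`. One application of the Picard map
changes neither the traces on a short time interval nor the weak equation there, since the
difference solves the free equation with zero trace at time 0 (`ev_eq_zero_of_pairing_eq_zero`) and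
the cube is local. Iterating from two solutions with the same data gives sequences with unchanged
traces and the same limit, so the solutions agree near time 0. Time translation and connectedness
extend this to the whole interval. -/

noncomputable section

open scoped ENNReal

/-! ### Trilinear estimates for nonnegative functions of the frequencies. -/

/-! ### Powers of the bracket `1 + |x|` -/

/-- The power `(1 + |x|)^e` as an extended nonnegative real. -/
def jpow (e x : ℝ) : ℝ≥0∞ := ENNReal.ofReal ((1 + |x|) ^ e)

theorem bracket_pos (x : ℝ) : 0 < 1 + |x| := by positivity

theorem one_le_bracket (x : ℝ) : 1 ≤ 1 + |x| := by linarith [abs_nonneg x]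

theorem jpow_ne_top (e x : ℝ) : jpow e x ≠ ∞ := ENNReal.ofReal_ne_top

theorem jpow_mul_jpow (e e' x : ℝ) : jpow e x * jpow e' x = jpow (e + e') x := by
  have := bracket_pos x
  rw [jpow, jpow, jpow, ← ENNReal.ofReal_mul (by positivity), Real.rpow_add this]

theorem jpow_zero (x : ℝ) : jpow 0 x = 1 := by simp [jpow]

theorem jpow_sq (e x : ℝ) : jpow e x ^ 2 = jpow (2 * e) x := by
  rw [sq, jpow_mul_jpow, two_mul]

theorem jpow_neg_arg (e x : ℝ) : jpow e (-x) = jpow e x := by simp [jpow]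

theorem jpow_mono {e e' : ℝ} (h : e ≤ e') (x : ℝ) : jpow e x ≤ jpow e' x :=
  ENNReal.ofReal_le_ofReal (Real.rpow_le_rpow_of_exponent_le (one_le_bracket x) h)

theorem jpow_le_one {e : ℝ} (h : e ≤ 0) (x : ℝ) : jpow e x ≤ 1 :=
  (jpow_mono h x).trans (jpow_zero x).le

@[fun_prop]
theorem measurable_jpow (e : ℝ) : Measurable (jpow e) := by
  unfold jpow; fun_prop

theorem lintegral_jpow_lt_top {e : ℝ} (he : 1 < e) : ∫⁻ x, jpow (-e) x < ∞ := by
  have := finite_integral_one_add_norm (E := ℝ) (μ := volume) (r := e) (by simpa using he)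
  simpa [jpow] using this

/-- Cauchy–Schwarz for lower integrals. -/
theorem lintegral_mul_sq_le {X : Type*} [MeasurableSpace X] {μ : Measure X} {f g : X → ℝ≥0∞}
    (hf : AEMeasurable f μ) (hg : AEMeasurable g μ) :
    (∫⁻ x, f x * g x ∂μ) ^ 2 ≤ (∫⁻ x, f x ^ 2 ∂μ) * ∫⁻ x, g x ^ 2 ∂μ := by
  have h := ENNReal.lintegral_mul_le_Lp_mul_Lq μ (p := 2) (q := 2)
    Real.HolderConjugate.two_two hf hg
  calc (∫⁻ x, f x * g x ∂μ) ^ 2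
      ≤ ((∫⁻ x, f x ^ (2 : ℝ) ∂μ) ^ (1 / 2 : ℝ) * (∫⁻ x, g x ^ (2 : ℝ) ∂μ) ^ (1 / 2 : ℝ)) ^ 2 := by
        gcongr; exact h
    _ = _ := by
        rw [mul_pow, ← ENNReal.rpow_natCast, ← ENNReal.rpow_natCast, ← ENNReal.rpow_mul,
          ← ENNReal.rpow_mul]
        norm_num

/-- The substitution y = q x on a set where the phase is injective. A lower bound for the derivative
of the phase is thereby converted into a bound for the measure of its level sets; both the L⁶ and
the bilinear estimate rest on this. -/
theorem setLIntegral_deriv_mul_comp_le {S : Set ℝ} (hS : MeasurableSet S) {q q' w : ℝ → ℝ}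
    (hq : ∀ x, HasDerivAt q (q' x) x) (hinj : S.InjOn q) (hw : ∀ x ∈ S, w x ≤ |q' x|)
    (g : ℝ → ℝ≥0∞) : ∫⁻ x in S, ENNReal.ofReal (w x) * g (q x) ≤ ∫⁻ y, g y := by
  calc ∫⁻ x in S, ENNReal.ofReal (w x) * g (q x)
      ≤ ∫⁻ x in S, ENNReal.ofReal |q' x| * g (q x) := by
        refine setLIntegral_mono' hS fun x hx => ?_
        gcongr
        exact hw x hx
    _ = ∫⁻ y in q '' S, g y :=
        (lintegral_image_eq_lintegral_abs_deriv_mul hS (fun x _ => (hq x).hasDerivWithinAt)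
          hinj g).symm
    _ ≤ ∫⁻ y, g y := setLIntegral_le_lintegral _ _

/-- By the triangle inequality the larger of the brackets of x and y - x is at least half the
bracket of y. Its power is traded for one of y and the other power survives in the sum. -/
theorem jpow_mul_jpow_sub_le {e : ℝ} (he : 0 ≤ e) (x y : ℝ) :
    jpow (-e) x * jpow (-e) (y - x) ≤
      ENNReal.ofReal (2 ^ e) * jpow (-e) y * (jpow (-e) x + jpow (-e) (y - x)) := by
  have hx := bracket_pos x
  have hy := bracket_pos y
  have hyx := bracket_pos (y - x)
  have key : ∀ u v : ℝ, 0 < v → 1 + |y| ≤ 2 * v →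
      v ^ (-e) ≤ 2 ^ e * (1 + |y|) ^ (-e) := by
    intro u v hv h
    have : (2 * v) ^ (-e) ≤ (1 + |y|) ^ (-e) :=
      Real.rpow_le_rpow_of_nonpos hy h (by linarith)
    rw [Real.mul_rpow (by norm_num) hv.le] at this
    have h2 : (2 : ℝ) ^ e * 2 ^ (-e) = 1 := by
      rw [← Real.rpow_add (by norm_num)]; simp
    calc v ^ (-e) = 2 ^ e * (2 ^ (-e) * v ^ (-e)) := by rw [← mul_assoc, h2, one_mul]
      _ ≤ _ := by gcongr
  have htri : |y| ≤ |x| + |y - x| := by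
    have := abs_add_le x (y - x); simpa using this
  unfold jpow
  rw [← ENNReal.ofReal_mul (by positivity), ← ENNReal.ofReal_mul (by positivity),
    ← ENNReal.ofReal_add (by positivity) (by positivity), ← ENNReal.ofReal_mul (by positivity)]
  apply ENNReal.ofReal_le_ofReal
  rcases le_total |x| |y - x| with h | h
  · have := key 0 (1 + |y - x|) hyx (by linarith)
    have h0 : 0 ≤ (1 + |x|) ^ (-e) := by positivity
    have h1 : 0 ≤ (1 + |y - x|) ^ (-e) := by positivity
    have h2 : 0 ≤ 2 ^ e * (1 + |y|) ^ (-e) := by positivity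
    nlinarith
  · have := key 0 (1 + |x|) hx (by linarith)
    have h0 : 0 ≤ (1 + |x|) ^ (-e) := by positivity
    have h1 : 0 ≤ (1 + |y - x|) ^ (-e) := by positivity
    have h2 : 0 ≤ 2 ^ e * (1 + |y|) ^ (-e) := by positivity
    nlinarith

theorem exists_lintegral_jpow_mul_jpow_le {e : ℝ} (he : 1 < e) : ∃ C : ℝ≥0∞, C ≠ ∞ ∧
    ∀ y c : ℝ, ∫⁻ x, jpow (-e) (x - c) * jpow (-e) (y - x) ≤ C * jpow (-e) (y - c) := by
  set I := ∫⁻ x, jpow (-e) x with hI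
  have hItop : I ≠ ∞ := (lintegral_jpow_lt_top he).ne
  refine ⟨ENNReal.ofReal (2 ^ e) * (I + I), by finiteness, fun y c => ?_⟩
  have h1 : ∫⁻ x, jpow (-e) (x - c) * jpow (-e) (y - x)
      = ∫⁻ x, jpow (-e) x * jpow (-e) (y - c - x) := by
    rw [← lintegral_sub_right_eq_self (fun x => jpow (-e) x * jpow (-e) (y - c - x)) c]
    congr 1; ext x; congr 2; ring
  rw [h1]
  calc ∫⁻ x, jpow (-e) x * jpow (-e) (y - c - x)
      ≤ ∫⁻ x, ENNReal.ofReal (2 ^ e) * jpow (-e) (y - c) *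
          (jpow (-e) x + jpow (-e) (y - c - x)) :=
        lintegral_mono fun x => jpow_mul_jpow_sub_le (by linarith) _ _
    _ = ENNReal.ofReal (2 ^ e) * jpow (-e) (y - c) * (I + I) := by
        rw [lintegral_const_mul _ (by fun_prop), lintegral_add_left (by fun_prop),
          lintegral_sub_left_eq_self (fun x => jpow (-e) x) (y - c)]
    _ = _ := by ring

/-- Integrates out the time frequencies of a trilinear convolution: with cⱼ the cubes of the spatial
frequencies, three modulation weights collapse into a single weight of the resonance function. -/
theorem exists_lintegral_jpow_triple_le {e : ℝ} (he : 1 < e) : ∃ C : ℝ≥0∞, C ≠ ∞ ∧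
    ∀ y c₁ c₂ c₃ : ℝ, ∫⁻ x₁, ∫⁻ x₂, jpow (-e) (x₁ - c₁) * jpow (-e) (x₂ - c₂) *
      jpow (-e) (y - x₁ - x₂ - c₃) ≤ C * jpow (-e) (y - c₁ - c₂ - c₃) := by
  obtain ⟨C, hC, h⟩ := exists_lintegral_jpow_mul_jpow_le he
  refine ⟨C * C, by finiteness, fun y c₁ c₂ c₃ => ?_⟩
  calc _ ≤ ∫⁻ x₁, jpow (-e) (x₁ - c₁) * (C * jpow (-e) (y - x₁ - c₃ - c₂)) := by
        refine lintegral_mono fun x₁ => ?_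
        have := h (y - x₁ - c₃) c₂
        simp_rw [mul_assoc]
        rw [lintegral_const_mul _ (by fun_prop)]
        gcongr
        refine le_trans (le_of_eq ?_) this
        congr 1; ext x₂
        rw [show y - x₁ - x₂ - c₃ = y - x₁ - c₃ - x₂ by ring]
    _ = C * ∫⁻ x₁, jpow (-e) (x₁ - c₁) * jpow (-e) (y - c₃ - c₂ - x₁) := by
        rw [← lintegral_const_mul _ (by fun_prop)]
        congr 1; ext x₁
        rw [show y - x₁ - c₃ - c₂ = y - c₃ - c₂ - x₁ by ring, mul_left_comm]
    _ ≤ C * (C * jpow (-e) (y - c₃ - c₂ - c₁)) := by gcongr; exact h _ _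
    _ = _ := by rw [show y - c₃ - c₂ - c₁ = y - c₁ - c₂ - c₃ by ring, mul_assoc]

/-! ### Measure of level sets of the cubic phases -/

/-- The level sets of `ξ₁³ + ξ₂³ + ξ₃³` on the simplex `ξ₁ + ξ₂ + ξ₃ = ξ`, `ξⱼ ≥ 0`, in coordinates
centred at the barycentre. -/
theorem lintegral_simplex_le (g : ℝ → ℝ≥0∞) (hg : Measurable g) {x : ℝ} (hx : 0 < x) (y : ℝ) :
    ENNReal.ofReal x * ∫⁻ p : ℝ × ℝ, Set.indicator
      {p : ℝ × ℝ | 0 ≤ x / 3 + p.1 ∧ 0 ≤ x / 3 + p.2 ∧ 0 ≤ x / 3 - p.1 - p.2}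
      (fun p => g (y - (x / 3 + p.1) ^ 3 - (x / 3 + p.2) ^ 3 - (x / 3 - p.1 - p.2) ^ 3)) p
      ≤ ENNReal.ofReal (2 * Real.pi) * ∫⁻ y, g y := by
  rw [← lintegral_comp_polarCoord_symm, ← lintegral_const_mul']
  swap; · exact ENNReal.ofReal_ne_top
  rw [polarCoord_target, Measure.volume_eq_prod, setLIntegral_prod_symm]
  swap
  · have hset : MeasurableSet
        {p : ℝ × ℝ | 0 ≤ x / 3 + p.1 ∧ 0 ≤ x / 3 + p.2 ∧ 0 ≤ x / 3 - p.1 - p.2} := by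
      measurability
    have hm := (Measurable.indicator (f := fun p : ℝ × ℝ =>
      g (y - (x / 3 + p.1) ^ 3 - (x / 3 + p.2) ^ 3 - (x / 3 - p.1 - p.2) ^ 3)) (by fun_prop)
      hset).comp continuous_polarCoord_symm.measurable
    exact (measurable_const.mul ((by fun_prop : Measurable fun p : ℝ × ℝ =>
      ENNReal.ofReal p.1).mul hm)).aemeasurable
  -- Along each ray from the barycentre the radial derivative of the phase has size at least x·r.
  -- The factor r comes from the polar area element and x stands in front of the integral, so the
  -- substitution absorbs both.
  have key : ∀ θ : ℝ, ∫⁻ r in Set.Ioi (0 : ℝ), ENNReal.ofReal x *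
      ENNReal.ofReal (r, θ).1 • Set.indicator
      {p : ℝ × ℝ | 0 ≤ x / 3 + p.1 ∧ 0 ≤ x / 3 + p.2 ∧ 0 ≤ x / 3 - p.1 - p.2}
      (fun p => g (y - (x / 3 + p.1) ^ 3 - (x / 3 + p.2) ^ 3 - (x / 3 - p.1 - p.2) ^ 3))
      (polarCoord.symm (r, θ)) ≤ ∫⁻ y, g y := by
    intro θ
    set a := Real.cos θ
    set b := Real.sin θ
    have hab : a ^ 2 + b ^ 2 = 1 := Real.cos_sq_add_sin_sq θ
    set S : Set ℝ := {r : ℝ | 0 ≤ x / 3 + r * a ∧ 0 ≤ x / 3 + r * b ∧ 0 ≤ x / 3 - r * a - r * b}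
      with hSdef
    have hS : MeasurableSet S := by rw [hSdef]; measurability
    set q : ℝ → ℝ := fun r => y - (x / 3 + r * a) ^ 3 - (x / 3 + r * b) ^ 3
      - (x / 3 - r * a - r * b) ^ 3 with hq
    set q' : ℝ → ℝ := fun r => - (r * (a ^ 2 * (2 * x + 3 * (r * a)) + b ^ 2 * (2 * x + 3 * (r * b))
      + (a + b) ^ 2 * (2 * x - 3 * (r * a + r * b)))) with hq'
    have hder : ∀ r, HasDerivAt q (q' r) r := by
      intro r
      have h1 : HasDerivAt (fun r : ℝ => x / 3 + r * a) a r := by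
        simpa using ((hasDerivAt_id r).mul_const a).const_add (x / 3)
      have h2 : HasDerivAt (fun r : ℝ => x / 3 + r * b) b r := by
        simpa using ((hasDerivAt_id r).mul_const b).const_add (x / 3)
      have h3 : HasDerivAt (fun r : ℝ => x / 3 - r * a - r * b) (-a - b) r := by
        simpa using (((hasDerivAt_id r).mul_const a).const_sub (x / 3)).fun_sub
          ((hasDerivAt_id r).mul_const b)
      refine ((((h1.pow 3).const_sub y).sub (h2.pow 3)).sub (h3.pow 3)).congr_deriv ?_
      simp only [hq']
      push_cast
      ring
    -- The phase is strictly decreasing along the ray: its difference quotient is a combination,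
    -- with coefficients a², b² and (a + b)², of terms that are nonnegative because the three
    -- frequencies are.
    have hinj : (Set.Ioi 0 ∩ S).InjOn q := by
      have hlt : ∀ r ∈ Set.Ioi 0 ∩ S, ∀ r' ∈ Set.Ioi 0 ∩ S, r < r' → q r' < q r := by
        rintro r ⟨hr, h1, h2, h3⟩ r' ⟨hr', h1', h2', h3'⟩ hlt
        simp only [Set.mem_Ioi] at hr hr'
        have aux : ∀ c : ℝ, 0 ≤ x / 3 + r * c → 0 ≤ x / 3 + r' * c →
            0 ≤ 3 * (x / 3) * (r + r') + c * (r ^ 2 + r * r' + r' ^ 2) := by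
          intro c hc hc'
          nlinarith [mul_nonneg hr.le hc, mul_nonneg hr'.le hc, mul_nonneg hr'.le hc',
            mul_pos hx hr, mul_pos hx hr']
        have aux2 : ∀ c : ℝ, 0 ≤ x / 3 + r * c → 0 ≤ x / 3 + r' * c →
            x / 3 * r ≤ 3 * (x / 3) * (r + r') + c * (r ^ 2 + r * r' + r' ^ 2) := by
          intro c hc hc'
          nlinarith [mul_nonneg hr.le hc, mul_nonneg hr'.le hc, mul_nonneg hr'.le hc',
            mul_pos hx hr, mul_pos hx hr']
        have e1 := mul_le_mul_of_nonneg_left (aux2 a h1 h1') (sq_nonneg a)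
        have e2 := mul_le_mul_of_nonneg_left (aux2 b h2 h2') (sq_nonneg b)
        have e3 := mul_nonneg (sq_nonneg (a + b)) (aux (-a - b) (by linarith) (by linarith))
        have hpos : 0 < (r' - r) * (x / 3 * r) := by
          have : 0 < r' - r := by linarith
          positivity
        have hsum : x / 3 * r ≤
            a ^ 2 * (3 * (x / 3) * (r + r') + a * (r ^ 2 + r * r' + r' ^ 2)) +
            b ^ 2 * (3 * (x / 3) * (r + r') + b * (r ^ 2 + r * r' + r' ^ 2)) +
            (a + b) ^ 2 * (3 * (x / 3) * (r + r') + (-a - b) * (r ^ 2 + r * r' + r' ^ 2)) := by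
          have : a ^ 2 * (x / 3 * r) + b ^ 2 * (x / 3 * r) = x / 3 * r := by
            rw [← add_mul, hab, one_mul]
          linarith
        have hfin := mul_le_mul_of_nonneg_left hsum (by linarith : 0 ≤ r' - r)
        have hid : q r - q r' = (r' - r) * (
            a ^ 2 * (3 * (x / 3) * (r + r') + a * (r ^ 2 + r * r' + r' ^ 2)) +
            b ^ 2 * (3 * (x / 3) * (r + r') + b * (r ^ 2 + r * r' + r' ^ 2)) +
            (a + b) ^ 2 * (3 * (x / 3) * (r + r') + (-a - b) * (r ^ 2 + r * r' + r' ^ 2))) := by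
          simp only [hq]; ring
        linarith
      intro r hr r' hr' h
      rcases lt_trichotomy r r' with hh | hh | hh
      · exact absurd h (hlt r hr r' hr' hh).ne'
      · exact hh
      · exact absurd h (hlt r' hr' r hr hh).ne
    -- Nonnegativity of the frequencies makes the factors of a² and b² at least x and that of (a +
    -- b)² nonnegative; then a² + b² = 1 gives the bound.
    have hw : ∀ r ∈ Set.Ioi 0 ∩ S, x * r ≤ |q' r| := by
      rintro r ⟨hr, h1, h2, h3⟩
      simp only [Set.mem_Ioi] at hr
      rw [hq', abs_neg]
      refine le_trans ?_ (le_abs_self _)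
      have e1 := mul_le_mul_of_nonneg_left (by linarith : x ≤ 2 * x + 3 * (r * a)) (sq_nonneg a)
      have e2 := mul_le_mul_of_nonneg_left (by linarith : x ≤ 2 * x + 3 * (r * b)) (sq_nonneg b)
      have e3 := mul_nonneg (sq_nonneg (a + b))
        (by linarith : 0 ≤ 2 * x - 3 * (r * a + r * b))
      have e4 : a ^ 2 * x + b ^ 2 * x = x := by rw [← add_mul, hab, one_mul]
      rw [mul_comm x r]
      exact mul_le_mul_of_nonneg_left (by linarith) hr.le
    have hmain := setLIntegral_deriv_mul_comp_le (measurableSet_Ioi.inter hS) hder hinj hw g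
    refine le_trans (le_of_eq ?_) hmain
    rw [← Set.inter_comm S, ← Measure.restrict_restrict hS, ← lintegral_indicator hS]
    refine setLIntegral_congr_fun measurableSet_Ioi fun r hr => ?_
    simp only [polarCoord_symm_apply, Set.indicator_apply, smul_eq_mul, Set.mem_ofPred_eq, hSdef]
    split_ifs
    · rw [← mul_assoc, ← ENNReal.ofReal_mul hx.le]
    · simp
  calc _ ≤ ∫⁻ θ in Set.Ioo (-Real.pi) Real.pi, ∫⁻ y, g y := lintegral_mono key
    _ = _ := by
      rw [lintegral_const, mul_comm, Measure.restrict_apply_univ, Real.volume_Ioo]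
      ring_nf

/-- The sum of the fibre integrals in the trilinear `L⁶` estimate is bounded. -/
theorem exists_lintegral_fibre_le {e : ℝ} (he : 1 < e) : ∃ C : ℝ≥0∞, C ≠ ∞ ∧ ∀ x y : ℝ,
    ∫⁻ x₁, ∫⁻ x₂, Set.indicator {p : ℝ × ℝ | 0 ≤ p.1 ∧ 0 ≤ p.2 ∧ 0 ≤ x - p.1 - p.2}
      (fun p => jpow (1 / 3) p.1 * jpow (1 / 3) p.2 * jpow (1 / 3) (x - p.1 - p.2) *
        jpow (-e) (y - p.1 ^ 3 - p.2 ^ 3 - (x - p.1 - p.2) ^ 3)) (x₁, x₂) ≤ C := by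
  set I := ∫⁻ x, jpow (-e) x with hI
  have hItop : I ≠ ∞ := (lintegral_jpow_lt_top he).ne
  refine ⟨2 + 2 * (ENNReal.ofReal (2 * Real.pi) * I), by finiteness, fun x y => ?_⟩
  set A : Set (ℝ × ℝ) := {p : ℝ × ℝ | 0 ≤ p.1 ∧ 0 ≤ p.2 ∧ 0 ≤ x - p.1 - p.2} with hA
  have hAm : MeasurableSet A := by rw [hA]; measurability
  -- pointwise bound of the weights
  have hpt : ∀ p : ℝ × ℝ, A.indicator (fun p => jpow (1 / 3) p.1 * jpow (1 / 3) p.2 *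
      jpow (1 / 3) (x - p.1 - p.2) * jpow (-e) (y - p.1 ^ 3 - p.2 ^ 3 - (x - p.1 - p.2) ^ 3)) p ≤
      jpow 1 x * A.indicator
        (fun p => jpow (-e) (y - p.1 ^ 3 - p.2 ^ 3 - (x - p.1 - p.2) ^ 3)) p := by
    intro p
    by_cases hp : p ∈ A
    · rw [Set.indicator_of_mem hp, Set.indicator_of_mem hp]
      obtain ⟨h1, h2, h3⟩ := hp
      have aux : ∀ z : ℝ, 0 ≤ z → z ≤ x → jpow (1 / 3) z ≤ jpow (1 / 3) x := by
        intro z hz hzx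
        refine ENNReal.ofReal_le_ofReal (Real.rpow_le_rpow (bracket_pos z).le ?_ (by norm_num))
        rw [abs_of_nonneg hz, abs_of_nonneg (hz.trans hzx)]; linarith
      -- Three weights of exponent 1/3 make up exactly one power of the bracket of x, which is what
      -- the level-set bound can afford.
      have : jpow 1 x = jpow (1 / 3) x * jpow (1 / 3) x * jpow (1 / 3) x := by
        rw [jpow_mul_jpow, jpow_mul_jpow]; norm_num
      rw [this]
      gcongr
      · exact aux _ h1 (by linarith)
      · exact aux _ h2 (by linarith)
      · exact aux _ h3 (by linarith)
    · rw [Set.indicator_of_notMem hp, Set.indicator_of_notMem hp]; simp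
  have hmeas : Measurable (A.indicator
        (fun p : ℝ × ℝ => jpow (-e) (y - p.1 ^ 3 - p.2 ^ 3 - (x - p.1 - p.2) ^ 3))) :=
    Measurable.indicator (by fun_prop) hAm
  calc _ ≤ ∫⁻ x₁, ∫⁻ x₂, jpow 1 x * A.indicator
        (fun p => jpow (-e) (y - p.1 ^ 3 - p.2 ^ 3 - (x - p.1 - p.2) ^ 3)) (x₁, x₂) :=
        lintegral_mono fun x₁ => lintegral_mono fun x₂ => hpt _
    _ = jpow 1 x * ∫⁻ p : ℝ × ℝ, A.indicator
        (fun p => jpow (-e) (y - p.1 ^ 3 - p.2 ^ 3 - (x - p.1 - p.2) ^ 3)) p := by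
        rw [Measure.volume_eq_prod, lintegral_prod _ hmeas.aemeasurable,
          ← lintegral_const_mul' _ _ (jpow_ne_top _ _)]
        congr 1; ext x₁
        rw [lintegral_const_mul' _ _ (jpow_ne_top _ _)]
    _ ≤ _ := ?_
  -- For x ≤ 1 the simplex lies in the unit square and nothing has to be gained. For x > 1 the
  -- bracket of x is at most 2x and the polar estimate about the barycentre applies.
  rcases le_or_gt x 1 with hx | hx
  · refine le_trans ?_ (le_add_of_nonneg_right (by positivity))
    rcases lt_or_ge x 0 with hx0 | hx0
    · have : A = ∅ := by
        ext p; simp only [hA, Set.mem_ofPred_eq, Set.mem_empty_iff_false, iff_false]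
        rintro ⟨h1, h2, h3⟩; linarith
      simp [this]
    · have hsub : A ⊆ Set.Icc 0 1 ×ˢ Set.Icc 0 1 := by
        rintro p ⟨h1, h2, h3⟩
        exact ⟨⟨h1, by linarith⟩, ⟨h2, by linarith⟩⟩
      have h2 : jpow 1 x ≤ 2 := by
        rw [jpow, Real.rpow_one, abs_of_nonneg hx0]
        calc ENNReal.ofReal (1 + x) ≤ ENNReal.ofReal 2 := ENNReal.ofReal_le_ofReal (by linarith)
          _ = 2 := by simp
      calc _ ≤ 2 * ∫⁻ p : ℝ × ℝ, A.indicator (fun _ => 1) p := by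
            gcongr with p
            exact jpow_le_one (by linarith) _
        _ = 2 * volume A := by rw [lintegral_indicator_const hAm, one_mul]
        _ ≤ 2 * volume (Set.Icc (0 : ℝ) 1 ×ˢ Set.Icc (0 : ℝ) 1) := by gcongr
        _ = 2 := by rw [Measure.volume_eq_prod, Measure.prod_prod]; simp
  · have hx0 : 0 < x := by linarith
    refine le_trans ?_ (le_add_of_nonneg_left (by positivity))
    have h2 : jpow 1 x ≤ 2 * ENNReal.ofReal x := by
      rw [jpow, Real.rpow_one, abs_of_nonneg hx0.le,
        show (2 : ℝ≥0∞) = ENNReal.ofReal 2 by simp, ← ENNReal.ofReal_mul (by norm_num)]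
      exact ENNReal.ofReal_le_ofReal (by linarith)
    refine (mul_le_mul_left h2 _).trans ?_
    rw [mul_assoc]
    refine mul_le_mul_right ?_ _
    rw [← lintegral_add_left_eq_self _ ((x / 3, x / 3) : ℝ × ℝ)]
    refine le_trans (le_of_eq ?_) (lintegral_simplex_le (jpow (-e)) (by fun_prop) hx0 y)
    congr 2
    ext p
    simp only [hA, Set.indicator_apply, Set.mem_ofPred_eq, Prod.fst_add, Prod.snd_add]
    have h3 : x - (x / 3 + p.1) - (x / 3 + p.2) = x / 3 - p.1 - p.2 := by ring
    rw [h3]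

/-! ### Convolutions of nonnegative functions -/

/-- The convolution of nonnegative functions on the plane. -/
def conv (F H : ℝ × ℝ → ℝ≥0∞) (z : ℝ × ℝ) : ℝ≥0∞ := ∫⁻ a, F a * H (z - a)

/-- The convolution of three nonnegative functions on the plane. -/
def tri (F₁ F₂ F₃ : ℝ × ℝ → ℝ≥0∞) (z : ℝ × ℝ) : ℝ≥0∞ :=
  ∫⁻ a, ∫⁻ b, F₁ a * F₂ b * F₃ (z - a - b)

@[fun_prop]
theorem measurable_conv {F H : ℝ × ℝ → ℝ≥0∞} (hF : Measurable F) (hH : Measurable H) :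
    Measurable (conv F H) := by
  unfold conv
  exact Measurable.lintegral_prod_right' (f := fun q : (ℝ × ℝ) × (ℝ × ℝ) => F q.2 * H (q.1 - q.2))
    (by fun_prop)

theorem conv_comm (F H : ℝ × ℝ → ℝ≥0∞) : conv F H = conv H F := by
  ext z
  unfold conv
  rw [← lintegral_sub_left_eq_self _ z]
  simp [mul_comm]

theorem tri_eq_conv {F₁ F₂ F₃ : ℝ × ℝ → ℝ≥0∞} (h₂ : Measurable F₂) (h₃ : Measurable F₃) :
    tri F₁ F₂ F₃ = conv F₁ (conv F₂ F₃) := by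
  ext z
  unfold tri conv
  congr 1; ext a
  rw [← lintegral_const_mul _ (by fun_prop)]
  congr 1; ext b
  rw [mul_assoc]

theorem tri_swap₂₃ (F₁ F₂ F₃ : ℝ × ℝ → ℝ≥0∞) : tri F₁ F₂ F₃ = tri F₁ F₃ F₂ := by
  ext z
  unfold tri
  congr 1; ext a
  rw [← lintegral_sub_left_eq_self _ (z - a)]
  congr 1; ext b
  rw [sub_sub_cancel]; ring

theorem tri_swap₁₂ {F₁ F₂ F₃ : ℝ × ℝ → ℝ≥0∞} (h₁ : Measurable F₁) (h₂ : Measurable F₂)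
    (h₃ : Measurable F₃) : tri F₁ F₂ F₃ = tri F₂ F₁ F₃ := by
  ext z
  unfold tri
  rw [lintegral_lintegral_swap (by fun_prop)]
  congr 1; ext a; congr 1; ext b
  rw [mul_comm (F₁ b), sub_right_comm]

@[fun_prop]
theorem measurable_tri {F₁ F₂ F₃ : ℝ × ℝ → ℝ≥0∞} (h₁ : Measurable F₁) (h₂ : Measurable F₂)
    (h₃ : Measurable F₃) : Measurable (tri F₁ F₂ F₃) := by
  rw [tri_eq_conv h₂ h₃]; fun_prop

/-- Young's inequality `L² * L¹ ⊆ L²`. -/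
theorem lintegral_conv_sq_le {F G : ℝ × ℝ → ℝ≥0∞} (hF : Measurable F) (hG : Measurable G) :
    ∫⁻ z, conv F G z ^ 2 ≤ (∫⁻ z, F z ^ 2) * (∫⁻ z, G z) ^ 2 := by
  have hpt : ∀ z, conv F G z ^ 2 ≤ (∫⁻ a, F (z - a) ^ 2 * G a) * ∫⁻ a, G a := by
    intro z
    rw [conv_comm, conv]
    have h := lintegral_mul_sq_le (μ := (volume : Measure (ℝ × ℝ)))
      (f := fun a => G a ^ (1 / 2 : ℝ) * F (z - a)) (g := fun a => G a ^ (1 / 2 : ℝ))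
      (by fun_prop) (by fun_prop)
    have hs : ∀ a, G a ^ (1 / 2 : ℝ) * G a ^ (1 / 2 : ℝ) = G a := by
      intro a
      rw [← ENNReal.rpow_add_of_nonneg _ _ (by norm_num) (by norm_num)]; norm_num
    have hs2 : ∀ a, (G a ^ (1 / 2 : ℝ)) ^ 2 = G a := fun a => by rw [sq, hs]
    simp only [mul_pow, hs2] at h
    refine le_trans (le_of_eq ?_) (h.trans (le_of_eq ?_))
    · congr 2; ext a
      rw [mul_right_comm, hs]
    · simp_rw [mul_comm]
  calc ∫⁻ z, conv F G z ^ 2 ≤ ∫⁻ z, (∫⁻ a, F (z - a) ^ 2 * G a) * ∫⁻ a, G a := lintegral_mono hpt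
    _ = (∫⁻ z, ∫⁻ a, F (z - a) ^ 2 * G a) * ∫⁻ a, G a := by
        rw [lintegral_mul_const]
        exact Measurable.lintegral_prod_right'
          (f := fun q : (ℝ × ℝ) × (ℝ × ℝ) => F (q.1 - q.2) ^ 2 * G q.2) (by fun_prop)
    _ = (∫⁻ a, (∫⁻ z, F z ^ 2) * G a) * ∫⁻ a, G a := by
        rw [lintegral_lintegral_swap (by fun_prop)]
        congr 2; ext a
        rw [lintegral_mul_const _ (by fun_prop),
          lintegral_sub_right_eq_self (fun z => F z ^ 2) a]
    _ = _ := by rw [lintegral_const_mul _ hG, mul_assoc, sq]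

/-- After expanding the square, the remaining integral of H(z - a) H(z - b) is unchanged when a and
b are both negated, by a translation. In physical space: conjugating one factor does not change the
modulus of a product. This carries estimates for nonnegative frequencies over to all frequencies. -/
theorem lintegral_conv_sq_reflect {F H : ℝ × ℝ → ℝ≥0∞} (hF : Measurable F) (hH : Measurable H) :
    ∫⁻ z, conv (fun a => F (-a)) H z ^ 2 = ∫⁻ z, conv F H z ^ 2 := by
  have expand : ∀ F' : ℝ × ℝ → ℝ≥0∞, Measurable F' → ∫⁻ z, conv F' H z ^ 2 =
      ∫⁻ a, ∫⁻ b, F' a * F' b * ∫⁻ z, H (z - a) * H (z - b) := by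
    intro F' hF'
    calc ∫⁻ z, conv F' H z ^ 2 = ∫⁻ z, ∫⁻ a, ∫⁻ b, F' a * F' b * (H (z - a) * H (z - b)) := by
          congr 1; ext z
          rw [sq, conv, ← lintegral_mul_const _ (by fun_prop)]
          congr 1; ext a
          rw [← lintegral_const_mul _ (by fun_prop)]
          congr 1; ext b; ring
      _ = ∫⁻ a, ∫⁻ z, ∫⁻ b, F' a * F' b * (H (z - a) * H (z - b)) := by
          rw [lintegral_lintegral_swap]
          exact Measurable.aemeasurable (Measurable.lintegral_prod_right'
            (f := fun q : ((ℝ × ℝ) × (ℝ × ℝ)) × (ℝ × ℝ) => F' q.1.2 * F' q.2 *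
              (H (q.1.1 - q.1.2) * H (q.1.1 - q.2))) (by fun_prop))
      _ = _ := by
          congr 1; ext a
          rw [lintegral_lintegral_swap (by fun_prop)]
          congr 1; ext b
          rw [lintegral_const_mul _ (by fun_prop)]
  rw [expand F hF, expand _ (by fun_prop)]
  rw [← lintegral_neg_eq_self]
  congr 1; ext a
  rw [← lintegral_neg_eq_self]
  congr 1; ext b
  simp only [neg_neg]
  congr 1
  rw [← lintegral_sub_right_eq_self _ (a + b)]
  congr 1; ext z
  rw [mul_comm, show z - (a + b) - -b = z - a by abel, show z - (a + b) - -a = z - b by abel]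

/-- The Cauchy–Schwarz inequality for a trilinear convolution with a kernel. -/
theorem lintegral_tri_kernel_sq_le {f₁ f₂ f₃ : ℝ × ℝ → ℝ≥0∞} (h₁ : Measurable f₁)
    (h₂ : Measurable f₂) (h₃ : Measurable f₃) {m₁ m₂ m₃ : ℝ × ℝ → ℝ≥0∞} (hm₁ : Measurable m₁)
    (hm₂ : Measurable m₂) (hm₃ : Measurable m₃) {C : ℝ≥0∞}
    (hC : ∀ z, tri (fun a => m₁ a ^ 2) (fun a => m₂ a ^ 2) (fun a => m₃ a ^ 2) z ≤ C) :
    ∫⁻ z, tri (fun a => f₁ a * m₁ a) (fun a => f₂ a * m₂ a) (fun a => f₃ a * m₃ a) z ^ 2 ≤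
      C * ((∫⁻ z, f₁ z ^ 2) * (∫⁻ z, f₂ z ^ 2) * ∫⁻ z, f₃ z ^ 2) := by
  have toProd : ∀ {g₁ g₂ g₃ : ℝ × ℝ → ℝ≥0∞} (z : ℝ × ℝ), Measurable g₁ → Measurable g₂ →
      Measurable g₃ → tri g₁ g₂ g₃ z =
        ∫⁻ q : (ℝ × ℝ) × (ℝ × ℝ), g₁ q.1 * g₂ q.2 * g₃ (z - q.1 - q.2) := by
    intro g₁ g₂ g₃ z hg₁ hg₂ hg₃
    rw [Measure.volume_eq_prod, lintegral_prod _ (by fun_prop)]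
    rfl
  have hpt : ∀ z, tri (fun a => f₁ a * m₁ a) (fun a => f₂ a * m₂ a) (fun a => f₃ a * m₃ a) z ^ 2 ≤
      tri (fun a => f₁ a ^ 2) (fun a => f₂ a ^ 2) (fun a => f₃ a ^ 2) z * C := by
    intro z
    rw [toProd z (by fun_prop) (by fun_prop) (by fun_prop)]
    have h := lintegral_mul_sq_le (μ := (volume : Measure ((ℝ × ℝ) × (ℝ × ℝ))))
      (f := fun q => f₁ q.1 * f₂ q.2 * f₃ (z - q.1 - q.2))
      (g := fun q => m₁ q.1 * m₂ q.2 * m₃ (z - q.1 - q.2)) (by fun_prop) (by fun_prop)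
    refine le_trans (le_of_eq ?_) (h.trans ?_)
    · congr 2; ext q; ring
    · simp only [mul_pow]
      rw [toProd z (by fun_prop) (by fun_prop) (by fun_prop)]
      refine mul_le_mul_right ?_ _
      have := hC z
      rwa [toProd z (by fun_prop) (by fun_prop) (by fun_prop)] at this
  have hconv : ∀ {g₁ g₂ : ℝ × ℝ → ℝ≥0∞}, Measurable g₁ → Measurable g₂ →
      ∫⁻ z, conv g₁ g₂ z = (∫⁻ z, g₁ z) * ∫⁻ z, g₂ z := by
    intro g₁ g₂ hg₁ hg₂
    unfold conv
    rw [lintegral_lintegral_swap (by fun_prop)]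
    rw [← lintegral_mul_const _ hg₁]
    congr 1; ext a
    rw [lintegral_const_mul _ (by fun_prop), lintegral_sub_right_eq_self g₂ a]
  calc _ ≤ ∫⁻ z, tri (fun a => f₁ a ^ 2) (fun a => f₂ a ^ 2) (fun a => f₃ a ^ 2) z * C :=
        lintegral_mono hpt
    _ = (∫⁻ z, tri (fun a => f₁ a ^ 2) (fun a => f₂ a ^ 2) (fun a => f₃ a ^ 2) z) * C :=
        lintegral_mul_const _ (by fun_prop)
    _ = _ := by
        rw [tri_eq_conv (by fun_prop) (by fun_prop), hconv (by fun_prop) (by fun_prop),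
          hconv (by fun_prop) (by fun_prop)]
        ring

/-! ### Bounded trilinear kernels -/

/-- The trilinear convolution with kernel `K` maps `L² × L² × L²` to `L²`. -/
def TriBdd (K : ℝ × ℝ → ℝ × ℝ → ℝ × ℝ → ℝ≥0∞) : Prop :=
  ∃ C : ℝ≥0∞, C ≠ ∞ ∧ ∀ f₁ f₂ f₃ : ℝ × ℝ → ℝ≥0∞, Measurable f₁ → Measurable f₂ → Measurable f₃ →
    ∫⁻ z, (∫⁻ a, ∫⁻ b, f₁ a * f₂ b * f₃ (z - a - b) * K a b (z - a - b)) ^ 2 ≤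
      C * ((∫⁻ z, f₁ z ^ 2) * (∫⁻ z, f₂ z ^ 2) * ∫⁻ z, f₃ z ^ 2)

/-- Joint measurability of a trilinear kernel. -/
def TriMeas (K : ℝ × ℝ → ℝ × ℝ → ℝ × ℝ → ℝ≥0∞) : Prop :=
  Measurable fun q : (ℝ × ℝ) × (ℝ × ℝ) × (ℝ × ℝ) => K q.1 q.2.1 q.2.2

theorem TriMeas.comp {K : ℝ × ℝ → ℝ × ℝ → ℝ × ℝ → ℝ≥0∞} (hK : TriMeas K) {X : Type*}
    [MeasurableSpace X] {u v w : X → ℝ × ℝ} (hu : Measurable u) (hv : Measurable v)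
    (hw : Measurable w) : Measurable fun x => K (u x) (v x) (w x) :=
  Measurable.comp (g := fun q : (ℝ × ℝ) × (ℝ × ℝ) × (ℝ × ℝ) => K q.1 q.2.1 q.2.2) hK
    (hu.prodMk (hv.prodMk hw))

theorem TriBdd.mono {K L : ℝ × ℝ → ℝ × ℝ → ℝ × ℝ → ℝ≥0∞} (hL : TriBdd L) {c : ℝ≥0∞} (hc : c ≠ ∞)
    (h : ∀ a b d, K a b d ≤ c * L a b d) : TriBdd K := by
  obtain ⟨C, hC, H⟩ := hL
  refine ⟨c ^ 2 * C, by finiteness, fun f₁ f₂ f₃ h₁ h₂ h₃ => ?_⟩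
  calc _ ≤ ∫⁻ z, c ^ 2 * (∫⁻ a, ∫⁻ b, f₁ a * f₂ b * f₃ (z - a - b) * L a b (z - a - b)) ^ 2 := by
        refine lintegral_mono fun z => ?_
        rw [← mul_pow]
        gcongr
        rw [← lintegral_const_mul' _ _ hc]
        refine lintegral_mono fun a => ?_
        rw [← lintegral_const_mul' _ _ hc]
        refine lintegral_mono fun b => ?_
        calc _ ≤ f₁ a * f₂ b * f₃ (z - a - b) * (c * L a b (z - a - b)) := by gcongr; exact h _ _ _
          _ = _ := by ring
    _ = c ^ 2 * ∫⁻ z, (∫⁻ a, ∫⁻ b, f₁ a * f₂ b * f₃ (z - a - b) * L a b (z - a - b)) ^ 2 :=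
        lintegral_const_mul' _ _ (by finiteness)
    _ ≤ _ := by rw [mul_assoc]; gcongr; exact H _ _ _ h₁ h₂ h₃

theorem measurable_triIntegral {K : ℝ × ℝ → ℝ × ℝ → ℝ × ℝ → ℝ≥0∞} (hK : TriMeas K)
    {f₁ f₂ f₃ : ℝ × ℝ → ℝ≥0∞} (h₁ : Measurable f₁) (h₂ : Measurable f₂) (h₃ : Measurable f₃) :
    Measurable fun z => ∫⁻ a, ∫⁻ b, f₁ a * f₂ b * f₃ (z - a - b) * K a b (z - a - b) := by
  have h4 : Measurable fun q : ((ℝ × ℝ) × (ℝ × ℝ)) × (ℝ × ℝ) =>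
      K q.1.2 q.2 (q.1.1 - q.1.2 - q.2) := hK.comp (by fun_prop) (by fun_prop) (by fun_prop)
  have h5 : Measurable fun q : (ℝ × ℝ) × (ℝ × ℝ) => ∫⁻ b, f₁ q.2 * f₂ b * f₃ (q.1 - q.2 - b) *
      K q.2 b (q.1 - q.2 - b) := Measurable.lintegral_prod_right'
    (f := fun q : ((ℝ × ℝ) × (ℝ × ℝ)) × (ℝ × ℝ) => f₁ q.1.2 * f₂ q.2 * f₃ (q.1.1 - q.1.2 - q.2) *
      K q.1.2 q.2 (q.1.1 - q.1.2 - q.2)) (Measurable.mul (by fun_prop) h4)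
  exact Measurable.lintegral_prod_right' h5

theorem TriBdd.add {K L : ℝ × ℝ → ℝ × ℝ → ℝ × ℝ → ℝ≥0∞} (hK : TriBdd K) (hL : TriBdd L)
    (mK : TriMeas K) : TriBdd fun a b c => K a b c + L a b c := by
  obtain ⟨C, hC, HK⟩ := hK
  obtain ⟨D, hD, HL⟩ := hL
  refine ⟨2 * (C + D), by finiteness, fun f₁ f₂ f₃ h₁ h₂ h₃ => ?_⟩
  have hsq : ∀ x y : ℝ≥0∞, (x + y) ^ 2 ≤ 2 * (x ^ 2 + y ^ 2) := by
    intro x y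
    have := ENNReal.rpow_add_le_mul_rpow_add_rpow x y (p := 2) (by norm_num)
    norm_num at this
    exact this
  calc _ ≤ ∫⁻ z, 2 * ((∫⁻ a, ∫⁻ b, f₁ a * f₂ b * f₃ (z - a - b) * K a b (z - a - b)) ^ 2 +
        (∫⁻ a, ∫⁻ b, f₁ a * f₂ b * f₃ (z - a - b) * L a b (z - a - b)) ^ 2) := by
        refine lintegral_mono fun z => ?_
        refine le_trans (le_of_eq ?_) (hsq _ _)
        have m1 : Measurable fun q : (ℝ × ℝ) × (ℝ × ℝ) =>
            f₁ q.1 * f₂ q.2 * f₃ (z - q.1 - q.2) * K q.1 q.2 (z - q.1 - q.2) := by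
          have := mK.comp (X := (ℝ × ℝ) × (ℝ × ℝ)) (u := fun q => q.1) (v := fun q => q.2)
            (w := fun q => z - q.1 - q.2) (by fun_prop) (by fun_prop) (by fun_prop)
          exact Measurable.mul (by fun_prop) this
        rw [← lintegral_add_left m1.lintegral_prod_right']
        congr 2; ext a
        have m2 : Measurable fun b => f₁ a * f₂ b * f₃ (z - a - b) * K a b (z - a - b) :=
          m1.comp measurable_prodMk_left
        rw [← lintegral_add_left m2]
        congr 1; ext b
        rw [mul_add]
    _ = 2 * ((∫⁻ z, (∫⁻ a, ∫⁻ b, f₁ a * f₂ b * f₃ (z - a - b) * K a b (z - a - b)) ^ 2) +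
        ∫⁻ z, (∫⁻ a, ∫⁻ b, f₁ a * f₂ b * f₃ (z - a - b) * L a b (z - a - b)) ^ 2) := by
        rw [lintegral_const_mul' _ _ (by finiteness), lintegral_add_left]
        exact (measurable_triIntegral mK h₁ h₂ h₃).pow_const 2
    _ ≤ 2 * (C * ((∫⁻ z, f₁ z ^ 2) * (∫⁻ z, f₂ z ^ 2) * ∫⁻ z, f₃ z ^ 2) +
        D * ((∫⁻ z, f₁ z ^ 2) * (∫⁻ z, f₂ z ^ 2) * ∫⁻ z, f₃ z ^ 2)) := by
        gcongr
        · exact HK _ _ _ h₁ h₂ h₃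
        · exact HL _ _ _ h₁ h₂ h₃
    _ = _ := by ring

theorem TriMeas.swap₁₂ {K : ℝ × ℝ → ℝ × ℝ → ℝ × ℝ → ℝ≥0∞} (mK : TriMeas K) :
    TriMeas fun a b c => K b a c := mK.comp (by fun_prop) (by fun_prop) (by fun_prop)

theorem TriMeas.swap₂₃ {K : ℝ × ℝ → ℝ × ℝ → ℝ × ℝ → ℝ≥0∞} (mK : TriMeas K) :
    TriMeas fun a b c => K a c b := mK.comp (by fun_prop) (by fun_prop) (by fun_prop)

theorem TriBdd.swap₁₂ {K : ℝ × ℝ → ℝ × ℝ → ℝ × ℝ → ℝ≥0∞} (hK : TriBdd K) (mK : TriMeas K) :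
    TriBdd fun a b c => K b a c := by
  obtain ⟨C, hC, H⟩ := hK
  refine ⟨C, hC, fun f₁ f₂ f₃ h₁ h₂ h₃ => ?_⟩
  refine le_trans (le_of_eq ?_) ((H f₂ f₁ f₃ h₂ h₁ h₃).trans (le_of_eq (by ring)))
  congr 1; ext z; congr 1
  rw [lintegral_lintegral_swap]
  · congr 1; ext a; congr 1; ext b
    rw [mul_comm (f₁ b), sub_right_comm]
  · have := mK.comp (X := (ℝ × ℝ) × (ℝ × ℝ)) (u := fun q => q.2) (v := fun q => q.1)
      (w := fun q => z - q.1 - q.2) (by fun_prop) (by fun_prop) (by fun_prop)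
    exact Measurable.aemeasurable (Measurable.mul (by fun_prop) this)

theorem TriBdd.swap₂₃ {K : ℝ × ℝ → ℝ × ℝ → ℝ × ℝ → ℝ≥0∞} (hK : TriBdd K) :
    TriBdd fun a b c => K a c b := by
  obtain ⟨C, hC, H⟩ := hK
  refine ⟨C, hC, fun f₁ f₂ f₃ h₁ h₂ h₃ => ?_⟩
  refine le_trans (le_of_eq ?_) ((H f₁ f₃ f₂ h₁ h₃ h₂).trans (le_of_eq (by ring)))
  congr 1; ext z; congr 1
  congr 1; ext a
  rw [← lintegral_sub_left_eq_self _ (z - a)]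
  congr 1; ext b
  rw [sub_sub_cancel]; ring

/-- When the kernel ignores the third variable, the first two can be integrated over the fibres of
constant sum before convolving with the third factor. Young's inequality then reduces the trilinear
bound to one for the fibre integral. -/
theorem triIntegral_eq_conv {k : ℝ × ℝ → ℝ × ℝ → ℝ≥0∞} (hk : Measurable (Function.uncurry k))
    {g : ℝ × ℝ → ℝ≥0∞} (hg : Measurable g) (z : ℝ × ℝ) :
    ∫⁻ a, ∫⁻ b, k a b * g (z - a - b) = conv (fun y => ∫⁻ a, k a (y - a)) g z := by
  have h1 : ∀ u v : (ℝ × ℝ) × (ℝ × ℝ) → ℝ × ℝ, Measurable u → Measurable v →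
      Measurable fun q => k (u q) (v q) := fun u v hu hv => hk.comp (hu.prodMk hv)
  have h2 := h1 (fun q => q.1) (fun q => q.2 - q.1) (by fun_prop) (by fun_prop)
  unfold conv
  calc _ = ∫⁻ a, ∫⁻ b, k a (b - a) * g (z - b) := by
        congr 1; ext a
        rw [← lintegral_sub_right_eq_self _ a]
        congr 1; ext b
        rw [show z - a - (b - a) = z - b by abel]
    _ = ∫⁻ b, ∫⁻ a, k a (b - a) * g (z - b) := by
        rw [lintegral_lintegral_swap]
        exact Measurable.aemeasurable (by simp only [Function.uncurry_def]; fun_prop)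
    _ = _ := by
        congr 1; ext b
        rw [lintegral_mul_const]
        exact hk.comp (by fun_prop : Measurable fun a : ℝ × ℝ => (a, b - a))

theorem lintegral_fibre_sub_eq {k : ℝ × ℝ → ℝ × ℝ → ℝ≥0∞} (hk : Measurable (Function.uncurry k)) :
    ∫⁻ y, ∫⁻ a, k a (y - a) = ∫⁻ a, ∫⁻ b, k a b := by
  rw [lintegral_lintegral_swap]
  · congr 1; ext a
    rw [lintegral_sub_right_eq_self (fun b => k a b) a]
  · exact Measurable.aemeasurable
      (hk.comp (by fun_prop : Measurable fun q : (ℝ × ℝ) × (ℝ × ℝ) => (q.2, q.1 - q.2)))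

theorem measurable_fibre_sub {k : ℝ × ℝ → ℝ × ℝ → ℝ≥0∞} (hk : Measurable (Function.uncurry k)) :
    Measurable fun y => ∫⁻ a, k a (y - a) :=
  Measurable.lintegral_prod_right' (f := fun q : (ℝ × ℝ) × (ℝ × ℝ) => k q.2 (q.1 - q.2))
    (hk.comp (by fun_prop : Measurable fun q : (ℝ × ℝ) × (ℝ × ℝ) => (q.2, q.1 - q.2)))

/-! ### The basic kernels for the phase `ξ³` -/

/-- The modulation weight `(1 + |τ - ξ³|)^e`. -/
def modw (e : ℝ) (a : ℝ × ℝ) : ℝ≥0∞ := jpow e (a.2 - a.1 ^ 3)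

@[fun_prop]
theorem measurable_modw (e : ℝ) : Measurable (modw e) := by unfold modw; fun_prop

theorem modw_neg (e : ℝ) (a : ℝ × ℝ) : modw e (-a) = modw e a := by
  unfold modw
  rw [← jpow_neg_arg]
  congr 1
  simp only [Prod.snd_neg, Prod.fst_neg]; ring

theorem modw_sq (e : ℝ) (a : ℝ × ℝ) : modw e a ^ 2 = modw (2 * e) a := jpow_sq _ _

theorem lintegral_prod_prod_eq {G : ℝ × ℝ → ℝ × ℝ → ℝ≥0∞} (hG : Measurable (Function.uncurry G)) :
    ∫⁻ a, ∫⁻ b, G a b = ∫⁻ x₁ : ℝ, ∫⁻ x₂ : ℝ, ∫⁻ t₁ : ℝ, ∫⁻ t₂ : ℝ, G (x₁, t₁) (x₂, t₂) := by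
  have h1 : Measurable fun a => ∫⁻ b, G a b := Measurable.lintegral_prod_right' hG
  rw [show ∫⁻ a, ∫⁻ b, G a b = ∫⁻ x₁ : ℝ, ∫⁻ t₁ : ℝ, ∫⁻ b, G (x₁, t₁) b from
    lintegral_prod _ h1.aemeasurable]
  congr 1; ext x₁
  have h2 : ∀ t₁ : ℝ, ∫⁻ b, G (x₁, t₁) b = ∫⁻ x₂ : ℝ, ∫⁻ t₂ : ℝ, G (x₁, t₁) (x₂, t₂) := by
    intro t₁
    exact lintegral_prod _ (hG.comp measurable_prodMk_left).aemeasurable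
  simp_rw [h2]
  rw [lintegral_lintegral_swap]
  apply Measurable.aemeasurable
  exact Measurable.lintegral_prod_right' (f := fun q : (ℝ × ℝ) × ℝ => G (x₁, q.1.1) (q.1.2, q.2))
    (hG.comp (by fun_prop : Measurable fun q : (ℝ × ℝ) × ℝ => ((x₁, q.1.1), (q.1.2, q.2))))

/-- The weight of the trilinear `L⁶` estimate. -/
def sixthWeight (b : ℝ) (a : ℝ × ℝ) : ℝ≥0∞ := jpow (1 / 6) a.1 * modw (-b) a

@[fun_prop]
theorem measurable_sixthWeight (b : ℝ) : Measurable (sixthWeight b) := by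
  unfold sixthWeight; fun_prop

theorem sixthWeight_neg (b : ℝ) (a : ℝ × ℝ) : sixthWeight b (-a) = sixthWeight b a := by
  unfold sixthWeight
  rw [modw_neg, Prod.fst_neg, jpow_neg_arg]

/-- The restriction of the weight to nonnegative frequencies. -/
def sixthWeightPos (b : ℝ) : ℝ × ℝ → ℝ≥0∞ := {a | 0 ≤ a.1}.indicator (sixthWeight b)

@[fun_prop]
theorem measurable_sixthWeightPos (b : ℝ) : Measurable (sixthWeightPos b) :=
  (measurable_sixthWeight b).indicator (by measurability)

/-- Integrating the time frequencies first, with exponent 2b > 1, leaves one weight of the resonance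
function; the integral over spatial frequencies is then the simplex bound. -/
theorem exists_tri_sixthWeightPos_le {b : ℝ} (hb : 1 / 2 < b) : ∃ C : ℝ≥0∞, C ≠ ∞ ∧
    ∀ z, tri (fun a => sixthWeightPos b a ^ 2) (fun a => sixthWeightPos b a ^ 2)
      (fun a => sixthWeightPos b a ^ 2) z ≤ C := by
  obtain ⟨C, hC, hfib⟩ := exists_lintegral_fibre_le (e := 2 * b) (by linarith)
  obtain ⟨D, hD, htau⟩ := exists_lintegral_jpow_triple_le (e := 2 * b) (by linarith)
  refine ⟨D * C, by finiteness, fun z => ?_⟩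
  have hw : ∀ a, sixthWeightPos b a ^ 2 = {x : ℝ | 0 ≤ x}.indicator (jpow (1 / 3)) a.1 *
      jpow (-(2 * b)) (a.2 - a.1 ^ 3) := by
    intro a
    unfold sixthWeightPos sixthWeight
    by_cases h : 0 ≤ a.1
    · rw [Set.indicator_of_mem (by exact h), Set.indicator_of_mem (by exact h), mul_pow, jpow_sq,
        modw_sq, modw]
      norm_num
    · rw [Set.indicator_of_notMem (by exact h), Set.indicator_of_notMem (by exact h)]
      simp
  set J := {x : ℝ | 0 ≤ x}.indicator (jpow (1 / 3)) with hJ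
  have mJ : Measurable J := (measurable_jpow _).indicator (by measurability)
  unfold tri
  rw [lintegral_prod_prod_eq (by simp only [Function.uncurry_def]; fun_prop)]
  calc _ ≤ ∫⁻ x₁ : ℝ, ∫⁻ x₂ : ℝ, D * (J x₁ * J x₂ * J (z.1 - x₁ - x₂) *
        jpow (-(2 * b)) (z.2 - x₁ ^ 3 - x₂ ^ 3 - (z.1 - x₁ - x₂) ^ 3)) := by
        refine lintegral_mono fun x₁ => lintegral_mono fun x₂ => ?_
        simp only [hw, Prod.fst_sub, Prod.snd_sub]
        calc _ = J x₁ * J x₂ * J (z.1 - x₁ - x₂) * ∫⁻ t₁, ∫⁻ t₂, jpow (-(2 * b)) (t₁ - x₁ ^ 3) *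
              jpow (-(2 * b)) (t₂ - x₂ ^ 3) *
              jpow (-(2 * b)) (z.2 - t₁ - t₂ - (z.1 - x₁ - x₂) ^ 3) := by
              have m1 : Measurable fun q : ℝ × ℝ => jpow (-(2 * b)) (q.1 - x₁ ^ 3) *
                jpow (-(2 * b)) (q.2 - x₂ ^ 3) *
                jpow (-(2 * b)) (z.2 - q.1 - q.2 - (z.1 - x₁ - x₂) ^ 3) := by fun_prop
              rw [← lintegral_const_mul _ m1.lintegral_prod_right']
              congr 1; ext t₁
              rw [← lintegral_const_mul _ (by fun_prop)]
              congr 1; ext t₂; ring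
          _ ≤ J x₁ * J x₂ * J (z.1 - x₁ - x₂) * (D *
              jpow (-(2 * b)) (z.2 - x₁ ^ 3 - x₂ ^ 3 - (z.1 - x₁ - x₂) ^ 3)) := by
              refine mul_le_mul_right (htau _ _ _ _) _
          _ = _ := by ring
    _ ≤ D * C := by
        simp_rw [lintegral_const_mul' _ _ hD]
        refine mul_le_mul_right ?_ _
        refine le_trans (le_of_eq ?_) (hfib z.1 z.2)
        congr 1; ext x₁; congr 1; ext x₂
        simp only [hJ, Set.indicator_apply, Set.mem_ofPred_eq]
        split_ifs <;> first | rfl | simp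
        all_goals simp_all

/-- The trilinear `L⁶` Strichartz estimate with a gain of `1/6` derivative. -/
theorem triBdd_sixth {b : ℝ} (hb : 1 / 2 < b) :
    TriBdd fun x y z => sixthWeight b x * sixthWeight b y * sixthWeight b z := by
  obtain ⟨C, hC, hpos⟩ := exists_tri_sixthWeightPos_le hb
  set m := sixthWeight b
  set mp := sixthWeightPos b
  -- from nonnegative to arbitrary frequencies in one slot
  have ext : ∀ H : ℝ × ℝ → ℝ≥0∞, Measurable H → ∀ K : ℝ≥0∞,
      (∀ f : ℝ × ℝ → ℝ≥0∞, Measurable f →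
        ∫⁻ z, conv (fun a => f a * mp a) H z ^ 2 ≤ K * ∫⁻ z, f z ^ 2) →
      ∀ f : ℝ × ℝ → ℝ≥0∞, Measurable f →
        ∫⁻ z, conv (fun a => f a * m a) H z ^ 2 ≤ (4 * K) * ∫⁻ z, f z ^ 2 := by
    intro H hH K hK f hf
    have hle : ∀ z, conv (fun a => f a * m a) H z ≤
        conv (fun a => f a * mp a) H z + conv (fun a => f a * mp (-a)) H z := by
      intro z
      unfold conv
      rw [← lintegral_add_left (by fun_prop)]
      refine lintegral_mono fun a => ?_
      rw [← add_mul, ← mul_add]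
      refine mul_le_mul_left (mul_le_mul_right ?_ _) _
      rcases le_total 0 a.1 with h | h
      · refine le_trans (le_of_eq ?_) (le_add_of_nonneg_right zero_le)
        exact (Set.indicator_of_mem (s := {a : ℝ × ℝ | 0 ≤ a.1}) h _).symm
      · refine le_trans (le_of_eq ?_) (le_add_of_nonneg_left zero_le)
        rw [← show m (-a) = m a from sixthWeight_neg b a]
        exact (Set.indicator_of_mem (s := {a : ℝ × ℝ | 0 ≤ a.1}) (a := -a) (by simpa using h) _).symm
    have hsq : ∀ x y : ℝ≥0∞, (x + y) ^ 2 ≤ 2 * (x ^ 2 + y ^ 2) := by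
      intro x y
      have := ENNReal.rpow_add_le_mul_rpow_add_rpow x y (p := 2) (by norm_num)
      norm_num at this
      exact this
    have hrefl : ∫⁻ z, conv (fun a => f a * mp (-a)) H z ^ 2 ≤ K * ∫⁻ z, f z ^ 2 := by
      rw [← lintegral_conv_sq_reflect (by fun_prop) hH]
      simp only [neg_neg]
      refine (hK (fun a => f (-a)) (by fun_prop)).trans (le_of_eq ?_)
      rw [lintegral_neg_eq_self (fun a => f a ^ 2)]
    calc _ ≤ ∫⁻ z, 2 * (conv (fun a => f a * mp a) H z ^ 2 +
          conv (fun a => f a * mp (-a)) H z ^ 2) :=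
          lintegral_mono fun z => (pow_le_pow_left' (hle z) 2).trans (hsq _ _)
      _ = 2 * ((∫⁻ z, conv (fun a => f a * mp a) H z ^ 2) +
          ∫⁻ z, conv (fun a => f a * mp (-a)) H z ^ 2) := by
          rw [lintegral_const_mul' _ _ (by finiteness), lintegral_add_left (by fun_prop)]
      _ ≤ 2 * ((K * ∫⁻ z, f z ^ 2) + K * ∫⁻ z, f z ^ 2) := by gcongr; exact hK f hf
      _ = _ := by ring
  -- The restriction to nonnegative frequencies is removed in one slot after the other. Each removal
  -- costs 4: a factor 2 from squaring a sum and a factor 2 for the two half-lines.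
  refine ⟨4 * (4 * (4 * C)), by finiteness, fun f₁ f₂ f₃ h₁ h₂ h₃ => ?_⟩
  have htri : ∀ z, ∫⁻ a, ∫⁻ c, f₁ a * f₂ c * f₃ (z - a - c) * (m a * m c * m (z - a - c)) =
      tri (fun a => f₁ a * m a) (fun a => f₂ a * m a) (fun a => f₃ a * m a) z := by
    intro z
    unfold tri
    congr 1; ext a; congr 1; ext c; ring
  simp_rw [htri]
  have s1 : ∀ g₁ g₂ g₃ : ℝ × ℝ → ℝ≥0∞, Measurable g₁ → Measurable g₂ → Measurable g₃ →
      ∫⁻ z, tri (fun a => g₁ a * m a) (fun a => g₂ a * mp a) (fun a => g₃ a * mp a) z ^ 2 ≤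
        (4 * C) * ((∫⁻ z, g₁ z ^ 2) * (∫⁻ z, g₂ z ^ 2) * ∫⁻ z, g₃ z ^ 2) := by
    intro g₁ g₂ g₃ k₁ k₂ k₃
    rw [tri_eq_conv (by fun_prop) (by fun_prop)]
    refine (ext _ (by fun_prop) (C * ((∫⁻ z, g₂ z ^ 2) * ∫⁻ z, g₃ z ^ 2)) ?_ g₁ k₁).trans
      (le_of_eq (by ring))
    intro f hf
    rw [← tri_eq_conv (by fun_prop) (by fun_prop)]
    exact (lintegral_tri_kernel_sq_le hf k₂ k₃ (by fun_prop) (by fun_prop) (by fun_prop)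
      hpos).trans (le_of_eq (by ring))
  have s2 : ∀ g₁ g₂ g₃ : ℝ × ℝ → ℝ≥0∞, Measurable g₁ → Measurable g₂ → Measurable g₃ →
      ∫⁻ z, tri (fun a => g₁ a * m a) (fun a => g₂ a * m a) (fun a => g₃ a * mp a) z ^ 2 ≤
        (4 * (4 * C)) * ((∫⁻ z, g₁ z ^ 2) * (∫⁻ z, g₂ z ^ 2) * ∫⁻ z, g₃ z ^ 2) := by
    intro g₁ g₂ g₃ k₁ k₂ k₃
    rw [tri_swap₁₂ (by fun_prop) (by fun_prop) (by fun_prop), tri_eq_conv (by fun_prop) (by fun_prop)]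
    refine (ext _ (by fun_prop) ((4 * C) * ((∫⁻ z, g₁ z ^ 2) * ∫⁻ z, g₃ z ^ 2)) ?_ g₂ k₂).trans
      (le_of_eq (by ring))
    intro f hf
    rw [← tri_eq_conv (by fun_prop) (by fun_prop), tri_swap₁₂ (by fun_prop) (by fun_prop) (by fun_prop)]
    exact (s1 g₁ f g₃ k₁ hf k₃).trans (le_of_eq (by ring))
  rw [tri_swap₂₃, tri_swap₁₂ (by fun_prop) (by fun_prop) (by fun_prop),
    tri_eq_conv (by fun_prop) (by fun_prop)]
  refine (ext _ (by fun_prop) ((4 * (4 * C)) * ((∫⁻ z, f₁ z ^ 2) * ∫⁻ z, f₂ z ^ 2)) ?_ f₃ h₃).trans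
    (le_of_eq (by ring))
  intro f hf
  rw [← tri_eq_conv (by fun_prop) (by fun_prop), tri_swap₁₂ (by fun_prop) (by fun_prop) (by fun_prop),
    tri_swap₂₃]
  exact (s2 f₁ f₂ f h₁ h₂ hf).trans (le_of_eq (by ring))

/-! ### Bilinear smoothing and the two-factor kernels. -/

theorem lintegral_jpow_mul_modw_lt_top {r b : ℝ} (hr : 1 < r) (hb : 1 < b) :
    ∫⁻ z : ℝ × ℝ, jpow (-r) z.1 * modw (-b) z < ∞ := by
  unfold modw
  rw [Measure.volume_eq_prod, lintegral_prod _ (by fun_prop)]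
  have : ∀ x : ℝ, ∫⁻ t : ℝ, jpow (-r) (x, t).1 * jpow (-b) ((x, t).2 - (x, t).1 ^ 3) =
      jpow (-r) x * ∫⁻ t, jpow (-b) t := by
    intro x
    simp only
    rw [lintegral_const_mul _ (by fun_prop), lintegral_sub_right_eq_self (jpow (-b)) (x ^ 3)]
  simp_rw [this]
  rw [lintegral_mul_const _ (by fun_prop)]
  exact ENNReal.mul_lt_top (lintegral_jpow_lt_top hr) (lintegral_jpow_lt_top hb)

/-- Frequencies `x, y` with `|x| ≥ 2|y|` and `|x| ≥ 1`. -/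
def sepSet : Set (ℝ × ℝ) := {p | 2 * |p.2| ≤ |p.1| ∧ 1 ≤ |p.1|}

theorem measurableSet_sepSet : MeasurableSet sepSet :=
  (measurableSet_le (f := fun p : ℝ × ℝ => 2 * |p.2|) (g := fun p => |p.1|) (by fun_prop)
    (by fun_prop)).inter
    (measurableSet_le (f := fun _ : ℝ × ℝ => (1 : ℝ)) (g := fun p => |p.1|) (by fun_prop)
      (by fun_prop))

/-- The indicator function of `sepSet`. -/
def sepInd (x y : ℝ) : ℝ≥0∞ := sepSet.indicator 1 (x, y)

theorem measurable_sepInd {X : Type*} [MeasurableSpace X] {u v : X → ℝ} (hu : Measurable u)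
    (hv : Measurable v) : Measurable fun x => sepInd (u x) (v x) :=
  (measurable_one.indicator measurableSet_sepSet).comp (hu.prodMk hv)

/-- With the sum x fixed, the derivative of the phase is 3(x - x₁)² - 3x₁². Separation makes this at
least x₁² in size, which pays for two powers of the bracket of x₁; two powers in the square of a
kernel are one full derivative. -/
theorem exists_lintegral_sep_le {e : ℝ} (he : 1 < e) : ∃ C : ℝ≥0∞, C ≠ ∞ ∧ ∀ x y : ℝ,
    ∫⁻ x₁, sepInd x₁ (x - x₁) * jpow 2 x₁ * jpow (-e) (y - x₁ ^ 3 - (x - x₁) ^ 3) ≤ C := by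
  set I := ∫⁻ x, jpow (-e) x with hI
  have hItop : I ≠ ∞ := (lintegral_jpow_lt_top he).ne
  refine ⟨4 * I, by finiteness, fun x y => ?_⟩
  set S : Set ℝ := {x₁ | (x₁, x - x₁) ∈ sepSet} with hS
  have hSm : MeasurableSet S := measurableSet_sepSet.preimage (by fun_prop)
  set q : ℝ → ℝ := fun x₁ => y - x₁ ^ 3 - (x - x₁) ^ 3 with hq
  have hder : ∀ x₁, HasDerivAt q (3 * (x - x₁) ^ 2 - 3 * x₁ ^ 2) x₁ := by
    intro x₁
    have h2 : HasDerivAt (fun x₁ : ℝ => x - x₁) (-1) x₁ := by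
      simpa using (hasDerivAt_id x₁).const_sub x
    refine (((hasDerivAt_pow 3 x₁).const_sub y).sub (h2.pow 3)).congr_deriv ?_
    push_cast; ring
  have hsqs : ∀ x₁ ∈ S, 4 * (x - x₁) ^ 2 ≤ x₁ ^ 2 ∧ 1 ≤ x₁ ^ 2 := by
    rintro x₁ ⟨h1, h2⟩
    simp only at h1 h2
    constructor
    · rw [← sq_abs x₁, ← sq_abs (x - x₁)]
      nlinarith [abs_nonneg (x - x₁)]
    · rw [← sq_abs x₁]; nlinarith
  -- The cubic terms cancel, so the phase is quadratic in x₁ and only u and x - u can share a value.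
  -- Separation allows just one of the two to be the large frequency; for x = 0 it excludes both.
  have hinj : S.InjOn q := by
    intro u hu v hv h
    by_contra hne
    have h1 : x * (u - v) * (u + v - x) = 0 := by
      simp only [hq] at h
      linear_combination (-1 / 3 : ℝ) * h
    have h2 := hsqs u hu
    have h3 := hsqs v hv
    rcases mul_eq_zero.mp h1 with h1 | h1
    · rcases mul_eq_zero.mp h1 with h1 | h1
      · subst h1; nlinarith
      · exact hne (by linarith)
    · have : v = x - u := by linarith
      subst this
      nlinarith
  have hw : ∀ x₁ ∈ S, x₁ ^ 2 ≤ |3 * (x - x₁) ^ 2 - 3 * x₁ ^ 2| := by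
    intro x₁ hx₁
    have := hsqs x₁ hx₁
    rw [abs_sub_comm]
    exact le_trans (by nlinarith) (le_abs_self _)
  have hmain := setLIntegral_deriv_mul_comp_le hSm hder hinj hw (jpow (-e))
  calc _ ≤ ∫⁻ x₁, 4 * S.indicator (fun x₁ => ENNReal.ofReal (x₁ ^ 2) * jpow (-e) (q x₁)) x₁ := by
        refine lintegral_mono fun x₁ => ?_
        by_cases h : x₁ ∈ S
        · rw [Set.indicator_of_mem h, sepInd, Set.indicator_of_mem (by exact h), ← mul_assoc]
          refine mul_le_mul_left ?_ _
          rw [Pi.one_apply, one_mul]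
          rw [jpow, show (4 : ℝ≥0∞) = ENNReal.ofReal 4 by simp, ← ENNReal.ofReal_mul (by norm_num)]
          apply ENNReal.ofReal_le_ofReal
          have h1 : 1 ≤ |x₁| := h.2
          rw [Real.rpow_two, ← sq_abs x₁]
          nlinarith
        · rw [Set.indicator_of_notMem h, sepInd, Set.indicator_of_notMem (by exact h)]
          simp
    _ ≤ _ := by
        rw [lintegral_const_mul' _ _ (by finiteness), lintegral_indicator hSm]
        exact mul_le_mul_right hmain _

/-- The kernel of the bilinear smoothing estimate, with the third factor in `L¹`. -/
def bilKer (b r : ℝ) (x y z : ℝ × ℝ) : ℝ≥0∞ :=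
  sepInd x.1 y.1 * jpow 1 x.1 * modw (-b) x * modw (-b) y * (jpow (-r) z.1 * modw (-b) z)

theorem triMeas_bilKer (b r : ℝ) : TriMeas (bilKer b r) := by
  unfold TriMeas bilKer
  have := measurable_sepInd (X := (ℝ × ℝ) × (ℝ × ℝ) × (ℝ × ℝ)) (u := fun q => q.1.1)
    (v := fun q => q.2.1.1) (by fun_prop) (by fun_prop)
  exact Measurable.mul (Measurable.mul (Measurable.mul (this.mul (by fun_prop)) (by fun_prop))
    (by fun_prop)) (by fun_prop)

/-- Cauchy–Schwarz: an L² factor with decaying weights belongs to L¹. The constant is finite as soon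
as both exponents exceed 1/2. -/
theorem lintegral_mul_weight_sq_le {b r : ℝ} {g : ℝ × ℝ → ℝ≥0∞} (hg : Measurable g) :
    (∫⁻ z, g z * (jpow (-r) z.1 * modw (-b) z)) ^ 2 ≤
      (∫⁻ z : ℝ × ℝ, jpow (-(2 * r)) z.1 * modw (-(2 * b)) z) * ∫⁻ z, g z ^ 2 := by
  refine (lintegral_mul_sq_le (by fun_prop) (by fun_prop)).trans (le_of_eq ?_)
  rw [mul_comm]
  congr 2; ext z
  rw [mul_pow, jpow_sq, modw_sq]
  ring_nf

theorem measurable_uncurry_comp {X Y Z W : Type*} [MeasurableSpace X] [MeasurableSpace Y]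
    [MeasurableSpace Z] [MeasurableSpace W] {k : Y → Z → W} (hk : Measurable (Function.uncurry k))
    {u : X → Y} {v : X → Z} (hu : Measurable u) (hv : Measurable v) :
    Measurable fun x => k (u x) (v x) := hk.comp (hu.prodMk hv)

/-- The separated pair is placed in L² by Cauchy–Schwarz on the fibres of constant sum: the time
integral merges the two modulations and `exists_lintegral_sep_le` bounds the rest. The third factor
is in L¹ because b and r exceed 1/2, and Young's inequality combines them. -/
theorem triBdd_bilKer {b r : ℝ} (hb : 1 / 2 < b) (hr : 1 / 2 < r) : TriBdd (bilKer b r) := by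
  obtain ⟨C, hC, hsep⟩ := exists_lintegral_sep_le (e := 2 * b) (by linarith)
  obtain ⟨D, hD, htau⟩ := exists_lintegral_jpow_mul_jpow_le (e := 2 * b) (by linarith)
  set A := ∫⁻ z : ℝ × ℝ, jpow (-(2 * r)) z.1 * modw (-(2 * b)) z with hA
  have hAtop : A ≠ ∞ := (lintegral_jpow_mul_modw_lt_top (by linarith) (by linarith)).ne
  refine ⟨D * C * A, by finiteness, fun f₁ f₂ f₃ h₁ h₂ h₃ => ?_⟩
  obtain ⟨m, hm⟩ : ∃ m : ℝ × ℝ → ℝ × ℝ → ℝ≥0∞, m = fun x y =>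
    sepInd x.1 y.1 * jpow 1 x.1 * modw (-b) x * modw (-b) y := ⟨_, rfl⟩
  have mm : Measurable (Function.uncurry m) := by
    rw [hm]
    have := measurable_sepInd (X := (ℝ × ℝ) × (ℝ × ℝ)) (u := fun q => q.1.1)
      (v := fun q => q.2.1) (by fun_prop) (by fun_prop)
    exact (Measurable.mul (Measurable.mul (this.mul (by fun_prop)) (by fun_prop)) (by fun_prop))
  have mk : Measurable (Function.uncurry fun x y => f₁ x * f₂ y * m x y) :=
    Measurable.mul (by fun_prop) mm
  have heq : ∀ z, ∫⁻ x, ∫⁻ y, f₁ x * f₂ y * f₃ (z - x - y) * bilKer b r x y (z - x - y) =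
      conv (fun y => ∫⁻ x, f₁ x * f₂ (y - x) * m x (y - x))
        (fun z => f₃ z * (jpow (-r) z.1 * modw (-b) z)) z := by
    intro z
    rw [← triIntegral_eq_conv mk (by fun_prop)]
    congr 1; ext x; congr 1; ext y
    rw [bilKer, hm]; ring
  simp_rw [heq]
  have hfib : ∀ y, (∫⁻ x, f₁ x * f₂ (y - x) * m x (y - x)) ^ 2 ≤
      (∫⁻ x, f₁ x ^ 2 * f₂ (y - x) ^ 2) * (D * C) := by
    intro y
    have mm' : Measurable fun x => m x (y - x) :=
      measurable_uncurry_comp mm measurable_id (by fun_prop)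
    have mf : AEMeasurable (fun x => f₁ x * f₂ (y - x)) volume := by fun_prop
    refine (lintegral_mul_sq_le mf mm'.aemeasurable).trans ?_
    simp_rw [mul_pow]
    refine mul_le_mul_right ?_ _
    have hm2 : ∀ x : ℝ × ℝ, m x (y - x) ^ 2 = sepInd x.1 (y.1 - x.1) * jpow 2 x.1 *
        (jpow (-(2 * b)) (x.2 - x.1 ^ 3) *
          jpow (-(2 * b)) (y.2 - (y.1 - x.1) ^ 3 - x.2)) := by
      intro x
      have : sepInd x.1 (y.1 - x.1) ^ 2 = sepInd x.1 (y.1 - x.1) := by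
        unfold sepInd Set.indicator
        split_ifs <;> simp
      simp only [hm, Prod.fst_sub, mul_pow, jpow_sq, this, modw, Prod.snd_sub]
      rw [show y.2 - x.2 - (y.1 - x.1) ^ 3 = y.2 - (y.1 - x.1) ^ 3 - x.2 by ring]
      ring_nf
    rw [Measure.volume_eq_prod, lintegral_prod _ (mm'.pow_const 2).aemeasurable]
    simp_rw [hm2]
    calc _ ≤ ∫⁻ x₁ : ℝ, D * (sepInd x₁ (y.1 - x₁) * jpow 2 x₁ *
          jpow (-(2 * b)) (y.2 - x₁ ^ 3 - (y.1 - x₁) ^ 3)) := by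
          refine lintegral_mono fun x₁ => ?_
          simp only
          rw [lintegral_const_mul _ (by fun_prop), mul_left_comm]
          refine mul_le_mul_right ?_ _
          refine (htau _ _).trans (le_of_eq ?_)
          rw [sub_right_comm]
      _ ≤ D * C := by
          rw [lintegral_const_mul' _ _ hD]
          exact mul_le_mul_right (hsep _ _) _
  have mfib := measurable_fibre_sub mk
  refine (lintegral_conv_sq_le mfib (by fun_prop)).trans ?_
  calc _ ≤ (∫⁻ y, (∫⁻ x, f₁ x ^ 2 * f₂ (y - x) ^ 2) * (D * C)) * (A * ∫⁻ z, f₃ z ^ 2) := by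
        gcongr with y
        · exact hfib y
        · exact lintegral_mul_weight_sq_le h₃
    _ = ((∫⁻ z, f₁ z ^ 2) * (∫⁻ z, f₂ z ^ 2)) * (D * C) * (A * ∫⁻ z, f₃ z ^ 2) := by
        rw [lintegral_mul_const' _ _ (by finiteness),
          lintegral_fibre_sub_eq (k := fun x y => f₁ x ^ 2 * f₂ y ^ 2)
            (by simp only [Function.uncurry_def]; fun_prop)]
        congr 2
        rw [← lintegral_mul_const _ (by fun_prop)]
        congr 1; ext x
        rw [lintegral_const_mul _ (by fun_prop)]
    _ = _ := by ring

/-- A kernel acting on two factors, with values in `L¹`. -/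
theorem triBdd_of_two {k : ℝ × ℝ → ℝ × ℝ → ℝ≥0∞} (hk : Measurable (Function.uncurry k))
    {C : ℝ≥0∞} (hC : C ≠ ∞) (h : ∀ f₁ f₂ : ℝ × ℝ → ℝ≥0∞, Measurable f₁ → Measurable f₂ →
      (∫⁻ x, ∫⁻ y, f₁ x * f₂ y * k x y) ^ 2 ≤ C * ((∫⁻ x, f₁ x ^ 2) * ∫⁻ x, f₂ x ^ 2)) :
    TriBdd fun x y _ => k x y := by
  refine ⟨C, hC, fun f₁ f₂ f₃ h₁ h₂ h₃ => ?_⟩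
  have mk : Measurable (Function.uncurry fun x y => f₁ x * f₂ y * k x y) :=
    Measurable.mul (by fun_prop) hk
  have heq : ∀ z, ∫⁻ x, ∫⁻ y, f₁ x * f₂ y * f₃ (z - x - y) * k x y =
      conv f₃ (fun y => ∫⁻ x, f₁ x * f₂ (y - x) * k x (y - x)) z := by
    intro z
    rw [conv_comm, ← triIntegral_eq_conv mk (by fun_prop)]
    congr 1; ext x; congr 1; ext y
    ring
  simp_rw [heq]
  refine (lintegral_conv_sq_le h₃ (measurable_fibre_sub mk)).trans ?_
  rw [lintegral_fibre_sub_eq mk]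
  exact (mul_le_mul_right (h f₁ f₂ h₁ h₂) _).trans (le_of_eq (by ring))

/-- Each of the two weighted factors is separately in L¹. -/
theorem triBdd_two_weights {b r : ℝ} (hb : 1 / 2 < b) (hr : 1 / 2 < r) :
    TriBdd fun x y _ => jpow (-r) x.1 * modw (-b) x * (jpow (-r) y.1 * modw (-b) y) := by
  set A := ∫⁻ z : ℝ × ℝ, jpow (-(2 * r)) z.1 * modw (-(2 * b)) z with hA
  have hAtop : A ≠ ∞ := (lintegral_jpow_mul_modw_lt_top (by linarith) (by linarith)).ne
  refine triBdd_of_two (C := A * A)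
    (k := fun x y => jpow (-r) x.1 * modw (-b) x * (jpow (-r) y.1 * modw (-b) y))
    (by simp only [Function.uncurry_def]; fun_prop) (by finiteness)
    fun f₁ f₂ h₁ h₂ => ?_
  have : ∫⁻ x, ∫⁻ y, f₁ x * f₂ y * (jpow (-r) x.1 * modw (-b) x * (jpow (-r) y.1 * modw (-b) y)) =
      (∫⁻ z, f₁ z * (jpow (-r) z.1 * modw (-b) z)) *
        ∫⁻ z, f₂ z * (jpow (-r) z.1 * modw (-b) z) := by
    rw [← lintegral_mul_const _ (by fun_prop)]
    congr 1; ext x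
    rw [← lintegral_const_mul _ (by fun_prop)]
    congr 1; ext y; ring
  rw [this, mul_pow]
  refine (mul_le_mul' (lintegral_mul_weight_sq_le h₁) (lintegral_mul_weight_sq_le h₂)).trans
    (le_of_eq (by ring))

/-- Decay is available only in the sum of the frequencies, so neither factor is in L¹ by itself.
Cauchy–Schwarz on the pair gives each factor half of the decay together with the modulation weight
of the other; integrating the other variable is then harmless because q > 1 and 2b > 1. -/
theorem triBdd_sum_weight {b q : ℝ} (hb : 1 / 2 < b) (hq : 1 < q) :
    TriBdd fun x y _ => jpow (-q) (x.1 + y.1) * (modw (-b) x * modw (-b) y) := by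
  set I := ∫⁻ x, jpow (-(2 * b)) x with hI
  have hItop : I ≠ ∞ := (lintegral_jpow_lt_top (by linarith)).ne
  set J := ∫⁻ x, jpow (-q) x with hJ
  have hJtop : J ≠ ∞ := (lintegral_jpow_lt_top hq).ne
  refine triBdd_of_two (C := (J * I) * (J * I))
    (k := fun x y => jpow (-q) (x.1 + y.1) * (modw (-b) x * modw (-b) y))
    (by simp only [Function.uncurry_def]; fun_prop) (by finiteness)
    fun f₁ f₂ h₁ h₂ => ?_
  have half : jpow (-q) = fun x => jpow (-(q / 2)) x * jpow (-(q / 2)) x := by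
    ext x; rw [jpow_mul_jpow]; ring_nf
  have hone : ∀ x : ℝ × ℝ, ∫⁻ y : ℝ × ℝ, jpow (-q) (x.1 + y.1) * modw (-(2 * b)) y = J * I := by
    intro x
    unfold modw
    rw [Measure.volume_eq_prod, lintegral_prod _ (by fun_prop)]
    have : ∀ y : ℝ, ∫⁻ t : ℝ, jpow (-q) (x.1 + (y, t).1) *
        jpow (-(2 * b)) ((y, t).2 - (y, t).1 ^ 3) = jpow (-q) (x.1 + y) * I := by
      intro y
      simp only
      rw [lintegral_const_mul _ (by fun_prop),
        lintegral_sub_right_eq_self (jpow (-(2 * b))) (y ^ 3)]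
    simp_rw [this]
    rw [lintegral_mul_const _ (by fun_prop), lintegral_add_left_eq_self (jpow (-q)) x.1]
  have hcs := lintegral_mul_sq_le (μ := (volume : Measure ((ℝ × ℝ) × (ℝ × ℝ))))
    (f := fun p => f₁ p.1 * (jpow (-(q / 2)) (p.1.1 + p.2.1) * modw (-b) p.2))
    (g := fun p => f₂ p.2 * (jpow (-(q / 2)) (p.1.1 + p.2.1) * modw (-b) p.1))
    (by fun_prop) (by fun_prop)
  have e0 : ∫⁻ x, ∫⁻ y, f₁ x * f₂ y * (jpow (-q) (x.1 + y.1) * (modw (-b) x * modw (-b) y)) =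
      ∫⁻ p : (ℝ × ℝ) × (ℝ × ℝ), f₁ p.1 * (jpow (-(q / 2)) (p.1.1 + p.2.1) * modw (-b) p.2) *
        (f₂ p.2 * (jpow (-(q / 2)) (p.1.1 + p.2.1) * modw (-b) p.1)) := by
    refine Eq.trans ?_ (lintegral_prod _ (by fun_prop)).symm
    congr 1; ext x; congr 1; ext y
    rw [half]; ring
  have e1 : ∫⁻ p : (ℝ × ℝ) × (ℝ × ℝ),
      (f₁ p.1 * (jpow (-(q / 2)) (p.1.1 + p.2.1) * modw (-b) p.2)) ^ 2 =
      (∫⁻ x, f₁ x ^ 2) * (J * I) := by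
    refine (lintegral_prod _ (by fun_prop)).trans ?_
    rw [← lintegral_mul_const _ (by fun_prop)]
    congr 1; ext x
    rw [← hone x, ← lintegral_const_mul _ (by fun_prop)]
    congr 1; ext y
    rw [mul_pow, mul_pow, jpow_sq, modw_sq]; ring_nf
  have e2 : ∫⁻ p : (ℝ × ℝ) × (ℝ × ℝ),
      (f₂ p.2 * (jpow (-(q / 2)) (p.1.1 + p.2.1) * modw (-b) p.1)) ^ 2 =
      (∫⁻ x, f₂ x ^ 2) * (J * I) := by
    refine (lintegral_prod_symm _ (by fun_prop)).trans ?_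
    rw [← lintegral_mul_const _ (by fun_prop)]
    congr 1; ext x
    rw [← hone x, ← lintegral_const_mul _ (by fun_prop)]
    congr 1; ext y
    simp only
    rw [mul_pow, mul_pow, jpow_sq, modw_sq, add_comm x.1]; ring_nf
  rw [e0]
  refine hcs.trans (le_of_eq ?_)
  rw [e1, e2]; ring

/-! ### The trilinear estimate for the phase `ξ³` -/

/-- The kernel of the trilinear estimate `X^{-k,b} × X^{-k,b} × X^{-k,b} → X^{-k,b'}`. -/
def cubicKer (k b b' : ℝ) (x y z : ℝ × ℝ) : ℝ≥0∞ :=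
  jpow k x.1 * jpow k y.1 * jpow k z.1 * jpow (-k) (x + y + z).1 *
    (modw (-b) x * modw (-b) y * modw (-b) z) * modw b' (x + y + z)

theorem cubicKer_swap₁₂ (k b b' : ℝ) (x y z : ℝ × ℝ) :
    cubicKer k b b' x y z = cubicKer k b b' y x z := by
  unfold cubicKer
  rw [add_comm x y]; ring

theorem cubicKer_swap₂₃ (k b b' : ℝ) (x y z : ℝ × ℝ) :
    cubicKer k b b' x y z = cubicKer k b b' x z y := by
  unfold cubicKer
  rw [add_right_comm]; ring

theorem rpow_le_mul_rpow_of_le_mul {u v c e : ℝ} (hv : 0 < v) (hc : 0 < c) (h : v ≤ c * u)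
    (he : e ≤ 0) : u ^ e ≤ c ^ (-e) * v ^ e := by
  have hu : 0 < u := by
    by_contra hu
    push Not at hu
    nlinarith
  have h1 : (c * u) ^ e ≤ v ^ e := Real.rpow_le_rpow_of_nonpos hv h he
  rw [Real.mul_rpow hc.le hu.le] at h1
  have h2 : c ^ (-e) * c ^ e = 1 := by rw [← Real.rpow_add hc]; simp
  calc u ^ e = c ^ (-e) * (c ^ e * u ^ e) := by rw [← mul_assoc, h2, one_mul]
    _ ≤ _ := by gcongr

section
variable {k b b' : ℝ}

/-- With P the product of the three brackets, the output bracket is at least a multiple of P^(1/3).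
The spatial weight is therefore O(P^(2k/3)), and 2k/3 ≤ 1/6 is the gain of the L⁶ estimate. -/
theorem cubicKer_le_of_comparable (hk : 0 ≤ k) (hk' : k ≤ 1 / 4) (hb' : b' ≤ 0) {x y z : ℝ × ℝ}
    (hx : 1 + |x.1| ≤ 32 * (1 + |(x + y + z).1|)) (hy : 1 + |y.1| ≤ 32 * (1 + |(x + y + z).1|))
    (hz : 1 + |z.1| ≤ 32 * (1 + |(x + y + z).1|)) :
    cubicKer k b b' x y z ≤ ENNReal.ofReal (32 ^ k) *
      (sixthWeight b x * sixthWeight b y * sixthWeight b z) := by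
  have key : jpow k x.1 * jpow k y.1 * jpow k z.1 * jpow (-k) (x + y + z).1 ≤
      ENNReal.ofReal (32 ^ k) * (jpow (1 / 6) x.1 * jpow (1 / 6) y.1 * jpow (1 / 6) z.1) := by
    unfold jpow
    have hA := one_le_bracket x.1
    have hB := one_le_bracket y.1
    have hD := one_le_bracket z.1
    have hN := one_le_bracket (x + y + z).1
    generalize 1 + |x.1| = A at *
    generalize 1 + |y.1| = B at *
    generalize 1 + |z.1| = D at *
    generalize 1 + |(x + y + z).1| = N at *
    rw [← ENNReal.ofReal_mul (by positivity), ← ENNReal.ofReal_mul (by positivity),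
      ← ENNReal.ofReal_mul (by positivity), ← ENNReal.ofReal_mul (by positivity),
      ← ENNReal.ofReal_mul (by positivity), ← ENNReal.ofReal_mul (by positivity)]
    apply ENNReal.ofReal_le_ofReal
    rw [← Real.mul_rpow (by positivity) (by positivity),
      ← Real.mul_rpow (by positivity) (by positivity),
      ← Real.mul_rpow (by positivity) (by positivity),
      ← Real.mul_rpow (by positivity) (by positivity)]
    have hAB : 1 ≤ A * B := one_le_mul_of_one_le_of_one_le hA hB
    have hP : 1 ≤ A * B * D := one_le_mul_of_one_le_of_one_le hAB hD
    have h3 : A * B * D ≤ (32 * N) ^ (3 : ℝ) := by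
      rw [show (3 : ℝ) = ((3 : ℕ) : ℝ) by norm_num, Real.rpow_natCast]
      calc A * B * D ≤ (32 * N) * (32 * N) * (32 * N) := by gcongr
        _ = _ := by ring
    set P := A * B * D
    have h4 : P ^ (1 / 3 : ℝ) ≤ 32 * N := by
      calc P ^ (1 / 3 : ℝ) ≤ ((32 * N) ^ (3 : ℝ)) ^ (1 / 3 : ℝ) :=
            Real.rpow_le_rpow (by positivity) h3 (by norm_num)
        _ = 32 * N := by rw [← Real.rpow_mul (by positivity)]; norm_num
    have h5 := rpow_le_mul_rpow_of_le_mul (e := -k) (by positivity) (by norm_num) h4 (by linarith)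
    rw [neg_neg, ← Real.rpow_mul (by positivity)] at h5
    calc P ^ k * N ^ (-k) ≤ P ^ k * (32 ^ k * P ^ (1 / 3 * -k)) := by gcongr
      _ = 32 ^ k * P ^ (k + 1 / 3 * -k) := by rw [Real.rpow_add (by positivity)]; ring
      _ ≤ 32 ^ k * P ^ (1 / 6 : ℝ) := by
        gcongr
        linarith
  calc cubicKer k b b' x y z ≤ ENNReal.ofReal (32 ^ k) * (jpow (1 / 6) x.1 * jpow (1 / 6) y.1 *
        jpow (1 / 6) z.1) * (modw (-b) x * modw (-b) y * modw (-b) z) * 1 := by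
        unfold cubicKer
        gcongr
        exact jpow_le_one hb' _
    _ = _ := by unfold sixthWeight; ring

theorem sepInd_eq_one {x y : ℝ} (h : 6 * (1 + |y|) ≤ 1 + |x|) : sepInd x y = 1 := by
  unfold sepInd
  rw [Set.indicator_of_mem]
  · rfl
  · constructor <;> simp only <;> linarith [abs_nonneg y]

/-- Writes A^k B^k as A·A^(-(1-k))·B^k and trades the negative power of A for one of B. One factor
then carries a full derivative, as in bilinear smoothing, and the other carries decay of order 1 -
2k, which exceeds 1/2 for k < 1/4. -/
theorem jpow_mul_jpow_le_of_le {x y : ℝ} (hk : k ≤ 1) (h : 1 + |y| ≤ 2 * (1 + |x|)) :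
    jpow k x * jpow k y ≤ ENNReal.ofReal (2 ^ (1 - k)) * (jpow 1 x * jpow (-(1 - 2 * k)) y) := by
  unfold jpow
  have hA := bracket_pos x
  have hB := bracket_pos y
  generalize 1 + |x| = A at *
  generalize 1 + |y| = B at *
  rw [← ENNReal.ofReal_mul (by positivity), ← ENNReal.ofReal_mul (by positivity),
    ← ENNReal.ofReal_mul (by positivity)]
  apply ENNReal.ofReal_le_ofReal
  have h1 := rpow_le_mul_rpow_of_le_mul (e := -(1 - k)) (by positivity) (by norm_num) h (by linarith)
  rw [neg_neg] at h1
  calc A ^ k * B ^ k = A ^ (1 : ℝ) * A ^ (-(1 - k)) * B ^ k := by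
        rw [← Real.rpow_add hA]; ring_nf
    _ ≤ A ^ (1 : ℝ) * (2 ^ (1 - k) * B ^ (-(1 - k))) * B ^ k := by gcongr
    _ = 2 ^ (1 - k) * (A ^ (1 : ℝ) * (B ^ (-(1 - k)) * B ^ k)) := by ring
    _ = _ := by rw [← Real.rpow_add hB]; ring_nf

/-- One of x, y is much larger than the output while z is not, so x and y nearly cancel: they are
comparable and both far larger than z. The pair x, z enjoys bilinear smoothing and y is put into L¹;
the weights of z and of the output compensate each other. -/
theorem cubicKer_le_of_low (hk : 0 ≤ k) (hk' : k ≤ 1 / 4) (hb' : b' ≤ 0) {x y z : ℝ × ℝ}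
    (hz : 1 + |z.1| ≤ 4 * (1 + |(x + y + z).1|))
    (hmax : 32 * (1 + |(x + y + z).1|) < 1 + |x.1| ∨ 32 * (1 + |(x + y + z).1|) < 1 + |y.1|) :
    cubicKer k b b' x y z ≤ ENNReal.ofReal (4 ^ k) * ENNReal.ofReal (2 ^ (1 - k)) *
      bilKer b (1 - 2 * k) x z y := by
  have hN := one_le_bracket (x + y + z).1
  have e1 : |x.1| ≤ |y.1| + |z.1| + |(x + y + z).1| := by
    have : x.1 = (x + y + z).1 - y.1 - z.1 := by simp only [Prod.fst_add]; ring
    rw [this]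
    have h1 := abs_sub ((x + y + z).1 - y.1) z.1
    have h2 := abs_sub (x + y + z).1 y.1
    linarith
  have e2 : |y.1| ≤ |x.1| + |z.1| + |(x + y + z).1| := by
    have : y.1 = (x + y + z).1 - x.1 - z.1 := by simp only [Prod.fst_add]; ring
    rw [this]
    have h1 := abs_sub ((x + y + z).1 - x.1) z.1
    have h2 := abs_sub (x + y + z).1 x.1
    linarith
  have hsep : sepInd x.1 z.1 = 1 := by
    apply sepInd_eq_one
    rcases hmax with h | h <;> linarith
  have hcmp : 1 + |y.1| ≤ 2 * (1 + |x.1|) := by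
    rcases hmax with h | h <;> linarith
  have key := jpow_mul_jpow_le_of_le (k := k) (by linarith) hcmp
  have hzN : jpow k z.1 * jpow (-k) (x + y + z).1 ≤ ENNReal.ofReal (4 ^ k) := by
    unfold jpow
    rw [← ENNReal.ofReal_mul (by positivity)]
    apply ENNReal.ofReal_le_ofReal
    have h5 := rpow_le_mul_rpow_of_le_mul (e := -k) (by positivity) (by norm_num) hz (by linarith)
    rw [neg_neg] at h5
    have hD := bracket_pos z.1
    calc _ ≤ (1 + |z.1|) ^ k * (4 ^ k * (1 + |z.1|) ^ (-k)) := by gcongr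
      _ = 4 ^ k * ((1 + |z.1|) ^ k * (1 + |z.1|) ^ (-k)) := by ring
      _ = _ := by rw [← Real.rpow_add hD]; simp
  calc cubicKer k b b' x y z = (jpow k x.1 * jpow k y.1) * (jpow k z.1 * jpow (-k) (x + y + z).1) *
        (modw (-b) x * modw (-b) y * modw (-b) z) * modw b' (x + y + z) := by
        unfold cubicKer; ring
    _ ≤ (ENNReal.ofReal (2 ^ (1 - k)) * (jpow 1 x.1 * jpow (-(1 - 2 * k)) y.1)) *
        ENNReal.ofReal (4 ^ k) * (modw (-b) x * modw (-b) y * modw (-b) z) * 1 := by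
        gcongr
        exact jpow_le_one hb' _
    _ = _ := by unfold bilKer; rw [hsep]; ring

/-- The two-factor kernel in which the third modulation has been used up. -/
def pairKer (b r : ℝ) (x y : ℝ × ℝ) : ℝ≥0∞ :=
  jpow (-r) x.1 * modw (-b) x * (jpow (-r) y.1 * modw (-b) y) +
    jpow (-(2 * r)) (x.1 + y.1) * (modw (-b) x * modw (-b) y)

/-- With P the product of the brackets, the modulation of x turns P^k into P^(-(b-k)) and is then
used up, so x is left as a plain L² factor. The decay has to be distributed over y and z alone, by
comparing the bracket of x with theirs. -/
theorem cubicKer_le_of_modulation_first (hk : 0 ≤ k) (hkb : k ≤ b) (hb' : b' ≤ 0)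
    {x y z : ℝ × ℝ}
    (hx : 4 * (1 + |(x + y + z).1|) < 1 + |x.1|)
    (hmod : (1 + |x.1|) * (1 + |y.1|) * (1 + |z.1|) ≤ 16 * (1 + |x.2 - x.1 ^ 3|)) :
    cubicKer k b b' x y z ≤ ENNReal.ofReal (16 ^ b) * ENNReal.ofReal (3 ^ (3 * (b - k))) *
      pairKer b (3 * (b - k) / 2) y z := by
  have hA := one_le_bracket x.1
  have hB := one_le_bracket y.1
  have hD := one_le_bracket z.1
  have hN := one_le_bracket (x + y + z).1
  have hS := one_le_bracket (x.2 - x.1 ^ 3)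
  have htri : 1 + |y.1 + z.1| ≤ 3 * (1 + |x.1|) := by
    have : y.1 + z.1 = (x + y + z).1 - x.1 := by simp only [Prod.fst_add]; ring
    rw [this]
    have h2 := abs_sub (x + y + z).1 x.1
    linarith
  have e1 : 1 + |z.1| ≤ (1 + |x.1|) + (1 + |y.1|) + (1 + |(x + y + z).1|) := by
    have : z.1 = (x + y + z).1 - x.1 - y.1 := by simp only [Prod.fst_add]; ring
    rw [this]
    have h1 := abs_sub ((x + y + z).1 - x.1) y.1
    have h2 := abs_sub (x + y + z).1 x.1
    linarith
  have e2 : 1 + |y.1| ≤ (1 + |x.1|) + (1 + |z.1|) + (1 + |(x + y + z).1|) := by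
    have : y.1 = (x + y + z).1 - x.1 - z.1 := by simp only [Prod.fst_add]; ring
    rw [this]
    have h1 := abs_sub ((x + y + z).1 - x.1) z.1
    have h2 := abs_sub (x + y + z).1 x.1
    linarith
  have key : jpow k x.1 * jpow k y.1 * jpow k z.1 * modw (-b) x ≤
      ENNReal.ofReal (16 ^ b) * ENNReal.ofReal (3 ^ (3 * (b - k))) *
      (jpow (-(3 * (b - k) / 2)) y.1 * jpow (-(3 * (b - k) / 2)) z.1 +
        jpow (-(2 * (3 * (b - k) / 2))) (y.1 + z.1)) := by
    have hM := one_le_bracket (y.1 + z.1)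
    unfold modw jpow
    generalize 1 + |x.1| = A at *
    generalize 1 + |y.1| = B at *
    generalize 1 + |z.1| = D at *
    generalize 1 + |(x + y + z).1| = N at *
    generalize 1 + |x.2 - x.1 ^ 3| = S at *
    generalize 1 + |y.1 + z.1| = M at *
    rw [← ENNReal.ofReal_mul (by positivity), ← ENNReal.ofReal_mul (by positivity),
      ← ENNReal.ofReal_mul (by positivity), ← ENNReal.ofReal_mul (by positivity),
      ← ENNReal.ofReal_mul (by positivity), ← ENNReal.ofReal_add (by positivity) (by positivity),
      ← ENNReal.ofReal_mul (by positivity)]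
    apply ENNReal.ofReal_le_ofReal
    rw [← Real.mul_rpow (by positivity) (by positivity),
      ← Real.mul_rpow (by positivity) (by positivity),
      ← Real.mul_rpow (by positivity) (by positivity)]
    have hBD : 1 ≤ B * D := one_le_mul_of_one_le_of_one_le hB hD
    have h5 := rpow_le_mul_rpow_of_le_mul (e := -b) (by positivity) (by norm_num) hmod (by linarith)
    rw [neg_neg] at h5
    have hPpos : 0 < A * B * D := by positivity
    have h6 : (A * B * D) ^ k * S ^ (-b) ≤ 16 ^ b * (A * B * D) ^ (-(b - k)) := by
      calc _ ≤ (A * B * D) ^ k * (16 ^ b * (A * B * D) ^ (-b)) := by gcongr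
        _ = 16 ^ b * ((A * B * D) ^ k * (A * B * D) ^ (-b)) := by ring
        _ = _ := by rw [← Real.rpow_add hPpos]; ring_nf
    refine h6.trans ?_
    rw [mul_assoc ((16 : ℝ) ^ b)]
    refine mul_le_mul_of_nonneg_left ?_ (by positivity)
    have h3pos : (0 : ℝ) ≤ 3 ^ (3 * (b - k)) := by positivity
    -- If A is smallest, P ≥ A³ and A controls the bracket of y + z, which gives decay in the sum of
    -- the two frequencies.
    by_cases hmin : A ≤ B ∧ A ≤ D
    · have h7 : (A * B * D) ^ (-(b - k)) ≤ A ^ (-(3 * (b - k))) := by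
        calc (A * B * D) ^ (-(b - k)) ≤ (A ^ (3 : ℝ)) ^ (-(b - k)) := by
              refine Real.rpow_le_rpow_of_nonpos (by positivity) ?_ (by linarith)
              rw [show (3 : ℝ) = ((3 : ℕ) : ℝ) by norm_num, Real.rpow_natCast]
              calc A ^ 3 = A * A * A := by ring
                _ ≤ A * B * D := by gcongr <;> tauto
          _ = _ := by rw [← Real.rpow_mul (by positivity)]; ring_nf
      have h8 := rpow_le_mul_rpow_of_le_mul (e := -(3 * (b - k))) (by positivity) (by norm_num) htri
        (by linarith)
      rw [neg_neg] at h8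
      refine (h7.trans h8).trans ?_
      gcongr
      rw [show 2 * (3 * (b - k) / 2) = 3 * (b - k) by ring]
      exact le_add_of_nonneg_left (by positivity)
    -- Otherwise A exceeds B or D, and since the output is small B and D are both at most 3A. Then P
    -- is at least a third of (BD)^(3/2), which gives decay in each of the two frequencies.
    · have hBD' : B * D ≤ (3 * A) ^ 2 := by
        have hB3 : B ≤ 3 * A ∧ D ≤ 3 * A := by
          by_cases hab : A ≤ B
          · have : D < A := by
              by_contra h; exact hmin ⟨hab, not_lt.mp h⟩
            constructor <;> linarith
          · constructor <;> linarith
        rw [sq]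
        gcongr
        exacts [hB3.1, hB3.2]
      have h9 : (B * D) ^ (3 / 2 : ℝ) ≤ 3 * (A * B * D) := by
        rw [show (3 / 2 : ℝ) = 1 / 2 + 1 by norm_num, Real.rpow_add (by positivity), Real.rpow_one]
        have : (B * D) ^ (1 / 2 : ℝ) ≤ 3 * A := by
          rw [← Real.sqrt_eq_rpow]
          exact Real.sqrt_le_iff.mpr ⟨by positivity, hBD'⟩
        calc (B * D) ^ (1 / 2 : ℝ) * (B * D) ≤ 3 * A * (B * D) := by gcongr
          _ = _ := by ring
      have h10 := rpow_le_mul_rpow_of_le_mul (e := -(b - k)) (by positivity) (by norm_num) h9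
        (by linarith)
      rw [neg_neg, ← Real.rpow_mul (by positivity)] at h10
      refine h10.trans ?_
      have h11 : (3 : ℝ) ^ (b - k) ≤ 3 ^ (3 * (b - k)) :=
        Real.rpow_le_rpow_of_exponent_le (by norm_num) (by linarith)
      have h12 : (B * D) ^ (3 / 2 * -(b - k)) = (B * D) ^ (-(3 * (b - k) / 2)) := by
        congr 1; ring
      rw [h12]
      gcongr
      exact le_add_of_nonneg_right (by positivity)
  calc cubicKer k b b' x y z = (jpow k x.1 * jpow k y.1 * jpow k z.1 * modw (-b) x) *
        (modw (-b) y * modw (-b) z) * jpow (-k) (x + y + z).1 * modw b' (x + y + z) := by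
        unfold cubicKer; ring
    _ ≤ (ENNReal.ofReal (16 ^ b) * ENNReal.ofReal (3 ^ (3 * (b - k))) *
      (jpow (-(3 * (b - k) / 2)) y.1 * jpow (-(3 * (b - k) / 2)) z.1 +
        jpow (-(2 * (3 * (b - k) / 2))) (y.1 + z.1))) *
        (modw (-b) y * modw (-b) z) * 1 * 1 := by
        gcongr
        · exact jpow_le_one (by linarith) _
        · exact jpow_le_one hb' _
    _ = _ := by unfold pairKer; ring

/-- The output modulation changes P^k into a multiple of P^(k + b'), and k + b' ≤ 1/4 - 1/12 = 1/6
is the gain of the L⁶ estimate. -/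
theorem cubicKer_le_of_modulation_out (hk : 0 ≤ k) (hk' : k ≤ 1 / 4) (hb' : b' ≤ -(1 / 12))
    {x y z : ℝ × ℝ}
    (hmod : (1 + |x.1|) * (1 + |y.1|) * (1 + |z.1|) ≤
      16 * (1 + |(x + y + z).2 - (x + y + z).1 ^ 3|)) :
    cubicKer k b b' x y z ≤ ENNReal.ofReal (16 ^ (-b')) *
      (sixthWeight b x * sixthWeight b y * sixthWeight b z) := by
  have key : jpow k x.1 * jpow k y.1 * jpow k z.1 * modw b' (x + y + z) ≤
      ENNReal.ofReal (16 ^ (-b')) * (jpow (1 / 6) x.1 * jpow (1 / 6) y.1 * jpow (1 / 6) z.1) := by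
    unfold modw jpow
    have hA := one_le_bracket x.1
    have hB := one_le_bracket y.1
    have hD := one_le_bracket z.1
    have hS := one_le_bracket ((x + y + z).2 - (x + y + z).1 ^ 3)
    generalize 1 + |x.1| = A at *
    generalize 1 + |y.1| = B at *
    generalize 1 + |z.1| = D at *
    generalize 1 + |(x + y + z).2 - (x + y + z).1 ^ 3| = S at *
    rw [← ENNReal.ofReal_mul (by positivity), ← ENNReal.ofReal_mul (by positivity),
      ← ENNReal.ofReal_mul (by positivity), ← ENNReal.ofReal_mul (by positivity),
      ← ENNReal.ofReal_mul (by positivity), ← ENNReal.ofReal_mul (by positivity)]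
    apply ENNReal.ofReal_le_ofReal
    rw [← Real.mul_rpow (by positivity) (by positivity),
      ← Real.mul_rpow (by positivity) (by positivity),
      ← Real.mul_rpow (by positivity) (by positivity),
      ← Real.mul_rpow (by positivity) (by positivity)]
    have hAB : 1 ≤ A * B := one_le_mul_of_one_le_of_one_le hA hB
    have hP : 1 ≤ A * B * D := one_le_mul_of_one_le_of_one_le hAB hD
    set P := A * B * D
    have h5 := rpow_le_mul_rpow_of_le_mul (e := b') (by positivity) (by norm_num) hmod (by linarith)
    calc P ^ k * S ^ b' ≤ P ^ k * (16 ^ (-b') * P ^ b') := by gcongr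
      _ = 16 ^ (-b') * P ^ (k + b') := by rw [Real.rpow_add (by positivity)]; ring
      _ ≤ 16 ^ (-b') * P ^ (1 / 6 : ℝ) := by
        gcongr
        linarith
  calc cubicKer k b b' x y z = (jpow k x.1 * jpow k y.1 * jpow k z.1 * modw b' (x + y + z)) *
        (modw (-b) x * modw (-b) y * modw (-b) z) * jpow (-k) (x + y + z).1 := by
        unfold cubicKer; ring
    _ ≤ ENNReal.ofReal (16 ^ (-b')) * (jpow (1 / 6) x.1 * jpow (1 / 6) y.1 *
        jpow (1 / 6) z.1) * (modw (-b) x * modw (-b) y * modw (-b) z) * 1 := by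
        gcongr
        exact jpow_le_one (by linarith) _
    _ = _ := by unfold sixthWeight; ring

/-- The resonance identity forces one of the four modulations to be large. -/
theorem exists_large_modulation {x y z : ℝ × ℝ}
    (hx : 4 * (1 + |(x + y + z).1|) < 1 + |x.1|) (hy : 4 * (1 + |(x + y + z).1|) < 1 + |y.1|)
    (hz : 4 * (1 + |(x + y + z).1|) < 1 + |z.1|) :
    (1 + |x.1|) * (1 + |y.1|) * (1 + |z.1|) ≤ 16 * (1 + |x.2 - x.1 ^ 3|) ∨
    (1 + |x.1|) * (1 + |y.1|) * (1 + |z.1|) ≤ 16 * (1 + |y.2 - y.1 ^ 3|) ∨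
    (1 + |x.1|) * (1 + |y.1|) * (1 + |z.1|) ≤ 16 * (1 + |z.2 - z.1 ^ 3|) ∨
    (1 + |x.1|) * (1 + |y.1|) * (1 + |z.1|) ≤
      16 * (1 + |(x + y + z).2 - (x + y + z).1 ^ 3|) := by
  by_contra! hcon
  obtain ⟨h1, h2, h3, h4⟩ := hcon
  have half : ∀ w : ℝ, 4 * (1 + |(x + y + z).1|) < 1 + |w| →
      (1 + |w|) / 2 ≤ |(x + y + z).1 - w| := by
    intro w hw
    have := abs_sub_abs_le_abs_sub w (x + y + z).1
    rw [abs_sub_comm]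
    linarith [abs_nonneg (x + y + z).1]
  have g1 := half _ hx
  have g2 := half _ hy
  have g3 := half _ hz
  have hprod : (1 + |x.1|) / 2 * ((1 + |y.1|) / 2) * ((1 + |z.1|) / 2) ≤
      |(x + y + z).1 - x.1| * |(x + y + z).1 - y.1| * |(x + y + z).1 - z.1| := by
    gcongr
  -- The identity (a+b+c)³ - a³ - b³ - c³ = 3(a+b)(b+c)(c+a). Its left side here is at least 3/8 of
  -- the product of the brackets, whereas four modulations below 1/16 of that product could only add
  -- up to less than 1/4 of it.
  have hid : 3 * (((x + y + z).1 - x.1) * ((x + y + z).1 - y.1) * ((x + y + z).1 - z.1)) =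
      (x.2 - x.1 ^ 3) + (y.2 - y.1 ^ 3) + (z.2 - z.1 ^ 3) -
      ((x + y + z).2 - (x + y + z).1 ^ 3) := by
    simp only [Prod.fst_add, Prod.snd_add]; ring
  have habs := congrArg abs hid
  rw [abs_mul, abs_mul, abs_mul, abs_of_pos (by norm_num : (0 : ℝ) < 3)] at habs
  have t1 := abs_sub ((x.2 - x.1 ^ 3) + (y.2 - y.1 ^ 3) + (z.2 - z.1 ^ 3))
    ((x + y + z).2 - (x + y + z).1 ^ 3)
  have t2 := abs_add_three (x.2 - x.1 ^ 3) (y.2 - y.1 ^ 3) (z.2 - z.1 ^ 3)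
  have t3 : (1 + |x.1|) / 2 * ((1 + |y.1|) / 2) * ((1 + |z.1|) / 2) =
      (1 + |x.1|) * (1 + |y.1|) * (1 + |z.1|) / 8 := by ring
  have t4 : 0 < (1 + |x.1|) * (1 + |y.1|) * (1 + |z.1|) := by positivity
  linarith

theorem triMeas_sixth (b : ℝ) :
    TriMeas fun x y z => sixthWeight b x * sixthWeight b y * sixthWeight b z := by
  unfold TriMeas; fun_prop

theorem triMeas_pairKer (b r : ℝ) : TriMeas fun x y _ => pairKer b r x y := by
  unfold TriMeas pairKer; fun_prop

theorem triBdd_pairKer {b r : ℝ} (hb : 1 / 2 < b) (hr : 1 / 2 < r) :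
    TriBdd fun x y _ => pairKer b r x y :=
  (triBdd_two_weights hb hr).add (triBdd_sum_weight hb (by linarith)) (by unfold TriMeas; fun_prop)

/-- The trilinear estimate in Bourgain spaces for the phase `ξ³`. -/
theorem triBdd_cubicKer (hk : 0 ≤ k) (hk' : k < 1 / 4) (hb : 7 / 12 < b) (hb' : b' ≤ -(1 / 12)) :
    TriBdd (cubicKer k b b') := by
  have B6 := triBdd_sixth (b := b) (by linarith)
  have M6 := triMeas_sixth b
  have BB := triBdd_bilKer (b := b) (r := 1 - 2 * k) (by linarith) (by linarith)
  have MB := triMeas_bilKer b (1 - 2 * k)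
  -- The bound 7/12 is used here: b - k > 7/12 - 1/4 = 1/3 makes 3(b - k)/2 larger than 1/2.
  have BP := triBdd_pairKer (b := b) (r := 3 * (b - k) / 2) (by linarith) (by linarith)
  have MP := triMeas_pairKer b (3 * (b - k) / 2)
  -- One kernel that contains every comparison kernel in all required arrangements of the slots: the
  -- L⁶ kernel, three bilinear ones and three two-factor ones. Each case below then only has to be
  -- compared with one summand.
  have all := ((((((B6.add (BB.swap₂₃) M6).add BB (M6.add MB.swap₂₃)).add (BB.swap₁₂ MB)
    ((M6.add MB.swap₂₃).add MB)).add BP (((M6.add MB.swap₂₃).add MB).add MB.swap₁₂)).add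
    BP.swap₂₃ ((((M6.add MB.swap₂₃).add MB).add MB.swap₁₂).add MP)).add
    (BP.swap₂₃.swap₁₂ MP.swap₂₃)
    (((((M6.add MB.swap₂₃).add MB).add MB.swap₁₂).add MP).add MP.swap₂₃))
  set c1 := ENNReal.ofReal (32 ^ k)
  set c2 := ENNReal.ofReal (4 ^ k) * ENNReal.ofReal (2 ^ (1 - k))
  set c3 := ENNReal.ofReal (16 ^ b) * ENNReal.ofReal (3 ^ (3 * (b - k)))
  set c4 := ENNReal.ofReal (16 ^ (-b'))
  refine all.mono (c := c1 + c2 + c3 + c4) (by finiteness) fun x y z => ?_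
  have w : ∀ {u c v : ℝ≥0∞}, cubicKer k b b' x y z ≤ c * u → c ≤ c1 + c2 + c3 + c4 → u ≤ v →
    cubicKer k b b' x y z ≤ (c1 + c2 + c3 + c4) * v := fun h h1 h2 => h.trans (mul_le_mul' h1 h2)
  have hc1 : c1 ≤ c1 + c2 + c3 + c4 := by
    rw [add_assoc, add_assoc]; exact le_self_add
  have hc2 : c2 ≤ c1 + c2 + c3 + c4 := by
    rw [add_assoc, add_assoc]; exact le_self_add.trans le_add_self
  have hc3 : c3 ≤ c1 + c2 + c3 + c4 := le_add_self.trans le_self_add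
  have hc4 : c4 ≤ c1 + c2 + c3 + c4 := le_add_self
  have hN := one_le_bracket (x + y + z).1
  -- The gap between the thresholds 32 and 4 ensures that a frequency below the lower one is
  -- separated by a factor 6 from the two large ones.
  by_cases hcomp : 1 + |x.1| ≤ 32 * (1 + |(x + y + z).1|) ∧ 1 + |y.1| ≤ 32 * (1 + |(x + y + z).1|) ∧
      1 + |z.1| ≤ 32 * (1 + |(x + y + z).1|)
  · refine w (cubicKer_le_of_comparable hk hk'.le (by linarith) hcomp.1 hcomp.2.1 hcomp.2.2) hc1 ?_
    exact le_self_add.trans (le_self_add.trans (le_self_add.trans (le_self_add.trans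
      (le_self_add.trans le_self_add))))
  rw [not_and_or, not_and_or, not_le, not_le, not_le] at hcomp
  have p23 : x + z + y = x + y + z := by abel
  have p12 : y + x + z = x + y + z := by abel
  have pc : y + z + x = x + y + z := by abel
  have pd : z + x + y = x + y + z := by abel
  by_cases hz : 1 + |z.1| ≤ 4 * (1 + |(x + y + z).1|)
  · refine w (cubicKer_le_of_low hk hk'.le (by linarith) hz ?_) hc2 ?_
    · rcases hcomp with h | h | h
      exacts [Or.inl h, Or.inr h, by linarith]
    · exact (le_add_self (a := bilKer b (1 - 2 * k) x z y)).trans (le_self_add.trans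
        (le_self_add.trans (le_self_add.trans (le_self_add.trans le_self_add))))
  by_cases hy : 1 + |y.1| ≤ 4 * (1 + |(x + y + z).1|)
  · rw [← p23] at hy hcomp
    have := cubicKer_le_of_low (b := b) (b' := b') hk hk'.le (by linarith) (x := x) (y := z) (z := y) hy
      (by rcases hcomp with h | h | h
          exacts [Or.inl h, by linarith [abs_nonneg (x + z + y).1], Or.inr h])
    rw [cubicKer_swap₂₃] at this
    refine w this hc2 ?_
    exact (le_add_self (a := bilKer b (1 - 2 * k) x y z)).trans
        (le_self_add.trans (le_self_add.trans (le_self_add.trans le_self_add)))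
  by_cases hx : 1 + |x.1| ≤ 4 * (1 + |(x + y + z).1|)
  · rw [← pc] at hx hcomp
    have := cubicKer_le_of_low (b := b) (b' := b') hk hk'.le (by linarith) (x := y) (y := z) (z := x) hx
      (by rcases hcomp with h | h | h
          exacts [by linarith [abs_nonneg (y + z + x).1], Or.inl h, Or.inr h])
    rw [cubicKer_swap₂₃, cubicKer_swap₁₂] at this
    refine w this hc2 ?_
    exact (le_add_self (a := bilKer b (1 - 2 * k) y x z)).trans
        (le_self_add.trans (le_self_add.trans le_self_add))
  rw [not_le] at hx hy hz
  rcases exists_large_modulation hx hy hz with h | h | h | h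
  · refine w (cubicKer_le_of_modulation_first hk (by linarith) (by linarith) hx h)
      hc3 ?_
    exact le_add_self
  · rw [← p12] at hy
    have := cubicKer_le_of_modulation_first (k := k) (b := b) (b' := b') (x := y) (y := x) (z := z) hk
      (by linarith) (by linarith) hy (by linarith)
    rw [cubicKer_swap₁₂] at this
    refine w this hc3 ?_
    exact (le_add_self (a := pairKer b (3 * (b - k) / 2) x z)).trans le_self_add
  · rw [← pd] at hz
    have := cubicKer_le_of_modulation_first (k := k) (b := b) (b' := b') (x := z) (y := x) (z := y) hk
      (by linarith) (by linarith) hz (by linarith)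
    rw [cubicKer_swap₁₂, cubicKer_swap₂₃] at this
    refine w this hc3 ?_
    exact (le_add_self (a := pairKer b (3 * (b - k) / 2) x y)).trans
      (le_self_add.trans le_self_add)
  · refine w (cubicKer_le_of_modulation_out hk hk'.le hb' h) hc4 ?_
    exact le_self_add.trans (le_self_add.trans (le_self_add.trans (le_self_add.trans
      (le_self_add.trans le_self_add))))

/-! ### The kernel behind the L⁴ embedding. -/

/-- The kernel of the estimate `X^{-k,b} × X^{-k,b} × X^{1,b} → L²`. -/
def embedKer (k b : ℝ) (x y z : ℝ × ℝ) : ℝ≥0∞ :=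
  jpow k x.1 * modw (-b) x * (jpow k y.1 * modw (-b) y) * (jpow (-1) z.1 * modw (-b) z)

/-- If x is the largest of the two rough frequencies and also far above z, the pair x, z has
bilinear smoothing and y goes into L¹. -/
theorem embedKer_le_of_high (hk' : k ≤ 1 / 4) {x y z : ℝ × ℝ}
    (hxy : 1 + |y.1| ≤ 1 + |x.1|) (hxz : 6 * (1 + |z.1|) ≤ 1 + |x.1|) :
    embedKer k b x y z ≤ ENNReal.ofReal (2 ^ (1 - k)) * bilKer b (1 - 2 * k) x z y := by
  have key := jpow_mul_jpow_le_of_le (k := k) (x := x.1) (y := y.1) (by linarith)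
    (by linarith [abs_nonneg x.1])
  calc embedKer k b x y z = (jpow k x.1 * jpow k y.1) *
        (modw (-b) x * modw (-b) y * modw (-b) z) * jpow (-1) z.1 := by unfold embedKer; ring
    _ ≤ (ENNReal.ofReal (2 ^ (1 - k)) * (jpow 1 x.1 * jpow (-(1 - 2 * k)) y.1)) *
        (modw (-b) x * modw (-b) y * modw (-b) z) * 1 := by
        gcongr
        exact jpow_le_one (by norm_num) _
    _ = _ := by unfold bilKer; rw [sepInd_eq_one hxz]; ring

/-- If z dominates both rough frequencies, its weight of order -1 pays for two weights of order k ≤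
1/2; the weights of the L⁶ estimate are then at least 1 and come for free. -/
theorem embedKer_le_of_low (hk' : k ≤ 1 / 4) {x y z : ℝ × ℝ}
    (hx : 1 + |x.1| ≤ 6 * (1 + |z.1|)) (hy : 1 + |y.1| ≤ 6 * (1 + |z.1|)) :
    embedKer k b x y z ≤ 6 * (sixthWeight b x * sixthWeight b y * sixthWeight b z) := by
  have key : jpow k x.1 * jpow k y.1 * jpow (-1) z.1 ≤
      6 * (jpow (1 / 6) x.1 * jpow (1 / 6) y.1 * jpow (1 / 6) z.1) := by
    have h1 : ∀ e u : ℝ, 0 ≤ e → 1 ≤ jpow e u := fun e u he =>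
      (jpow_zero u).symm.le.trans (jpow_mono he u)
    have h2 : ∀ u : ℝ, 1 + |u| ≤ 6 * (1 + |z.1|) → jpow k u ≤
        ENNReal.ofReal (6 ^ (1 / 2 : ℝ)) * jpow (1 / 2) z.1 := by
      intro u hu
      refine (jpow_mono (by linarith : k ≤ 1 / 2) u).trans ?_
      unfold jpow
      rw [← ENNReal.ofReal_mul (by positivity)]
      apply ENNReal.ofReal_le_ofReal
      rw [← Real.mul_rpow (by norm_num) (by positivity)]
      exact Real.rpow_le_rpow (by positivity) hu (by norm_num)
    calc _ ≤ (ENNReal.ofReal (6 ^ (1 / 2 : ℝ)) * jpow (1 / 2) z.1) *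
          (ENNReal.ofReal (6 ^ (1 / 2 : ℝ)) * jpow (1 / 2) z.1) * jpow (-1) z.1 := by
          gcongr
          exacts [h2 _ hx, h2 _ hy]
      _ = ENNReal.ofReal (6 ^ (1 / 2 : ℝ) * 6 ^ (1 / 2 : ℝ)) *
          (jpow (1 / 2) z.1 * jpow (1 / 2) z.1 * jpow (-1) z.1) := by
          rw [ENNReal.ofReal_mul (by positivity)]; ring
      _ = 6 * (1 * 1 * 1) := by
          rw [← Real.rpow_add (by norm_num), jpow_mul_jpow, jpow_mul_jpow]
          norm_num [jpow_zero]
      _ ≤ _ := by gcongr <;> exact h1 _ _ (by norm_num)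
  calc embedKer k b x y z = (jpow k x.1 * jpow k y.1 * jpow (-1) z.1) *
        (modw (-b) x * modw (-b) y * modw (-b) z) := by unfold embedKer; ring
    _ ≤ (6 * (jpow (1 / 6) x.1 * jpow (1 / 6) y.1 * jpow (1 / 6) z.1)) *
        (modw (-b) x * modw (-b) y * modw (-b) z) := by gcongr
    _ = _ := by unfold sixthWeight; ring

theorem triBdd_embedKer (hk' : k < 1 / 4) (hb : 1 / 2 < b) :
    TriBdd (embedKer k b) := by
  have B6 := triBdd_sixth (b := b) (by linarith)
  have M6 := triMeas_sixth b
  have BB := triBdd_bilKer (b := b) (r := 1 - 2 * k) (by linarith) (by linarith)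
  have MB := triMeas_bilKer b (1 - 2 * k)
  have all := (B6.add BB.swap₂₃ M6).add (BB.swap₂₃.swap₁₂ MB.swap₂₃) (M6.add MB.swap₂₃)
  set c2 := ENNReal.ofReal (2 ^ (1 - k))
  refine all.mono (c := 6 + c2) (by finiteness) fun x y z => ?_
  have hc1 : (6 : ℝ≥0∞) ≤ 6 + c2 := le_self_add
  have hc2 : c2 ≤ 6 + c2 := le_add_self
  by_cases h : 1 + |x.1| ≤ 6 * (1 + |z.1|) ∧ 1 + |y.1| ≤ 6 * (1 + |z.1|)
  · exact (embedKer_le_of_low hk'.le h.1 h.2).trans (mul_le_mul' hc1 (le_self_add.trans le_self_add))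
  · rw [not_and_or, not_le, not_le] at h
    rcases le_total (1 + |y.1|) (1 + |x.1|) with hxy | hxy
    · refine (embedKer_le_of_high hk'.le hxy ?_).trans
        (mul_le_mul' hc2 ((le_add_self (a := bilKer b (1 - 2 * k) x z y)).trans le_self_add))
      rcases h with h | h <;> linarith
    · have hsw : embedKer k b x y z = embedKer k b y x z := by unfold embedKer; ring
      rw [hsw]
      refine (embedKer_le_of_high hk'.le hxy ?_).trans
        (mul_le_mul' hc2 (le_add_self (a := bilKer b (1 - 2 * k) y z x)))
      rcases h with h | h <;> linarith
end

/-! ### Affine change of the phase -/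

/-- The affine change of variables which turns a general cubic phase into a pure cube. -/
def cubicShift (a c : ℝ) (hc : c ≠ 0) : (ℝ × ℝ) ≃ᵐ (ℝ × ℝ) where
  toFun ζ := (ζ.1 + a, (ζ.2 + 3 * a ^ 2 * c * ζ.1 + a ^ 3 * c) / c)
  invFun x := (x.1 - a, c * x.2 - 3 * a ^ 2 * c * (x.1 - a) - a ^ 3 * c)
  left_inv ζ := by
    ext
    · simp
    · simp only; field_simp; ring
  right_inv x := by
    ext
    · simp
    · simp only; field_simp; ring
  measurable_toFun := by simp only [Equiv.coe_fn_mk]; fun_prop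
  measurable_invFun := by simp only [Equiv.coe_fn_symm_mk]; fun_prop

theorem cubicShift_apply (a c : ℝ) (hc : c ≠ 0) (ζ : ℝ × ℝ) :
    cubicShift a c hc ζ = (ζ.1 + a, (ζ.2 + 3 * a ^ 2 * c * ζ.1 + a ^ 3 * c) / c) := rfl

/-- The coefficients 1, -1, 1 sum to 1, so an affine map, and not only a linear one, respects this
combination. Thus the form u ū u of the nonlinearity allows the quadratic part of the phase to be
shifted away. -/
theorem cubicShift_sub_add (a c : ℝ) (hc : c ≠ 0) (x y z : ℝ × ℝ) :
    cubicShift a c hc (x - y + z) =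
      cubicShift a c hc x - cubicShift a c hc y + cubicShift a c hc z := by
  ext
  · simp [cubicShift_apply]; ring
  · simp [cubicShift_apply]; field_simp; ring

theorem lintegral_comp_div_real (f : ℝ → ℝ≥0∞) (hf : Measurable f) {c : ℝ} (hc : c ≠ 0) :
    ∫⁻ x, f (x / c) = ENNReal.ofReal |c| * ∫⁻ x, f x := by
  have h := Real.map_volume_mul_left (inv_ne_zero hc)
  have h2 : ∫⁻ x, f x ∂(Measure.map (c⁻¹ * ·) volume) = ∫⁻ x, f (x / c) := by
    rw [lintegral_map hf (by fun_prop)]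
    simp_rw [div_eq_inv_mul]
  rw [← h2, h, lintegral_smul_measure, inv_inv, smul_eq_mul]

theorem lintegral_comp_cubicShift (a c : ℝ) (hc : c ≠ 0) (H : ℝ × ℝ → ℝ≥0∞) :
    ∫⁻ ζ, H (cubicShift a c hc ζ) = ENNReal.ofReal |c| * ∫⁻ x, H x := by
  have key : Measure.map (cubicShift a c hc) volume =
      ENNReal.ofReal |c| • (volume : Measure (ℝ × ℝ)) := by
    refine Measure.ext_of_lintegral _ fun f hf => ?_
    rw [lintegral_map hf (cubicShift a c hc).measurable, lintegral_smul_measure,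
      Measure.volume_eq_prod, lintegral_prod _ (by fun_prop), lintegral_prod _ (by fun_prop),
      smul_eq_mul, ← lintegral_const_mul _ (by fun_prop)]
    simp only [cubicShift_apply]
    rw [← lintegral_add_right_eq_self (fun x => ENNReal.ofReal |c| * ∫⁻ y, f (x, y)) a]
    refine lintegral_congr fun η => ?_
    rw [← lintegral_comp_div_real (fun y => f (η + a, y)) (by fun_prop) hc,
      ← lintegral_add_right_eq_self (fun x => f (η + a, x / c)) (3 * a ^ 2 * c * η + a ^ 3 * c)]
    simp only [add_assoc]
  rw [← MeasureTheory.lintegral_map_equiv, key, lintegral_smul_measure, smul_eq_mul]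

/-- Transport of a trilinear bound through an affine change of variables. -/
theorem TriBdd.cubicShift {K : ℝ × ℝ → ℝ × ℝ → ℝ × ℝ → ℝ≥0∞} (hK : TriBdd K)
    {a c : ℝ} (hc : c ≠ 0) {W w₁ w₂ w₃ : ℝ × ℝ → ℝ≥0∞} {A : ℝ≥0∞} (hA : A ≠ ∞)
    (hw : ∀ x y z, W (x - y + z) * (w₁ x * w₂ y * w₃ z) ≤
      A * K (cubicShift a c hc x) (-cubicShift a c hc y) (cubicShift a c hc z)) :
    ∃ C : ℝ≥0∞, C ≠ ∞ ∧ ∀ f₁ f₂ f₃ : ℝ × ℝ → ℝ≥0∞,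
      Measurable f₁ → Measurable f₂ → Measurable f₃ →
      ∫⁻ ζ, (∫⁻ x, ∫⁻ y, W ζ *
        ((w₁ x * f₁ x) * (w₂ y * f₂ y) * (w₃ (ζ - x + y) * f₃ (ζ - x + y)))) ^ 2 ≤
      C * ((∫⁻ z, f₁ z ^ 2) * (∫⁻ z, f₂ z ^ 2) * ∫⁻ z, f₃ z ^ 2) := by
  obtain ⟨C, hC, H⟩ := hK
  set Λ := _root_.cubicShift a c hc with hΛ
  set J := ENNReal.ofReal |c|
  have hJ : J ≠ ∞ := ENNReal.ofReal_ne_top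
  have hJ0 : J ≠ 0 := by simpa [J] using hc
  have hI : ∀ G : ℝ × ℝ → ℝ≥0∞, ∫⁻ ζ, G (Λ ζ) = J * ∫⁻ x, G x :=
    fun G => lintegral_comp_cubicShift a c hc G
  have hI' : ∀ G : ℝ × ℝ → ℝ≥0∞, ∫⁻ ζ, G (-Λ ζ) = J * ∫⁻ x, G x := fun G => by
    rw [hI fun x => G (-x), lintegral_neg_eq_self]
  -- Jacobians: (J·J)² from the two inner integrals under the square, J from the outer one, and J⁻¹
  -- for each of the three norms.
  refine ⟨A ^ 2 * (J * (J * J) ^ 2) * C * (J⁻¹ * J⁻¹ * J⁻¹), by finiteness, fun f₁ f₂ f₃ h₁ h₂ h₃ => ?_⟩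
  set g₁ := fun x => f₁ (Λ.symm x) with hg₁
  set g₂ := fun x => f₂ (Λ.symm (-x)) with hg₂
  set g₃ := fun x => f₃ (Λ.symm x) with hg₃
  have m₁ : Measurable g₁ := h₁.comp Λ.symm.measurable
  have m₂ : Measurable g₂ := h₂.comp (Λ.symm.measurable.comp measurable_neg)
  have m₃ : Measurable g₃ := h₃.comp Λ.symm.measurable
  have n : ∀ {f g : ℝ × ℝ → ℝ≥0∞}, (∫⁻ ζ, g (Λ ζ) ^ 2 = ∫⁻ ζ, f ζ ^ 2) →
      ∫⁻ z, g z ^ 2 = J⁻¹ * ∫⁻ z, f z ^ 2 := fun {f g} h => by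
    rw [← h, hI fun x => g x ^ 2, ← mul_assoc, ENNReal.inv_mul_cancel hJ0 hJ, one_mul]
  have n₁ : ∫⁻ z, g₁ z ^ 2 = J⁻¹ * ∫⁻ z, f₁ z ^ 2 := n (by simp [hg₁])
  have n₃ : ∫⁻ z, g₃ z ^ 2 = J⁻¹ * ∫⁻ z, f₃ z ^ 2 := n (by simp [hg₃])
  have n₂ : ∫⁻ z, g₂ z ^ 2 = J⁻¹ * ∫⁻ z, f₂ z ^ 2 := by
    rw [← lintegral_neg_eq_self]
    exact n (g := fun x => g₂ (-x)) (by simp [hg₂])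
  calc _ ≤ ∫⁻ ζ, (A * ((J * J) * ∫⁻ p, ∫⁻ q, g₁ p * g₂ q * g₃ (Λ ζ - p - q) *
          K p q (Λ ζ - p - q))) ^ 2 := by
        refine lintegral_mono fun ζ => ?_
        simp only
        gcongr
        calc _ ≤ ∫⁻ x, ∫⁻ y, A * (g₁ (Λ x) * g₂ (-Λ y) * g₃ (Λ ζ - Λ x - -Λ y) *
              K (Λ x) (-Λ y) (Λ ζ - Λ x - -Λ y)) := by
              refine lintegral_mono fun x => lintegral_mono fun y => ?_
              have e : Λ ζ - Λ x - -Λ y = Λ (ζ - x + y) := by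
                rw [hΛ, cubicShift_sub_add, sub_neg_eq_add]
              simp only [e, hg₁, hg₂, hg₃, neg_neg, MeasurableEquiv.symm_apply_apply]
              have := hw x y (ζ - x + y)
              rw [show x - y + (ζ - x + y) = ζ by abel] at this
              calc _ = (W ζ * (w₁ x * w₂ y * w₃ (ζ - x + y))) *
                    (f₁ x * f₂ y * f₃ (ζ - x + y)) := by ring
                _ ≤ _ := mul_le_mul_left this _
                _ = _ := by ring
          _ = A * (J * J * _) := by
              simp_rw [lintegral_const_mul' A _ hA]
              rw [hI fun p => ∫⁻ y, g₁ p * g₂ (-Λ y) * g₃ (Λ ζ - p - -Λ y) *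
                K p (-Λ y) (Λ ζ - p - -Λ y)]
              have e2 : ∀ p, ∫⁻ y, g₁ p * g₂ (-Λ y) * g₃ (Λ ζ - p - -Λ y) *
                  K p (-Λ y) (Λ ζ - p - -Λ y) = J * ∫⁻ q, g₁ p * g₂ q * g₃ (Λ ζ - p - q) *
                  K p q (Λ ζ - p - q) := fun p =>
                hI' fun q => g₁ p * g₂ q * g₃ (Λ ζ - p - q) * K p q (Λ ζ - p - q)
              simp_rw [e2]
              rw [lintegral_const_mul' J _ hJ, mul_assoc J J]
    _ = A ^ 2 * (J * J) ^ 2 * (J * ∫⁻ z, (∫⁻ p, ∫⁻ q, g₁ p * g₂ q * g₃ (z - p - q) *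
          K p q (z - p - q)) ^ 2) := by
        rw [← hI fun z => (∫⁻ p, ∫⁻ q, g₁ p * g₂ q * g₃ (z - p - q) *
          K p q (z - p - q)) ^ 2, ← lintegral_const_mul' _ _ (by finiteness)]
        refine lintegral_congr fun ζ => ?_
        ring
    _ ≤ A ^ 2 * (J * J) ^ 2 * (J * (C * ((∫⁻ z, g₁ z ^ 2) * (∫⁻ z, g₂ z ^ 2) *
          ∫⁻ z, g₃ z ^ 2))) := by
        gcongr
        exact H g₁ g₂ g₃ m₁ m₂ m₃
    _ = _ := by rw [n₁, n₂, n₃]; ring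

/-! ### Weights for a general phase -/

/-- The phase of the linear equation, for the normalization `e^{2πi(xη + tτ)}`. -/
def phase (α β η : ℝ) : ℝ := 2 * Real.pi * α * η ^ 2 + 4 * Real.pi ^ 2 * β * η ^ 3

/-- The weight `(1 + η²)^{s/2} (1 + |τ - p(η)|)^b`. -/
def wt (p : ℝ → ℝ) (s b : ℝ) (ζ : ℝ × ℝ) : ℝ :=
  (1 + ζ.1 ^ 2) ^ (s / 2) * (1 + |ζ.2 - p ζ.1|) ^ b

theorem wt_pos (p : ℝ → ℝ) (s b : ℝ) (ζ : ℝ × ℝ) : 0 < wt p s b ζ := by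
  unfold wt; positivity

theorem wt_ne_zero (p : ℝ → ℝ) (s b : ℝ) (ζ : ℝ × ℝ) : wt p s b ζ ≠ 0 := (wt_pos p s b ζ).ne'

theorem wt_neg (p : ℝ → ℝ) (s b : ℝ) (ζ : ℝ × ℝ) : wt p (-s) (-b) ζ = (wt p s b ζ)⁻¹ := by
  unfold wt
  rw [neg_div, Real.rpow_neg (by positivity), Real.rpow_neg (by positivity), mul_inv]

theorem measurable_wt {p : ℝ → ℝ} (hp : Measurable p) (s b : ℝ) : Measurable (wt p s b) := by
  unfold wt; fun_prop

/-- The weight `wt` as an extended nonnegative real. -/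
def ewt (p : ℝ → ℝ) (s b : ℝ) (ζ : ℝ × ℝ) : ℝ≥0∞ := ENNReal.ofReal (wt p s b ζ)

theorem rpow_le_of_comparable {u v M e : ℝ} (hu : 0 < u) (hv : 0 < v) (hM : 1 ≤ M)
    (h1 : u ≤ M * v) (h2 : v ≤ M * u) : u ^ e ≤ M ^ |e| * v ^ e := by
  rcases le_total 0 e with he | he
  · rw [abs_of_nonneg he, ← Real.mul_rpow (by positivity) hv.le]
    exact Real.rpow_le_rpow hu.le h1 he
  · rw [abs_of_nonpos he]
    exact rpow_le_mul_rpow_of_le_mul hv (by positivity) h2 he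

theorem sqrt_bracket_comparable (x : ℝ) :
    (1 + x ^ 2) ^ (1 / 2 : ℝ) ≤ 1 + |x| ∧ 1 + |x| ≤ 2 * (1 + x ^ 2) ^ (1 / 2 : ℝ) := by
  rw [← Real.sqrt_eq_rpow]
  constructor
  · rw [Real.sqrt_le_left (by positivity)]
    nlinarith [abs_nonneg x, sq_abs x]
  · rw [← div_le_iff₀' (by norm_num)]
    apply Real.le_sqrt_of_sq_le
    nlinarith [sq_abs x, sq_nonneg (|x| - 1)]

theorem sobolevWeight_le (s x : ℝ) : (1 + x ^ 2) ^ (s / 2) ≤ 2 ^ |s| * (1 + |x|) ^ s := by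
  have h := sqrt_bracket_comparable x
  have := rpow_le_of_comparable (e := s) (by positivity) (bracket_pos x) one_le_two
    (h.1.trans (by linarith [bracket_pos x])) h.2
  rwa [← Real.rpow_mul (by positivity), one_div_mul_eq_div] at this

theorem le_sobolevWeight (s x : ℝ) : (1 + |x|) ^ s ≤ 2 ^ |s| * (1 + x ^ 2) ^ (s / 2) := by
  have h := sqrt_bracket_comparable x
  have := rpow_le_of_comparable (e := s) (bracket_pos x) (by positivity) one_le_two h.2
    (h.1.trans (by linarith [bracket_pos x]))
  rwa [← Real.rpow_mul (by positivity), one_div_mul_eq_div] at this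

theorem bracket_le_add (x y : ℝ) : 1 + |x + y| ≤ (1 + |y|) * (1 + |x|) := by
  nlinarith [abs_add_le x y, abs_nonneg x, abs_nonneg y]

section
variable {α β : ℝ}

theorem phase_coeff_ne_zero (hβ : β ≠ 0) : 4 * Real.pi ^ 2 * β ≠ 0 := by positivity

/-- The affine change of variables adapted to `phase α β`. -/
def phaseShift (α : ℝ) (hβ : β ≠ 0) : (ℝ × ℝ) ≃ᵐ (ℝ × ℝ) :=
  cubicShift (2 * Real.pi * α / (3 * (4 * Real.pi ^ 2 * β))) (4 * Real.pi ^ 2 * β)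
    (phase_coeff_ne_zero hβ)

/-- Completing the cube: with a the quadratic coefficient divided by 3c, c(η + a)³ has the cubic and
quadratic terms of the phase. The leftover linear and constant terms are absorbed into the time
frequency. -/
theorem phaseShift_modulation (α : ℝ) (hβ : β ≠ 0) (ζ : ℝ × ℝ) :
    ζ.2 - phase α β ζ.1 = 4 * Real.pi ^ 2 * β *
      ((phaseShift α hβ ζ).2 - (phaseShift α hβ ζ).1 ^ 3) := by
  have := phase_coeff_ne_zero hβ
  simp only [phaseShift, cubicShift_apply, phase]
  generalize 4 * Real.pi ^ 2 * β = c at *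
  field_simp
  ring

/-- The weights for the phase `phase α β` are comparable with those for the phase `ξ³`. -/
theorem exists_wt_le (α : ℝ) (hβ : β ≠ 0) (s b : ℝ) : ∃ A : ℝ≥0∞, A ≠ ∞ ∧ ∀ ζ,
    ewt (phase α β) s b ζ ≤
      A * (jpow s (phaseShift α hβ ζ).1 * modw b (phaseShift α hβ ζ)) := by
  set a := 2 * Real.pi * α / (3 * (4 * Real.pi ^ 2 * β)) with ha
  set c := 4 * Real.pi ^ 2 * β with hc
  have hc0 : c ≠ 0 := phase_coeff_ne_zero hβ
  set M := max (1 + |a|) (max |c| (max |c⁻¹| 1)) with hM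
  have hM1 : 1 ≤ M := by simp [hM]
  have hMa : 1 + |a| ≤ M := by simp [hM]
  have hMc : |c| ≤ M := by simp [hM]
  have hMc' : |c⁻¹| ≤ M := by simp [hM]
  refine ⟨ENNReal.ofReal (2 ^ |s| * M ^ |s| * M ^ |b|), by finiteness, fun ζ => ?_⟩
  unfold jpow modw ewt
  unfold jpow
  rw [← ENNReal.ofReal_mul (by positivity), ← ENNReal.ofReal_mul (by positivity)]
  apply ENNReal.ofReal_le_ofReal
  have e1 : (phaseShift α hβ ζ).1 = ζ.1 + a := rfl
  have e2 := phaseShift_modulation α hβ ζ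
  rw [← hc] at e2
  set X := (phaseShift α hβ ζ).1
  set S := (phaseShift α hβ ζ).2 - X ^ 3
  unfold wt
  rw [e2]
  have h1 : (1 + |ζ.1|) ^ s ≤ M ^ |s| * (1 + |X|) ^ s := by
    refine rpow_le_of_comparable (bracket_pos _) (bracket_pos _) hM1 ?_ ?_
    · have := bracket_le_add X (-a)
      rw [e1, add_neg_cancel_right, abs_neg] at this
      rw [e1]
      exact this.trans (by gcongr)
    · rw [e1]
      exact (bracket_le_add ζ.1 a).trans (by gcongr)
  have h2 : (1 + |c * S|) ^ b ≤ M ^ |b| * (1 + |S|) ^ b := by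
    refine rpow_le_of_comparable (bracket_pos _) (bracket_pos _) hM1 ?_ ?_
    · rw [abs_mul, mul_add]
      gcongr
      linarith
    · have : |S| = |c⁻¹| * |c * S| := by rw [← abs_mul, inv_mul_cancel_left₀ hc0]
      rw [this, mul_add]
      gcongr
      linarith
  calc _ ≤ (2 ^ |s| * (1 + |ζ.1|) ^ s) * (M ^ |b| * (1 + |S|) ^ b) := by
        gcongr
        exact sobolevWeight_le s ζ.1
    _ ≤ (2 ^ |s| * (M ^ |s| * (1 + |X|) ^ s)) * (M ^ |b| * (1 + |S|) ^ b) := by gcongr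
    _ = _ := by ring

theorem modw_neg_arg (e : ℝ) (x : ℝ × ℝ) : modw e (-x) = modw e x := by
  unfold modw
  rw [← jpow_neg_arg]
  congr 1
  simp only [Prod.fst_neg, Prod.snd_neg]; ring

theorem jpow_add_le {e : ℝ} (he : 0 ≤ e) (x y : ℝ) : jpow e (x + y) ≤ jpow e x * jpow e y := by
  unfold jpow
  rw [← ENNReal.ofReal_mul (by positivity), ← Real.mul_rpow (by positivity) (by positivity)]
  refine ENNReal.ofReal_le_ofReal (Real.rpow_le_rpow (by positivity) ?_ he)
  rw [mul_comm]
  exact bracket_le_add x y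

/-- The trilinear estimate `X^{s,b} × X^{s,b} × X^{s,b} → X^{s,b'}` for `u₁ ū₂ u₃`. -/
theorem exists_cubic_bound (α : ℝ) (hβ : β ≠ 0) {s b b' : ℝ} (hs : -(1 / 4) < s) (hb : 7 / 12 < b)
    (hb' : b' ≤ -(1 / 12)) : ∃ C : ℝ≥0∞, C ≠ ∞ ∧ ∀ f₁ f₂ f₃ : ℝ × ℝ → ℝ≥0∞,
      Measurable f₁ → Measurable f₂ → Measurable f₃ →
      ∫⁻ ζ, (∫⁻ x, ∫⁻ y, ewt (phase α β) s b' ζ *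
        ((ewt (phase α β) (-s) (-b) x * f₁ x) *
          (ewt (phase α β) (-s) (-b) y * f₂ y) *
          (ewt (phase α β) (-s) (-b) (ζ - x + y) * f₃ (ζ - x + y)))) ^ 2 ≤
      C * ((∫⁻ z, f₁ z ^ 2) * (∫⁻ z, f₂ z ^ 2) * ∫⁻ z, f₃ z ^ 2) := by
  obtain ⟨A, hA, hA'⟩ := exists_wt_le α hβ s b'
  obtain ⟨B, hB, hB'⟩ := exists_wt_le α hβ (-s) (-b)
  -- Reduction to regularity -k with k = max(0, -s). The excess weight of exponent s + k ≥ 0 is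
  -- submultiplicative, so that of the output is distributed over the three inputs.
  have hk : ∃ k : ℝ, 0 ≤ k ∧ k < 1 / 4 ∧ 0 ≤ s + k :=
    ⟨max 0 (-s), le_max_left _ _, max_lt (by norm_num) (by linarith),
      by linarith [le_max_right 0 (-s)]⟩
  obtain ⟨k, hk0, hk1, hk2⟩ := hk
  refine (triBdd_cubicKer hk0 hk1 hb hb').cubicShift
    (a := 2 * Real.pi * α / (3 * (4 * Real.pi ^ 2 * β)))
    (phase_coeff_ne_zero hβ) (W := ewt (phase α β) s b') (w₁ := ewt (phase α β) (-s) (-b))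
    (w₂ := ewt (phase α β) (-s) (-b)) (w₃ := ewt (phase α β) (-s) (-b)) (A := A * (B * B * B)) (by finiteness) fun x y z => ?_
  change _ ≤ _ * cubicKer k b b' (phaseShift α hβ x) (-phaseShift α hβ y) (phaseShift α hβ z)
  have e : phaseShift α hβ (x - y + z) =
      phaseShift α hβ x + -phaseShift α hβ y + phaseShift α hβ z := by
    rw [← sub_eq_add_neg]; exact cubicShift_sub_add _ _ _ x y z
  refine (mul_le_mul' (hA' _) (mul_le_mul' (mul_le_mul' (hB' x) (hB' y)) (hB' z))).trans ?_
  rw [e]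
  set X := phaseShift α hβ x
  set Y := phaseShift α hβ y
  set Z := phaseShift α hβ z
  unfold cubicKer
  rw [modw_neg_arg]
  have j : jpow s (X + -Y + Z).1 * (jpow (-s) X.1 * jpow (-s) Y.1 * jpow (-s) Z.1) ≤
      jpow k X.1 * jpow k (-Y).1 * jpow k Z.1 * jpow (-k) (X + -Y + Z).1 := by
    have h : ∀ w : ℝ × ℝ, jpow k w.1 = jpow (-s) w.1 * jpow (s + k) w.1 := fun w => by
      rw [jpow_mul_jpow]; congr 1; ring
    have h' : jpow s (X + -Y + Z).1 = jpow (-k) (X + -Y + Z).1 * jpow (s + k) (X + -Y + Z).1 := by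
      rw [jpow_mul_jpow]; congr 1; ring
    rw [h X, h Z, h (-Y), h', Prod.fst_neg, jpow_neg_arg, jpow_neg_arg]
    have h3 : jpow (s + k) (X + -Y + Z).1 ≤
        jpow (s + k) X.1 * jpow (s + k) Y.1 * jpow (s + k) Z.1 := by
      rw [Prod.fst_add, Prod.fst_add, Prod.fst_neg]
      refine (jpow_add_le hk2 _ _).trans (mul_le_mul_left ?_ _)
      refine (jpow_add_le hk2 _ _).trans ?_
      rw [jpow_neg_arg]
    calc _ ≤ jpow (-k) (X + -Y + Z).1 *
          (jpow (s + k) X.1 * jpow (s + k) Y.1 * jpow (s + k) Z.1) *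
          (jpow (-s) X.1 * jpow (-s) Y.1 * jpow (-s) Z.1) := by gcongr
      _ = _ := by ring
  calc _ = A * (B * B * B) * ((jpow s (X + -Y + Z).1 *
        (jpow (-s) X.1 * jpow (-s) Y.1 * jpow (-s) Z.1)) *
        (modw (-b) X * modw (-b) Y * modw (-b) Z) * modw b' (X + -Y + Z)) := by ring
    _ ≤ _ := by gcongr

/-- The trilinear estimate `X^{s,b} × X^{s,b} × X^{1,b} → L²` for `u₁ ū₂ u₃`. -/
theorem exists_embed_bound (α : ℝ) (hβ : β ≠ 0) {s b : ℝ} (hs : -(1 / 4) < s) (hb : 1 / 2 < b) :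
    ∃ C : ℝ≥0∞, C ≠ ∞ ∧ ∀ f₁ f₂ f₃ : ℝ × ℝ → ℝ≥0∞,
      Measurable f₁ → Measurable f₂ → Measurable f₃ →
      ∫⁻ ζ, (∫⁻ x, ∫⁻ y, (1 : ℝ≥0∞) *
        ((ewt (phase α β) (-s) (-b) x * f₁ x) *
          (ewt (phase α β) (-s) (-b) y * f₂ y) *
          (ewt (phase α β) (-1) (-b) (ζ - x + y) * f₃ (ζ - x + y)))) ^ 2 ≤
      C * ((∫⁻ z, f₁ z ^ 2) * (∫⁻ z, f₂ z ^ 2) * ∫⁻ z, f₃ z ^ 2) := by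
  obtain ⟨A, hA, hA'⟩ := exists_wt_le α hβ (-1) (-b)
  obtain ⟨B, hB, hB'⟩ := exists_wt_le α hβ (-s) (-b)
  have hk : ∃ k : ℝ, 0 ≤ k ∧ k < 1 / 4 ∧ 0 ≤ s + k :=
    ⟨max 0 (-s), le_max_left _ _, max_lt (by norm_num) (by linarith),
      by linarith [le_max_right 0 (-s)]⟩
  obtain ⟨k, -, hk1, hk2⟩ := hk
  refine (triBdd_embedKer hk1 hb).cubicShift
    (a := 2 * Real.pi * α / (3 * (4 * Real.pi ^ 2 * β)))
    (phase_coeff_ne_zero hβ) (W := fun _ => 1) (w₁ := ewt (phase α β) (-s) (-b))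
    (w₂ := ewt (phase α β) (-s) (-b)) (w₃ := ewt (phase α β) (-1) (-b)) (A := B * B * A) (by finiteness) fun x y z => ?_
  change _ ≤ _ * embedKer k b (phaseShift α hβ x) (-phaseShift α hβ y) (phaseShift α hβ z)
  rw [one_mul]
  refine (mul_le_mul' (mul_le_mul' (hB' x) (hB' y)) (hA' z)).trans ?_
  set X := phaseShift α hβ x
  set Y := phaseShift α hβ y
  set Z := phaseShift α hβ z
  unfold embedKer
  rw [modw_neg_arg, Prod.fst_neg, jpow_neg_arg]
  have hX := jpow_mono (show -s ≤ k by linarith) X.1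
  have hY := jpow_mono (show -s ≤ k by linarith) Y.1
  calc _ = B * B * A * (jpow (-s) X.1 * modw (-b) X * (jpow (-s) Y.1 * modw (-b) Y) *
        (jpow (-1) Z.1 * modw (-b) Z)) := by ring
    _ ≤ _ := by gcongr
end

/-! ### Bounded operators on weighted coefficients: trace, free flow, Duhamel, cube. -/

/-! ### Operators with a kernel on `L²` -/

theorem ennreal_add_sq_le (x y : ℝ≥0∞) : (x + y) ^ 2 ≤ 2 * (x ^ 2 + y ^ 2) := by
  have := ENNReal.rpow_add_le_mul_rpow_add_rpow x y (p := 2) (by norm_num)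
  norm_num at this
  exact this

section
variable {X Θ Y : Type*} [MeasurableSpace X] [MeasurableSpace Θ] [MeasurableSpace Y]
  {μ : Measure X} {ρ : Measure Θ} {ν : Measure Y}

theorem eLpNorm_two_sq {E : Type*} [NormedAddCommGroup E] (f : X → E) :
    eLpNorm f 2 μ ^ 2 = ∫⁻ x, ‖f x‖ₑ ^ 2 ∂μ := by
  have := eLpNorm_nnreal_pow_eq_lintegral (μ := μ) (f := f) (p := 2) (by norm_num)
  simpa only [NNReal.coe_ofNat, ENNReal.rpow_ofNat, ENNReal.coe_ofNat] using this

theorem eLpNorm_two_le_of_sq {E : Type*} [NormedAddCommGroup E] {f : X → E} {A : ℝ≥0∞}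
    (h : ∫⁻ x, ‖f x‖ₑ ^ 2 ∂μ ≤ A ^ 2) : eLpNorm f 2 μ ≤ A := by
  rw [← eLpNorm_two_sq] at h
  exact (ENNReal.pow_le_pow_left_iff two_ne_zero).mp h

theorem lintegral_enorm_sq_lp (h : Lp ℂ 2 ν) :
    ∫⁻ y, ‖h y‖ₑ ^ 2 ∂ν = ENNReal.ofReal ‖h‖ ^ 2 := by
  rw [← eLpNorm_two_sq, ← Lp.enorm_def, ofReal_norm]

theorem norm_toLp_le_of_lintegral {f : X → ℂ} (hf : MemLp f 2 μ) {A : ℝ} (hA : 0 ≤ A)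
    (h : ∫⁻ x, ‖f x‖ₑ ^ 2 ∂μ ≤ ENNReal.ofReal A ^ 2) : ‖hf.toLp f‖ ≤ A := by
  rw [Lp.norm_toLp]
  exact ENNReal.toReal_le_of_le_ofReal hA (eLpNorm_two_le_of_sq h)

/-- A bound for the positive operator with kernel |k| yields the bounded operator, the almost
everywhere absolute convergence of its integral, and joint integrability against any L² function
`w`; the last is what later exchanges of integrals use. The map `y` allows the input to depend on
some of the coordinates only. -/
theorem exists_kernelCLM [SFinite μ] [SFinite ρ] {k : X → Θ → ℂ}
    (hk : Measurable (Function.uncurry k)) {y : X × Θ → Y}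
    (hy : Measure.QuasiMeasurePreserving y (μ.prod ρ) ν) {C : ℝ} (hC : 0 ≤ C)
    (H : ∀ F : Y → ℝ≥0∞, Measurable F →
      ∫⁻ x, (∫⁻ θ, ‖k x θ‖ₑ * F (y (x, θ)) ∂ρ) ^ 2 ∂μ ≤ ENNReal.ofReal C ^ 2 * ∫⁻ z, F z ^ 2 ∂ν) :
    ∃ T : Lp ℂ 2 ν →L[ℂ] Lp ℂ 2 μ, (∀ h, ‖T h‖ ≤ C * ‖h‖) ∧ ∀ h : Lp ℂ 2 ν,
      (∀ᵐ x ∂μ, Integrable (fun θ => k x θ * h (y (x, θ))) ρ) ∧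
      (∀ w : X → ℂ, MemLp w 2 μ →
        Integrable (fun q : X × Θ => w q.1 * (k q.1 q.2 * h (y q))) (μ.prod ρ)) ∧
      T h =ᵐ[μ] fun x => ∫ θ, k x θ * h (y (x, θ)) ∂ρ := by
  have hm : ∀ h : Lp ℂ 2 ν, Measurable fun q : X × Θ => k q.1 q.2 * h (y q) := fun h =>
    hk.mul ((Lp.stronglyMeasurable h).measurable.comp hy.measurable)
  have hb : ∀ h : Lp ℂ 2 ν, ∫⁻ x, (∫⁻ θ, ‖k x θ * h (y (x, θ))‖ₑ ∂ρ) ^ 2 ∂μ ≤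
      ENNReal.ofReal (C * ‖h‖) ^ 2 := fun h => by
    have := H (fun z => ‖h z‖ₑ) (Lp.stronglyMeasurable h).measurable.enorm
    rw [lintegral_enorm_sq_lp, ← mul_pow, ← ENNReal.ofReal_mul hC] at this
    simpa only [enorm_mul] using this
  have hI : ∀ h : Lp ℂ 2 ν, ∀ᵐ x ∂μ, Integrable (fun θ => k x θ * h (y (x, θ))) ρ := fun h => by
    have hfin : ∫⁻ x, (∫⁻ θ, ‖k x θ * h (y (x, θ))‖ₑ ∂ρ) ^ 2 ∂μ ≠ ∞ :=
      ((hb h).trans_lt (by finiteness)).ne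
    have hmm : Measurable fun x => (∫⁻ θ, ‖k x θ * h (y (x, θ))‖ₑ ∂ρ) ^ 2 :=
      ((hm h).enorm.lintegral_prod_right').pow_const 2
    filter_upwards [ae_lt_top hmm hfin] with x hx
    refine ⟨((hm h).comp measurable_prodMk_left).aestronglyMeasurable, ?_⟩
    by_contra hcon
    rw [HasFiniteIntegral, not_lt, top_le_iff] at hcon
    rw [hcon] at hx
    simp at hx
  have hle : ∀ h : Lp ℂ 2 ν, ∫⁻ x, ‖∫ θ, k x θ * h (y (x, θ)) ∂ρ‖ₑ ^ 2 ∂μ ≤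
      ENNReal.ofReal (C * ‖h‖) ^ 2 := fun h =>
    (lintegral_mono fun x => pow_le_pow_left' (enorm_integral_le_lintegral_enorm _) 2).trans (hb h)
  have hL : ∀ h : Lp ℂ 2 ν, MemLp (fun x => ∫ θ, k x θ * h (y (x, θ)) ∂ρ) 2 μ := fun h =>
    ⟨((hm h).stronglyMeasurable.integral_prod_right').aestronglyMeasurable,
      (eLpNorm_two_le_of_sq (hle h)).trans_lt ENNReal.ofReal_lt_top⟩
  let L : Lp ℂ 2 ν →ₗ[ℂ] Lp ℂ 2 μ :=
    { toFun := fun h => (hL h).toLp _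
      map_add' := fun f g => by
        rw [← MemLp.toLp_add]
        apply MemLp.toLp_congr
        have hae : ∀ᵐ q ∂μ.prod ρ, (f + g : Lp ℂ 2 ν) (y q) = f (y q) + g (y q) :=
          hy.ae (Lp.coeFn_add f g)
        filter_upwards [Measure.ae_ae_of_ae_prod hae, hI f, hI g] with x hx hf hg
        rw [Pi.add_apply, ← integral_add hf hg]
        refine integral_congr_ae ?_
        filter_upwards [hx] with θ hθ
        simp only [hθ, mul_add]
      map_smul' := fun c f => by
        rw [RingHom.id_apply, ← MemLp.toLp_const_smul]
        apply MemLp.toLp_congr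
        have hae : ∀ᵐ q ∂μ.prod ρ, (c • f : Lp ℂ 2 ν) (y q) = c • f (y q) :=
          hy.ae (Lp.coeFn_smul c f)
        filter_upwards [Measure.ae_ae_of_ae_prod hae, hI f] with x hx hf
        rw [Pi.smul_apply, smul_eq_mul, ← integral_const_mul]
        refine integral_congr_ae ?_
        filter_upwards [hx] with θ hθ
        simp only [hθ, smul_eq_mul]
        ring }
  have hn : ∀ h, ‖L h‖ ≤ C * ‖h‖ := fun h =>
    norm_toLp_le_of_lintegral (hL h) (by positivity) (hle h)
  refine ⟨L.mkContinuous C hn, hn, fun h => ⟨hI h, fun w hw => ?_, MemLp.coeFn_toLp (hL h)⟩⟩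
  have hmq := (hm h).aestronglyMeasurable (μ := μ.prod ρ)
  refine ⟨hw.aestronglyMeasurable.comp_fst.mul hmq, ?_⟩
  have hmw : AEMeasurable (fun q : X × Θ => ‖w q.1 * (k q.1 q.2 * h (y q))‖ₑ) (μ.prod ρ) :=
    (hw.aestronglyMeasurable.comp_fst.mul hmq).enorm
  have hin : Measurable fun x => ∫⁻ θ, ‖k x θ * h (y (x, θ))‖ₑ ∂ρ :=
    (hm h).enorm.lintegral_prod_right'
  rw [HasFiniteIntegral, lintegral_prod _ hmw]
  have e : ∀ x, ∫⁻ θ, ‖w x * (k x θ * h (y (x, θ)))‖ₑ ∂ρ =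
      ‖w x‖ₑ * ∫⁻ θ, ‖k x θ * h (y (x, θ))‖ₑ ∂ρ := fun x => by
    simp_rw [enorm_mul (w x)]
    exact lintegral_const_mul' _ _ (by finiteness)
  simp only [e]
  have hsq := lintegral_mul_sq_le hw.aestronglyMeasurable.enorm hin.aemeasurable
  have hfin : (∫⁻ x, ‖w x‖ₑ ^ 2 ∂μ) * ∫⁻ x, (∫⁻ θ, ‖k x θ * h (y (x, θ))‖ₑ ∂ρ) ^ 2 ∂μ < ∞ := by
    refine ENNReal.mul_lt_top ?_ ((hb h).trans_lt (by finiteness))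
    rw [← eLpNorm_two_sq]
    exact ENNReal.pow_lt_top hw.2
  exact (ENNReal.pow_lt_top_iff.mp (hsq.trans_lt hfin)).resolve_right (by norm_num)

end

theorem quasiMeasurePreserving_replace_snd :
    Measure.QuasiMeasurePreserving (fun q : (ℝ × ℝ) × ℝ => (q.1.1, q.2))
      ((volume : Measure (ℝ × ℝ)).prod volume) volume := by
  have h1 : MeasurePreserving (MeasurableEquiv.prodAssoc : (ℝ × ℝ) × ℝ ≃ᵐ ℝ × ℝ × ℝ)
    ((volume.prod volume).prod volume) (volume.prod (volume.prod volume)) :=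
    measurePreserving_prodAssoc _ _ _
  have h3 : Measure.QuasiMeasurePreserving (fun q : ℝ × ℝ × ℝ => (q.1, q.2.2))
      (volume.prod (volume.prod volume)) (volume.prod volume) := by
    have a : MeasurePreserving (Prod.map id Prod.swap : ℝ × ℝ × ℝ → ℝ × ℝ × ℝ)
        (volume.prod (volume.prod volume)) (volume.prod (volume.prod volume)) :=
      (MeasurePreserving.id volume).prod Measure.measurePreserving_swap
    have b : MeasurePreserving (MeasurableEquiv.prodAssoc.symm : ℝ × ℝ × ℝ ≃ᵐ (ℝ × ℝ) × ℝ)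
        (volume.prod (volume.prod volume)) ((volume.prod volume).prod volume) :=
      (measurePreserving_prodAssoc _ _ _).symm _
    exact (Measure.quasiMeasurePreserving_fst.comp b.quasiMeasurePreserving).comp
      a.quasiMeasurePreserving
  exact h3.comp h1.quasiMeasurePreserving

/-! ### One-dimensional kernels in the modulation variable -/

/-- Young's inequality `L¹ * L² → L²` on the line. -/
theorem lintegral_convolution_sq_le {F G : ℝ → ℝ≥0∞} (hF : Measurable F) (hG : Measurable G) :
    ∫⁻ x, (∫⁻ y, G (x - y) * F y) ^ 2 ≤ (∫⁻ x, G x) ^ 2 * ∫⁻ x, F x ^ 2 := by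
  have hpt : ∀ x, (∫⁻ y, G (x - y) * F y) ^ 2 ≤ (∫⁻ x, G x) * ∫⁻ y, G (x - y) * F y ^ 2 := by
    intro x
    have h := lintegral_mul_sq_le (μ := (volume : Measure ℝ))
      (f := fun y => G (x - y) ^ (1 / 2 : ℝ)) (g := fun y => G (x - y) ^ (1 / 2 : ℝ) * F y)
      (by fun_prop) (by fun_prop)
    have hs : ∀ a : ℝ≥0∞, a ^ (1 / 2 : ℝ) * a ^ (1 / 2 : ℝ) = a := by
      intro a
      rw [← ENNReal.rpow_add_of_nonneg _ _ (by norm_num) (by norm_num)]; norm_num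
    have hs2 : ∀ a : ℝ≥0∞, (a ^ (1 / 2 : ℝ)) ^ 2 = a := fun a => by rw [sq, hs]
    simp only [mul_pow, hs2, ← mul_assoc, hs] at h
    rwa [lintegral_sub_left_eq_self G x] at h
  calc _ ≤ ∫⁻ x, (∫⁻ x, G x) * ∫⁻ y, G (x - y) * F y ^ 2 := lintegral_mono hpt
    _ = (∫⁻ x, G x) * ∫⁻ y, ∫⁻ x, G (x - y) * F y ^ 2 := by
        rw [lintegral_const_mul _ (by fun_prop), lintegral_lintegral_swap (by fun_prop)]
    _ = _ := by
        have : ∀ y, ∫⁻ x, G (x - y) * F y ^ 2 = (∫⁻ x, G x) * F y ^ 2 := fun y => by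
          rw [lintegral_mul_const _ (by fun_prop), lintegral_sub_right_eq_self G y]
        simp_rw [this]
        rw [lintegral_const_mul _ (by fun_prop)]
        ring

theorem lintegral_comp_mul_left_real (f : ℝ → ℝ≥0∞) (hf : Measurable f) {T : ℝ} (hT : 0 < T) :
    ∫⁻ x, f (T * x) = ENNReal.ofReal T⁻¹ * ∫⁻ x, f x := by
  have := lintegral_comp_div_real f hf (inv_ne_zero hT.ne')
  rw [abs_of_pos (inv_pos.mpr hT)] at this
  rw [← this]
  simp [div_eq_mul_inv, mul_comm]

/-- The kernel of the truncated Duhamel operator in the modulation variables; `Ψ` is the Fourier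
transform of the cutoff. -/
def duhK (Ψ : ℝ → ℂ) (T σ μ : ℝ) : ℂ :=
  T * (Ψ (T * (σ - μ)) - Ψ (T * σ)) / (2 * Real.pi * Complex.I * μ)

theorem measurable_duhK {Ψ : ℝ → ℂ} (hΨ : Measurable Ψ) (T : ℝ) :
    Measurable (Function.uncurry (duhK Ψ T)) := by
  unfold duhK Function.uncurry; fun_prop

theorem SchwartzMap.exists_norm_le_bracket (Ψ : 𝓢(ℝ, ℂ)) (m : ℕ) :
    ∃ C : ℝ, 0 < C ∧ ∀ x, ‖Ψ x‖ ≤ C * ((1 + |x|) ^ m)⁻¹ := by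
  refine ⟨2 ^ m * ((Finset.Iic (m, 0)).sup fun q => SchwartzMap.seminorm ℂ q.1 q.2) Ψ + 1,
    by positivity, fun x => ?_⟩
  have h := SchwartzMap.one_add_le_sup_seminorm_apply (𝕜 := ℂ) (m := (m, 0)) (le_refl m)
    (le_refl 0) Ψ x
  rw [norm_iteratedFDeriv_zero, Real.norm_eq_abs] at h
  have := bracket_pos x
  rw [← div_eq_mul_inv, le_div_iff₀ (by positivity), mul_comm]
  simp only at h
  linarith

/-- The factor 1/μ is harmless: for |μ| ≥ 1 it is comparable with the inverse bracket, and for |μ| <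
1 the difference of the two values of Ψ is O(|μ|) by the mean value theorem. No splitting into high
and low modulations is needed. -/
theorem exists_norm_duhK_one_le (Ψ : 𝓢(ℝ, ℂ)) : ∃ C : ℝ, 0 < C ∧ ∀ σ μ,
    ‖duhK Ψ 1 σ μ‖ ≤ C * (1 + |μ|)⁻¹ * (((1 + |σ - μ|) ^ 3)⁻¹ + ((1 + |σ|) ^ 3)⁻¹) := by
  obtain ⟨C₀, hC₀, h₀⟩ := Ψ.exists_norm_le_bracket 3
  obtain ⟨C₁, hC₁, h₁⟩ := (SchwartzMap.derivCLM ℂ ℂ Ψ).exists_norm_le_bracket 3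
  refine ⟨2 * C₀ + 16 * C₁, by positivity, fun σ μ => ?_⟩
  have hp := bracket_pos σ
  have hq := bracket_pos (σ - μ)
  have hr := bracket_pos μ
  set P := ((1 + |σ|) ^ 3)⁻¹ with hP
  set Q := ((1 + |σ - μ|) ^ 3)⁻¹ with hQ
  have hP0 : 0 ≤ P := by positivity
  have hQ0 : 0 ≤ Q := by positivity
  have hnorm : ‖duhK Ψ 1 σ μ‖ = ‖Ψ (σ - μ) - Ψ σ‖ / (2 * Real.pi * |μ|) := by
    simp [duhK, abs_of_pos Real.pi_pos]
  have hpi : 1 ≤ 2 * Real.pi := by linarith [Real.pi_gt_three]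
  rw [hnorm]
  by_cases h : 1 ≤ |μ|
  · have h3 : ‖Ψ (σ - μ) - Ψ σ‖ ≤ C₀ * (Q + P) := by
      refine (norm_sub_le _ _).trans ?_
      rw [mul_add]
      exact add_le_add (h₀ _) (h₀ _)
    have h4 : (2 * Real.pi * |μ|)⁻¹ ≤ 2 * (1 + |μ|)⁻¹ := by
      rw [← div_eq_mul_inv, inv_eq_one_div, div_le_div_iff₀ (by positivity) hr]
      nlinarith
    calc _ ≤ C₀ * (Q + P) * (2 * (1 + |μ|)⁻¹) := by
          rw [div_eq_mul_inv]; gcongr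
      _ = 2 * C₀ * (1 + |μ|)⁻¹ * (Q + P) := by ring
      _ ≤ _ := by gcongr; linarith
  · push Not at h
    rcases eq_or_ne μ 0 with h0 | h0
    · simp only [h0, abs_zero, mul_zero, div_zero]
      positivity
    have h5 : ‖Ψ (σ - μ) - Ψ σ‖ ≤ C₁ * (8 * P) * ‖(σ - μ) - σ‖ := by
      refine Convex.norm_image_sub_le_of_norm_deriv_le (s := Metric.closedBall σ |μ|) (𝕜 := ℝ)
        (fun x _ => Ψ.differentiableAt) (fun x hx => ?_) (convex_closedBall _ _)
        (Metric.mem_closedBall_self (abs_nonneg _)) (by simp)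
      refine (h₁ x).trans ?_
      rw [Metric.mem_closedBall, Real.dist_eq] at hx
      gcongr
      have h6 : 1 + |σ| ≤ 2 * (1 + |x|) := by
        have := abs_sub_abs_le_abs_sub σ x
        rw [abs_sub_comm] at this
        linarith [abs_nonneg x]
      have h7 := bracket_pos x
      rw [hP, ← div_eq_mul_inv, inv_eq_one_div, div_le_div_iff₀ (by positivity) (by positivity)]
      calc 1 * (1 + |σ|) ^ 3 ≤ (2 * (1 + |x|)) ^ 3 := by rw [one_mul]; gcongr
        _ = _ := by ring
    rw [sub_sub_cancel_left, norm_neg, Real.norm_eq_abs] at h5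
    have h8 : (1 / 2 : ℝ) ≤ (1 + |μ|)⁻¹ := by
      rw [inv_eq_one_div]; gcongr; linarith
    have hμ : 0 < |μ| := abs_pos.mpr h0
    calc _ ≤ C₁ * (8 * P) := by
          rw [div_le_iff₀ (by positivity)]
          refine h5.trans ?_
          have : |μ| ≤ 2 * Real.pi * |μ| := le_mul_of_one_le_left hμ.le hpi
          gcongr
      _ = (16 * C₁) * (1 / 2) * (0 + P) := by ring
      _ ≤ _ := by gcongr; linarith

theorem duhK_scale (Ψ : ℝ → ℂ) {T : ℝ} (hT : T ≠ 0) (σ μ : ℝ) :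
    duhK Ψ T σ μ = T ^ 2 * duhK Ψ 1 (T * σ) (T * μ) := by
  have hT' : (T : ℂ) ≠ 0 := by exact_mod_cast hT
  unfold duhK
  rcases eq_or_ne μ 0 with h | h
  · simp [h]
  have hμ' : (μ : ℂ) ≠ 0 := by exact_mod_cast h
  have hpi : (Real.pi : ℂ) ≠ 0 := by exact_mod_cast Real.pi_ne_zero
  have hI := Complex.I_ne_zero
  push_cast
  rw [one_mul, one_mul, one_mul, mul_sub]
  field_simp

/-- The pointwise bound for the weighted kernel of the truncated Duhamel operator. -/
theorem exists_weighted_duhK_le (Ψ : 𝓢(ℝ, ℂ)) {b b' : ℝ} (hb : 0 ≤ b) (hb'0 : b' ≤ 0)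
    (hbb : b - 1 ≤ b') : ∃ C : ℝ, 0 < C ∧ ∀ T : ℝ, 0 < T → T ≤ 1 → ∀ σ μ,
    (1 + |σ|) ^ b * ‖duhK Ψ T σ μ‖ * (1 + |μ|) ^ (-b') ≤ C * T ^ (2 - b + b') *
      ((1 + |T * (σ - μ)|) ^ (b - 3) + (1 + |T * σ|) ^ (b - 3) * (1 + |T * μ|) ^ (-1 - b')) := by
  obtain ⟨C, hC, h⟩ := exists_norm_duhK_one_le Ψ
  refine ⟨C, hC, fun T hT hT1 σ μ => ?_⟩
  rw [duhK_scale _ hT.ne', norm_mul, norm_pow, Complex.norm_real, Real.norm_of_nonneg hT.le]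
  have hk := h (T * σ) (T * μ)
  rw [← mul_sub] at hk
  -- Rescaling to T = 1: each bracket costs at most 1/T since T ≤ 1. Together with the factor T²
  -- from `duhK_scale` this produces T^(2-b+b').
  have key : ∀ x : ℝ, 1 + |x| ≤ T⁻¹ * (1 + |T * x|) := fun x => by
    rw [abs_mul, abs_of_pos hT, mul_add, inv_mul_cancel_left₀ hT.ne', mul_one]
    have := one_le_inv₀ hT |>.mpr hT1
    linarith
  have e1 : (1 + |σ|) ^ b ≤ T ^ (-b) * (1 + |T * σ|) ^ b := by
    rw [Real.rpow_neg hT.le, ← Real.inv_rpow hT.le, ← Real.mul_rpow (by positivity) (by positivity)]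
    exact Real.rpow_le_rpow (by positivity) (key σ) hb
  have e2 : (1 + |μ|) ^ (-b') ≤ T ^ b' * (1 + |T * μ|) ^ (-b') := by
    have : T ^ b' = (T⁻¹) ^ (-b') := by rw [Real.inv_rpow hT.le, Real.rpow_neg hT.le, inv_inv]
    rw [this, ← Real.mul_rpow (by positivity) (by positivity)]
    exact Real.rpow_le_rpow (by positivity) (key μ) (by linarith)
  have hA := bracket_pos (T * σ)
  have hB := one_le_bracket (T * μ)
  have hD := one_le_bracket (T * (σ - μ))
  have hABD : 1 + |T * σ| ≤ (1 + |T * μ|) * (1 + |T * (σ - μ)|) := by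
    have := bracket_le_add (T * (σ - μ)) (T * μ)
    rwa [← mul_add, sub_add_cancel] at this
  set A := 1 + |T * σ|
  set B := 1 + |T * μ|
  set D := 1 + |T * (σ - μ)|
  have hBp : 0 < B := by linarith
  have hDp : 0 < D := by linarith
  have r3 : ∀ x : ℝ, 0 < x → (x ^ 3)⁻¹ = x ^ (-3 : ℝ) := fun x hx => by
    rw [Real.rpow_neg hx.le]; norm_cast
  rw [r3 _ hA, r3 _ hDp] at hk
  have e3 : A ^ b * (B⁻¹ * (D ^ (-3 : ℝ) + A ^ (-3 : ℝ))) * B ^ (-b') ≤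
      D ^ (b - 3) + A ^ (b - 3) * B ^ (-1 - b') := by
    have f1 : A ^ b ≤ B ^ b * D ^ b := by
      rw [← Real.mul_rpow hBp.le hDp.le]
      exact Real.rpow_le_rpow hA.le hABD hb
    -- The condition b - 1 ≤ b' says that division by μ regains at least the difference of the two
    -- weights.
    have f2 : B ^ (b - 1 - b') ≤ 1 := Real.rpow_le_one_of_one_le_of_nonpos hB (by linarith)
    calc _ = A ^ b * (B⁻¹ * B ^ (-b')) * D ^ (-3 : ℝ) +
          (A ^ b * A ^ (-3 : ℝ)) * (B⁻¹ * B ^ (-b')) := by ring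
      _ ≤ (B ^ b * D ^ b) * (B⁻¹ * B ^ (-b')) * D ^ (-3 : ℝ) +
          (A ^ b * A ^ (-3 : ℝ)) * (B⁻¹ * B ^ (-b')) := by gcongr
      _ = B ^ (b - 1 - b') * D ^ (b - 3) + A ^ (b - 3) * B ^ (-1 - b') := by
          rw [← Real.rpow_neg_one B, ← Real.rpow_add hA, ← Real.rpow_add hBp]
          have : B ^ (b - 1 - b') = B ^ b * B ^ (-1 + -b') := by
            rw [← Real.rpow_add hBp]; ring_nf
          have h2 : D ^ (b - 3) = D ^ b * D ^ (-3 : ℝ) := by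
            rw [← Real.rpow_add hDp]; ring_nf
          rw [this, h2, sub_eq_add_neg b 3, sub_eq_add_neg (-1) b']
          ring
      _ ≤ 1 * D ^ (b - 3) + A ^ (b - 3) * B ^ (-1 - b') := by gcongr
      _ = _ := by rw [one_mul]
  calc _ ≤ (T ^ (-b) * A ^ b) * (T ^ 2 * (C * B⁻¹ * (D ^ (-3 : ℝ) + A ^ (-3 : ℝ)))) *
        (T ^ b' * B ^ (-b')) := by gcongr
    _ = C * (T ^ (-b) * T ^ 2 * T ^ b') *
        (A ^ b * (B⁻¹ * (D ^ (-3 : ℝ) + A ^ (-3 : ℝ))) * B ^ (-b')) := by ring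
    _ ≤ C * (T ^ (-b) * T ^ 2 * T ^ b') * (D ^ (b - 3) + A ^ (b - 3) * B ^ (-1 - b')) := by gcongr
    _ = _ := by
        congr 2
        rw [← Real.rpow_natCast, ← Real.rpow_add hT, ← Real.rpow_add hT]
        congr 1; push_cast; ring

/-- The truncated Duhamel operator gains the power `T^{1-b+b'}` in the modulation variable. -/
theorem exists_lintegral_duhK_le (Ψ : 𝓢(ℝ, ℂ)) {b b' : ℝ} (hb : 0 ≤ b) (hb1 : b ≤ 1)
    (hb'0 : b' ≤ 0) (hb' : -(1 / 2) < b') (hbb : b - 1 ≤ b') :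
    ∃ C : ℝ, 0 < C ∧ ∀ T : ℝ, 0 < T → T ≤ 1 → ∀ F : ℝ → ℝ≥0∞, Measurable F →
    ∫⁻ σ, (∫⁻ μ, ENNReal.ofReal ((1 + |σ|) ^ b * ‖duhK Ψ T σ μ‖ * (1 + |μ|) ^ (-b')) * F μ) ^ 2 ≤
      ENNReal.ofReal (C * T ^ (1 - b + b')) ^ 2 * ∫⁻ μ, F μ ^ 2 := by
  obtain ⟨C, hC, h⟩ := exists_weighted_duhK_le Ψ hb hb'0 hbb
  have i1 := lintegral_jpow_lt_top (e := 3 - b) (by linarith)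
  have i2 := lintegral_jpow_lt_top (e := 2 * (3 - b)) (by linarith)
  have i3 := lintegral_jpow_lt_top (e := 2 * (1 + b')) (by linarith)
  set I₁ := ∫⁻ x, jpow (-(3 - b)) x
  set I₂ := ∫⁻ x, jpow (-(2 * (3 - b))) x
  set I₃ := ∫⁻ x, jpow (-(2 * (1 + b'))) x
  set M := 2 * (I₁ ^ 2 + I₂ * I₃) with hM
  have hMf : M ≠ ∞ := by finiteness
  refine ⟨C * (M.toReal + 1), by positivity, fun T hT hT1 F hF => ?_⟩
  set t := ENNReal.ofReal T⁻¹ with ht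
  -- The convolution part is bounded by Young's inequality; rescaling its L¹ norm gives one factor
  -- 1/T.
  have b1 : ∫⁻ σ, (∫⁻ μ, jpow (-(3 - b)) (T * (σ - μ)) * F μ) ^ 2 ≤
      (t * I₁) ^ 2 * ∫⁻ μ, F μ ^ 2 := by
    have := lintegral_convolution_sq_le hF (G := fun x => jpow (-(3 - b)) (T * x)) (by fun_prop)
    rwa [lintegral_comp_mul_left_real _ (by fun_prop) hT] at this
  -- The product part has rank one, and Cauchy–Schwarz again gives 1/T, half from each L² norm.
  -- Finiteness of `I₃` is the condition b' > -1/2.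
  have b2 : ∫⁻ σ, (∫⁻ μ, jpow (-(3 - b)) (T * σ) * jpow (-(1 + b')) (T * μ) * F μ) ^ 2 ≤
      (t * I₂) * ((t * I₃) * ∫⁻ μ, F μ ^ 2) := by
    simp_rw [mul_assoc]
    have e : ∀ σ, ∫⁻ μ, jpow (-(3 - b)) (T * σ) * (jpow (-(1 + b')) (T * μ) * F μ) =
        jpow (-(3 - b)) (T * σ) * ∫⁻ μ, (jpow (-(1 + b')) (T * μ) * F μ) := fun σ =>
      lintegral_const_mul _ (by fun_prop)
    simp_rw [e, mul_pow, jpow_sq]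
    rw [lintegral_mul_const _ (by fun_prop)]
    have e2 : ∫⁻ σ, jpow (2 * -(3 - b)) (T * σ) = t * I₂ := by
      rw [lintegral_comp_mul_left_real _ (by fun_prop) hT, mul_neg]
    rw [e2, mul_assoc]
    gcongr
    refine (lintegral_mul_sq_le (by fun_prop) (by fun_prop)).trans ?_
    simp_rw [jpow_sq]
    rw [lintegral_comp_mul_left_real _ (by fun_prop) hT, mul_neg, mul_assoc]
  set c := ENNReal.ofReal (C * T ^ (2 - b + b')) with hc
  have hpt : ∀ σ, (∫⁻ μ, ENNReal.ofReal ((1 + |σ|) ^ b * ‖duhK Ψ T σ μ‖ * (1 + |μ|) ^ (-b')) *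
      F μ) ^ 2 ≤ c ^ 2 * (2 * ((∫⁻ μ, jpow (-(3 - b)) (T * (σ - μ)) * F μ) ^ 2 +
        (∫⁻ μ, jpow (-(3 - b)) (T * σ) * jpow (-(1 + b')) (T * μ) * F μ) ^ 2)) := by
    intro σ
    have g1 : ∫⁻ μ, ENNReal.ofReal ((1 + |σ|) ^ b * ‖duhK Ψ T σ μ‖ * (1 + |μ|) ^ (-b')) * F μ ≤
        c * ((∫⁻ μ, jpow (-(3 - b)) (T * (σ - μ)) * F μ) +
          ∫⁻ μ, jpow (-(3 - b)) (T * σ) * jpow (-(1 + b')) (T * μ) * F μ) := by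
      rw [← lintegral_add_left (by fun_prop), ← lintegral_const_mul _ (by fun_prop)]
      refine lintegral_mono fun μ => ?_
      rw [← add_mul, ← mul_assoc]
      refine mul_le_mul_left ?_ _
      unfold jpow
      rw [hc, ← ENNReal.ofReal_mul (by positivity), ← ENNReal.ofReal_add (by positivity)
        (by positivity), ← ENNReal.ofReal_mul (by positivity)]
      refine ENNReal.ofReal_le_ofReal ((h T hT hT1 σ μ).trans (le_of_eq ?_))
      rw [neg_sub, neg_add']
    refine (pow_le_pow_left' g1 2).trans ?_
    rw [mul_pow]
    gcongr
    exact ennreal_add_sq_le _ _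
  refine (lintegral_mono hpt).trans ?_
  rw [lintegral_const_mul' _ _ (by finiteness), lintegral_const_mul' _ _ (by finiteness),
    lintegral_add_left (by
      refine Measurable.pow_const ?_ 2
      exact Measurable.lintegral_prod_right' (f := fun q : ℝ × ℝ =>
        jpow (-(3 - b)) (T * (q.1 - q.2)) * F q.2) (by fun_prop))]
  calc _ ≤ c ^ 2 * (2 * ((t * I₁) ^ 2 * (∫⁻ μ, F μ ^ 2) + (t * I₂) * ((t * I₃) * ∫⁻ μ, F μ ^ 2))) := by
        gcongr
    _ = (c * t) ^ 2 * M * ∫⁻ μ, F μ ^ 2 := by rw [hM]; ring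
    _ ≤ _ := by
        gcongr
        rw [hc, ht, ← ENNReal.ofReal_mul (by positivity)]
        have e1 : C * T ^ (2 - b + b') * T⁻¹ = C * T ^ (1 - b + b') := by
          rw [← Real.rpow_neg_one, mul_assoc, ← Real.rpow_add hT]; congr 2; ring
        rw [e1, mul_right_comm, ENNReal.ofReal_mul (p := C * T ^ (1 - b + b')) (by positivity),
          mul_pow]
        gcongr
        calc M = ENNReal.ofReal M.toReal := (ENNReal.ofReal_toReal hMf).symm
          _ ≤ ENNReal.ofReal ((M.toReal + 1) ^ 2) := by
              apply ENNReal.ofReal_le_ofReal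
              nlinarith [ENNReal.toReal_nonneg (a := M)]
          _ = _ := ENNReal.ofReal_pow (by positivity) 2

/-! ### The linear operators of the Duhamel formula on the Fourier side -/

/-- Square integrable functions of the frequencies `(η, τ)`. -/
abbrev L2P : Type := Lp ℂ 2 (volume : Measure (ℝ × ℝ))

/-- Square integrable functions of the frequency `η`. -/
abbrev L2L : Type := Lp ℂ 2 (volume : Measure ℝ)

/-- The character `e^{2πix}`. -/
def e2 (x : ℝ) : ℂ := Complex.exp (2 * Real.pi * x * Complex.I)

theorem e2_add (x y : ℝ) : e2 (x + y) = e2 x * e2 y := by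
  unfold e2
  rw [← Complex.exp_add]
  congr 1; push_cast; ring

theorem e2_zero : e2 0 = 1 := by simp [e2]

theorem norm_e2 (x : ℝ) : ‖e2 x‖ = 1 := by
  unfold e2
  rw [show (2 * Real.pi * x * Complex.I : ℂ) = ((2 * Real.pi * x : ℝ) : ℂ) * Complex.I by push_cast; ring]
  exact Complex.norm_exp_ofReal_mul_I _

theorem enorm_e2 (x : ℝ) : ‖e2 x‖ₑ = 1 := by
  rw [← ofReal_norm, norm_e2, ENNReal.ofReal_one]

@[fun_prop]
theorem continuous_e2 : Continuous e2 := by unfold e2; fun_prop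

@[fun_prop]
theorem measurable_e2 : Measurable e2 := continuous_e2.measurable

theorem conj_e2 (x : ℝ) : (starRingEnd ℂ) (e2 x) = e2 (-x) := by
  unfold e2
  rw [← Complex.exp_conj]
  congr 1
  simp [Complex.conj_ofNat]

theorem e2_eq_fourierChar (x : ℝ) : e2 x = (Real.fourierChar x : ℂ) := by
  rw [Real.fourierChar_apply, e2]; push_cast; rfl

/-- The power `(1 + |τ - p(η)|)^b` of the modulation. -/
def mdl (p : ℝ → ℝ) (b : ℝ) (ζ : ℝ × ℝ) : ℝ := (1 + |ζ.2 - p ζ.1|) ^ b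

theorem mdl_pos (p : ℝ → ℝ) (b : ℝ) (ζ : ℝ × ℝ) : 0 < mdl p b ζ := by
  unfold mdl; positivity

theorem measurable_mdl {p : ℝ → ℝ} (hp : Measurable p) (b : ℝ) : Measurable (mdl p b) := by
  unfold mdl; fun_prop

theorem wt_eq_mul_mdl (p : ℝ → ℝ) (s b : ℝ) (ζ : ℝ × ℝ) :
    wt p s b ζ = (1 + ζ.1 ^ 2) ^ (s / 2) * mdl p b ζ := rfl

theorem enorm_mdl (p : ℝ → ℝ) (b : ℝ) (ζ : ℝ × ℝ) :
    ‖(mdl p b ζ : ℂ)‖ₑ = jpow b (ζ.2 - p ζ.1) := by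
  rw [← ofReal_norm, Complex.norm_real, Real.norm_of_nonneg (mdl_pos p b ζ).le]; rfl

theorem lintegral_fst_snd {f : ℝ × ℝ → ℝ≥0∞} (hf : Measurable f) :
    ∫⁻ ζ, f ζ = ∫⁻ η, ∫⁻ τ, f (η, τ) := by
  rw [Measure.volume_eq_prod, lintegral_prod _ hf.aemeasurable]

theorem lintegral_mdl_mul_sq_le {p : ℝ → ℝ} (b : ℝ) {F : ℝ × ℝ → ℝ≥0∞}
    (hF : Measurable F) :
    ∫⁻ η, (∫⁻ τ, jpow (-b) (τ - p η) * F (η, τ)) ^ 2 ≤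
      (∫⁻ x, jpow (-(2 * b)) x) * ∫⁻ ζ, F ζ ^ 2 := by
  rw [lintegral_fst_snd (hF.pow_const 2), ← lintegral_const_mul _ (by fun_prop)]
  refine lintegral_mono fun η => ?_
  refine (lintegral_mul_sq_le (by fun_prop) (by fun_prop)).trans ?_
  simp_rw [jpow_sq, mul_neg]
  rw [lintegral_sub_right_eq_self (fun x => jpow (-(2 * b)) x) (p η)]

/-- Restriction to time t is integration against e^{2πitτ} in τ. Cauchy–Schwarz in τ bounds it
uniformly in t because b > 1/2, and dominated convergence gives continuity in t: the embedding of
`X^{s,b}` into continuous curves in `H^s`. -/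
theorem exists_traceOp {p : ℝ → ℝ} (hp : Measurable p) {b : ℝ} (hb : 1 / 2 < b) :
    ∃ ev : ℝ → L2P →L[ℂ] L2L, (∃ C : ℝ, 0 < C ∧ ∀ t h, ‖ev t h‖ ≤ C * ‖h‖) ∧
      (∀ h : L2P, Continuous fun t => ev t h) ∧
      (∀ t (h : L2P), ∀ᵐ η, Integrable fun τ => (mdl p (-b) (η, τ) : ℂ) * e2 (t * τ) * h (η, τ)) ∧
      ∀ t (h : L2P), ev t h =ᵐ[volume]
        fun η => ∫ τ, (mdl p (-b) (η, τ) : ℂ) * e2 (t * τ) * h (η, τ) := by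
  have hJ := lintegral_jpow_lt_top (e := 2 * b) (by linarith)
  set J := ∫⁻ x, jpow (-(2 * b)) x with hJdef
  set C := Real.sqrt J.toReal with hC
  have hCJ : J = ENNReal.ofReal C ^ 2 := by
    rw [← ENNReal.ofReal_pow (Real.sqrt_nonneg _), Real.sq_sqrt ENNReal.toReal_nonneg,
      ENNReal.ofReal_toReal hJ.ne]
  have hm := measurable_mdl hp (-b)
  have H := fun t : ℝ => exists_kernelCLM (μ := (volume : Measure ℝ)) (ρ := (volume : Measure ℝ))
    (ν := (volume : Measure (ℝ × ℝ)))
    (k := fun η τ => (mdl p (-b) (η, τ) : ℂ) * e2 (t * τ)) (by unfold Function.uncurry; fun_prop)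
    (y := fun q => q) (by
      rw [← Measure.volume_eq_prod]
      exact (MeasurePreserving.id volume).quasiMeasurePreserving) (C := C) (Real.sqrt_nonneg _)
    (fun F hF => by
      simp_rw [enorm_mul, enorm_e2, mul_one, enorm_mdl]
      rw [← hCJ]
      exact lintegral_mdl_mul_sq_le b hF)
  choose ev hev using H
  refine ⟨ev, ⟨C + 1, by positivity, fun t h => ((hev t).1 h).trans (by gcongr; linarith)⟩, ?_,
    fun t h => ((hev t).2 h).1, fun t h => ((hev t).2 h).2.2⟩
  intro h
  rw [continuous_iff_continuousAt]
  intro t₀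
  have hmh : Measurable fun ζ : ℝ × ℝ => h ζ := (Lp.stronglyMeasurable h).measurable
  have hbound : ∀ t, ENNReal.ofReal ‖ev t h - ev t₀ h‖ ^ 2 ≤
      J * ∫⁻ ζ : ℝ × ℝ, (‖e2 (t * ζ.2) - e2 (t₀ * ζ.2)‖ₑ * ‖h ζ‖ₑ) ^ 2 := by
    intro t
    rw [← lintegral_enorm_sq_lp]
    calc _ = ∫⁻ η, ‖∫ τ, (mdl p (-b) (η, τ) : ℂ) *
          ((e2 (t * τ) - e2 (t₀ * τ)) * h (η, τ))‖ₑ ^ 2 := by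
          refine lintegral_congr_ae ?_
          filter_upwards [Lp.coeFn_sub (ev t h) (ev t₀ h), ((hev t).2 h).1, ((hev t).2 h).2.2,
            ((hev t₀).2 h).1, ((hev t₀).2 h).2.2] with η h1 h2 h3 h4 h5
          rw [h1, Pi.sub_apply, h3, h5, ← integral_sub h2 h4]
          congr 3; ext τ; ring
      _ ≤ ∫⁻ η, (∫⁻ τ, ‖(mdl p (-b) (η, τ) : ℂ) *
          ((e2 (t * τ) - e2 (t₀ * τ)) * h (η, τ))‖ₑ) ^ 2 :=
          lintegral_mono fun η => pow_le_pow_left' (enorm_integral_le_lintegral_enorm _) 2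
      _ ≤ _ := by
          simp_rw [enorm_mul, enorm_mdl]
          exact lintegral_mdl_mul_sq_le (F := fun ζ => ‖e2 (t * ζ.2) - e2 (t₀ * ζ.2)‖ₑ * ‖h ζ‖ₑ) b
            (by fun_prop)
  have hlim : Filter.Tendsto (fun t => ∫⁻ ζ : ℝ × ℝ,
      (‖e2 (t * ζ.2) - e2 (t₀ * ζ.2)‖ₑ * ‖h ζ‖ₑ) ^ 2) (nhds t₀) (nhds 0) := by
    have := tendsto_lintegral_filter_of_dominated_convergence (μ := (volume : Measure (ℝ × ℝ)))
      (l := nhds t₀) (F := fun t (ζ : ℝ × ℝ) => (‖e2 (t * ζ.2) - e2 (t₀ * ζ.2)‖ₑ * ‖h ζ‖ₑ) ^ 2)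
      (f := fun _ => 0) (fun ζ => (2 * ‖h ζ‖ₑ) ^ 2) (.of_forall fun t => by fun_prop)
      (.of_forall fun t => .of_forall fun ζ => by
        gcongr
        refine (enorm_sub_le).trans ?_
        rw [enorm_e2, enorm_e2]; norm_num)
      (by
        simp_rw [mul_pow]
        rw [lintegral_const_mul' _ _ (by finiteness), lintegral_enorm_sq_lp]
        finiteness)
      (.of_forall fun ζ => by
        have hc : Continuous fun t => ‖e2 (t * ζ.2) - e2 (t₀ * ζ.2)‖ₑ := by fun_prop
        have h0 := hc.tendsto t₀
        simp only [sub_self, enorm_zero] at h0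
        have h1 := ENNReal.Tendsto.mul_const (b := ‖h ζ‖ₑ) h0 (.inr (by finiteness))
        have h2 := (ENNReal.continuous_pow 2).tendsto _ |>.comp h1
        simpa [Function.comp_def] using h2)
    simpa using this
  have hlim2 : Filter.Tendsto (fun t => ENNReal.ofReal ‖ev t h - ev t₀ h‖ ^ 2) (nhds t₀) (nhds 0) := by
    refine tendsto_of_tendsto_of_tendsto_of_le_of_le tendsto_const_nhds ?_ (fun _ => zero_le) hbound
    have := ENNReal.Tendsto.const_mul (a := J) hlim (.inr hJ.ne)
    simpa using this
  rw [ContinuousAt, tendsto_iff_norm_sub_tendsto_zero]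
  have h3 := (ENNReal.tendsto_toReal (a := 0) (by simp)).comp hlim2
  simp only [ENNReal.toReal_zero] at h3
  have h4 : Filter.Tendsto (fun t => ‖ev t h - ev t₀ h‖ ^ 2) (nhds t₀) (nhds 0) := by
    refine h3.congr fun t => ?_
    simp
  have h5 := (Real.continuous_sqrt.tendsto 0).comp h4
  simp only [Real.sqrt_zero] at h5
  refine h5.congr fun t => ?_
  simp

theorem lintegral_schwartz_weight_lt_top (Ψ : 𝓢(ℝ, ℂ)) (b : ℝ) :
    ∫⁻ x, (jpow b x * ‖Ψ x‖ₑ) ^ 2 < ∞ := by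
  obtain ⟨m, hm⟩ := exists_nat_ge (b + 1)
  obtain ⟨C, hC, h⟩ := Ψ.exists_norm_le_bracket m
  have hJ := lintegral_jpow_lt_top (e := 2) (by norm_num)
  refine lt_of_le_of_lt (lintegral_mono fun x => ?_)
    (b := ∫⁻ x, ENNReal.ofReal C ^ 2 * jpow (-2) x) ?_
  · have h1 : jpow b x * ‖Ψ x‖ₑ ≤ ENNReal.ofReal C * jpow (-1) x := by
      have := bracket_pos x
      rw [← ofReal_norm, jpow, jpow, ← ENNReal.ofReal_mul (by positivity),
        ← ENNReal.ofReal_mul (by positivity)]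
      apply ENNReal.ofReal_le_ofReal
      calc _ ≤ (1 + |x|) ^ b * (C * ((1 + |x|) ^ m)⁻¹) := by gcongr; exact h x
        _ = C * (1 + |x|) ^ (b - m) := by
            rw [Real.rpow_sub this, Real.rpow_natCast]; ring
        _ ≤ C * (1 + |x|) ^ (-1 : ℝ) := by
            gcongr
            · exact one_le_bracket x
            · linarith
    calc _ ≤ (ENNReal.ofReal C * jpow (-1) x) ^ 2 := by gcongr
      _ = _ := by rw [mul_pow, jpow_sq]; norm_num
  · rw [lintegral_const_mul' _ _ (by finiteness)]
    finiteness

/-- The coefficient of cutoff times free evolution is the transform of the cutoff evaluated at the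
modulation. Its rapid decay in the modulation absorbs any weight, so b is arbitrary. -/
theorem exists_freeOp {p : ℝ → ℝ} (hp : Measurable p) (Ψ : 𝓢(ℝ, ℂ)) (b : ℝ) :
    ∃ W : L2L →L[ℂ] L2P, ∀ g : L2L, W g =ᵐ[volume]
      fun ζ => (mdl p b ζ : ℂ) * Ψ (ζ.2 - p ζ.1) * g ζ.1 := by
  have hJ := lintegral_schwartz_weight_lt_top Ψ b
  set J := ∫⁻ x, (jpow b x * ‖Ψ x‖ₑ) ^ 2 with hJdef
  set C := Real.sqrt J.toReal with hC
  have hCJ : J = ENNReal.ofReal C ^ 2 := by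
    rw [← ENNReal.ofReal_pow (Real.sqrt_nonneg _), Real.sq_sqrt ENNReal.toReal_nonneg,
      ENNReal.ofReal_toReal hJ.ne]
  have hm := measurable_mdl hp b
  have hΨ : Measurable (Ψ : ℝ → ℂ) := Ψ.continuous.measurable
  obtain ⟨W, -, hW⟩ := exists_kernelCLM (μ := (volume : Measure (ℝ × ℝ)))
    -- A one-point parameter space: the operator is a multiplication composed with a pull-back and
    -- involves no integration.
    (ρ := Measure.dirac ()) (ν := (volume : Measure ℝ))
    (k := fun ζ _ => (mdl p b ζ : ℂ) * Ψ (ζ.2 - p ζ.1)) (by unfold Function.uncurry; fun_prop)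
    (y := fun q => q.1.1) (by
      have h1 : Measure.QuasiMeasurePreserving (Prod.fst : ℝ × ℝ → ℝ) volume volume :=
        Measure.quasiMeasurePreserving_fst
      exact h1.comp Measure.quasiMeasurePreserving_fst) (C := C) (Real.sqrt_nonneg _)
    (fun F hF => by
      simp only [lintegral_dirac, enorm_mul, enorm_mdl]
      rw [lintegral_fst_snd (by fun_prop), ← hCJ, mul_comm, ← lintegral_mul_const _ (by fun_prop)]
      refine lintegral_mono fun η => ?_
      simp_rw [mul_pow _ (F _)]
      rw [lintegral_mul_const _ (by fun_prop), mul_comm,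
        lintegral_sub_right_eq_self (fun x => (jpow b x * ‖Ψ x‖ₑ) ^ 2) (p η)])
  refine ⟨W, fun g => ((hW g).2.2).trans (.of_forall fun ζ => ?_)⟩
  simp

/-- The spatial frequency is only a parameter and its Sobolev weight cancels. For fixed η,
translation of both time frequencies by the phase reduces the bound to the one-dimensional estimate.
-/
theorem exists_duhOp {p : ℝ → ℝ} (hp : Measurable p) (Ψ : 𝓢(ℝ, ℂ)) {b b' : ℝ} (hb : 0 ≤ b)
    (hb1 : b ≤ 1) (hb'0 : b' ≤ 0) (hb' : -(1 / 2) < b') (hbb : b - 1 ≤ b') :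
    ∃ C : ℝ, 0 < C ∧ ∀ T : ℝ, 0 < T → T ≤ 1 → ∃ D : L2P →L[ℂ] L2P,
      (∀ h, ‖D h‖ ≤ C * T ^ (1 - b + b') * ‖h‖) ∧ ∀ h : L2P,
      (∀ w : ℝ × ℝ → ℂ, MemLp w 2 volume → Integrable (fun q : (ℝ × ℝ) × ℝ =>
        w q.1 * (((mdl p b q.1 : ℂ) * duhK Ψ T (q.1.2 - p q.1.1) (q.2 - p q.1.1) *
        (mdl p (-b') (q.1.1, q.2) : ℂ)) * h (q.1.1, q.2)))) ∧
      D h =ᵐ[volume] fun ζ => ∫ τ', ((mdl p b ζ : ℂ) * duhK Ψ T (ζ.2 - p ζ.1) (τ' - p ζ.1) *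
        (mdl p (-b') (ζ.1, τ') : ℂ)) * h (ζ.1, τ') := by
  obtain ⟨C, hC, H⟩ := exists_lintegral_duhK_le Ψ hb hb1 hb'0 hb' hbb
  refine ⟨C, hC, fun T hT hT1 => ?_⟩
  have hm := measurable_mdl hp b
  have hm' := measurable_mdl hp (-b')
  have hK : Measurable (Function.uncurry (duhK Ψ T)) := measurable_duhK Ψ.continuous.measurable T
  have hK2 : Measurable fun q : (ℝ × ℝ) × ℝ => duhK Ψ T (q.1.2 - p q.1.1) (q.2 - p q.1.1) :=
    hK.comp (g := Function.uncurry (duhK Ψ T))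
      (f := fun q : (ℝ × ℝ) × ℝ => (q.1.2 - p q.1.1, q.2 - p q.1.1)) (by fun_prop)
  suffices hb : ∀ F : ℝ × ℝ → ℝ≥0∞, Measurable F → ∫⁻ ζ : ℝ × ℝ, (∫⁻ τ', ‖(mdl p b ζ : ℂ) *
      duhK Ψ T (ζ.2 - p ζ.1) (τ' - p ζ.1) * (mdl p (-b') (ζ.1, τ') : ℂ)‖ₑ * F (ζ.1, τ')) ^ 2 ≤
      ENNReal.ofReal (C * T ^ (1 - b + b')) ^ 2 * ∫⁻ z, F z ^ 2 by
    obtain ⟨D, hD, h⟩ := exists_kernelCLM (μ := (volume : Measure (ℝ × ℝ)))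
      (ρ := (volume : Measure ℝ)) (ν := (volume : Measure (ℝ × ℝ)))
      (k := fun ζ τ' => (mdl p b ζ : ℂ) * duhK Ψ T (ζ.2 - p ζ.1) (τ' - p ζ.1) *
        (mdl p (-b') (ζ.1, τ') : ℂ)) (by unfold Function.uncurry; fun_prop)
      (y := fun q => (q.1.1, q.2)) quasiMeasurePreserving_replace_snd (C := C * T ^ (1 - b + b'))
      (by positivity) hb
    exact ⟨D, hD, fun g => (h g).2⟩
  intro F hF
  have en : ∀ η τ τ', ‖(mdl p b (η, τ) : ℂ) * duhK Ψ T (τ - p η) (τ' - p η) *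
      (mdl p (-b') (η, τ') : ℂ)‖ₑ = ENNReal.ofReal ((1 + |τ - p η|) ^ b *
        ‖duhK Ψ T (τ - p η) (τ' - p η)‖ * (1 + |τ' - p η|) ^ (-b')) := fun η τ τ' => by
    rw [← ofReal_norm, norm_mul, norm_mul, Complex.norm_real, Complex.norm_real,
      Real.norm_of_nonneg (mdl_pos _ _ _).le, Real.norm_of_nonneg (mdl_pos _ _ _).le]
    rfl
  have hmeas : Measurable fun ζ : ℝ × ℝ => (∫⁻ τ', ‖(mdl p b ζ : ℂ) *
      duhK Ψ T (ζ.2 - p ζ.1) (τ' - p ζ.1) * (mdl p (-b') (ζ.1, τ') : ℂ)‖ₑ * F (ζ.1, τ')) ^ 2 := by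
    refine Measurable.pow_const ?_ 2
    refine Measurable.lintegral_prod_right' (f := fun q : (ℝ × ℝ) × ℝ => ‖(mdl p b q.1 : ℂ) *
      duhK Ψ T (q.1.2 - p q.1.1) (q.2 - p q.1.1) * (mdl p (-b') (q.1.1, q.2) : ℂ)‖ₑ *
      F (q.1.1, q.2)) ?_
    fun_prop
  rw [lintegral_fst_snd hmeas, lintegral_fst_snd (hF.pow_const 2),
    ← lintegral_const_mul _ (by fun_prop)]
  refine lintegral_mono fun η => ?_
  simp only [en]
  have h1 := H T hT hT1 (fun μ => F (η, μ + p η)) (by fun_prop)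
  rw [lintegral_add_right_eq_self (fun μ => F (η, μ) ^ 2) (p η)] at h1
  refine le_trans (le_of_eq ?_) h1
  rw [← lintegral_sub_right_eq_self (fun σ => (∫⁻ μ, ENNReal.ofReal ((1 + |σ|) ^ b *
    ‖duhK Ψ T σ μ‖ * (1 + |μ|) ^ (-b')) * F (η, μ + p η)) ^ 2) (p η)]
  refine lintegral_congr fun τ => ?_
  rw [← lintegral_sub_right_eq_self (fun μ => ENNReal.ofReal ((1 + |τ - p η|) ^ b *
    ‖duhK Ψ T (τ - p η) μ‖ * (1 + |μ|) ^ (-b')) * F (η, μ + p η)) (p η)]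
  simp only [sub_add_cancel]

/-! ### The cubic nonlinearity on the Fourier side -/

/-- The integrand of the Fourier transform of `u₁ ū₂ u₃`. -/
def cubicIntegrand (f₁ f₂ f₃ : ℝ × ℝ → ℂ) (ζ : ℝ × ℝ) (q : (ℝ × ℝ) × (ℝ × ℝ)) : ℂ :=
  f₁ q.1 * (starRingEnd ℂ) (f₂ q.2) * f₃ (ζ - q.1 + q.2)

/-- The Fourier transform of `|u|² u` in terms of that of `u`. -/
def cubicInt (f : ℝ × ℝ → ℂ) (ζ : ℝ × ℝ) : ℂ := ∫ q, cubicIntegrand f f f ζ q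

/-- The Fourier coefficient with weighted coefficient `h`. -/
def coef (p : ℝ → ℝ) (s b : ℝ) (h : ℝ × ℝ → ℂ) (ζ : ℝ × ℝ) : ℂ := h ζ / wt p s b ζ

theorem measurable_coef {p : ℝ → ℝ} (hp : Measurable p) (s b : ℝ) {h : ℝ × ℝ → ℂ}
    (hh : Measurable h) : Measurable (coef p s b h) := by
  have := measurable_wt hp s b
  unfold coef; fun_prop

theorem measurable_lp (h : L2P) : Measurable h := (Lp.stronglyMeasurable h).measurable

theorem measurable_cubicIntegrand {f₁ f₂ f₃ : ℝ × ℝ → ℂ} (h₁ : Measurable f₁) (h₂ : Measurable f₂)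
    (h₃ : Measurable f₃) : Measurable fun r : (ℝ × ℝ) × (ℝ × ℝ) × (ℝ × ℝ) =>
      cubicIntegrand f₁ f₂ f₃ r.1 r.2 := by
  have hc : Measurable (starRingEnd ℂ) := Complex.continuous_conj.measurable
  unfold cubicIntegrand
  fun_prop

theorem enorm_coef (p : ℝ → ℝ) (s b : ℝ) (h : ℝ × ℝ → ℂ) (ζ : ℝ × ℝ) :
    ‖coef p s b h ζ‖ₑ = ewt p (-s) (-b) ζ * ‖h ζ‖ₑ := by
  rw [coef, ewt, wt_neg, div_eq_mul_inv, enorm_mul, mul_comm]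
  congr 1
  rw [← ofReal_norm, norm_inv, Complex.norm_real, Real.norm_of_nonneg (wt_pos _ _ _ _).le]

theorem lintegral_cubicIntegrand {f₁ f₂ f₃ : ℝ × ℝ → ℂ} (h₁ : Measurable f₁) (h₂ : Measurable f₂)
    (h₃ : Measurable f₃) (ζ : ℝ × ℝ) : ∫⁻ q, ‖cubicIntegrand f₁ f₂ f₃ ζ q‖ₑ =
      ∫⁻ x, ∫⁻ y, ‖f₁ x‖ₑ * ‖f₂ y‖ₑ * ‖f₃ (ζ - x + y)‖ₑ := by
  have hm : Measurable fun q => cubicIntegrand f₁ f₂ f₃ ζ q :=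
    (measurable_cubicIntegrand h₁ h₂ h₃).comp measurable_prodMk_left
  rw [Measure.volume_eq_prod, lintegral_prod _ hm.enorm.aemeasurable]
  simp [cubicIntegrand, enorm_mul]

theorem enorm_wt (p : ℝ → ℝ) (s b : ℝ) (ζ : ℝ × ℝ) : ‖(wt p s b ζ : ℂ)‖ₑ = ewt p s b ζ := by
  rw [← ofReal_norm, Complex.norm_real, Real.norm_of_nonneg (wt_pos p s b ζ).le]; rfl

theorem measurable_ewt {p : ℝ → ℝ} (hp : Measurable p) (s b : ℝ) : Measurable (ewt p s b) := by
  have := measurable_wt hp s b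
  unfold ewt; fun_prop

theorem measurable_phase (α β : ℝ) : Measurable (phase α β) := by
  unfold phase; fun_prop

theorem ewt_ne_zero (p : ℝ → ℝ) (s b : ℝ) (ζ : ℝ × ℝ) : ewt p s b ζ ≠ 0 := by
  simp [ewt, wt_pos]

theorem ewt_ne_top (p : ℝ → ℝ) (s b : ℝ) (ζ : ℝ × ℝ) : ewt p s b ζ ≠ ∞ := ENNReal.ofReal_ne_top

theorem exists_cubicIntegrand_bound (α : ℝ) {β : ℝ} (hβ : β ≠ 0) {s b b' : ℝ} (hs : -(1 / 4) < s)
    (hb : 7 / 12 < b) (hb' : b' ≤ -(1 / 12)) : ∃ C : ℝ≥0∞, C ≠ ∞ ∧ ∀ h₁ h₂ h₃ : ℝ × ℝ → ℂ,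
      Measurable h₁ → Measurable h₂ → Measurable h₃ →
      ∫⁻ ζ, (ewt (phase α β) s b' ζ * ∫⁻ q, ‖cubicIntegrand (coef (phase α β) s b h₁)
        (coef (phase α β) s b h₂) (coef (phase α β) s b h₃) ζ q‖ₑ) ^ 2 ≤
      C * ((∫⁻ z, ‖h₁ z‖ₑ ^ 2) * (∫⁻ z, ‖h₂ z‖ₑ ^ 2) * ∫⁻ z, ‖h₃ z‖ₑ ^ 2) := by
  obtain ⟨C, hC, H⟩ := exists_cubic_bound α hβ hs hb hb'
  refine ⟨C, hC, fun h₁ h₂ h₃ m₁ m₂ m₃ => le_of_eq_of_le ?_ (H (fun z => ‖h₁ z‖ₑ)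
    (fun z => ‖h₂ z‖ₑ) (fun z => ‖h₃ z‖ₑ) m₁.enorm m₂.enorm m₃.enorm)⟩
  have hp := measurable_phase α β
  refine lintegral_congr fun ζ => ?_
  rw [lintegral_cubicIntegrand (measurable_coef hp s b m₁) (measurable_coef hp s b m₂)
    (measurable_coef hp s b m₃), ← lintegral_const_mul' _ _ (ewt_ne_top _ _ _ _)]
  congr 1
  refine lintegral_congr fun x => ?_
  rw [← lintegral_const_mul' _ _ (ewt_ne_top _ _ _ _)]
  simp only [enorm_coef]

theorem measurable_lintegral_cubicIntegrand {f₁ f₂ f₃ : ℝ × ℝ → ℂ} (h₁ : Measurable f₁)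
    (h₂ : Measurable f₂) (h₃ : Measurable f₃) :
    Measurable fun ζ => ∫⁻ q, ‖cubicIntegrand f₁ f₂ f₃ ζ q‖ₑ :=
  (measurable_cubicIntegrand h₁ h₂ h₃).enorm.lintegral_prod_right'

theorem cubicIntegrand_sub (f g : ℝ × ℝ → ℂ) (ζ : ℝ × ℝ) (q : (ℝ × ℝ) × (ℝ × ℝ)) :
    cubicIntegrand f f f ζ q - cubicIntegrand g g g ζ q =
      cubicIntegrand (fun z => f z - g z) f f ζ q +
      (cubicIntegrand g (fun z => f z - g z) f ζ q +
        cubicIntegrand g g (fun z => f z - g z) ζ q) := by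
  unfold cubicIntegrand
  rw [map_sub]; ring

/-- The difference of two cubes telescopes into three trilinear terms, each containing the
difference once; the trilinear bound applies to every one of them. -/
theorem exists_cubicOp (α : ℝ) {β : ℝ} (hβ : β ≠ 0) {s b b' : ℝ} (hs : -(1 / 4) < s)
    (hb : 7 / 12 < b) (hb' : b' ≤ -(1 / 12)) :
    ∃ N : L2P → L2P, (∃ C : ℝ, 0 < C ∧ ∀ h g, ‖N h - N g‖ ≤ C * (‖h‖ ^ 2 + ‖g‖ ^ 2) * ‖h - g‖) ∧
      (∀ h : L2P, ∀ᵐ ζ, Integrable (cubicIntegrand (coef (phase α β) s b h)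
        (coef (phase α β) s b h) (coef (phase α β) s b h) ζ)) ∧
      ∀ h : L2P, N h =ᵐ[volume]
        fun ζ => (wt (phase α β) s b' ζ : ℂ) * cubicInt (coef (phase α β) s b h) ζ := by
  obtain ⟨C, hC, H⟩ := exists_cubicIntegrand_bound α hβ hs hb hb'
  have hp := measurable_phase α β
  have hw := measurable_wt hp s b'
  have hew := measurable_ewt hp s b'
  have hmc := fun h : L2P => measurable_coef hp s b (measurable_lp h)
  have hI : ∀ h : L2P, ∀ᵐ ζ, Integrable (cubicIntegrand (coef (phase α β) s b h)
        (coef (phase α β) s b h) (coef (phase α β) s b h) ζ) := fun h => by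
    have hb := H h h h (measurable_lp h) (measurable_lp h) (measurable_lp h)
    simp_rw [lintegral_enorm_sq_lp] at hb
    have hm := measurable_lintegral_cubicIntegrand (hmc h) (hmc h) (hmc h)
    filter_upwards [ae_lt_top (by fun_prop) (hb.trans_lt (by finiteness)).ne] with ζ hζ
    refine ⟨((measurable_cubicIntegrand (hmc h) (hmc h) (hmc h)).comp
      measurable_prodMk_left).aestronglyMeasurable, ?_⟩
    by_contra hcon
    rw [HasFiniteIntegral, not_lt, top_le_iff] at hcon
    rw [hcon, ENNReal.mul_top (ewt_ne_zero _ _ _ _)] at hζ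
    simp at hζ
  have hM : ∀ h : L2P, MemLp (fun ζ => (wt (phase α β) s b' ζ : ℂ) *
      cubicInt (coef (phase α β) s b h) ζ) 2 volume := fun h => by
    have hb := H h h h (measurable_lp h) (measurable_lp h) (measurable_lp h)
    simp_rw [lintegral_enorm_sq_lp] at hb
    refine ⟨?_, ?_⟩
    · have := ((measurable_cubicIntegrand (hmc h) (hmc h)
        (hmc h)).stronglyMeasurable.integral_prod_right' (ν := volume)).measurable
      exact Measurable.aestronglyMeasurable (Measurable.mul (by fun_prop) this)
    · have h2 : eLpNorm (fun ζ => (wt (phase α β) s b' ζ : ℂ) *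
          cubicInt (coef (phase α β) s b h) ζ) 2 volume ^ 2 < ∞ := by
        rw [eLpNorm_two_sq]
        refine lt_of_le_of_lt ((lintegral_mono fun ζ => ?_).trans hb) (by finiteness)
        rw [enorm_mul, enorm_wt]
        gcongr
        exact enorm_integral_le_lintegral_enorm _
      exact (ENNReal.pow_lt_top_iff.mp h2).resolve_right (by norm_num)
  -- The square of this constant dominates 4C, where 4 is the cost of squaring a sum of three terms.
  refine ⟨fun h => (hM h).toLp _, ⟨2 * Real.sqrt C.toReal + 1, by positivity, fun h g => ?_⟩, hI,
    fun h => MemLp.coeFn_toLp (hM h)⟩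
  rw [← MemLp.toLp_sub]
  refine norm_toLp_le_of_lintegral _ (by positivity) ?_
  set f₁ := coef (phase α β) s b h
  set f₂ := coef (phase α β) s b g
  set d : ℝ × ℝ → ℂ := fun z => h z - g z with hd
  have hdm : Measurable d := (measurable_lp h).sub (measurable_lp g)
  have hdn : ∫⁻ z, ‖d z‖ₑ ^ 2 = ENNReal.ofReal ‖h - g‖ ^ 2 := by
    rw [← lintegral_enorm_sq_lp]
    refine lintegral_congr_ae ?_
    filter_upwards [Lp.coeFn_sub h g] with z hz
    rw [hz]; rfl
  have hdc : (fun z => f₁ z - f₂ z) = coef (phase α β) s b d := by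
    ext z
    simp only [f₁, f₂, coef, hd]; ring
  have mh := measurable_lp h
  have mg := measurable_lp g
  have mdc := measurable_coef hp s b hdm
  have B₁ := H d h h hdm mh mh
  have B₂ := H g d h mg hdm mh
  have B₃ := H g g d mg mg hdm
  simp_rw [lintegral_enorm_sq_lp, hdn] at B₁ B₂ B₃
  set A₁ := fun ζ => ewt (phase α β) s b' ζ *
    ∫⁻ q, ‖cubicIntegrand (coef (phase α β) s b d) f₁ f₁ ζ q‖ₑ with hA₁
  set A₂ := fun ζ => ewt (phase α β) s b' ζ *
    ∫⁻ q, ‖cubicIntegrand f₂ (coef (phase α β) s b d) f₁ ζ q‖ₑ with hA₂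
  set A₃ := fun ζ => ewt (phase α β) s b' ζ *
    ∫⁻ q, ‖cubicIntegrand f₂ f₂ (coef (phase α β) s b d) ζ q‖ₑ with hA₃
  have mA₁ : Measurable A₁ := by
    have := measurable_lintegral_cubicIntegrand mdc (hmc h) (hmc h)
    fun_prop
  have mA₂ : Measurable A₂ := by
    have := measurable_lintegral_cubicIntegrand (hmc g) mdc (hmc h)
    fun_prop
  set a := ENNReal.ofReal ‖h‖
  set c := ENNReal.ofReal ‖g‖
  set e := ENNReal.ofReal ‖h - g‖
  calc _ ≤ ∫⁻ ζ, (A₁ ζ + (A₂ ζ + A₃ ζ)) ^ 2 := by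
        refine lintegral_mono_ae ?_
        filter_upwards [hI h, hI g] with ζ h1 h2
        gcongr
        rw [Pi.sub_apply, ← mul_sub, enorm_mul, enorm_wt]
        simp only [hA₁, hA₂, hA₃]
        rw [← mul_add, ← mul_add]
        gcongr
        unfold cubicInt
        rw [← integral_sub h1 h2]
        refine (enorm_integral_le_lintegral_enorm _).trans ?_
        have m1 : Measurable fun q => ‖cubicIntegrand (coef (phase α β) s b d) f₁ f₁ ζ q‖ₑ :=
          ((measurable_cubicIntegrand mdc (hmc h) (hmc h)).comp measurable_prodMk_left).enorm
        have m2 : Measurable fun q => ‖cubicIntegrand f₂ (coef (phase α β) s b d) f₁ ζ q‖ₑ :=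
          ((measurable_cubicIntegrand (hmc g) mdc (hmc h)).comp measurable_prodMk_left).enorm
        rw [← lintegral_add_left m2, ← lintegral_add_left m1]
        refine lintegral_mono fun q => ?_
        rw [cubicIntegrand_sub, hdc]
        exact (enorm_add_le _ _).trans (add_le_add_right (enorm_add_le _ _) _)
    _ ≤ ∫⁻ ζ, 4 * (A₁ ζ ^ 2 + (A₂ ζ ^ 2 + A₃ ζ ^ 2)) := by
        refine lintegral_mono fun ζ => ?_
        calc (A₁ ζ + (A₂ ζ + A₃ ζ)) ^ 2 ≤ 2 * (A₁ ζ ^ 2 + (A₂ ζ + A₃ ζ) ^ 2) :=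
              ennreal_add_sq_le _ _
          _ ≤ 2 * (2 * A₁ ζ ^ 2 + 2 * (A₂ ζ ^ 2 + A₃ ζ ^ 2)) := by
              gcongr
              · exact le_mul_of_one_le_left zero_le one_le_two
              · exact ennreal_add_sq_le _ _
          _ = _ := by ring
    _ = 4 * ((∫⁻ ζ, A₁ ζ ^ 2) + ((∫⁻ ζ, A₂ ζ ^ 2) + ∫⁻ ζ, A₃ ζ ^ 2)) := by
        rw [lintegral_const_mul' _ _ (by finiteness), lintegral_add_left (by fun_prop),
          lintegral_add_left (by fun_prop)]
    _ ≤ 4 * (C * (e ^ 2 * a ^ 2 * a ^ 2) + (C * (c ^ 2 * e ^ 2 * a ^ 2) +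
          C * (c ^ 2 * c ^ 2 * e ^ 2))) := by
        gcongr
    _ ≤ 4 * C * ((a ^ 2 + c ^ 2) * e) ^ 2 := by
        have : (a ^ 2 * a ^ 2 + c ^ 2 * a ^ 2 + c ^ 2 * c ^ 2) ≤ (a ^ 2 + c ^ 2) ^ 2 := by
          calc _ ≤ (a ^ 2 * a ^ 2 + c ^ 2 * a ^ 2 + c ^ 2 * c ^ 2) + c ^ 2 * a ^ 2 := le_self_add
            _ = _ := by ring
        calc _ = 4 * C * ((a ^ 2 * a ^ 2 + c ^ 2 * a ^ 2 + c ^ 2 * c ^ 2) * e ^ 2) := by ring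
          _ ≤ 4 * C * ((a ^ 2 + c ^ 2) ^ 2 * e ^ 2) := by gcongr
          _ = _ := by ring
    _ ≤ _ := by
        rw [mul_assoc (2 * Real.sqrt C.toReal + 1), ENNReal.ofReal_mul (by positivity),
          mul_pow (ENNReal.ofReal (2 * Real.sqrt C.toReal + 1))]
        have e1 : ENNReal.ofReal ((‖h‖ ^ 2 + ‖g‖ ^ 2) * ‖h - g‖) = (a ^ 2 + c ^ 2) * e := by
          rw [ENNReal.ofReal_mul (by positivity), ENNReal.ofReal_add (by positivity)
            (by positivity), ENNReal.ofReal_pow (by positivity), ENNReal.ofReal_pow (by positivity)]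
        rw [e1]
        gcongr
        calc 4 * C = ENNReal.ofReal (4 * C.toReal) := by
              rw [ENNReal.ofReal_mul (by norm_num), ENNReal.ofReal_toReal hC]; norm_num
          _ ≤ ENNReal.ofReal ((2 * Real.sqrt C.toReal + 1) ^ 2) := by
              apply ENNReal.ofReal_le_ofReal
              nlinarith [Real.sq_sqrt (ENNReal.toReal_nonneg (a := C)), Real.sqrt_nonneg C.toReal]
          _ = _ := ENNReal.ofReal_pow (by positivity) 2

/-! ### Distributions, Sobolev data and test functions in terms of coefficients. -/

/-! ### Coordinates on the plane -/

/-- The coordinates of the plane. -/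
def planeEquiv : Plane ≃ᵐ ℝ × ℝ :=
  (MeasurableEquiv.toLp 2 (Fin 2 → ℝ)).symm.trans MeasurableEquiv.finTwoArrow

theorem planeEquiv_symm_apply (ζ : ℝ × ℝ) : planeEquiv.symm ζ = !₂[ζ.1, ζ.2] := rfl

theorem measurePreserving_planeEquiv : MeasurePreserving planeEquiv :=
  (volume_preserving_finTwoArrow ℝ).comp
    (EuclideanSpace.volume_preserving_symm_measurableEquiv_toLp (Fin 2))

theorem measurePreserving_planeEquiv_symm : MeasurePreserving planeEquiv.symm :=
  measurePreserving_planeEquiv.symm _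

theorem integral_plane (F : Plane → ℂ) : ∫ x, F x = ∫ ζ : ℝ × ℝ, F !₂[ζ.1, ζ.2] :=
  (measurePreserving_planeEquiv_symm.integral_comp' F).symm

theorem integrable_plane_iff (F : Plane → ℂ) :
    Integrable F ↔ Integrable fun ζ : ℝ × ℝ => F !₂[ζ.1, ζ.2] :=
  (measurePreserving_planeEquiv_symm.integrable_comp_emb planeEquiv.symm.measurableEmbedding).symm

@[fun_prop]
theorem continuous_planePoint : Continuous fun ζ : ℝ × ℝ => (!₂[ζ.1, ζ.2] : Plane) := by
  refine (PiLp.continuous_toLp 2 _).comp (continuous_pi fun i => ?_)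
  fin_cases i
  · exact continuous_fst
  · exact continuous_snd

theorem inner_planePoint (x y : ℝ × ℝ) :
    inner ℝ (!₂[x.1, x.2] : Plane) !₂[y.1, y.2] = x.1 * y.1 + x.2 * y.2 := by
  simp [PiLp.inner_apply, mul_comm]

/-! ### The inverse Fourier transform of a test function -/

/-- The inverse Fourier transform of `φ` in coordinates. -/
def hat (φ : 𝓢(Plane, ℂ)) (ζ : ℝ × ℝ) : ℂ := (𝓕⁻ φ) !₂[ζ.1, ζ.2]

theorem continuous_hat (φ : 𝓢(Plane, ℂ)) : Continuous (hat φ) :=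
  (𝓕⁻ φ).continuous.comp continuous_planePoint

@[fun_prop]
theorem measurable_hat (φ : 𝓢(Plane, ℂ)) : Measurable (hat φ) := (continuous_hat φ).measurable

theorem hat_eq_integral (φ : 𝓢(Plane, ℂ)) (ζ : ℝ × ℝ) :
    hat φ ζ = ∫ q : ℝ × ℝ, e2 (q.1 * ζ.1 + q.2 * ζ.2) * φ !₂[q.1, q.2] := by
  rw [hat, SchwartzMap.fourierInv_coe, Real.fourierInv_eq, integral_plane]
  refine integral_congr_ae (.of_forall fun q => ?_)
  simp only [inner_planePoint, e2_eq_fourierChar]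
  rfl

/-- The bracket `(1 + |η|)(1 + |τ|)`. -/
def br (ζ : ℝ × ℝ) : ℝ := (1 + |ζ.1|) * (1 + |ζ.2|)

theorem one_le_br (ζ : ℝ × ℝ) : 1 ≤ br ζ :=
  one_le_mul_of_one_le_of_one_le (one_le_bracket _) (one_le_bracket _)

theorem br_pos (ζ : ℝ × ℝ) : 0 < br ζ := zero_lt_one.trans_le (one_le_br ζ)

theorem continuous_br : Continuous br := by unfold br; fun_prop

@[fun_prop]
theorem measurable_br : Measurable br := continuous_br.measurable

theorem br_le_sq (ζ : ℝ × ℝ) : br ζ ≤ (1 + ‖(!₂[ζ.1, ζ.2] : Plane)‖) ^ 2 := by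
  have h1 := PiLp.norm_apply_le (!₂[ζ.1, ζ.2] : Plane) 0
  have h2 := PiLp.norm_apply_le (!₂[ζ.1, ζ.2] : Plane) 1
  simp only [Real.norm_eq_abs] at h1 h2
  rw [sq]
  unfold br
  have h1' : |ζ.1| ≤ ‖(!₂[ζ.1, ζ.2] : Plane)‖ := h1
  have h2' : |ζ.2| ≤ ‖(!₂[ζ.1, ζ.2] : Plane)‖ := h2
  gcongr

/-- The constant in the decay estimate of order `m` of a Schwartz function. -/
def decayConst (m : ℕ) (g : 𝓢(Plane, ℂ)) : ℝ :=
  2 ^ (2 * m) * ((Finset.Iic (2 * m, 0)).sup fun q => SchwartzMap.seminorm ℂ q.1 q.2) g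

theorem decayConst_nonneg (m : ℕ) (g : 𝓢(Plane, ℂ)) : 0 ≤ decayConst m g := by
  unfold decayConst; positivity

theorem br_pow_mul_norm_le (m : ℕ) (g : 𝓢(Plane, ℂ)) (ζ : ℝ × ℝ) :
    br ζ ^ m * ‖g !₂[ζ.1, ζ.2]‖ ≤ decayConst m g := by
  have h := SchwartzMap.one_add_le_sup_seminorm_apply (𝕜 := ℂ) (m := (2 * m, 0)) (le_refl (2 * m))
    (le_refl 0) g !₂[ζ.1, ζ.2]
  rw [norm_iteratedFDeriv_zero] at h
  refine le_trans ?_ h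
  have := br_le_sq ζ
  have h0 := br_pos ζ
  simp only [pow_mul]
  gcongr

theorem norm_hat_le (m : ℕ) (φ : 𝓢(Plane, ℂ)) (ζ : ℝ × ℝ) :
    ‖hat φ ζ‖ ≤ decayConst m (𝓕⁻ φ) * (br ζ ^ m)⁻¹ := by
  have h := br_pow_mul_norm_le m (𝓕⁻ φ) ζ
  have := br_pos ζ
  rw [← div_eq_mul_inv, le_div_iff₀ (by positivity), mul_comm]
  exact h

theorem lintegral_br_inv_sq_lt_top : ∫⁻ ζ, ENNReal.ofReal ((br ζ ^ 2)⁻¹) < ∞ := by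
  have hJ := lintegral_jpow_lt_top (e := 2) (by norm_num)
  have e : ∀ ζ : ℝ × ℝ, ENNReal.ofReal ((br ζ ^ 2)⁻¹) = jpow (-2) ζ.1 * jpow (-2) ζ.2 := fun ζ => by
    have h1 := bracket_pos ζ.1
    have h2 := bracket_pos ζ.2
    unfold jpow br
    rw [← ENNReal.ofReal_mul (by positivity), ← Real.mul_rpow (by positivity) (by positivity),
      Real.rpow_neg (by positivity)]
    norm_cast
  simp_rw [e]
  rw [lintegral_fst_snd (by fun_prop)]
  have : ∀ η, ∫⁻ τ, jpow (-2) η * jpow (-2) τ = jpow (-2) η * ∫⁻ τ, jpow (-2) τ := fun η =>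
    lintegral_const_mul _ (by fun_prop)
  simp_rw [this]
  rw [lintegral_mul_const _ (by fun_prop)]
  exact ENNReal.mul_lt_top hJ hJ

theorem integrable_br_inv_sq : Integrable fun ζ => (br ζ ^ 2)⁻¹ := by
  refine ⟨by fun_prop, ?_⟩
  rw [hasFiniteIntegral_iff_ofReal (.of_forall fun ζ => by have := br_pos ζ; positivity)]
  exact lintegral_br_inv_sq_lt_top

/-- The adjoint of the linear part of the equation. -/
def adjointOp (α β : ℝ) (φ : 𝓢(Plane, ℂ)) : 𝓢(Plane, ℂ) :=
  -(∂_{dirT} φ) + (Complex.I * α) • (∂_{dirX} (∂_{dirX} φ)) -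
    (β : ℂ) • (∂_{dirX} (∂_{dirX} (∂_{dirX} φ)))

theorem fourierInv_lineDeriv_apply (φ : 𝓢(Plane, ℂ)) (m x : Plane) :
    (𝓕⁻ (∂_{m} φ)) x = -(2 * Real.pi * Complex.I) * ((inner ℝ x m : ℝ) : ℂ) * (𝓕⁻ φ) x := by
  rw [SchwartzMap.fourierInv_lineDerivOp_eq]
  have : (fun x : Plane => inner ℝ x m).HasTemperateGrowth := by fun_prop
  rw [smul_apply, SchwartzMap.smulLeftCLM_apply_apply this]
  simp [mul_assoc]

theorem hat_lineDeriv_dirX (φ : 𝓢(Plane, ℂ)) (ζ : ℝ × ℝ) :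
    hat (∂_{dirX} φ) ζ = -(2 * Real.pi * Complex.I) * ζ.1 * hat φ ζ := by
  rw [hat, fourierInv_lineDeriv_apply, hat]
  congr 3
  simp [dirX, EuclideanSpace.inner_single_right]

theorem hat_lineDeriv_dirT (φ : 𝓢(Plane, ℂ)) (ζ : ℝ × ℝ) :
    hat (∂_{dirT} φ) ζ = -(2 * Real.pi * Complex.I) * ζ.2 * hat φ ζ := by
  rw [hat, fourierInv_lineDeriv_apply, hat]
  congr 3
  simp [dirT, EuclideanSpace.inner_single_right]

/-- The linear equation enters the proof only through this: its adjoint acts as multiplication by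
2πi times the modulation. -/
theorem hat_adjointOp (α β : ℝ) (φ : 𝓢(Plane, ℂ)) (ζ : ℝ × ℝ) :
    hat (adjointOp α β φ) ζ = 2 * Real.pi * Complex.I * (ζ.2 - phase α β ζ.1 : ℝ) * hat φ ζ := by
  have hadd : ∀ f g : 𝓢(Plane, ℂ), hat (f + g) ζ = hat f ζ + hat g ζ := fun f g => by
    unfold hat; rw [FourierInvAdd.fourierInv_add]; rfl
  have hsm : ∀ (c : ℂ) (f : 𝓢(Plane, ℂ)), hat (c • f) ζ = c * hat f ζ := fun c f => by
    unfold hat; rw [FourierInvSMul.fourierInv_smul]; rfl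
  have hneg : ∀ f : 𝓢(Plane, ℂ), hat (-f) ζ = -hat f ζ := fun f => by
    rw [← neg_one_smul ℂ, hsm]; ring
  unfold adjointOp
  rw [sub_eq_add_neg, hadd, hadd, hneg, hneg, hsm, hsm]
  simp only [hat_lineDeriv_dirT, hat_lineDeriv_dirX]
  unfold phase
  push_cast
  linear_combination (4 * Real.pi ^ 2 * Complex.I * α * ζ.1 ^ 2 +
    8 * Real.pi ^ 3 * Complex.I * β * ζ.1 ^ 3) * hat φ ζ * Complex.I_sq

theorem adjointOp_apply (α β : ℝ) (φ : 𝓢(Plane, ℂ)) (x : Plane) : adjointOp α β φ x =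
    -(∂_{dirT} φ) x + Complex.I * α * (∂_{dirX} (∂_{dirX} φ)) x
        - β * (∂_{dirX} (∂_{dirX} (∂_{dirX} φ))) x := rfl

theorem IsTestOn.lineDeriv {T : ℝ} {φ : 𝓢(Plane, ℂ)} (h : IsTestOn T φ) (m : Plane) :
    IsTestOn T (∂_{m} φ) := by
  have hs : tsupport (∂_{m} φ : 𝓢(Plane, ℂ)) ⊆ tsupport φ := by
    refine (closure_minimal ?_ (isClosed_tsupport φ))
    intro x hx
    by_contra hcon
    apply hx
    have := SchwartzMap.lineDerivOp_apply_eq_fderiv m φ x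
    rw [this, fderiv_of_notMem_tsupport ℝ hcon]
    rfl
  exact ⟨h.1.of_isClosed_subset (isClosed_tsupport _) hs, hs.trans h.2⟩

theorem IsTestOn.adjointOp {T : ℝ} {φ : 𝓢(Plane, ℂ)} (h : IsTestOn T φ) (α β : ℝ) :
    IsTestOn T (adjointOp α β φ) := by
  have h1 := h.lineDeriv dirT
  have h2 := (h.lineDeriv dirX).lineDeriv dirX
  have h3 := h2.lineDeriv dirX
  have hs : tsupport (_root_.adjointOp α β φ) ⊆ tsupport (∂_{dirT} φ : 𝓢(Plane, ℂ)) ∪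
      tsupport (∂_{dirX} (∂_{dirX} φ) : 𝓢(Plane, ℂ)) ∪
      tsupport (∂_{dirX} (∂_{dirX} (∂_{dirX} φ)) : 𝓢(Plane, ℂ)) := by
    refine closure_minimal ?_ (((isClosed_tsupport _).union (isClosed_tsupport _)).union
      (isClosed_tsupport _))
    intro x hx
    by_contra hcon
    simp only [Set.mem_union, not_or] at hcon
    apply hx
    rw [adjointOp_apply, image_eq_zero_of_notMem_tsupport hcon.1.1,
      image_eq_zero_of_notMem_tsupport hcon.1.2, image_eq_zero_of_notMem_tsupport hcon.2]
    simp
  exact ⟨((h1.1.isCompact.union h2.1.isCompact).union h3.1.isCompact).of_isClosed_subset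
    (isClosed_tsupport _) hs, hs.trans (Set.union_subset (Set.union_subset h1.2 h2.2) h3.2)⟩

theorem IsTestOn.eq_zero {T : ℝ} {φ : 𝓢(Plane, ℂ)} (h : IsTestOn T φ) {q : ℝ × ℝ}
    (hq : T ≤ |q.2|) : φ !₂[q.1, q.2] = 0 := by
  refine image_eq_zero_of_notMem_tsupport fun hx => ?_
  have h2 : -T < q.2 ∧ q.2 < T := h.2 hx
  exact absurd (abs_lt.mpr h2) (not_lt.mpr hq)

/-! ### The cutoff and the reproducing formula -/

/-- A smooth bump function equal to `1` on `[-1, 1]` and supported in `[-2, 2]`. -/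
def timeBump : ContDiffBump (0 : ℝ) := ⟨1, 2, one_pos, one_lt_two⟩

theorem hasCompactSupport_timeBump : HasCompactSupport fun x => (timeBump x : ℂ) :=
  HasCompactSupport.comp_left (g := fun x : ℝ => (x : ℂ)) timeBump.hasCompactSupport
    Complex.ofReal_zero

theorem contDiff_timeBump : ContDiff ℝ ((⊤ : ℕ∞) : WithTop ℕ∞) fun x => (timeBump x : ℂ) :=
  Complex.ofRealCLM.contDiff.comp timeBump.contDiff

/-- A smooth cutoff in time, equal to `1` on `[-1, 1]`. -/
def cutoff : 𝓢(ℝ, ℂ) := hasCompactSupport_timeBump.toSchwartzMap contDiff_timeBump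

theorem cutoff_apply (t : ℝ) : cutoff t = timeBump t := rfl

theorem cutoff_eq_one {t : ℝ} (ht : |t| ≤ 1) : cutoff t = 1 := by
  rw [cutoff_apply, ContDiffBump.one_of_mem_closedBall, Complex.ofReal_one]
  simpa [timeBump] using ht

/-- The Fourier transform of the cutoff. -/
def cutoffHat : 𝓢(ℝ, ℂ) := 𝓕 cutoff

theorem fourierInv_eq_e2 (f : ℝ → ℂ) (t : ℝ) : 𝓕⁻ f t = ∫ x, e2 (t * x) * f x := by
  rw [Real.fourierInv_eq]
  refine integral_congr_ae (.of_forall fun x => ?_)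
  simp only [e2_eq_fourierChar, Real.inner_apply, mul_comm t x]
  rfl

theorem integral_e2_mul_cutoffHat (t : ℝ) : ∫ x, e2 (t * x) * cutoffHat x = cutoff t := by
  rw [← fourierInv_eq_e2, cutoffHat, ← SchwartzMap.fourierInv_coe, FourierPair.fourierInv_fourier_eq]

theorem integral_e2_mul_cutoffHat_scaled {T : ℝ} (hT : 0 < T) (t q : ℝ) :
    ∫ τ, e2 (t * τ) * (T * cutoffHat (T * (τ - q))) = e2 (t * q) * cutoff (t / T) := by
  rw [← integral_add_right_eq_self _ q]
  have : ∀ σ, e2 (t * (σ + q)) * (T * cutoffHat (T * (σ + q - q))) =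
      (e2 (t * q) * T) * (fun x => e2 (t / T * x) * cutoffHat x) (T * σ) := fun σ => by
    simp only [add_sub_cancel_right]
    rw [mul_add, e2_add, show t / T * (T * σ) = t * σ by field_simp]
    ring
  simp_rw [this]
  rw [integral_const_mul,
    Measure.integral_comp_mul_left (fun x => e2 (t / T * x) * cutoffHat x) T, integral_e2_mul_cutoffHat,
    abs_of_pos (inv_pos.mpr hT), Complex.real_smul]
  have : (T : ℂ) ≠ 0 := by exact_mod_cast hT.ne'
  push_cast
  field_simp

theorem integrable_cutoffHat_scaled {T : ℝ} (hT : 0 < T) (q : ℝ) :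
    Integrable fun τ => (T : ℂ) * cutoffHat (T * (τ - q)) :=
  ((cutoffHat.integrable.comp_mul_left' hT.ne').comp_sub_right q).const_mul _

theorem integrable_testFunction (φ : 𝓢(Plane, ℂ)) :
    Integrable fun q : ℝ × ℝ => φ !₂[q.1, q.2] :=
  (integrable_plane_iff _).mp φ.integrable

/-- The reproducing formula for test functions supported where the cutoff is `1`. -/
theorem integral_cutoffHat_mul_hat {T : ℝ} (hT : 0 < T) {φ : 𝓢(Plane, ℂ)} (hφ : IsTestOn T φ)
    (η q : ℝ) : ∫ τ, (T * cutoffHat (T * (τ - q))) * hat φ (η, τ) = hat φ (η, q) := by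
  have hI : Integrable (Function.uncurry fun (τ : ℝ) (x : ℝ × ℝ) =>
      (T * cutoffHat (T * (τ - q))) * (e2 (x.1 * η + x.2 * τ) * φ !₂[x.1, x.2]))
      (volume.prod volume) := by
    refine ((integrable_cutoffHat_scaled hT q).mul_prod (integrable_testFunction φ)).mono
      ?_ (.of_forall fun z => ?_)
    · have h1 := cutoffHat.continuous
      have h2 := φ.continuous.comp continuous_planePoint
      refine Continuous.aestronglyMeasurable ?_
      unfold Function.uncurry
      have h3 : Continuous fun z : ℝ × ℝ × ℝ => φ !₂[z.2.1, z.2.2] := h2.comp continuous_snd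
      fun_prop
    · simp [Function.uncurry, norm_e2]
  calc _ = ∫ τ, ∫ x : ℝ × ℝ, (T * cutoffHat (T * (τ - q))) *
        (e2 (x.1 * η + x.2 * τ) * φ !₂[x.1, x.2]) := by
        refine integral_congr_ae (.of_forall fun τ => ?_)
        simp only [hat_eq_integral]
        rw [← integral_const_mul]
    _ = ∫ x : ℝ × ℝ, ∫ τ, (T * cutoffHat (T * (τ - q))) *
        (e2 (x.1 * η + x.2 * τ) * φ !₂[x.1, x.2]) := integral_integral_swap hI
    _ = ∫ x : ℝ × ℝ, e2 (x.1 * η + x.2 * q) * φ !₂[x.1, x.2] := by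
        refine integral_congr_ae (.of_forall fun x => ?_)
        have : ∀ τ, (T * cutoffHat (T * (τ - q))) * (e2 (x.1 * η + x.2 * τ) * φ !₂[x.1, x.2]) =
            (e2 (x.1 * η) * φ !₂[x.1, x.2]) * (e2 (x.2 * τ) * (T * cutoffHat (T * (τ - q)))) :=
          fun τ => by rw [e2_add]; ring
        simp only [this]
        rw [integral_const_mul, integral_e2_mul_cutoffHat_scaled hT, e2_add]
        -- Convolution in τ amounts to multiplication by the cutoff at time t/T, which is 1 wherever
        -- the test function does not vanish.
        by_cases hx : T ≤ |x.2|
        · rw [hφ.eq_zero hx]; ring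
        · rw [cutoff_eq_one]
          · ring
          · rw [abs_div, abs_of_pos hT, div_le_one hT]
            exact (not_le.mp hx).le
    _ = _ := (hat_eq_integral φ (η, q)).symm

/-! ### Pairing of weighted coefficients with test functions -/

/-- Polynomial growth of the weights is all that is needed for coefficients to pair with the
transforms of test functions, since these decay rapidly. -/
theorem exists_wt_le_br (α β s b : ℝ) : ∃ C : ℝ, 0 < C ∧ ∃ m : ℕ, ∀ ζ,
    wt (phase α β) s b ζ ≤ C * br ζ ^ m := by
  obtain ⟨n₁, h₁⟩ := exists_nat_ge |s|
  obtain ⟨n₂, h₂⟩ := exists_nat_ge |b|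
  set P := 1 + |2 * Real.pi * α| + |4 * Real.pi ^ 2 * β| with hP
  have hP0 : 0 < P := by positivity
  refine ⟨2 ^ |s| * P ^ n₂, by positivity, n₁ + 3 * n₂, fun ζ => ?_⟩
  have hη := one_le_bracket ζ.1
  have hτ := one_le_bracket ζ.2
  have hσ := one_le_bracket (ζ.2 - phase α β ζ.1)
  have e1 : (1 + ζ.1 ^ 2) ^ (s / 2) ≤ 2 ^ |s| * br ζ ^ n₁ := by
    refine (sobolevWeight_le s ζ.1).trans ?_
    gcongr
    calc (1 + |ζ.1|) ^ s ≤ (1 + |ζ.1|) ^ (n₁ : ℝ) :=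
          Real.rpow_le_rpow_of_exponent_le hη ((le_abs_self s).trans h₁)
      _ = (1 + |ζ.1|) ^ n₁ := Real.rpow_natCast _ _
      _ ≤ br ζ ^ n₁ := by
          gcongr
          exact le_mul_of_one_le_right (by positivity) hτ
  have e2 : 1 + |ζ.2 - phase α β ζ.1| ≤ P * br ζ ^ 3 := by
    have hb1 := bracket_le_add ζ.2 (-phase α β ζ.1)
    rw [← sub_eq_add_neg, abs_neg] at hb1
    have hb2 : 1 + |phase α β ζ.1| ≤ P * (1 + |ζ.1|) ^ 3 := by
      have : |phase α β ζ.1| ≤ |2 * Real.pi * α| * |ζ.1| ^ 2 + |4 * Real.pi ^ 2 * β| * |ζ.1| ^ 3 := by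
        unfold phase
        refine (abs_add_le _ _).trans (le_of_eq ?_)
        rw [abs_mul, abs_mul (4 * Real.pi ^ 2 * β), abs_pow, abs_pow]
      have h3 : (1 : ℝ) ≤ (1 + |ζ.1|) ^ 3 := one_le_pow₀ hη
      have h4 : |ζ.1| ^ 2 ≤ (1 + |ζ.1|) ^ 3 :=
        calc |ζ.1| ^ 2 ≤ (1 + |ζ.1|) ^ 2 := by gcongr; linarith
          _ ≤ _ := pow_le_pow_right₀ hη (by norm_num)
      have h5 : |ζ.1| ^ 3 ≤ (1 + |ζ.1|) ^ 3 := by gcongr; linarith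
      calc _ ≤ 1 + (|2 * Real.pi * α| * |ζ.1| ^ 2 + |4 * Real.pi ^ 2 * β| * |ζ.1| ^ 3) := by gcongr
        _ ≤ (1 + |ζ.1|) ^ 3 + (|2 * Real.pi * α| * (1 + |ζ.1|) ^ 3 +
            |4 * Real.pi ^ 2 * β| * (1 + |ζ.1|) ^ 3) := by gcongr
        _ = _ := by rw [hP]; ring
    calc _ ≤ (1 + |phase α β ζ.1|) * (1 + |ζ.2|) := hb1
      _ ≤ (P * (1 + |ζ.1|) ^ 3) * (1 + |ζ.2|) ^ 3 := by
          gcongr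
          exact le_self_pow₀ hτ (by norm_num)
      _ = _ := by unfold br; ring
  unfold wt
  calc _ ≤ (2 ^ |s| * br ζ ^ n₁) * (P * br ζ ^ 3) ^ n₂ := by
        have := br_pos ζ
        gcongr
        calc (1 + |ζ.2 - phase α β ζ.1|) ^ b ≤ (1 + |ζ.2 - phase α β ζ.1|) ^ (n₂ : ℝ) :=
              Real.rpow_le_rpow_of_exponent_le hσ ((le_abs_self b).trans h₂)
          _ = (1 + |ζ.2 - phase α β ζ.1|) ^ n₂ := Real.rpow_natCast _ _
          _ ≤ _ := by gcongr
    _ = _ := by ring_nf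

theorem memLp_br_inv_sq : MemLp (fun ζ => (br ζ ^ 2)⁻¹) 2 volume := by
  rw [memLp_two_iff_integrable_sq (by fun_prop)]
  refine integrable_br_inv_sq.mono' (by fun_prop) (.of_forall fun ζ => ?_)
  have h1 := one_le_br ζ
  rw [Real.norm_of_nonneg (by positivity)]
  exact pow_le_of_le_one (by positivity) (inv_le_one_of_one_le₀ (one_le_pow₀ h1)) two_ne_zero

theorem memLp_wt_mul_hat (α β s b : ℝ) (φ : 𝓢(Plane, ℂ)) :
    MemLp (fun ζ => (wt (phase α β) s b ζ : ℂ) * hat φ ζ) 2 volume := by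
  obtain ⟨C, hC, m, h⟩ := exists_wt_le_br α β s b
  have hw := measurable_wt (measurable_phase α β) s b
  refine MemLp.of_le_mul (c := C * decayConst (m + 2) (𝓕⁻ φ)) memLp_br_inv_sq (by fun_prop)
    (.of_forall fun ζ => ?_)
  have hb := br_pos ζ
  rw [norm_mul, Complex.norm_real, Real.norm_of_nonneg (wt_pos _ _ _ _).le,
    Real.norm_of_nonneg (by positivity)]
  calc _ ≤ (C * br ζ ^ m) * (decayConst (m + 2) (𝓕⁻ φ) * (br ζ ^ (m + 2))⁻¹) := by
        gcongr
        · exact h ζ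
        · exact norm_hat_le (m + 2) φ ζ
    _ = _ := by
        rw [pow_add, mul_inv]
        have := decayConst_nonneg (m + 2) (𝓕⁻ φ)
        field_simp

theorem coef_eq_mul (p : ℝ → ℝ) (s b : ℝ) (h : ℝ × ℝ → ℂ) (ζ : ℝ × ℝ) :
    coef p s b h ζ = h ζ * (wt p (-s) (-b) ζ : ℂ) := by
  rw [coef, wt_neg, Complex.ofReal_inv, div_eq_mul_inv]

theorem integrable_coef_mul_hat (α β s b : ℝ) (h : L2P) (φ : 𝓢(Plane, ℂ)) :
    Integrable fun ζ => coef (phase α β) s b h ζ * hat φ ζ := by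
  simp_rw [coef_eq_mul, mul_assoc]
  exact (Lp.memLp h).integrable_mul (memLp_wt_mul_hat α β (-s) (-b) φ)

/-- The pairing of the distribution with weighted coefficient `h` with the test function `φ`. -/
def pairing (α β s b : ℝ) (φ : 𝓢(Plane, ℂ)) : L2P →L[ℂ] ℂ :=
  (ContinuousLinearMap.mul ℂ ℂ).lpPairing volume 2 2
    ((memLp_wt_mul_hat α β (-s) (-b) φ).toLp _)

theorem pairing_apply (α β s b : ℝ) (φ : 𝓢(Plane, ℂ)) (h : L2P) :
    pairing α β s b φ h = ∫ ζ, coef (phase α β) s b h ζ * hat φ ζ := by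
  rw [pairing, ContinuousLinearMap.lpPairing_eq_integral]
  refine integral_congr_ae ?_
  filter_upwards [MemLp.coeFn_toLp (memLp_wt_mul_hat α β (-s) (-b) φ)] with ζ hζ
  rw [hζ, coef_eq_mul, ContinuousLinearMap.mul_apply']
  ring

theorem exists_integrable_coef_br (α β s b : ℝ) (h : L2P) : ∃ m : ℕ,
    Integrable fun ζ => coef (phase α β) s b h ζ * ((br ζ ^ m)⁻¹ : ℝ) := by
  obtain ⟨C, hC, m, hm⟩ := exists_wt_le_br α β (-s) (-b)
  have hw := measurable_wt (measurable_phase α β) (-s) (-b)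
  refine ⟨m + 2, ?_⟩
  simp_rw [coef_eq_mul, mul_assoc]
  refine (Lp.memLp h).integrable_mul (MemLp.of_le_mul (c := C) memLp_br_inv_sq (by fun_prop)
    (.of_forall fun ζ => ?_))
  have hb := br_pos ζ
  rw [norm_mul, Complex.norm_real, Complex.norm_real, Real.norm_of_nonneg (wt_pos _ _ _ _).le,
    Real.norm_of_nonneg (by positivity), Real.norm_of_nonneg (by positivity)]
  calc _ ≤ (C * br ζ ^ m) * (br ζ ^ (m + 2))⁻¹ := by gcongr; exact hm ζ
    _ = _ := by rw [pow_add, mul_inv]; field_simp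

theorem exists_bourgain_distribution (α β s b : ℝ) (h : L2P) : ∃ V : 𝓢'(Plane, ℂ),
    ∀ g : 𝓢(Plane, ℂ), V g = ∫ ζ : ℝ × ℝ, coef (phase α β) s b h ζ * g !₂[ζ.1, ζ.2] := by
  obtain ⟨m, hm⟩ := exists_integrable_coef_br α β s b h
  have hcm := measurable_coef (measurable_phase α β) s b (measurable_lp h)
  have hgm : ∀ g : 𝓢(Plane, ℂ), Measurable fun ζ : ℝ × ℝ => g !₂[ζ.1, ζ.2] := fun g =>
    (g.continuous.comp continuous_planePoint).measurable
  have hpt : ∀ (g : 𝓢(Plane, ℂ)) (ζ : ℝ × ℝ), ‖coef (phase α β) s b h ζ * g !₂[ζ.1, ζ.2]‖ ≤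
      decayConst m g * ‖coef (phase α β) s b h ζ * ((br ζ ^ m)⁻¹ : ℝ)‖ := fun g ζ => by
    have h1 := br_pow_mul_norm_le m g ζ
    have hb := br_pos ζ
    rw [norm_mul, norm_mul, Complex.norm_real, Real.norm_of_nonneg (by positivity), mul_left_comm]
    gcongr
    rwa [← div_eq_mul_inv, le_div_iff₀ (by positivity), mul_comm]
  have hI : ∀ g : 𝓢(Plane, ℂ), Integrable fun ζ : ℝ × ℝ =>
      coef (phase α β) s b h ζ * g !₂[ζ.1, ζ.2] := fun g =>
    (hm.norm.const_mul (decayConst m g)).mono' (by have := hgm g; fun_prop) (.of_forall (hpt g))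
  let L : 𝓢(Plane, ℂ) →L[ℂ] ℂ := SchwartzMap.mkCLMtoNormedSpace
    (fun g => ∫ ζ : ℝ × ℝ, coef (phase α β) s b h ζ * g !₂[ζ.1, ζ.2])
    (fun f g => by
      rw [← integral_add (hI f) (hI g)]
      refine integral_congr_ae (.of_forall fun ζ => ?_)
      simp [mul_add])
    (fun a f => by
      rw [RingHom.id_apply, smul_eq_mul, ← integral_const_mul]
      refine integral_congr_ae (.of_forall fun ζ => ?_)
      simp [mul_left_comm])
    ⟨Finset.Iic (2 * m, 0),
      2 ^ (2 * m) * ∫ ζ, ‖coef (phase α β) s b h ζ * ((br ζ ^ m)⁻¹ : ℝ)‖,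
      mul_nonneg (by positivity) (integral_nonneg fun _ => norm_nonneg _), fun g => by
        refine (norm_integral_le_integral_norm _).trans
          ((integral_mono (hI g).norm (hm.norm.const_mul _) (hpt g)).trans (le_of_eq ?_))
        rw [integral_const_mul, mul_right_comm]
        rfl⟩
  exact ⟨ContinuousLinearMap.toPointwiseConvergenceCLM ℂ (RingHom.id ℂ) 𝓢(Plane, ℂ) ℂ L, fun g => rfl⟩

theorem bourgainWeight_planePoint (α β s b : ℝ) (ζ : ℝ × ℝ) :
    bourgainWeight α β s b !₂[ζ.1, ζ.2] = (1 + |2 * Real.pi * ζ.1|) ^ s *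
      (1 + |2 * Real.pi * (ζ.2 - phase α β ζ.1)|) ^ b := by
  unfold bourgainWeight phase
  simp only [Fin.isValue, Matrix.cons_val_zero, Matrix.cons_val_one]
  have e : 2 * Real.pi * ζ.2 - (α * (2 * Real.pi * ζ.1) ^ 2 + β * (2 * Real.pi * ζ.1) ^ 3) =
      2 * Real.pi * (ζ.2 - (2 * Real.pi * α * ζ.1 ^ 2 + 4 * Real.pi ^ 2 * β * ζ.1 ^ 3)) := by ring
  rw [e]

theorem bracket_two_pi_comparable (x : ℝ) : 1 + |2 * Real.pi * x| ≤ 8 * (1 + |x|) ∧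
    1 + |x| ≤ 8 * (1 + |2 * Real.pi * x|) := by
  rw [abs_mul, abs_of_pos (by positivity : 0 < 2 * Real.pi)]
  have := Real.pi_gt_three
  have := Real.pi_lt_four
  have := abs_nonneg x
  constructor <;> nlinarith

/-- Passes to a weight without the factors 2π whose spatial part is exactly that of the norm of
`Hs`; traces then land in `H^s` without any conversion. -/
theorem bourgainWeight_comparable (α β s b : ℝ) : ∃ C : ℝ, 0 < C ∧ ∀ ζ : ℝ × ℝ,
    bourgainWeight α β s b !₂[ζ.1, ζ.2] ≤ C * wt (phase α β) s b ζ ∧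
    wt (phase α β) s b ζ ≤ C * bourgainWeight α β s b !₂[ζ.1, ζ.2] := by
  refine ⟨8 ^ |s| * 8 ^ |b| * 2 ^ |s|, by positivity, fun ζ => ?_⟩
  rw [bourgainWeight_planePoint]
  unfold wt
  have h1 := bracket_two_pi_comparable ζ.1
  have h2 := bracket_two_pi_comparable (ζ.2 - phase α β ζ.1)
  have p1 := bracket_pos ζ.1
  have p2 := bracket_pos (2 * Real.pi * ζ.1)
  have p3 := bracket_pos (ζ.2 - phase α β ζ.1)
  have p4 := bracket_pos (2 * Real.pi * (ζ.2 - phase α β ζ.1))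
  have a1 := rpow_le_of_comparable (e := s) p2 p1 (by norm_num) h1.1 h1.2
  have a2 := rpow_le_of_comparable (e := s) p1 p2 (by norm_num) h1.2 h1.1
  have a3 := rpow_le_of_comparable (e := b) p4 p3 (by norm_num) h2.1 h2.2
  have a4 := rpow_le_of_comparable (e := b) p3 p4 (by norm_num) h2.2 h2.1
  have s1 := sobolevWeight_le s ζ.1
  have s2 := le_sobolevWeight s ζ.1
  constructor
  · calc _ ≤ (8 ^ |s| * (2 ^ |s| * (1 + ζ.1 ^ 2) ^ (s / 2))) *
          (8 ^ |b| * (1 + |ζ.2 - phase α β ζ.1|) ^ b) := by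
          gcongr
          exact a1.trans (by gcongr)
      _ = _ := by ring
  · calc _ ≤ (2 ^ |s| * (8 ^ |s| * (1 + |2 * Real.pi * ζ.1|) ^ s)) *
          (8 ^ |b| * (1 + |2 * Real.pi * (ζ.2 - phase α β ζ.1)|) ^ b) := by
          gcongr
          exact s1.trans (by gcongr)
      _ = _ := by ring

theorem measurable_bourgainWeight (α β s b : ℝ) : Measurable (bourgainWeight α β s b) := by
  unfold bourgainWeight
  have h0 : Measurable fun ζ : Plane => ζ 0 := by fun_prop
  have h1 : Measurable fun ζ : Plane => ζ 1 := by fun_prop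
  fun_prop

/-- Every square integrable weighted coefficient defines an element of `X^{s,b}`. -/
theorem exists_memBourgain (α β s b : ℝ) (h : L2P) : ∃ U : 𝓢'(Plane, ℂ),
    MemBourgain α β s b U ∧ ∀ φ, U φ = pairing α β s b φ h := by
  obtain ⟨V, hV⟩ := exists_bourgain_distribution α β s b h
  refine ⟨𝓕⁻ V, ⟨fun x => coef (phase α β) s b h (planeEquiv x), ?_, fun g => ?_⟩, fun φ => ?_⟩
  · obtain ⟨C, hC, hcomp⟩ := bourgainWeight_comparable α β s b
    have hL : MemLp (fun ζ : ℝ × ℝ => (bourgainWeight α β s b !₂[ζ.1, ζ.2] : ℂ) *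
        coef (phase α β) s b h ζ) 2 volume := by
      refine MemLp.of_le_mul (c := C) (Lp.memLp h) ?_ (.of_forall fun ζ => ?_)
      · have h1 := measurable_coef (measurable_phase α β) s b (measurable_lp h)
        have h2 := (measurable_bourgainWeight α β s b).comp continuous_planePoint.measurable
        have h3 : Measurable fun ζ : ℝ × ℝ => bourgainWeight α β s b !₂[ζ.1, ζ.2] := h2
        fun_prop
      · have hw := wt_pos (phase α β) s b ζ
        have hb : 0 ≤ bourgainWeight α β s b !₂[ζ.1, ζ.2] := by
          rw [bourgainWeight_planePoint]; positivity
        rw [norm_mul, coef, norm_div, Complex.norm_real, Complex.norm_real,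
          Real.norm_of_nonneg hb, Real.norm_of_nonneg hw.le, mul_div_assoc', div_le_iff₀ hw]
        calc _ ≤ (C * wt (phase α β) s b ζ) * ‖h ζ‖ := by gcongr; exact (hcomp ζ).1
          _ = _ := by ring
    have := hL.comp_measurePreserving measurePreserving_planeEquiv
    refine (memLp_congr_ae (.of_forall fun x => ?_)).mp this
    simp only [Function.comp_apply]
    congr 3
    exact planeEquiv.symm_apply_apply x
  · rw [FourierInvPair.fourier_fourierInv_eq, hV, integral_plane]
    rfl
  · rw [TemperedDistribution.fourierInv_apply, hV, pairing_apply]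
    rfl

/-- Every element of `X^{s,b}` has a square integrable weighted coefficient. -/
theorem MemBourgain.exists_coef {α β s b : ℝ} {U : 𝓢'(Plane, ℂ)} (hU : MemBourgain α β s b U) :
    ∃ h : L2P, ∀ φ, U φ = pairing α β s b φ h := by
  obtain ⟨f, hf, hfU⟩ := hU
  obtain ⟨C, hC, hcomp⟩ := bourgainWeight_comparable α β s b
  have h1 := hf.comp_measurePreserving measurePreserving_planeEquiv_symm
  have hbm := (measurable_bourgainWeight α β s b).comp continuous_planePoint.measurable
  have hbm' : Measurable fun ζ : ℝ × ℝ => bourgainWeight α β s b !₂[ζ.1, ζ.2] := hbm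
  have hwm := measurable_wt (measurable_phase α β) s b
  have hb : ∀ ζ : ℝ × ℝ, 0 < bourgainWeight α β s b !₂[ζ.1, ζ.2] := fun ζ => by
    rw [bourgainWeight_planePoint]; positivity
  have hL : MemLp (fun ζ : ℝ × ℝ => (wt (phase α β) s b ζ : ℂ) * f !₂[ζ.1, ζ.2]) 2 volume := by
    refine MemLp.of_le_mul (c := C) h1 ?_ (.of_forall fun ζ => ?_)
    · have : (fun ζ : ℝ × ℝ => (wt (phase α β) s b ζ : ℂ) * f !₂[ζ.1, ζ.2]) =
          fun ζ => ((wt (phase α β) s b ζ / bourgainWeight α β s b !₂[ζ.1, ζ.2] : ℝ) : ℂ) *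
            (((fun ζ ↦ (bourgainWeight α β s b ζ : ℂ) * f ζ) ∘ planeEquiv.symm) ζ) := by
        ext ζ
        have : (bourgainWeight α β s b !₂[ζ.1, ζ.2] : ℂ) ≠ 0 := by exact_mod_cast (hb ζ).ne'
        simp only [Function.comp_apply, planeEquiv_symm_apply]
        push_cast
        field_simp
      rw [this]
      exact (Measurable.aestronglyMeasurable (by fun_prop)).mul h1.aestronglyMeasurable
    · simp only [Function.comp_apply, planeEquiv_symm_apply]
      rw [norm_mul, norm_mul, Complex.norm_real, Complex.norm_real,
          Real.norm_of_nonneg (hb ζ).le, Real.norm_of_nonneg (wt_pos _ _ _ _).le, ← mul_assoc]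
      gcongr
      exact (hcomp ζ).2
  refine ⟨hL.toLp _, fun φ => ?_⟩
  have h2 : U φ = 𝓕 U (𝓕⁻ φ) := by
    rw [TemperedDistribution.fourier_apply, FourierInvPair.fourier_fourierInv_eq]
  rw [h2, hfU, pairing_apply, integral_plane]
  refine integral_congr_ae ?_
  filter_upwards [MemLp.coeFn_toLp hL] with ζ hζ
  rw [coef, hζ, mul_div_cancel_left₀ _ (by exact_mod_cast wt_ne_zero _ _ _ _)]
  rfl

/-! ### The Sobolev space on the Fourier side -/

/-- The weighted Fourier transform `(1 + η²)^{s/2} f̂`. -/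
def sobolevCoef {s : ℝ} (f : Hs s) : L2L := 𝓕 (Hs.bessel f)

theorem smulLeft_smulLeft_neg (s : ℝ) (V : 𝓢'(ℝ, ℂ)) :
    TemperedDistribution.smulLeftCLM ℂ (fun x : ℝ ↦ (((1 + ‖x‖ ^ 2) ^ (-s / 2) : ℝ) : ℂ))
      (TemperedDistribution.smulLeftCLM ℂ (fun x : ℝ ↦ (((1 + ‖x‖ ^ 2) ^ (s / 2) : ℝ) : ℂ)) V) = V := by
  rw [TemperedDistribution.smulLeftCLM_smulLeftCLM_apply (by fun_prop) (by fun_prop)]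
  have : ((fun x : ℝ ↦ (((1 + ‖x‖ ^ 2) ^ (-s / 2) : ℝ) : ℂ)) *
      fun x : ℝ ↦ (((1 + ‖x‖ ^ 2) ^ (s / 2) : ℝ) : ℂ)) = fun _ => 1 := by
    ext x
    have h : (0 : ℝ) < 1 + ‖x‖ ^ 2 := by positivity
    rw [Pi.mul_apply, ← Complex.ofReal_mul, ← Real.rpow_add h]
    norm_num [neg_div]
  rw [mul_comm, this, TemperedDistribution.smulLeftCLM_const, one_smul]

theorem smulLeft_lp_apply (r : ℝ) (g : L2L) (χ : 𝓢(ℝ, ℂ)) :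
    TemperedDistribution.smulLeftCLM ℂ (fun x : ℝ ↦ (((1 + ‖x‖ ^ 2) ^ (r / 2) : ℝ) : ℂ))
      (g : 𝓢'(ℝ, ℂ)) χ = ∫ η, ((1 + η ^ 2) ^ (r / 2) : ℝ) * g η * χ η := by
  rw [TemperedDistribution.smulLeftCLM_apply_apply, Lp.toTemperedDistribution_apply]
  refine integral_congr_ae (.of_forall fun η => ?_)
  simp only
  rw [SchwartzMap.smulLeftCLM_apply_apply (by fun_prop)]
  simp only [Real.norm_eq_abs, sq_abs, smul_eq_mul]
  ring

theorem Hs.toDistribution_apply {s : ℝ} (f : Hs s) (χ : 𝓢(ℝ, ℂ)) :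
    f.toDistribution χ = ∫ η, ((1 + η ^ 2) ^ (-s / 2) : ℝ) * sobolevCoef f η * (𝓕⁻ χ) η := by
  have h1 := congrArg (fun V : 𝓢'(ℝ, ℂ) => 𝓕 V) (Hs.bessel_spec f)
  simp only [TemperedDistribution.fourier_besselPotential_eq_smulLeftCLM_fourier_apply,
    Lp.fourier_toTemperedDistribution_eq] at h1
  have h2 := smulLeft_smulLeft_neg s (𝓕 f.toDistribution)
  rw [h1] at h2
  have h3 : f.toDistribution χ = 𝓕 f.toDistribution (𝓕⁻ χ) := by
    rw [TemperedDistribution.fourier_apply, FourierInvPair.fourier_fourierInv_eq]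
  rw [h3, ← h2, smulLeft_lp_apply]
  rfl

theorem norm_sobolevCoef {s : ℝ} (f : Hs s) : ‖sobolevCoef f‖ = ‖f‖ := by
  rw [Hs.norm_def, sobolevCoef]
  exact (Lp.fourierTransformₗᵢ ℝ ℂ).norm_map _

theorem sobolevCoef_surjective {s : ℝ} (g : L2L) : ∃ f : Hs s, sobolevCoef f = g := by
  set V : 𝓢'(ℝ, ℂ) := 𝓕⁻ (TemperedDistribution.smulLeftCLM ℂ
    (fun x : ℝ ↦ (((1 + ‖x‖ ^ 2) ^ (-s / 2) : ℝ) : ℂ)) (g : 𝓢'(ℝ, ℂ))) with hV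
  have h1 : TemperedDistribution.smulLeftCLM ℂ
      (fun x : ℝ ↦ (((1 + ‖x‖ ^ 2) ^ (s / 2) : ℝ) : ℂ)) (𝓕 V) = g := by
    have := smulLeft_smulLeft_neg (-s) (g : 𝓢'(ℝ, ℂ))
    rw [neg_neg] at this
    rw [hV, FourierInvPair.fourier_fourierInv_eq, this]
  have hmem : TemperedDistribution.MemSobolev s 2 V :=
    TemperedDistribution.memSobolev_iff_exists_smulLeftCLM_fourier.mpr ⟨g, h1⟩
  let f : Hs s := ⟨V, hmem⟩
  refine ⟨f, ?_⟩
  apply Hs.lp_toTemperedDistribution_injective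
  change ((𝓕 (Hs.bessel f) : L2L) : 𝓢'(ℝ, ℂ)) = g
  rw [← Lp.fourier_toTemperedDistribution_eq, ← Hs.bessel_spec,
    TemperedDistribution.fourier_besselPotential_eq_smulLeftCLM_fourier_apply]
  exact h1

/-- `H^s(ℝ)` is isometric to `L²(ℝ)` by the weighted Fourier transform. -/
def sobolevIso (s : ℝ) : Hs s ≃ₗᵢ[ℂ] L2L :=
  LinearIsometryEquiv.ofSurjective
    { toFun := sobolevCoef
      map_add' := fun f g => by
        unfold sobolevCoef; rw [map_add, FourierAdd.fourier_add]
      map_smul' := fun c f => by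
        unfold sobolevCoef; rw [map_smul, FourierSMul.fourier_smul]; rfl
      norm_map' := norm_sobolevCoef } sobolevCoef_surjective

theorem sobolevIso_apply {s : ℝ} (f : Hs s) : sobolevIso s f = sobolevCoef f := rfl

theorem sobolevIso_symm_toDistribution {s : ℝ} (g : L2L) (χ : 𝓢(ℝ, ℂ)) :
    ((sobolevIso s).symm g).toDistribution χ =
      ∫ η, ((1 + η ^ 2) ^ (-s / 2) : ℝ) * g η * (𝓕⁻ χ) η := by
  rw [Hs.toDistribution_apply, ← sobolevIso_apply, LinearIsometryEquiv.apply_symm_apply]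

/-! ### Modulated bump functions -/

theorem contDiff_e2 : ContDiff ℝ ((⊤ : ℕ∞) : WithTop ℕ∞) e2 := by
  unfold e2
  have : ContDiff ℝ ((⊤ : ℕ∞) : WithTop ℕ∞) fun x : ℝ => (x : ℂ) := Complex.ofRealCLM.contDiff
  fun_prop

theorem timeBump_eq_zero {t : ℝ} (ht : 2 ≤ |t|) : timeBump t = 0 :=
  ContDiffBump.zero_of_le_dist _ (by simpa [timeBump] using ht)

theorem hasCompactSupport_modBump {ε : ℝ} (hε : 0 < ε) (a c : ℝ) :
    HasCompactSupport fun x => e2 (-(a * x)) * (timeBump (ε * (x - c)) : ℂ) := by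
  refine HasCompactSupport.intro (isCompact_closedBall c (2 / ε)) fun x hx => ?_
  rw [Metric.mem_closedBall, Real.dist_eq, not_le, div_lt_iff₀' hε] at hx
  rw [timeBump_eq_zero, Complex.ofReal_zero, mul_zero]
  rw [abs_mul, abs_of_pos hε]
  exact hx.le

theorem contDiff_modBump (ε a c : ℝ) : ContDiff ℝ ((⊤ : ℕ∞) : WithTop ℕ∞)
    fun x => e2 (-(a * x)) * (timeBump (ε * (x - c)) : ℂ) := by
  have h1 : ContDiff ℝ ((⊤ : ℕ∞) : WithTop ℕ∞) fun x => e2 (-(a * x)) :=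
    contDiff_e2.comp (by fun_prop)
  have h2 : ContDiff ℝ ((⊤ : ℕ∞) : WithTop ℕ∞) fun x => (timeBump (ε * (x - c)) : ℂ) :=
    contDiff_timeBump.comp (g := fun x => (timeBump x : ℂ)) (f := fun x => ε * (x - c))
      (by fun_prop)
  exact h1.mul h2

/-- The bump function of width `ε⁻¹` centred at `c` and modulated with frequency `-a`. -/
def modBump {ε : ℝ} (hε : 0 < ε) (a c : ℝ) : 𝓢(ℝ, ℂ) :=
  (hasCompactSupport_modBump hε a c).toSchwartzMap (contDiff_modBump ε a c)

theorem modBump_apply {ε : ℝ} (hε : 0 < ε) (a c x : ℝ) :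
    modBump hε a c x = e2 (-(a * x)) * (timeBump (ε * (x - c)) : ℂ) := rfl

/-- The inverse Fourier transform of the cutoff. -/
def cutoffInv : 𝓢(ℝ, ℂ) := 𝓕⁻ cutoff

theorem cutoffInv_apply (η : ℝ) : cutoffInv η = ∫ x, e2 (η * x) * timeBump x := by
  rw [cutoffInv, SchwartzMap.fourierInv_coe, fourierInv_eq_e2]
  rfl

theorem cutoffInv_zero_ne_zero : cutoffInv 0 ≠ 0 := by
  rw [cutoffInv_apply]
  simp only [zero_mul, e2_zero, one_mul]
  rw [integral_complex_ofReal]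
  have := timeBump.integral_pos (μ := volume)
  exact_mod_cast this.ne'

theorem fourierInv_modBump {ε : ℝ} (hε : 0 < ε) (a c η : ℝ) :
    (𝓕⁻ (modBump hε a c)) η = e2 (c * (η - a)) * (ε⁻¹ : ℝ) * cutoffInv ((η - a) / ε) := by
  rw [SchwartzMap.fourierInv_coe, fourierInv_eq_e2, cutoffInv_apply]
  simp only [modBump_apply]
  rw [← integral_add_right_eq_self _ c]
  have : ∀ x, e2 (η * (x + c)) * (e2 (-(a * (x + c))) * (timeBump (ε * (x + c - c)) : ℂ)) =
      e2 (c * (η - a)) * (fun y => e2 ((η - a) / ε * y) * (timeBump y : ℂ)) (ε * x) := fun x => by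
    simp only [add_sub_cancel_right]
    rw [← mul_assoc, ← mul_assoc, ← e2_add, ← e2_add]
    congr 2
    field_simp; ring
  simp_rw [this]
  rw [integral_const_mul, Measure.integral_comp_mul_left
    (fun y => e2 ((η - a) / ε * y) * (timeBump y : ℂ)) ε, abs_of_pos (inv_pos.mpr hε),
    Complex.real_smul, mul_assoc]

theorem integral_cutoffInv : ∫ y, cutoffInv y = 1 := by
  have h : 𝓕 (cutoffInv : ℝ → ℂ) 0 = ∫ y, cutoffInv y := by
    rw [Real.fourier_eq]; simp
  rw [← h, ← SchwartzMap.fourier_coe, cutoffInv, FourierInvPair.fourier_fourierInv_eq,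
    cutoff_eq_one (by simp)]

/-- A function of polynomial growth whose Fourier transform vanishes on all test functions is
zero. -/
theorem ae_eq_zero_of_integral_mul_fourierInv_eq_zero {F : ℝ → ℂ} (hF : Measurable F) {m : ℕ}
    (hFi : Integrable fun η => F η * (((1 + |η|) ^ m)⁻¹ : ℝ))
    (h : ∀ χ : 𝓢(ℝ, ℂ), HasCompactSupport χ → ∫ η, F η * (𝓕⁻ χ) η = 0) : ∀ᵐ η, F η = 0 := by
  have bpos := bracket_pos
  have hloc : LocallyIntegrable F := by
    rw [locallyIntegrable_iff]
    intro K hK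
    have h1 := (hFi.integrableOn (s := K)).mul_continuousOn (g' := fun η => (((1 + |η|) ^ m : ℝ) : ℂ))
      (by fun_prop) hK
    refine h1.congr_fun (fun η _ => ?_) hK.measurableSet
    have : (((1 + |η|) ^ m : ℝ) : ℂ) ≠ 0 := by
      have := bpos η
      exact_mod_cast (by positivity : (1 + |η|) ^ m ≠ 0)
    simp only
    rw [mul_assoc, ← Complex.ofReal_mul, inv_mul_cancel₀ (by exact_mod_cast this)]
    simp
  refine ae_eq_zero_of_integral_contDiff_smul_eq_zero hloc fun g hg hgc => ?_
  obtain ⟨Cg, hCg⟩ : ∃ C, ∀ x, ‖(1 + |x|) ^ m * g x‖ ≤ C :=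
    (hgc.mul_left).exists_bound_of_continuous (by have := hg.continuous; fun_prop)
  have hCg0 : 0 ≤ Cg := (norm_nonneg _).trans (hCg 0)
  have hgb : ∀ x, |g x| ≤ Cg * ((1 + |x|) ^ m)⁻¹ := fun x => by
    have := bpos x
    have h1 := hCg x
    rw [norm_mul, Real.norm_of_nonneg (by positivity), Real.norm_eq_abs] at h1
    rw [← div_eq_mul_inv, le_div_iff₀ (by positivity), mul_comm]
    exact h1
  have hpeetre : ∀ x y : ℝ, ((1 + |x - y|) ^ m)⁻¹ ≤ ((1 + |x|) ^ m)⁻¹ * (1 + |y|) ^ m := fun x y => by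
    have h1 := bpos x; have h2 := bpos (x - y)
    rw [inv_mul_eq_div, inv_eq_one_div, div_le_div_iff₀ (by positivity) (by positivity), one_mul,
      ← mul_pow]
    have := bracket_le_add (x - y) y
    rw [sub_add_cancel] at this
    gcongr
  -- Decay of order m + 2 leaves an integrable function after multiplication by the growth factor of
  -- order m.
  obtain ⟨Cρ, hCρ, hρ⟩ := cutoffInv.exists_norm_le_bracket (m + 2)
  have hρm : Integrable fun y => ‖cutoffInv y‖ * (1 + |y|) ^ m := by
    have hJ := integrable_one_add_norm (E := ℝ) (μ := volume) (r := 2) (by norm_num)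
    refine (hJ.const_mul Cρ).mono' (by have := cutoffInv.continuous; fun_prop)
      (.of_forall fun y => ?_)
    have := bpos y
    rw [Real.norm_of_nonneg (by positivity), Real.norm_eq_abs, Real.rpow_neg (by positivity)]
    calc _ ≤ (Cρ * ((1 + |y|) ^ (m + 2))⁻¹) * (1 + |y|) ^ m := by gcongr; exact hρ y
      _ = _ := by
          rw [pow_add, mul_inv]
          norm_cast
          field_simp
  have hgm := hg.continuous
  have hρc := cutoffInv.continuous
  -- Mollification of `g` by dilates of `cutoffInv`, an approximate identity because `cutoffInv` has
  -- integral `cutoff 0 = 1`.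
  set G : ℕ → ℝ → ℂ := fun n η => ∫ y, cutoffInv y * g (η - y / (n + 1)) with hG
  have hzero : ∀ n, ∫ η, F η * G n η = 0 := by
    intro n
    have hn : (0 : ℝ) < n + 1 := by positivity
    have hε : (0 : ℝ) < ((n : ℝ) + 1)⁻¹ := by positivity
    -- Transforms of compactly supported functions cannot themselves be compactly supported. Dilates
    -- of `cutoffInv` centred at arbitrary points `a` are available, however, as transforms of wide
    -- modulated bumps, and averaging over `a` with weight `g a` produces `G n`.
    have h0 : ∀ a, ∫ η, F η * cutoffInv ((n + 1) * (η - a)) = 0 := fun a => by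
      have := h (modBump hε a 0) (hasCompactSupport_modBump hε a 0)
      simp only [fourierInv_modBump, zero_mul, e2_zero, one_mul, inv_inv, div_inv_eq_mul] at this
      have e : ∀ η, F η * (((n : ℝ) + 1 : ℝ) * cutoffInv ((η - a) * ((n : ℝ) + 1))) =
          ((n : ℝ) + 1 : ℝ) * (F η * cutoffInv ((n + 1) * (η - a))) := fun η => by
        rw [mul_comm (η - a)]; ring
      simp_rw [e] at this
      rw [integral_const_mul, mul_eq_zero] at this
      exact this.resolve_left (by exact_mod_cast hn.ne')
    have hGn : ∀ η, G n η = ((n : ℝ) + 1 : ℝ) * ∫ a, g a * cutoffInv ((n + 1) * (η - a)) := by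
      intro η
      rw [← integral_sub_left_eq_self (fun a => (g a : ℂ) * cutoffInv ((n + 1) * (η - a))) _ η]
      simp only [sub_sub_cancel]
      have : ∀ x : ℝ, (g (η - x) : ℂ) * cutoffInv ((n + 1) * x) =
          (fun y => cutoffInv y * (g (η - y / (n + 1)) : ℂ)) ((n + 1) * x) := fun x => by
        simp only
        rw [mul_div_cancel_left₀ _ hn.ne', mul_comm]
      simp_rw [this]
      rw [Measure.integral_comp_mul_left (fun y => cutoffInv y * (g (η - y / (n + 1)) : ℂ)),
        abs_of_pos (inv_pos.mpr hn), Complex.real_smul, ← mul_assoc, ← Complex.ofReal_mul,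
        mul_inv_cancel₀ hn.ne']
      simp [hG]
    have hint : Integrable (Function.uncurry fun η a =>
        F η * ((g a : ℂ) * cutoffInv ((n + 1) * (η - a)))) (volume.prod volume) := by
      have hgi : Integrable fun a => |g a| * (1 + |a|) ^ m :=
        Continuous.integrable_of_hasCompactSupport (by fun_prop) (hgc.norm.mul_right)
      refine ((hFi.norm.mul_prod hgi).const_mul Cρ).mono' ?_ (.of_forall fun z => ?_)
      · unfold Function.uncurry
        refine Measurable.aestronglyMeasurable ?_
        have := hρc.measurable
        have := hgm.measurable
        fun_prop
      · simp only [Function.uncurry]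
        rw [norm_mul, norm_mul, norm_mul, Complex.norm_real, Complex.norm_real, Real.norm_eq_abs]
        have b1 := bpos z.1; have b2 := bpos z.2; have b3 := bpos (z.1 - z.2)
        have b4 := bpos ((n + 1) * (z.1 - z.2))
        have hk : ‖cutoffInv ((n + 1) * (z.1 - z.2))‖ ≤ Cρ * (((1 + |z.1|) ^ m)⁻¹ * (1 + |z.2|) ^ m) := by
          refine (hρ _).trans ?_
          gcongr
          refine le_trans ?_ (hpeetre z.1 z.2)
          gcongr 1
          have c1 : 1 + |z.1 - z.2| ≤ 1 + |(n + 1) * (z.1 - z.2)| := by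
            rw [abs_mul, abs_of_pos hn]
            have : (0 : ℝ) ≤ n := by positivity
            nlinarith [abs_nonneg (z.1 - z.2)]
          calc _ ≤ (1 + |(n + 1) * (z.1 - z.2)|) ^ m := by gcongr
            _ ≤ _ := pow_le_pow_right₀ (one_le_bracket _) (by omega)
        rw [Real.norm_of_nonneg (by positivity : 0 ≤ ((1 + |z.1|) ^ m)⁻¹)]
        calc _ ≤ ‖F z.1‖ * (|g z.2| * (Cρ * (((1 + |z.1|) ^ m)⁻¹ * (1 + |z.2|) ^ m))) := by gcongr
          _ = _ := by ring
    calc _ = ∫ η, ((n : ℝ) + 1 : ℝ) * ∫ a, F η * (g a * cutoffInv ((n + 1) * (η - a))) := by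
          refine integral_congr_ae (.of_forall fun η => ?_)
          simp only
          rw [hGn, integral_const_mul]; ring
      _ = ((n : ℝ) + 1 : ℝ) * ∫ a, ∫ η, F η * (g a * cutoffInv ((n + 1) * (η - a))) := by
          rw [integral_const_mul, integral_integral_swap hint]
      _ = 0 := by
          have : ∀ a, ∫ η, F η * (g a * cutoffInv ((n + 1) * (η - a))) = 0 := fun a => by
            have e : ∀ η, F η * (g a * cutoffInv ((n + 1) * (η - a))) =
              g a * (F η * cutoffInv ((n + 1) * (η - a))) := fun η => by ring
            simp_rw [e]
            rw [integral_const_mul, h0, mul_zero]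
          simp_rw [this]
          simp
  have hyb : ∀ (n : ℕ) (η y : ℝ), ‖cutoffInv y * (g (η - y / (n + 1)) : ℂ)‖ ≤
      Cg * ((1 + |η|) ^ m)⁻¹ * (‖cutoffInv y‖ * (1 + |y|) ^ m) := fun n η y => by
    rw [norm_mul, Complex.norm_real, Real.norm_eq_abs]
    have b1 := bpos η; have b2 := bpos y
    have c1 : 1 + |y / (n + 1)| ≤ 1 + |y| := by
      rw [abs_div, abs_of_pos (by positivity : (0 : ℝ) < n + 1)]
      gcongr
      exact div_le_self (abs_nonneg _) (by simp)
    have c2 : |g (η - y / (n + 1))| ≤ Cg * (((1 + |η|) ^ m)⁻¹ * (1 + |y|) ^ m) := by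
      refine (hgb _).trans ?_
      gcongr
      refine (hpeetre _ _).trans ?_
      gcongr
    calc _ ≤ ‖cutoffInv y‖ * (Cg * (((1 + |η|) ^ m)⁻¹ * (1 + |y|) ^ m)) := by gcongr
      _ = _ := by ring
  have hGm : ∀ n, AEStronglyMeasurable (G n) volume := fun n => by
    have : StronglyMeasurable (Function.uncurry fun (η y : ℝ) => cutoffInv y * (g (η - y / (n + 1)) : ℂ)) := by
      refine Continuous.stronglyMeasurable ?_
      unfold Function.uncurry
      fun_prop
    exact (this.integral_prod_right).aestronglyMeasurable
  have hGb : ∀ n η, ‖G n η‖ ≤ Cg * ((1 + |η|) ^ m)⁻¹ * ∫ y, ‖cutoffInv y‖ * (1 + |y|) ^ m := fun n η => by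
    rw [← integral_const_mul]
    exact norm_integral_le_of_norm_le (hρm.const_mul _) (.of_forall (hyb n η))
  have hGlim : ∀ η, Filter.Tendsto (fun n => G n η) Filter.atTop (nhds (g η)) := fun η => by
    have : (g η : ℂ) = ∫ y, cutoffInv y * g η := by
      rw [integral_mul_const, integral_cutoffInv, one_mul]
    rw [this]
    refine tendsto_integral_of_dominated_convergence
      (fun y => Cg * ((1 + |η|) ^ m)⁻¹ * (‖cutoffInv y‖ * (1 + |y|) ^ m))
      (fun n => Continuous.aestronglyMeasurable (by fun_prop)) (hρm.const_mul _)
      (fun n => .of_forall (hyb n η)) (.of_forall fun y => ?_)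
    have t1 : Filter.Tendsto (fun n : ℕ => η - y / ((n : ℝ) + 1)) Filter.atTop (nhds η) := by
      have := tendsto_one_div_add_atTop_nhds_zero_nat (𝕜 := ℝ)
      have h2 := (this.const_mul y).const_sub η
      simpa [div_eq_mul_inv] using h2
    have t2 := (hgm.tendsto η).comp t1
    exact ((Complex.continuous_ofReal.tendsto _).comp t2).const_mul _
  have hlim : Filter.Tendsto (fun n => ∫ η, F η * G n η) Filter.atTop (nhds (∫ η, F η * g η)) := by
    refine tendsto_integral_of_dominated_convergence
      (fun η => ‖F η * (((1 + |η|) ^ m)⁻¹ : ℝ)‖ * (Cg * ∫ y, ‖cutoffInv y‖ * (1 + |y|) ^ m))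
      (fun n => hF.aestronglyMeasurable.mul (hGm n)) (hFi.norm.mul_const _)
      (fun n => .of_forall fun η => ?_) (.of_forall fun η => (hGlim η).const_mul _)
    have := bpos η
    rw [norm_mul, norm_mul, Complex.norm_real,
      Real.norm_of_nonneg (by positivity : 0 ≤ ((1 + |η|) ^ m)⁻¹)]
    calc _ ≤ ‖F η‖ * (Cg * ((1 + |η|) ^ m)⁻¹ * ∫ y, ‖cutoffInv y‖ * (1 + |y|) ^ m) := by
          gcongr; exact hGb n η
      _ = _ := by ring
  simp_rw [hzero] at hlim
  have h0 := tendsto_nhds_unique hlim tendsto_const_nhds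
  rw [← h0]
  refine integral_congr_ae (.of_forall fun η => ?_)
  simp only [Complex.real_smul]
  ring

/-! ### The integral equation and its contraction property. -/

/-! ### The operators of the integral equation -/

/-- For fixed ζ the third argument runs over a translate of the second one, so null sets pull back
to null sets. Hence `cubicInt` depends only on the almost everywhere class of its argument, at every
single ζ. -/
theorem ae_replace_third {P : ℝ × ℝ → Prop} (h : ∀ᵐ z : ℝ × ℝ, P z) (ζ : ℝ × ℝ) :
    ∀ᵐ q : (ℝ × ℝ) × (ℝ × ℝ), P (ζ - q.1 + q.2) := by
  have h1 : ∀ x : ℝ × ℝ, ∀ᵐ y : ℝ × ℝ, P (ζ - x + y) := fun x =>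
    (measurePreserving_add_left (volume : Measure (ℝ × ℝ)) (ζ - x)).quasiMeasurePreserving.ae h
  obtain ⟨s, hs, hsm, hs0⟩ := exists_measurable_superset_of_null (ae_iff.mp h)
  have h2 : ∀ᵐ q : (ℝ × ℝ) × (ℝ × ℝ), ζ - q.1 + q.2 ∉ s := by
    rw [Measure.volume_eq_prod, Measure.ae_prod_iff_ae_ae]
    · refine .of_forall fun x => ?_
      have := (measurePreserving_add_left (volume : Measure (ℝ × ℝ))
        (ζ - x)).quasiMeasurePreserving.ae (measure_eq_zero_iff_ae_notMem.mp hs0)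
      exact this
    · exact (hsm.preimage (by fun_prop : Measurable fun q : (ℝ × ℝ) × (ℝ × ℝ) => ζ - q.1 + q.2)).compl
  filter_upwards [h2] with q hq
  by_contra hc
  exact hq (hs hc)

theorem ae_cubicIntegrand_congr {f g : ℝ × ℝ → ℂ} (h : f =ᵐ[volume] g) (ζ : ℝ × ℝ) :
    cubicIntegrand f f f ζ =ᵐ[volume] cubicIntegrand g g g ζ := by
  have h1 : ∀ᵐ q : (ℝ × ℝ) × (ℝ × ℝ), f q.1 = g q.1 :=
    Measure.quasiMeasurePreserving_fst.ae h
  have h2 : ∀ᵐ q : (ℝ × ℝ) × (ℝ × ℝ), f q.2 = g q.2 :=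
    Measure.quasiMeasurePreserving_snd.ae h
  filter_upwards [h1, h2, ae_replace_third h ζ] with q a b c
  simp only [cubicIntegrand, a, b, c]

theorem cubicInt_congr {f g : ℝ × ℝ → ℂ} (h : f =ᵐ[volume] g) (ζ : ℝ × ℝ) :
    cubicInt f ζ = cubicInt g ζ :=
  integral_congr_ae (ae_cubicIntegrand_congr h ζ)

/-- The linear and trilinear operators acting on weighted Fourier coefficients: traces at fixed
times, the cut-off free evolution, the cut-off Duhamel integral and the cubic nonlinearity. -/
structure FlowOps (α β s b b' : ℝ) where
  ev : ℝ → L2P →L[ℂ] L2L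
  evBound : ℝ
  norm_ev_le : ∀ t h, ‖ev t h‖ ≤ evBound * ‖h‖
  continuous_ev : ∀ h, Continuous fun t => ev t h
  integrable_ev : ∀ t (h : L2P), ∀ᵐ η, Integrable fun τ =>
    (mdl (phase α β) (-b) (η, τ) : ℂ) * e2 (t * τ) * h (η, τ)
  ev_ae : ∀ t (h : L2P), ev t h =ᵐ[volume]
    fun η => ∫ τ, (mdl (phase α β) (-b) (η, τ) : ℂ) * e2 (t * τ) * h (η, τ)
  free : L2L →L[ℂ] L2P
  free_ae : ∀ g : L2L, free g =ᵐ[volume]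
    fun ζ => (mdl (phase α β) b ζ : ℂ) * cutoffHat (ζ.2 - phase α β ζ.1) * g ζ.1
  duh : ℝ → L2P →L[ℂ] L2P
  duhBound : ℝ
  duhBound_nonneg : 0 ≤ duhBound
  norm_duh_le : ∀ T, 0 < T → T ≤ 1 → ∀ h, ‖duh T h‖ ≤ duhBound * T ^ (1 - b + b') * ‖h‖
  integrable_duh : ∀ T, 0 < T → T ≤ 1 → ∀ h : L2P, ∀ w : ℝ × ℝ → ℂ, MemLp w 2 volume →
    Integrable (fun q : (ℝ × ℝ) × ℝ => w q.1 * (((mdl (phase α β) b q.1 : ℂ) *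
      duhK cutoffHat T (q.1.2 - phase α β q.1.1) (q.2 - phase α β q.1.1) *
        (mdl (phase α β) (-b') (q.1.1, q.2) : ℂ)) * h (q.1.1, q.2)))
  duh_ae : ∀ T, 0 < T → T ≤ 1 → ∀ h : L2P, duh T h =ᵐ[volume] fun ζ => ∫ τ',
    ((mdl (phase α β) b ζ : ℂ) * duhK cutoffHat T (ζ.2 - phase α β ζ.1) (τ' - phase α β ζ.1) *
        (mdl (phase α β) (-b') (ζ.1, τ') : ℂ)) * h (ζ.1, τ')
  cubic : L2P → L2P
  cubicBound : ℝ
  cubicBound_nonneg : 0 ≤ cubicBound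
  norm_cubic_sub_le : ∀ h g, ‖cubic h - cubic g‖ ≤ cubicBound * (‖h‖ ^ 2 + ‖g‖ ^ 2) * ‖h - g‖
  integrable_cubic : ∀ h : L2P, ∀ᵐ ζ, Integrable (cubicIntegrand (coef (phase α β) s b h)
    (coef (phase α β) s b h) (coef (phase α β) s b h) ζ)
  cubic_ae : ∀ h : L2P, cubic h =ᵐ[volume]
    fun ζ => (wt (phase α β) s b' ζ : ℂ) * cubicInt (coef (phase α β) s b h) ζ

theorem nonempty_flowOps (α : ℝ) {β : ℝ} (hβ : β ≠ 0) {s b b' : ℝ} (hs : -(1 / 4) < s)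
    (hb : 7 / 12 < b) (hb1 : b < 11 / 12) (hb' : b' ≤ -(1 / 12)) (hbb' : b - 1 ≤ b') :
    Nonempty (FlowOps α β s b b') := by
  have hp := measurable_phase α β
  obtain ⟨ev, ⟨C, -, h1⟩, h2, h3, h4⟩ := exists_traceOp hp (b := b) (by linarith)
  obtain ⟨W, h5⟩ := exists_freeOp hp cutoffHat b
  obtain ⟨D, hD, H⟩ := exists_duhOp hp cutoffHat (b := b) (b' := b') (by linarith) (by linarith)
    (by linarith) (by linarith) hbb'
  obtain ⟨N, ⟨E, hE, h6⟩, h7, h8⟩ := exists_cubicOp α hβ hs hb hb'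
  -- The Duhamel operator is extended by 0 to times outside (0, 1], so that it is a function of T
  -- alone.
  have H' : ∀ T : ℝ, ∃ L : L2P →L[ℂ] L2P, ∀ hT : 0 < T, ∀ hT1 : T ≤ 1,
      L = (H T hT hT1).choose := fun T => by
    by_cases hT : 0 < T
    · by_cases hT1 : T ≤ 1
      · exact ⟨(H T hT hT1).choose, fun _ _ => rfl⟩
      · exact ⟨0, fun _ h => absurd h hT1⟩
    · exact ⟨0, fun h => absurd h hT⟩
  choose L hL using H'
  exact ⟨⟨ev, C, h1, h2, h3, h4, W, h5, L, D, hD.le,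
    fun T hT hT1 => by rw [hL T hT hT1]; exact (H T hT hT1).choose_spec.1,
    fun T hT hT1 h => ((H T hT hT1).choose_spec.2 h).1,
    fun T hT hT1 h => by rw [hL T hT hT1]; exact ((H T hT hT1).choose_spec.2 h).2,
    N, E, hE.le, h6, h7, h8⟩⟩

namespace FlowOps

variable {α β s b b' : ℝ} (F : FlowOps α β s b b')

theorem cubic_zero : F.cubic 0 = 0 := by
  refine Lp.ext ?_
  filter_upwards [F.cubic_ae 0, Lp.coeFn_zero ℂ 2 (volume : Measure (ℝ × ℝ))] with ζ h1 h2
  have e : coef (phase α β) s b (0 : L2P) =ᵐ[volume] fun _ => 0 := by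
    filter_upwards [Lp.coeFn_zero ℂ 2 (volume : Measure (ℝ × ℝ))] with z hz
    rw [coef, hz, Pi.zero_apply, zero_div]
  rw [h1, cubicInt_congr e, h2]
  simp [cubicInt, cubicIntegrand]

theorem continuous_cubic : Continuous F.cubic := by
  rw [continuous_iff_continuousAt]
  intro h
  rw [ContinuousAt, tendsto_iff_norm_sub_tendsto_zero]
  have hc : Filter.Tendsto (fun g : L2P => F.cubicBound * (‖g‖ ^ 2 + ‖h‖ ^ 2) * ‖g - h‖) (nhds h)
      (nhds 0) := by
    have : Continuous fun g : L2P => F.cubicBound * (‖g‖ ^ 2 + ‖h‖ ^ 2) * ‖g - h‖ := by fun_prop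
    simpa using this.tendsto h
  exact squeeze_zero (fun _ => norm_nonneg _) (fun g => F.norm_cubic_sub_le g h) hc

/-- The right side of the integral equation localized to times of size `T`. -/
def picard (γ : ℂ) (T : ℝ) (g : L2L) (h : L2P) : L2P :=
  F.free g - (Complex.I * γ) • F.duh T (F.cubic h)

theorem norm_picard_sub_le (γ : ℂ) {T r : ℝ} (hT : 0 < T) (hT1 : T ≤ 1) (g : L2L) {h k : L2P}
    (hh : ‖h‖ ≤ r) (hk : ‖k‖ ≤ r) : ‖F.picard γ T g h - F.picard γ T g k‖ ≤
      ‖γ‖ * F.duhBound * F.cubicBound * (2 * r ^ 2) * T ^ (1 - b + b') * ‖h - k‖ := by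
  have e : F.picard γ T g h - F.picard γ T g k =
      -((Complex.I * γ) • F.duh T (F.cubic h - F.cubic k)) := by
    rw [picard, picard, map_sub, smul_sub]; abel
  rw [e, norm_neg, norm_smul, norm_mul, Complex.norm_I, one_mul]
  have h1 := F.norm_duh_le T hT hT1 (F.cubic h - F.cubic k)
  have h2 := F.norm_cubic_sub_le h k
  have h0 := F.duhBound_nonneg
  have h0' := F.cubicBound_nonneg
  calc _ ≤ ‖γ‖ * (F.duhBound * T ^ (1 - b + b') *
        (F.cubicBound * (r ^ 2 + r ^ 2) * ‖h - k‖)) := by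
        gcongr
        refine h1.trans ?_
        gcongr
        refine h2.trans ?_
        gcongr
    _ = _ := by ring

/-- The power of T has positive exponent and beats any constant. The time depends on the radius but
not on `g`, because differences of `picard` do not involve the data; existence on an interval
determined by R follows from this. -/
theorem exists_time (hbb' : b - 1 < b') (γ : ℂ) (r : ℝ) : ∃ T₀ : ℝ, 0 < T₀ ∧ T₀ ≤ 1 ∧
    ∀ T, 0 < T → T ≤ T₀ → ∀ g : L2L, ∀ h k : L2P, ‖h‖ ≤ r → ‖k‖ ≤ r →
      ‖F.picard γ T g h - F.picard γ T g k‖ ≤ 1 / 2 * ‖h - k‖ := by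
  set A := ‖γ‖ * F.duhBound * F.cubicBound * (2 * r ^ 2) with hA
  have h0 := F.duhBound_nonneg
  have h0' := F.cubicBound_nonneg
  have hA0 : 0 ≤ A := by positivity
  have he : 0 < 1 - b + b' := by linarith
  have hlim : Filter.Tendsto (fun T : ℝ => A * T ^ (1 - b + b')) (nhds 0) (nhds 0) := by
    have : Continuous fun T : ℝ => A * T ^ (1 - b + b') :=
      continuous_const.mul (Real.continuous_rpow_const he.le)
    simpa [Real.zero_rpow he.ne'] using this.tendsto 0
  have := (hlim.eventually (gt_mem_nhds (by norm_num : (0 : ℝ) < 1 / 2)))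
  obtain ⟨ε, hε, h⟩ := Metric.eventually_nhds_iff.mp this
  refine ⟨min (ε / 2) 1, by positivity, min_le_right _ _, fun T hT hTle g x y hx hy => ?_⟩
  have hT1 : T ≤ 1 := hTle.trans (min_le_right _ _)
  have hTε : T < ε := by linarith [hTle.trans (min_le_left _ _)]
  refine (F.norm_picard_sub_le γ hT hT1 g hx hy).trans ?_
  gcongr
  exact (h (by rw [Real.dist_eq, sub_zero, abs_of_pos hT]; exact hTε)).le

end FlowOps

/-- Picard iteration in a ball, with convergence of the iterates. -/
theorem exists_fixedPoint_closedBall {E : Type*} [NormedAddCommGroup E] [CompleteSpace E]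
    {Φ : E → E} {r : ℝ} (h0 : ‖Φ 0‖ ≤ r / 2)
    (hΦ : ∀ x y, ‖x‖ ≤ r → ‖y‖ ≤ r → ‖Φ x - Φ y‖ ≤ 1 / 2 * ‖x - y‖) {x : E} (hx : ‖x‖ ≤ r) :
    ∃ y, ‖y‖ ≤ r ∧ Φ y = y ∧ Filter.Tendsto (fun n => Φ^[n] x) Filter.atTop (nhds y) := by
  have hr : 0 ≤ r := (norm_nonneg x).trans hx
  have hmaps : Set.MapsTo Φ (Metric.closedBall 0 r) (Metric.closedBall 0 r) := fun z hz => by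
    rw [mem_closedBall_zero_iff] at hz ⊢
    have h1 := hΦ z 0 hz (by simpa using hr)
    rw [sub_zero] at h1
    calc ‖Φ z‖ = ‖Φ z - Φ 0 + Φ 0‖ := by rw [sub_add_cancel]
      _ ≤ ‖Φ z - Φ 0‖ + ‖Φ 0‖ := norm_add_le _ _
      _ ≤ r := by linarith
  have hc : ContractingWith (1 / 2) (hmaps.restrict Φ _ _) := by
    refine ⟨by norm_num, LipschitzWith.of_dist_le_mul fun u v => ?_⟩
    have := hΦ u v (mem_closedBall_zero_iff.mp u.2) (mem_closedBall_zero_iff.mp v.2)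
    rw [Subtype.dist_eq, Subtype.dist_eq, dist_eq_norm, dist_eq_norm]
    simpa using this
  obtain ⟨y, hy, hfix, hlim, -⟩ := hc.exists_fixedPoint' Metric.isClosed_closedBall.isComplete
    hmaps (mem_closedBall_zero_iff.mpr hx) (edist_ne_top _ _)
  exact ⟨y, mem_closedBall_zero_iff.mp hy, hfix, hlim⟩

/-! ### Elements of the Bourgain space as functions on space-time. -/

/-! ### Fourier integrals on the plane and a Gaussian weight -/

/-- The scalar product of `ℝ²`. -/
def dot (q ζ : ℝ × ℝ) : ℝ := q.1 * ζ.1 + q.2 * ζ.2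

@[fun_prop]
theorem continuous_dot : Continuous fun z : (ℝ × ℝ) × (ℝ × ℝ) => dot z.1 z.2 := by
  unfold dot; fun_prop

theorem dot_comm (q ζ : ℝ × ℝ) : dot q ζ = dot ζ q := by unfold dot; ring

theorem dot_add (q x y : ℝ × ℝ) : dot q (x + y) = dot q x + dot q y := by
  simp [dot]; ring

theorem dot_sub (q x y : ℝ × ℝ) : dot q (x - y) = dot q x - dot q y := by
  simp [dot]; ring

/-- The inverse Fourier integral. -/
def osc (f : ℝ × ℝ → ℂ) (q : ℝ × ℝ) : ℂ := ∫ ζ, e2 (dot q ζ) * f ζ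

theorem norm_osc_le (f : ℝ × ℝ → ℂ) (q : ℝ × ℝ) : ‖osc f q‖ ≤ ∫ ζ, ‖f ζ‖ := by
  refine (norm_integral_le_integral_norm _).trans_eq ?_
  simp [norm_e2]

theorem integrable_e2_dot_mul {f : ℝ × ℝ → ℂ} (hf : Integrable f) (q : ℝ × ℝ) :
    Integrable fun ζ => e2 (dot q ζ) * f ζ := by
  refine hf.bdd_mul (c := 1) (Continuous.aestronglyMeasurable ?_) (.of_forall fun ζ => (norm_e2 _).le)
  unfold dot; fun_prop

theorem continuous_osc {f : ℝ × ℝ → ℂ} (hf : Integrable f) : Continuous (osc f) := by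
  refine continuous_of_dominated (bound := fun ζ => ‖f ζ‖)
    (fun q => (integrable_e2_dot_mul hf q).aestronglyMeasurable)
    (fun q => .of_forall fun ζ => by rw [norm_mul, norm_e2, one_mul]) hf.norm
    (.of_forall fun ζ => ?_)
  unfold dot; fun_prop

theorem osc_sub {f g : ℝ × ℝ → ℂ} (hf : Integrable f) (hg : Integrable g) (q : ℝ × ℝ) :
    osc (fun z => f z - g z) q = osc f q - osc g q := by
  unfold osc
  rw [← integral_sub (integrable_e2_dot_mul hf q) (integrable_e2_dot_mul hg q)]
  simp_rw [mul_sub]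

theorem osc_congr {f g : ℝ × ℝ → ℂ} (h : f =ᵐ[volume] g) (q : ℝ × ℝ) : osc f q = osc g q := by
  refine integral_congr_ae ?_
  filter_upwards [h] with z hz
  rw [hz]

theorem integral_osc_mul {f g : ℝ × ℝ → ℂ} (hf : Integrable f) (hg : Integrable g) :
    ∫ q, osc f q * g q = ∫ ζ, f ζ * osc g ζ := by
  have hi : Integrable (Function.uncurry fun q ζ : ℝ × ℝ => e2 (dot q ζ) * f ζ * g q)
      (volume.prod volume) := by
    have := (hg.mul_prod hf)
    have h2 : AEStronglyMeasurable (fun z : (ℝ × ℝ) × (ℝ × ℝ) => e2 (dot z.1 z.2))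
        (volume.prod volume) := Continuous.aestronglyMeasurable (by fun_prop)
    refine (this.bdd_mul (c := 1) h2 (.of_forall fun _ => (norm_e2 _).le)).congr
      (.of_forall fun z => ?_)
    simp only [Function.uncurry]; ring
  calc _ = ∫ q, ∫ ζ, e2 (dot q ζ) * f ζ * g q := by
        simp_rw [integral_mul_const]; rfl
    _ = ∫ ζ, ∫ q, e2 (dot q ζ) * f ζ * g q := integral_integral_swap hi
    _ = _ := by
        refine integral_congr_ae (.of_forall fun ζ => ?_)
        simp only [osc]
        rw [← integral_const_mul]
        refine integral_congr_ae (.of_forall fun q => ?_)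
        simp only
        rw [dot_comm]; ring

/-- The Gaussian `e^{-π|q|²}`. -/
def gau (q : ℝ × ℝ) : ℝ := Real.exp (-Real.pi * q.1 ^ 2) * Real.exp (-Real.pi * q.2 ^ 2)

theorem gau_pos (q : ℝ × ℝ) : 0 < gau q := by unfold gau; positivity

@[fun_prop]
theorem continuous_gau : Continuous gau := by unfold gau; fun_prop

@[fun_prop]
theorem measurable_gau : Measurable gau := continuous_gau.measurable

theorem gau_neg (q : ℝ × ℝ) : gau (-q) = gau q := by simp [gau]

theorem bracket_pow_mul_exp_le (m : ℕ) (x : ℝ) :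
    (1 + |x|) ^ m * Real.exp (-Real.pi * x ^ 2) ≤ Real.exp (m ^ 2) := by
  have h1 : (1 + |x|) ^ m ≤ Real.exp (m * |x|) := by
    rw [Real.exp_nat_mul]
    have := Real.add_one_le_exp |x|
    have := abs_nonneg x
    gcongr
    linarith
  calc _ ≤ Real.exp (m * |x|) * Real.exp (-Real.pi * x ^ 2) := by gcongr
    _ = Real.exp (m * |x| + -Real.pi * x ^ 2) := (Real.exp_add _ _).symm
    _ ≤ _ := by
        gcongr
        have := Real.pi_gt_three
        have h := sq_abs x
        nlinarith [sq_nonneg ((m : ℝ) - |x|), sq_nonneg x, sq_nonneg (m : ℝ)]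

theorem br_pow_mul_gau_le (m : ℕ) (q : ℝ × ℝ) : br q ^ m * gau q ≤ Real.exp (m ^ 2) ^ 2 := by
  have h1 := bracket_pow_mul_exp_le m q.1
  have h2 := bracket_pow_mul_exp_le m q.2
  have := bracket_pos q.2
  rw [br, gau, mul_pow, mul_mul_mul_comm, pow_two (Real.exp _)]
  exact mul_le_mul h1 h2 (by positivity) (by positivity)

theorem gau_le (m : ℕ) (q : ℝ × ℝ) : gau q ≤ Real.exp (m ^ 2) ^ 2 * (br q ^ m)⁻¹ := by
  have hb := br_pos q
  rw [← div_eq_mul_inv, le_div_iff₀ (by positivity), mul_comm]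
  exact br_pow_mul_gau_le m q

theorem integrable_gau : Integrable gau := by
  refine (integrable_br_inv_sq.const_mul (Real.exp ((2 : ℕ) ^ 2) ^ 2)).mono' (by fun_prop)
    (.of_forall fun q => ?_)
  rw [Real.norm_of_nonneg (gau_pos q).le]
  exact gau_le 2 q

theorem gau_le_one (q : ℝ × ℝ) : gau q ≤ 1 := by
  have := gau_le 0 q
  simpa using this

theorem integral_e2_mul_gaussian (t : ℝ) : ∫ x : ℝ, e2 (t * x) * (Real.exp (-Real.pi * x ^ 2) : ℂ) =
    (Real.exp (-Real.pi * t ^ 2) : ℝ) := by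
  have h := fourierIntegral_gaussian (b := Real.pi) (by simpa using Real.pi_pos) (2 * Real.pi * t)
  have e : ∀ x : ℝ, e2 (t * x) * (Real.exp (-Real.pi * x ^ 2) : ℂ) =
      Complex.exp (Complex.I * (2 * Real.pi * t) * x) * Complex.exp (-Real.pi * x ^ 2) := fun x => by
    rw [e2, Complex.ofReal_exp]
    congr 2
    · push_cast; ring
    · push_cast; ring
  simp_rw [e, h]
  have hpi : (Real.pi : ℂ) ≠ 0 := by exact_mod_cast Real.pi_ne_zero
  rw [div_self hpi, Complex.one_cpow, one_mul, Complex.ofReal_exp]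
  congr 1
  push_cast
  field_simp
  ring

/-- The Gaussian is its own transform, decays fast enough to lie in every Bourgain space, and is
positive everywhere. It can therefore act both as the third factor of a trilinear estimate and as a
weight that dominates compactly supported functions. -/
theorem osc_gau (ζ : ℝ × ℝ) : osc (fun q => (gau q : ℂ)) ζ = gau ζ := by
  have e : ∀ q : ℝ × ℝ, e2 (dot ζ q) * (gau q : ℂ) =
      (e2 (ζ.1 * q.1) * (Real.exp (-Real.pi * q.1 ^ 2) : ℝ)) *
      (e2 (ζ.2 * q.2) * (Real.exp (-Real.pi * q.2 ^ 2) : ℝ)) := fun q => by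
    rw [dot, e2_add, gau]; push_cast; ring
  unfold osc
  simp_rw [e]
  rw [Measure.volume_eq_prod, integral_prod_mul
    (f := fun x : ℝ => e2 (ζ.1 * x) * ((Real.exp (-Real.pi * x ^ 2) : ℝ) : ℂ))
    (g := fun x : ℝ => e2 (ζ.2 * x) * ((Real.exp (-Real.pi * x ^ 2) : ℝ) : ℂ)),
    integral_e2_mul_gaussian, integral_e2_mul_gaussian, gau]
  push_cast; rfl

/-! ### The autocorrelation of an integrable function smoothed by the Gaussian -/

/-- `f` and its conjugate at the two points. -/
def pairProd (f : ℝ × ℝ → ℂ) (z : (ℝ × ℝ) × (ℝ × ℝ)) : ℂ := f z.1 * (starRingEnd ℂ) (f z.2)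

theorem integrable_conj {X : Type*} [MeasurableSpace X] {μ : Measure X} {f : X → ℂ}
    (hf : Integrable f μ) : Integrable (fun z => (starRingEnd ℂ) (f z)) μ :=
  ((Complex.conjCLE : ℂ →L[ℝ] ℂ)).integrable_comp hf

theorem integrable_pairProd {f : ℝ × ℝ → ℂ} (hf : Integrable f) : Integrable (pairProd f) :=
  hf.mul_prod (integrable_conj hf)

theorem integral_pairProd_mul_e2 {f : ℝ × ℝ → ℂ} (q : ℝ × ℝ) :
    ∫ z, pairProd f z * e2 (dot q (z.1 - z.2)) = (‖osc f q‖ : ℂ) ^ 2 := by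
  have e : ∀ z : (ℝ × ℝ) × (ℝ × ℝ), pairProd f z * e2 (dot q (z.1 - z.2)) =
      (e2 (dot q z.1) * f z.1) * (starRingEnd ℂ) (e2 (dot q z.2) * f z.2) := fun z => by
    rw [pairProd, map_mul, conj_e2, dot_sub, sub_eq_add_neg, e2_add]; ring
  simp_rw [e]
  rw [Measure.volume_eq_prod, integral_prod_mul (f := fun x => e2 (dot q x) * f x)
    (g := fun x => (starRingEnd ℂ) (e2 (dot q x) * f x)), integral_conj]
  exact Complex.mul_conj' _

/-- The convolution of the autocorrelation of `f` with `k`. -/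
def smear (f k : ℝ × ℝ → ℂ) (ζ : ℝ × ℝ) : ℂ := ∫ z, pairProd f z * k (ζ - z.1 + z.2)

theorem integrable_smear_integrand {f k : ℝ × ℝ → ℂ} (hfm : Measurable f) (hf : Integrable f)
    (hkm : Measurable k) (hk : Integrable k) :
    Integrable (Function.uncurry fun (ζ : ℝ × ℝ) (z : (ℝ × ℝ) × (ℝ × ℝ)) =>
      pairProd f z * k (ζ - z.1 + z.2)) (volume.prod volume) := by
  have hc : Measurable (starRingEnd ℂ) := Complex.continuous_conj.measurable
  have hm : Measurable (Function.uncurry fun (ζ : ℝ × ℝ) (z : (ℝ × ℝ) × (ℝ × ℝ)) =>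
      pairProd f z * k (ζ - z.1 + z.2)) := by
    unfold Function.uncurry pairProd; fun_prop
  have hg : ∀ z : (ℝ × ℝ) × (ℝ × ℝ), Integrable fun ζ => k (ζ - z.1 + z.2) := fun z => by
    have := hk.comp_add_right (-z.1 + z.2)
    refine this.congr (.of_forall fun ζ => ?_)
    simp only; congr 1; abel
  rw [integrable_prod_iff' hm.aestronglyMeasurable]
  refine ⟨.of_forall fun z => (hg z).const_mul (pairProd f z), ?_⟩
  have e : ∀ z : (ℝ × ℝ) × (ℝ × ℝ), ∫ ζ, ‖Function.uncurry (fun (ζ : ℝ × ℝ) (z : (ℝ × ℝ) × (ℝ × ℝ)) =>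
      pairProd f z * k (ζ - z.1 + z.2)) (ζ, z)‖ = ‖pairProd f z‖ * ∫ ζ, ‖k ζ‖ := fun z => by
    simp only [Function.uncurry, norm_mul]
    rw [integral_const_mul, ← integral_add_right_eq_self (fun ζ => ‖k ζ‖) (-z.1 + z.2)]
    simp_rw [← add_assoc, ← sub_eq_add_neg]
  simp_rw [e]
  exact (integrable_pairProd hf).norm.mul_const _

theorem integrable_smear {f k : ℝ × ℝ → ℂ} (hfm : Measurable f) (hf : Integrable f)
    (hkm : Measurable k) (hk : Integrable k) : Integrable (smear f k) :=
  (integrable_smear_integrand hfm hf hkm hk).integral_prod_left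

/-- Convolution theorem: autocorrelation corresponds to the squared modulus. Taking k = f identifies
the convolution integral with the pointwise cube; taking k Gaussian gives the weighted square used
for the L⁴ bound. -/
theorem osc_smear {f k : ℝ × ℝ → ℂ} (hfm : Measurable f) (hf : Integrable f)
    (hkm : Measurable k) (hk : Integrable k) (q : ℝ × ℝ) :
    osc (smear f k) q = osc k q * (‖osc f q‖ : ℂ) ^ 2 := by
  have hi : Integrable (Function.uncurry fun (ζ : ℝ × ℝ) (z : (ℝ × ℝ) × (ℝ × ℝ)) =>
      e2 (dot q ζ) * (pairProd f z * k (ζ - z.1 + z.2))) (volume.prod volume) := by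
    refine (integrable_smear_integrand hfm hf hkm hk).bdd_mul (c := 1)
      (f := fun x : (ℝ × ℝ) × ((ℝ × ℝ) × (ℝ × ℝ)) => e2 (dot q x.1))
      (Continuous.aestronglyMeasurable ?_) (.of_forall fun _ => (norm_e2 _).le)
    unfold dot; fun_prop
  calc _ = ∫ ζ, ∫ z, e2 (dot q ζ) * (pairProd f z * k (ζ - z.1 + z.2)) := by
        simp_rw [integral_const_mul]; rfl
    _ = ∫ z, ∫ ζ, e2 (dot q ζ) * (pairProd f z * k (ζ - z.1 + z.2)) :=
        integral_integral_swap hi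
    _ = ∫ z, osc k q * (pairProd f z * e2 (dot q (z.1 - z.2))) := by
        refine integral_congr_ae (.of_forall fun z => ?_)
        simp only
        rw [← integral_add_right_eq_self _ (z.1 - z.2)]
        have e : ∀ ζ : ℝ × ℝ, e2 (dot q (ζ + (z.1 - z.2))) *
            (pairProd f z * k (ζ + (z.1 - z.2) - z.1 + z.2)) =
            (pairProd f z * e2 (dot q (z.1 - z.2))) * (e2 (dot q ζ) * k ζ) := fun ζ => by
          rw [show ζ + (z.1 - z.2) - z.1 + z.2 = ζ by abel, dot_add, e2_add]; ring
        simp_rw [e]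
        rw [integral_const_mul, osc]; ring
    _ = _ := by rw [integral_const_mul, integral_pairProd_mul_e2]

theorem integrable_cubicInt {f : ℝ × ℝ → ℂ} (hfm : Measurable f) (hf : Integrable f) :
    Integrable (cubicInt f) :=
  integrable_smear hfm hf hfm hf

theorem osc_cubicInt {f : ℝ × ℝ → ℂ} (hfm : Measurable f) (hf : Integrable f) (q : ℝ × ℝ) :
    osc (cubicInt f) q = (‖osc f q‖ : ℂ) ^ 2 * osc f q :=
  (osc_smear hfm hf hfm hf q).trans (mul_comm _ _)

/-- The Fourier transform of `gau * |osc f|²`. -/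
def autocor (f : ℝ × ℝ → ℂ) (ζ : ℝ × ℝ) : ℂ := ∫ z, pairProd f z * gau (ζ - z.1 + z.2)

theorem integrable_autocor {f : ℝ × ℝ → ℂ} (hfm : Measurable f) (hf : Integrable f) :
    Integrable (autocor f) :=
  integrable_smear (k := fun q => (gau q : ℂ)) hfm hf (by fun_prop) integrable_gau.ofReal

theorem osc_autocor {f : ℝ × ℝ → ℂ} (hfm : Measurable f) (hf : Integrable f) (q : ℝ × ℝ) :
    osc (autocor f) q = gau q * (‖osc f q‖ : ℂ) ^ 2 := by
  have := osc_smear (k := fun q => (gau q : ℂ)) hfm hf (by fun_prop) integrable_gau.ofReal q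
  rwa [osc_gau] at this

theorem osc_gau_mul_sq {f : ℝ × ℝ → ℂ} (hfm : Measurable f) (hf : Integrable f) (ζ : ℝ × ℝ) :
    osc (fun q => gau q * (‖osc f q‖ : ℂ) ^ 2) ζ = autocor f (-ζ) := by
  have hc : Measurable (starRingEnd ℂ) := Complex.continuous_conj.measurable
  have hi : Integrable (Function.uncurry fun (q : ℝ × ℝ) (z : (ℝ × ℝ) × (ℝ × ℝ)) =>
      e2 (dot ζ q) * (gau q * (pairProd f z * e2 (dot q (z.1 - z.2))))) (volume.prod volume) := by
    have h1 := integrable_gau.ofReal (𝕜 := ℂ).mul_prod (integrable_pairProd hf)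
    refine h1.mono ?_ (.of_forall fun x => ?_)
    · refine Measurable.aestronglyMeasurable ?_
      unfold Function.uncurry pairProd dot; fun_prop
    · simp [Function.uncurry, norm_e2]
  calc _ = ∫ q, ∫ z, e2 (dot ζ q) * (gau q * (pairProd f z * e2 (dot q (z.1 - z.2)))) := by
        simp_rw [integral_const_mul, integral_pairProd_mul_e2]; rfl
    _ = ∫ z, ∫ q, e2 (dot ζ q) * (gau q * (pairProd f z * e2 (dot q (z.1 - z.2)))) :=
        integral_integral_swap hi
    _ = _ := by
        unfold autocor
        refine integral_congr_ae (.of_forall fun z => ?_)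
        simp only
        have e : ∀ q : ℝ × ℝ, e2 (dot ζ q) * (gau q * (pairProd f z * e2 (dot q (z.1 - z.2)))) =
            pairProd f z * (e2 (dot (ζ + (z.1 - z.2)) q) * gau q) := fun q => by
          rw [dot_comm _ q, dot_comm _ q, dot_add, e2_add]; ring
        simp_rw [e]
        rw [integral_const_mul]
        have := osc_gau (ζ + (z.1 - z.2))
        rw [osc] at this
        rw [this, ← gau_neg]
        congr 3; abel

/-- The inequality of Plancherel needed for the weighted square, proved by hand: the multiplication
formula moves one factor to the frequency side and Cauchy–Schwarz finishes. -/
theorem lintegral_gau_mul_sq_le {f : ℝ × ℝ → ℂ} (hfm : Measurable f) (hf : Integrable f) :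
    ∫⁻ q, (ENNReal.ofReal (gau q) * ‖osc f q‖ₑ ^ 2) ^ 2 ≤ ∫⁻ ζ, ‖autocor f ζ‖ₑ ^ 2 := by
  set W : ℝ × ℝ → ℂ := fun q => gau q * (‖osc f q‖ : ℂ) ^ 2 with hW
  have hosc := continuous_osc hf
  have hWi : Integrable W := by
    refine (integrable_gau.ofReal (𝕜 := ℂ)).mul_bdd (c := (∫ ζ, ‖f ζ‖) ^ 2)
      (Continuous.aestronglyMeasurable (by fun_prop)) (.of_forall fun q => ?_)
    rw [norm_pow, Complex.norm_real, norm_norm]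
    gcongr
    exact norm_osc_le f q
  have hWn : ∀ q, ‖W q‖ₑ = ENNReal.ofReal (gau q) * ‖osc f q‖ₑ ^ 2 := fun q => by
    rw [hW]
    simp only [enorm_mul, enorm_pow]
    rw [← ofReal_norm, Complex.norm_real, Real.norm_of_nonneg (gau_pos q).le,
      ← ofReal_norm (((‖osc f q‖ : ℝ) : ℂ)), Complex.norm_real, norm_norm, ofReal_norm]
  -- One copy of `W` is the transform of the autocorrelation, and transforming the other copy gives
  -- the reflected autocorrelation.
  have h1 : ∫ q, W q * W q = ∫ ζ, autocor f ζ * autocor f (-ζ) := by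
    have := integral_osc_mul (integrable_autocor hfm hf) hWi
    simp_rw [osc_autocor hfm hf] at this
    rw [this]
    refine integral_congr_ae (.of_forall fun ζ => ?_)
    simp only
    rw [hW, osc_gau_mul_sq hfm hf]
  have hWsq : ∀ q, W q * W q = ((‖W q‖ ^ 2 : ℝ) : ℂ) := fun q => by
    rw [hW]
    simp only [norm_mul, norm_pow, Complex.norm_real, Real.norm_of_nonneg (gau_pos q).le, norm_norm]
    push_cast; ring
  have hWi2 : Integrable fun q => ‖W q‖ ^ 2 := by
    have : Integrable fun q => W q * W q := by
      refine hWi.bdd_mul (c := (∫ ζ, ‖f ζ‖) ^ 2) hWi.aestronglyMeasurable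
        (.of_forall fun q => ?_)
      simp only [hW, norm_mul, norm_pow, Complex.norm_real, Real.norm_of_nonneg (gau_pos q).le, norm_norm]
      calc _ ≤ 1 * (∫ ζ, ‖f ζ‖) ^ 2 := by
            gcongr
            · exact gau_le_one q
            · exact norm_osc_le f q
        _ = _ := one_mul _
    simp_rw [hWsq] at this
    exact this.re
  have hKm : Measurable (autocor f) := by
    have hc : Measurable (starRingEnd ℂ) := Complex.continuous_conj.measurable
    have hm : StronglyMeasurable (Function.uncurry fun (ζ : ℝ × ℝ) (z : (ℝ × ℝ) × (ℝ × ℝ)) =>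
      pairProd f z * (gau (ζ - z.1 + z.2) : ℂ)) := by
      refine Measurable.stronglyMeasurable ?_
      unfold Function.uncurry pairProd; fun_prop
    exact hm.integral_prod_right.measurable
  calc _ = ∫⁻ q, ENNReal.ofReal (‖W q‖ ^ 2) := by
        refine lintegral_congr fun q => ?_
        rw [← hWn, ENNReal.ofReal_pow (norm_nonneg _), ofReal_norm]
    _ = ENNReal.ofReal (∫ q, ‖W q‖ ^ 2) :=
        (ofReal_integral_eq_lintegral_ofReal hWi2 (.of_forall fun q => by positivity)).symm
    _ ≤ ‖∫ q, W q * W q‖ₑ := by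
        simp_rw [hWsq]
        rw [integral_complex_ofReal, ← ofReal_norm, Complex.norm_real]
        gcongr
        exact Real.le_norm_self _
    _ ≤ ∫⁻ ζ, ‖autocor f ζ‖ₑ * ‖autocor f (-ζ)‖ₑ := by
        rw [h1]
        refine (enorm_integral_le_lintegral_enorm _).trans_eq ?_
        simp_rw [enorm_mul]
    _ ≤ _ := by
        have h2 := lintegral_mul_sq_le (μ := (volume : Measure (ℝ × ℝ))) (f := fun ζ => ‖autocor f ζ‖ₑ)
          (g := fun ζ => ‖autocor f (-ζ)‖ₑ) (by fun_prop) (by fun_prop)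
        have h3 : ∫⁻ ζ, ‖autocor f (-ζ)‖ₑ ^ 2 = ∫⁻ ζ, ‖autocor f ζ‖ₑ ^ 2 :=
          lintegral_neg_eq_self (fun ζ => ‖autocor f ζ‖ₑ ^ 2)
        rw [h3, ← sq] at h2
        exact (ENNReal.pow_le_pow_left_iff two_ne_zero).mp h2

/-! ### The embedding of the Bourgain space into `L⁴` with Gaussian weight -/

/-- The measure on space-time with the square of the Gaussian as density. -/
def gauMeasure : Measure (ℝ × ℝ) := volume.withDensity fun q => ENNReal.ofReal (gau q) ^ 2

theorem lintegral_gauMeasure (f : ℝ × ℝ → ℝ≥0∞) :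
    ∫⁻ q, f q ∂gauMeasure = ∫⁻ q, ENNReal.ofReal (gau q) ^ 2 * f q := by
  rw [gauMeasure, lintegral_withDensity_eq_lintegral_mul_non_measurable _ (by fun_prop)
    (.of_forall fun q => by finiteness)]
  rfl

instance : IsFiniteMeasure gauMeasure := by
  refine ⟨?_⟩
  rw [← lintegral_one, lintegral_gauMeasure]
  have h := integrable_gau.lintegral_lt_top
  refine lt_of_le_of_lt (lintegral_mono fun q => ?_) h
  rw [mul_one]
  exact pow_le_of_le_one zero_le (ENNReal.ofReal_le_one.mpr (gau_le_one q)) two_ne_zero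

theorem eLpNorm_four_pow {X : Type*} [MeasurableSpace X] {μ : Measure X} (f : X → ℂ) :
    eLpNorm f 4 μ ^ 4 = ∫⁻ x, ‖f x‖ₑ ^ 4 ∂μ := by
  have := eLpNorm_nnreal_pow_eq_lintegral (μ := μ) (f := f) (p := 4) (by norm_num)
  simpa only [NNReal.coe_ofNat, ENNReal.rpow_ofNat, ENNReal.coe_ofNat] using this

theorem memLp_wt_mul_gau (α β s b : ℝ) :
    MemLp (fun ζ => (wt (phase α β) s b ζ : ℂ) * gau ζ) 2 volume := by
  obtain ⟨C, hC, m, h⟩ := exists_wt_le_br α β s b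
  have hw := measurable_wt (measurable_phase α β) s b
  refine MemLp.of_le_mul (c := C * Real.exp ((m + 2 : ℕ) ^ 2) ^ 2) memLp_br_inv_sq (by fun_prop)
    (.of_forall fun ζ => ?_)
  have hb := br_pos ζ
  rw [norm_mul, Complex.norm_real, Complex.norm_real, Real.norm_of_nonneg (wt_pos _ _ _ _).le,
    Real.norm_of_nonneg (gau_pos ζ).le, Real.norm_of_nonneg (by positivity)]
  calc _ ≤ (C * br ζ ^ m) * (Real.exp ((m + 2 : ℕ) ^ 2) ^ 2 * (br ζ ^ (m + 2))⁻¹) := by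
        have := gau_pos ζ
        gcongr
        · exact h ζ
        · exact gau_le (m + 2) ζ
    _ = _ := by
        rw [pow_add, mul_inv]
        field_simp

/-- The Gaussian times |u|² is a product u ū G with G in `X^{1,b}`, so the embedding estimate puts
it in L². Its L² norm squared is the fourth power of the weighted L⁴ norm of u. -/
theorem exists_lintegral_osc_le (α : ℝ) {β : ℝ} (hβ : β ≠ 0) {s b : ℝ} (hs : -(1 / 4) < s)
    (hb : 1 / 2 < b) : ∃ C : ℝ≥0∞, C ≠ ∞ ∧ ∀ h : L2P, Integrable (coef (phase α β) s b h) →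
      eLpNorm (osc (coef (phase α β) s b h)) 4 gauMeasure ≤ C * ‖h‖ₑ := by
  obtain ⟨C, hC, H⟩ := exists_embed_bound α hβ hs hb
  have hp := measurable_phase α β
  set G : ℝ≥0∞ := ∫⁻ z, (ewt (phase α β) 1 b z * ENNReal.ofReal (gau z)) ^ 2 with hG
  have hGt : G ≠ ∞ := by
    have h1 := (memLp_wt_mul_gau α β 1 b).2
    have h2 := eLpNorm_two_sq (μ := volume) (fun ζ => (wt (phase α β) 1 b ζ : ℂ) * gau ζ)
    have e : ∀ ζ, ‖(wt (phase α β) 1 b ζ : ℂ) * gau ζ‖ₑ =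
        ewt (phase α β) 1 b ζ * ENNReal.ofReal (gau ζ) := fun ζ => by
      rw [enorm_mul, enorm_wt, ← ofReal_norm, Complex.norm_real, Real.norm_of_nonneg (gau_pos ζ).le]
    simp_rw [e] at h2
    rw [hG, ← h2]
    finiteness
  refine ⟨(C * G) ^ (1 / 4 : ℝ), by finiteness, fun h hi => ?_⟩
  have hfm := measurable_coef hp s b (measurable_lp h)
  have hewt := measurable_ewt hp 1 b
  have hew1 := measurable_ewt hp (-s) (-b)
  have hk := measurable_lp h
  refine (ENNReal.pow_le_pow_left_iff (n := 4) (by norm_num)).mp ?_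
  rw [eLpNorm_four_pow, mul_pow, ← ENNReal.rpow_mul_natCast]
  norm_num
  calc _ = ∫⁻ q, (ENNReal.ofReal (gau q) * ‖osc (coef (phase α β) s b h) q‖ₑ ^ 2) ^ 2 := by
        rw [lintegral_gauMeasure]
        refine lintegral_congr fun q => ?_
        ring
    _ ≤ ∫⁻ ζ, ‖autocor (coef (phase α β) s b h) ζ‖ₑ ^ 2 := lintegral_gau_mul_sq_le hfm hi
    _ ≤ _ := by
        refine le_trans (lintegral_mono fun ζ => ?_) (H (fun z => ‖h z‖ₑ) (fun z => ‖h z‖ₑ)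
          (fun z => ewt (phase α β) 1 b z * ENNReal.ofReal (gau z)) (by fun_prop) (by fun_prop)
          (by fun_prop))
        gcongr
        refine (enorm_integral_le_lintegral_enorm _).trans_eq ?_
        rw [Measure.volume_eq_prod, lintegral_prod]
        · refine lintegral_congr fun x => lintegral_congr fun y => ?_
          have e1 : ewt (phase α β) (-1) (-b) (ζ - x + y) * ewt (phase α β) 1 b (ζ - x + y) = 1 := by
            rw [ewt, ewt, wt_neg, ← ENNReal.ofReal_mul (by have := wt_pos (phase α β) 1 b (ζ - x + y); positivity),
              inv_mul_cancel₀ (wt_ne_zero _ _ _ _), ENNReal.ofReal_one]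
          rw [one_mul, ← mul_assoc (ewt (phase α β) (-1) (-b) _), e1, one_mul, pairProd, enorm_mul,
            enorm_mul, RCLike.enorm_conj, enorm_coef, enorm_coef,
            ← ofReal_norm ((gau (ζ - x + y) : ℝ) : ℂ), Complex.norm_real,
            Real.norm_of_nonneg (gau_pos _).le]
        · have hc : Measurable (starRingEnd ℂ) := Complex.continuous_conj.measurable
          unfold pairProd
          fun_prop
    _ = _ := by
        rw [lintegral_enorm_sq_lp, ofReal_norm, ← hG]
        ring

/-- Truncation to bounded frequencies: there the inverse weight is bounded, so the coefficient is
square integrable on a set of finite measure. -/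
theorem exists_seq_integrable_coef (α β s b : ℝ) (h : L2P) : ∃ g : ℕ → L2P,
    Filter.Tendsto g Filter.atTop (nhds h) ∧ ∀ n, Integrable (coef (phase α β) s b (g n)) := by
  have hbm := measurable_br
  set S : ℕ → Set (ℝ × ℝ) := fun n => {ζ | br ζ ≤ n} with hS
  have hSm : ∀ n, MeasurableSet (S n) := fun n => measurableSet_le hbm measurable_const
  have hmem : ∀ n, MemLp ((S n).indicator h) 2 volume := fun n => (Lp.memLp h).indicator (hSm n)
  have hk := measurable_lp h
  refine ⟨fun n => (hmem n).toLp _, ?_, fun n => ?_⟩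
  · have e : h = (Lp.memLp h).toLp h := (Lp.toLp_coeFn h _).symm
    conv => arg 3; rw [e]
    rw [Lp.tendsto_Lp_iff_tendsto_eLpNorm'']
    have hlim : Filter.Tendsto (fun n => ∫⁻ ζ, ‖(S n).indicator h ζ - h ζ‖ₑ ^ 2) Filter.atTop
        (nhds (∫⁻ _ : ℝ × ℝ, 0)) := by
      refine tendsto_lintegral_of_dominated_convergence (fun ζ => ‖h ζ‖ₑ ^ 2)
        (fun n => by have := hk.indicator (hSm n); fun_prop) (fun n => .of_forall fun ζ => ?_)
        (by rw [lintegral_enorm_sq_lp]; finiteness) (.of_forall fun ζ => ?_)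
      · by_cases hz : ζ ∈ S n
        · simp [Set.indicator_of_mem hz]
        · simp [Set.indicator_of_notMem hz]
      · refine tendsto_const_nhds.congr' ?_
        obtain ⟨N, hN⟩ := exists_nat_ge (br ζ)
        filter_upwards [Filter.eventually_ge_atTop N] with n hn
        have hz : ζ ∈ S n := hN.trans (by exact_mod_cast hn)
        simp [Set.indicator_of_mem hz]
    rw [lintegral_zero] at hlim
    have h2 := (ENNReal.continuous_rpow_const (y := (1 / 2 : ℝ))).tendsto 0 |>.comp hlim
    rw [ENNReal.zero_rpow_of_pos (by norm_num)] at h2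
    refine h2.congr fun n => ?_
    simp only [Function.comp]
    have h3 := eLpNorm_two_sq (μ := volume) ((S n).indicator h - (h : ℝ × ℝ → ℂ))
    simp only [Pi.sub_apply] at h3
    rw [← h3, ← ENNReal.rpow_natCast, ← ENNReal.rpow_mul]
    norm_num
  · obtain ⟨C, hC, m, hw⟩ := exists_wt_le_br α β (-s) (-b)
    have hwm := measurable_wt (measurable_phase α β) (-s) (-b)
    have hM : MemLp ((S n).indicator fun ζ => (wt (phase α β) (-s) (-b) ζ : ℂ)) 2 volume := by
      refine MemLp.of_le_mul (c := C * (n : ℝ) ^ (m + 2)) memLp_br_inv_sq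
        ((Measurable.indicator (by fun_prop) (hSm n)).aestronglyMeasurable) (.of_forall fun ζ => ?_)
      have hb := br_pos ζ
      rw [Real.norm_of_nonneg (by positivity : 0 ≤ (br ζ ^ 2)⁻¹)]
      by_cases hz : ζ ∈ S n
      · rw [Set.indicator_of_mem hz, Complex.norm_real, Real.norm_of_nonneg (wt_pos _ _ _ _).le]
        have hz' : br ζ ≤ n := hz
        refine (hw ζ).trans ?_
        rw [mul_assoc]
        gcongr
        rw [← div_eq_mul_inv, le_div_iff₀ (by positivity), ← pow_add]
        gcongr
      · rw [Set.indicator_of_notMem hz, norm_zero]; positivity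
    refine ((Lp.memLp h).integrable_mul hM).congr ?_
    filter_upwards [(hmem n).coeFn_toLp] with ζ hζ
    rw [coef_eq_mul, hζ]
    by_cases hz : ζ ∈ S n
    · simp [Set.indicator_of_mem hz]
    · simp [Set.indicator_of_notMem hz]

theorem coef_sub_ae (p : ℝ → ℝ) (s b : ℝ) (h g : L2P) :
    coef p s b (h - g : L2P) =ᵐ[volume] fun ζ => coef p s b h ζ - coef p s b g ζ := by
  filter_upwards [Lp.coeFn_sub h g] with ζ hζ
  simp only [coef, hζ, Pi.sub_apply, sub_div]

/-- The function with weighted Fourier coefficient `h` is an `L⁴` limit of functions with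
integrable Fourier transform. -/
theorem exists_osc_limit (α : ℝ) {β : ℝ} (hβ : β ≠ 0) {s b : ℝ} (hs : -(1 / 4) < s)
    (hb : 1 / 2 < b) (h : L2P) : ∃ (g : ℕ → L2P) (v : ℝ × ℝ → ℂ),
      Filter.Tendsto g Filter.atTop (nhds h) ∧ (∀ n, Integrable (coef (phase α β) s b (g n))) ∧
      Measurable v ∧ MemLp v 4 gauMeasure ∧
      ∀ n, eLpNorm (fun q => osc (coef (phase α β) s b (g n)) q - v q) 4 gauMeasure ≤ 2⁻¹ ^ n := by
  obtain ⟨C, hC, H⟩ := exists_lintegral_osc_le α hβ hs hb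
  obtain ⟨g, hg, hgi⟩ := exists_seq_integrable_coef α β s b h
  have hmem : ∀ n, MemLp (osc (coef (phase α β) s b (g n))) 4 gauMeasure := fun n =>
    ⟨(continuous_osc (hgi n)).aestronglyMeasurable, (H (g n) (hgi n)).trans_lt (by finiteness)⟩
  have : Fact ((1 : ℝ≥0∞) ≤ 4) := ⟨by norm_num⟩
  set U : ℕ → Lp ℂ 4 gauMeasure := fun n => (hmem n).toLp _ with hU
  have hdiff : ∀ n m, edist (U n) (U m) ≤ C * edist (g n) (g m) := fun n m => by
    have hi : Integrable (coef (phase α β) s b (g n - g m : L2P)) :=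
      ((hgi n).sub (hgi m)).congr (coef_sub_ae _ _ _ _ _).symm
    have := H _ hi
    rw [edist_eq_enorm_sub (g n)]
    refine le_trans (le_of_eq ?_) this
    rw [Lp.edist_toLp_toLp]
    congr 1
    ext q
    rw [osc_congr (coef_sub_ae _ _ _ _ _), osc_sub (hgi n) (hgi m)]
    rfl
  have hcau : CauchySeq U := by
    have hL : CauchySeq g := hg.cauchySeq
    rw [EMetric.cauchySeq_iff] at hL ⊢
    intro ε hε
    obtain ⟨N, hN⟩ := hL (ε / (C + 1)) (ENNReal.div_pos hε.ne' (by finiteness))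
    refine ⟨N, fun m hm n hn => ?_⟩
    refine (hdiff m n).trans_lt ?_
    have h1 := hN m hm n hn
    calc C * edist (g m) (g n) ≤ (C + 1) * edist (g m) (g n) := by gcongr; exact le_self_add
      _ < ε := by
        rw [mul_comm]
        exact ENNReal.mul_lt_of_lt_div h1
  obtain ⟨V, hV⟩ := cauchySeq_tendsto_of_complete hcau
  have hlim : Filter.Tendsto (fun n => edist (U n) V) Filter.atTop (nhds 0) := by
    rw [← tendsto_iff_edist_tendsto_0]; exact hV
  -- A subsequence with geometric rate; summability will later give convergence on almost every time
  -- slice.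
  have hsel : ∀ k : ℕ, ∃ n, k ≤ n ∧ edist (U n) V ≤ 2⁻¹ ^ k := fun k => by
    have hpos : (0 : ℝ≥0∞) < 2⁻¹ ^ k := ENNReal.pow_pos (by norm_num) _
    obtain ⟨N, hN⟩ := Filter.eventually_atTop.mp (hlim.eventually (ge_mem_nhds hpos))
    exact ⟨max k N, le_max_left _ _, hN _ (le_max_right _ _)⟩
  choose n hn hn' using hsel
  refine ⟨fun k => g (n k), V, hg.comp (Filter.tendsto_atTop_mono hn Filter.tendsto_id),
    fun k => hgi _, (Lp.stronglyMeasurable V).measurable, Lp.memLp V, fun k => ?_⟩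
  refine le_trans (le_of_eq ?_) (hn' k)
  rw [Lp.edist_def]
  refine eLpNorm_congr_ae ?_
  filter_upwards [(hmem (n k)).coeFn_toLp] with q hq
  simp [hU, hq]

/-! ### Passage to the limit in the nonlinearity -/

theorem tendsto_zero_of_pow_four_le {a b : ℕ → ℝ≥0∞} (h : ∀ n, a n ^ 4 ≤ b n)
    (hb : Filter.Tendsto b Filter.atTop (nhds 0)) : Filter.Tendsto a Filter.atTop (nhds 0) := by
  have h1 := (ENNReal.continuous_rpow_const (y := (1 / 4 : ℝ))).tendsto 0 |>.comp hb
  rw [ENNReal.zero_rpow_of_pos (by norm_num)] at h1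
  refine tendsto_of_tendsto_of_tendsto_of_le_of_le tendsto_const_nhds h1 (fun _ => zero_le)
    fun n => ?_
  simp only [Function.comp]
  calc a n = (a n ^ 4) ^ (1 / 4 : ℝ) := by
        rw [← ENNReal.rpow_natCast, ← ENNReal.rpow_mul]; norm_num
    _ ≤ _ := by gcongr; exact h n

theorem norm_cube_sub_le (u v : ℂ) : ‖(‖u‖ : ℂ) ^ 2 * u - (‖v‖ : ℂ) ^ 2 * v‖ ≤
    ‖u - v‖ * (4 * ‖u - v‖ ^ 2 + 6 * ‖v‖ ^ 2) := by
  have e : (‖u‖ : ℂ) ^ 2 * u - (‖v‖ : ℂ) ^ 2 * v =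
      (‖u‖ : ℂ) ^ 2 * (u - v) + ((‖u‖ - ‖v‖ : ℝ) : ℂ) * ((‖u‖ + ‖v‖ : ℝ) : ℂ) * v := by
    push_cast; ring
  have h1 : |‖u‖ - ‖v‖| ≤ ‖u - v‖ := abs_norm_sub_norm_le u v
  have h2 : ‖u‖ ≤ ‖u - v‖ + ‖v‖ := by
    calc ‖u‖ = ‖u - v + v‖ := by rw [sub_add_cancel]
      _ ≤ _ := norm_add_le _ _
  set d := ‖u - v‖ with hd
  have hd0 : 0 ≤ d := norm_nonneg _
  have hv0 := norm_nonneg v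
  have hu0 := norm_nonneg u
  calc _ ≤ ‖u‖ ^ 2 * d + |‖u‖ - ‖v‖| * (‖u‖ + ‖v‖) * ‖v‖ := by
        rw [e]
        refine (norm_add_le _ _).trans_eq ?_
        rw [norm_mul, norm_mul, norm_mul, norm_pow, Complex.norm_real, Complex.norm_real,
          Complex.norm_real, norm_norm, Real.norm_eq_abs, Real.norm_eq_abs,
          abs_of_nonneg (by positivity : 0 ≤ ‖u‖ + ‖v‖)]
    _ ≤ (d + ‖v‖) ^ 2 * d + d * ((d + ‖v‖) + ‖v‖) * ‖v‖ := by gcongr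
    _ ≤ _ := by nlinarith [mul_nonneg hd0 (sq_nonneg (d - ‖v‖)), mul_nonneg hd0 (sq_nonneg d),
        mul_nonneg hd0 (sq_nonneg ‖v‖)]

section
variable {X : Type*} [MeasurableSpace X] {ν : Measure X}

theorem lintegral_sq_sq_le {d : X → ℝ≥0∞} (hd : AEMeasurable d ν) :
    (∫⁻ x, d x ^ 2 ∂ν) ^ 2 ≤ (∫⁻ x, d x ^ 4 ∂ν) * ν Set.univ := by
  have := lintegral_mul_sq_le (μ := ν) (f := fun x => d x ^ 2) (g := fun _ => 1)
    (hd.pow_const 2) aemeasurable_const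
  simpa [← pow_mul] using this

theorem lintegral_pow_four_le {d : X → ℝ≥0∞} (hd : AEMeasurable d ν) :
    (∫⁻ x, d x ∂ν) ^ 4 ≤ (∫⁻ x, d x ^ 4 ∂ν) * ν Set.univ ^ 3 := by
  have h1 := lintegral_mul_sq_le (μ := ν) (f := d) (g := fun _ => 1) hd aemeasurable_const
  simp only [mul_one, one_pow, lintegral_const, one_mul] at h1
  calc _ = ((∫⁻ x, d x ∂ν) ^ 2) ^ 2 := by ring
    _ ≤ ((∫⁻ x, d x ^ 2 ∂ν) * ν Set.univ) ^ 2 := by gcongr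
    _ = (∫⁻ x, d x ^ 2 ∂ν) ^ 2 * ν Set.univ ^ 2 := by ring
    _ ≤ ((∫⁻ x, d x ^ 4 ∂ν) * ν Set.univ) * ν Set.univ ^ 2 := by
        gcongr; exact lintegral_sq_sq_le hd
    _ = _ := by ring

variable [IsFiniteMeasure ν]

theorem tendsto_lintegral_sub {u : ℕ → X → ℂ} {v : X → ℂ} (hu : ∀ n, AEStronglyMeasurable (u n) ν)
    (hv : AEStronglyMeasurable v ν)
    (h : Filter.Tendsto (fun n => ∫⁻ x, ‖u n x - v x‖ₑ ^ 4 ∂ν) Filter.atTop (nhds 0)) :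
    Filter.Tendsto (fun n => ∫⁻ x, ‖u n x - v x‖ₑ ∂ν) Filter.atTop (nhds 0) := by
  refine tendsto_zero_of_pow_four_le (fun n => lintegral_pow_four_le ((hu n).sub hv).enorm) ?_
  have := ENNReal.Tendsto.mul_const (b := ν Set.univ ^ 3) h (Or.inr (by finiteness))
  simpa using this

/-- On a finite measure space L⁴ convergence implies L¹ convergence of the cubes. Two applications
of Cauchy–Schwarz take the place of Hölder's inequality. -/
theorem tendsto_lintegral_cube_sub {u : ℕ → X → ℂ} {v : X → ℂ}
    (hu : ∀ n, AEStronglyMeasurable (u n) ν) (hv : MemLp v 4 ν)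
    (h : Filter.Tendsto (fun n => ∫⁻ x, ‖u n x - v x‖ₑ ^ 4 ∂ν) Filter.atTop (nhds 0)) :
    Filter.Tendsto (fun n => ∫⁻ x, ‖(‖u n x‖ : ℂ) ^ 2 * u n x - (‖v x‖ : ℂ) ^ 2 * v x‖ₑ ∂ν)
      Filter.atTop (nhds 0) := by
  set A := ∫⁻ x, ‖v x‖ₑ ^ 4 ∂ν with hA
  have hAt : A ≠ ∞ := by
    rw [hA, ← eLpNorm_four_pow]
    have := hv.2
    finiteness
  have hdm : ∀ n, AEMeasurable (fun x => ‖u n x - v x‖ₑ) ν := fun n => ((hu n).sub hv.1).enorm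
  have hvm : AEMeasurable (fun x => ‖v x‖ₑ) ν := hv.1.enorm
  set D : ℕ → ℝ≥0∞ := fun n => ∫⁻ x, ‖u n x - v x‖ₑ ^ 4 ∂ν with hD
  refine tendsto_zero_of_pow_four_le (b := fun n => (D n * ν Set.univ) *
    (2 * (16 * D n + 36 * A)) ^ 2) (fun n => ?_) ?_
  · have h1 : ∀ x, ‖(‖u n x‖ : ℂ) ^ 2 * u n x - (‖v x‖ : ℂ) ^ 2 * v x‖ₑ ≤
        ‖u n x - v x‖ₑ * (4 * ‖u n x - v x‖ₑ ^ 2 + 6 * ‖v x‖ₑ ^ 2) := fun x => by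
      have := ENNReal.ofReal_le_ofReal (norm_cube_sub_le (u n x) (v x))
      rw [ofReal_norm, ENNReal.ofReal_mul (norm_nonneg _), ofReal_norm,
        ENNReal.ofReal_add (by positivity) (by positivity), ENNReal.ofReal_mul (by norm_num),
        ENNReal.ofReal_mul (by norm_num), ENNReal.ofReal_pow (norm_nonneg _),
        ENNReal.ofReal_pow (norm_nonneg _), ofReal_norm, ofReal_norm] at this
      simpa using this
    have h2 : (∫⁻ x, ‖u n x - v x‖ₑ * (4 * ‖u n x - v x‖ₑ ^ 2 + 6 * ‖v x‖ₑ ^ 2) ∂ν) ^ 2 ≤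
        (∫⁻ x, ‖u n x - v x‖ₑ ^ 2 ∂ν) *
          ∫⁻ x, (4 * ‖u n x - v x‖ₑ ^ 2 + 6 * ‖v x‖ₑ ^ 2) ^ 2 ∂ν :=
      lintegral_mul_sq_le (hdm n) ((((hdm n).pow_const 2).const_mul 4).add
        ((hvm.pow_const 2).const_mul 6))
    have h3 : ∫⁻ x, (4 * ‖u n x - v x‖ₑ ^ 2 + 6 * ‖v x‖ₑ ^ 2) ^ 2 ∂ν ≤
        2 * (16 * D n + 36 * A) := by
      calc _ ≤ ∫⁻ x, (2 * ((16 * ‖u n x - v x‖ₑ ^ 4) + 36 * ‖v x‖ₑ ^ 4)) ∂ν := by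
            refine lintegral_mono fun x => (ennreal_add_sq_le _ _).trans_eq ?_
            ring
        _ = _ := by
            rw [lintegral_const_mul' _ _ (by norm_num), lintegral_add_right' _
              ((hvm.pow_const 4).const_mul 36), lintegral_const_mul' _ _ (by norm_num),
              lintegral_const_mul' _ _ (by norm_num)]
    calc _ ≤ (∫⁻ x, ‖u n x - v x‖ₑ * (4 * ‖u n x - v x‖ₑ ^ 2 + 6 * ‖v x‖ₑ ^ 2) ∂ν) ^ 4 := by
          gcongr; exact h1 _
      _ = ((∫⁻ x, ‖u n x - v x‖ₑ * (4 * ‖u n x - v x‖ₑ ^ 2 + 6 * ‖v x‖ₑ ^ 2) ∂ν) ^ 2) ^ 2 := by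
          ring
      _ ≤ ((∫⁻ x, ‖u n x - v x‖ₑ ^ 2 ∂ν) * (2 * (16 * D n + 36 * A))) ^ 2 := by
          gcongr; exact h2.trans (by gcongr)
      _ = (∫⁻ x, ‖u n x - v x‖ₑ ^ 2 ∂ν) ^ 2 * (2 * (16 * D n + 36 * A)) ^ 2 := by ring
      _ ≤ _ := by gcongr; exact lintegral_sq_sq_le (hdm n)
  · have t1 : Filter.Tendsto (fun n => D n * ν Set.univ) Filter.atTop (nhds 0) := by
      have := ENNReal.Tendsto.mul_const (b := ν Set.univ) h (Or.inr (by finiteness))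
      simpa using this
    have t2 : Filter.Tendsto (fun n => (2 * (16 * D n + 36 * A)) ^ 2) Filter.atTop
        (nhds ((2 * (16 * 0 + 36 * A)) ^ 2)) := by
      refine ENNReal.Tendsto.pow (ENNReal.Tendsto.const_mul ?_ (Or.inr (by norm_num)))
      exact (ENNReal.Tendsto.const_mul h (Or.inr (by norm_num))).add_const _
    have := ENNReal.Tendsto.mul t1 (Or.inr (by finiteness)) t2 (Or.inr (by norm_num))
    simpa using this

end

/-! ### Test functions against the Gaussian weight -/

/-- A test function in coordinates. -/
def flat (φ : 𝓢(Plane, ℂ)) (q : ℝ × ℝ) : ℂ := φ !₂[q.1, q.2]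

theorem continuous_flat (φ : 𝓢(Plane, ℂ)) : Continuous (flat φ) :=
  φ.continuous.comp continuous_planePoint

theorem integrable_flat (φ : 𝓢(Plane, ℂ)) : Integrable (flat φ) := integrable_testFunction φ

theorem osc_flat (φ : 𝓢(Plane, ℂ)) (ζ : ℝ × ℝ) : osc (flat φ) ζ = hat φ ζ := by
  rw [hat_eq_integral, osc]
  refine integral_congr_ae (.of_forall fun q => ?_)
  simp only
  rw [dot_comm]; rfl

/-- The Gaussian is bounded below on compact sets, so convergence in the weighted measure implies
convergence against test functions. -/
theorem exists_norm_flat_le {φ : 𝓢(Plane, ℂ)} (hφ : HasCompactSupport φ) : ∃ C : ℝ, 0 ≤ C ∧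
    ∀ q, ‖flat φ q‖ ≤ C * gau q ^ 2 := by
  have hc : Continuous fun x : Plane => (((gau (x 0, x 1) ^ 2)⁻¹ : ℝ) : ℂ) * φ x := by
    have := φ.continuous
    have h1 : Continuous fun x : Plane => gau (x 0, x 1) ^ 2 := by fun_prop
    exact (Complex.continuous_ofReal.comp (h1.inv₀ fun x => (pow_pos (gau_pos _) 2).ne')).mul this
  obtain ⟨C, hC⟩ := (hφ.mul_left (f := fun x : Plane => (((gau (x 0, x 1) ^ 2)⁻¹ : ℝ) : ℂ))).exists_bound_of_continuous hc
  refine ⟨C, (norm_nonneg _).trans (hC 0), fun q => ?_⟩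
  have h := hC !₂[q.1, q.2]
  have hg := gau_pos q
  rw [Pi.mul_apply, norm_mul, Complex.norm_real] at h
  have e : gau ((!₂[q.1, q.2] : Plane) 0, (!₂[q.1, q.2] : Plane) 1) = gau q := rfl
  rw [e, Real.norm_of_nonneg (by positivity), inv_mul_le_iff₀ (by positivity)] at h
  rw [flat, mul_comm]; exact h

/-- Convergence of integrals against a function dominated by a density. -/
theorem tendsto_integral_mul {X : Type*} [MeasurableSpace X] {μ : Measure X} {u : ℕ → X → ℂ}
    {v χ : X → ℂ} (hu : ∀ n, Integrable (fun x => u n x * χ x) μ)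
    (hv : AEStronglyMeasurable (fun x => v x * χ x) μ)
    (h : Filter.Tendsto (fun n => ∫⁻ x, ‖u n x - v x‖ₑ * ‖χ x‖ₑ ∂μ) Filter.atTop (nhds 0)) :
    Integrable (fun x => v x * χ x) μ ∧
      Filter.Tendsto (fun n => ∫ x, u n x * χ x ∂μ) Filter.atTop (nhds (∫ x, v x * χ x ∂μ)) := by
  have e : ∀ n, ∫⁻ x, ‖u n x * χ x - v x * χ x‖ₑ ∂μ = ∫⁻ x, ‖u n x - v x‖ₑ * ‖χ x‖ₑ ∂μ :=
    fun n => by simp_rw [← sub_mul, enorm_mul]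
  have hvi : Integrable (fun x => v x * χ x) μ := by
    obtain ⟨n, hn⟩ := (h.eventually (gt_mem_nhds zero_lt_one)).exists
    have h1 : Integrable (fun x => u n x * χ x - v x * χ x) μ :=
      ⟨(hu n).1.sub hv, by rw [HasFiniteIntegral, e]; exact hn.trans (by finiteness)⟩
    have := (hu n).sub h1
    refine this.congr (.of_forall fun x => ?_)
    simp
  refine ⟨hvi, tendsto_integral_of_L1 _ hvi.1 (.of_forall hu) ?_⟩
  simp_rw [e]
  exact h

/-! ### Pairing of a Sobolev function with a test function -/

theorem exists_sobolevWeight_le_pow (s : ℝ) : ∃ m : ℕ, ∀ η : ℝ,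
    (1 + η ^ 2) ^ (-s / 2) ≤ (1 + |η|) ^ m := by
  obtain ⟨m, hm⟩ := exists_nat_ge |s|
  refine ⟨m, fun η => ?_⟩
  have hb := bracket_pos η
  have a1 : 1 ≤ 1 + η ^ 2 := by nlinarith [sq_nonneg η]
  have a2 : 1 + η ^ 2 ≤ (1 + |η|) ^ (2 : ℝ) := by
    rw [Real.rpow_two]
    nlinarith [sq_abs η, abs_nonneg η]
  calc (1 + η ^ 2) ^ (-s / 2) ≤ (1 + η ^ 2) ^ (|s| / 2) :=
        Real.rpow_le_rpow_of_exponent_le a1 (by linarith [neg_abs_le s])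
    _ ≤ ((1 + |η|) ^ (2 : ℝ)) ^ (|s| / 2) := by gcongr
    _ = (1 + |η|) ^ |s| := by rw [← Real.rpow_mul hb.le]; congr 1; ring
    _ ≤ (1 + |η|) ^ (m : ℝ) := Real.rpow_le_rpow_of_exponent_le (one_le_bracket η) hm
    _ = _ := Real.rpow_natCast _ _

theorem memLp_bracket_inv : MemLp (fun η : ℝ => (1 + |η|)⁻¹) 2 volume := by
  rw [memLp_two_iff_integrable_sq (by fun_prop)]
  refine (integrable_one_add_norm (E := ℝ) (μ := volume) (r := 2) (by norm_num)).congr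
    (.of_forall fun η => ?_)
  simp only [Real.norm_eq_abs]
  rw [Real.rpow_neg (bracket_pos η).le, inv_pow]
  norm_cast

theorem memLp_sobolevWeight_mul_of_le {s : ℝ} {m : ℕ} (hm : ∀ η : ℝ,
    (1 + η ^ 2) ^ (-s / 2) ≤ (1 + |η|) ^ m) {f : ℝ → ℂ} (hf : Measurable f) {C : ℝ}
    (h : ∀ η, ‖f η‖ ≤ C * ((1 + |η|) ^ (m + 1))⁻¹) :
    MemLp (fun η : ℝ => (((1 + η ^ 2) ^ (-s / 2) : ℝ) : ℂ) * f η) 2 volume := by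
  refine MemLp.of_le_mul (c := C) memLp_bracket_inv
    (Measurable.aestronglyMeasurable (by fun_prop)) (.of_forall fun η => ?_)
  have hb := bracket_pos η
  rw [norm_mul, Complex.norm_real, Real.norm_of_nonneg (by positivity),
    Real.norm_of_nonneg (by positivity)]
  calc _ ≤ (1 + |η|) ^ m * (C * ((1 + |η|) ^ (m + 1))⁻¹) := by
        gcongr
        · exact hm η
        · exact h η
    _ = _ := by rw [pow_succ, mul_inv]; field_simp

theorem memLp_sobolevWeight_mul (s : ℝ) (χ : 𝓢(ℝ, ℂ)) :
    MemLp (fun η : ℝ => (((1 + η ^ 2) ^ (-s / 2) : ℝ) : ℂ) * χ η) 2 volume := by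
  obtain ⟨m, hm⟩ := exists_sobolevWeight_le_pow s
  obtain ⟨C, hC, h⟩ := χ.exists_norm_le_bracket (m + 1)
  exact memLp_sobolevWeight_mul_of_le hm χ.continuous.measurable h

/-- The pairing of the distribution with weighted Fourier transform `g` with `χ`. -/
def sobolevPairing (s : ℝ) (χ : 𝓢(ℝ, ℂ)) : L2L →L[ℂ] ℂ :=
  (ContinuousLinearMap.mul ℂ ℂ).lpPairing volume 2 2
    ((memLp_sobolevWeight_mul s (𝓕⁻ χ)).toLp _)

theorem sobolevPairing_apply (s : ℝ) (χ : 𝓢(ℝ, ℂ)) (g : L2L) :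
    sobolevPairing s χ g = ∫ η, ((1 + η ^ 2) ^ (-s / 2) : ℝ) * g η * (𝓕⁻ χ) η := by
  rw [sobolevPairing, ContinuousLinearMap.lpPairing_eq_integral]
  refine integral_congr_ae ?_
  filter_upwards [MemLp.coeFn_toLp (memLp_sobolevWeight_mul s (𝓕⁻ χ))] with η hη
  rw [hη, ContinuousLinearMap.mul_apply']
  ring

theorem sobolevIso_symm_eq_pairing {s : ℝ} (g : L2L) (χ : 𝓢(ℝ, ℂ)) :
    ((sobolevIso s).symm g).toDistribution χ = sobolevPairing s χ g := by
  rw [sobolevIso_symm_toDistribution, sobolevPairing_apply]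

theorem eq_zero_of_sobolevPairing_eq_zero {s : ℝ} {g : L2L}
    (h : ∀ χ : 𝓢(ℝ, ℂ), HasCompactSupport χ → sobolevPairing s χ g = 0) : g = 0 := by
  obtain ⟨m, hm⟩ := exists_sobolevWeight_le_pow s
  have hgm : Measurable g := (Lp.stronglyMeasurable g).measurable
  have hM : MemLp (fun η : ℝ => (((1 + η ^ 2) ^ (-s / 2) : ℝ) : ℂ) *
      ((((1 + |η|) ^ (m + 1))⁻¹ : ℝ) : ℂ)) 2 volume :=
    memLp_sobolevWeight_mul_of_le (C := 1) hm (by fun_prop) fun η => by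
      have := bracket_pos η
      rw [Complex.norm_real, Real.norm_of_nonneg (by positivity), one_mul]
  have hz := ae_eq_zero_of_integral_mul_fourierInv_eq_zero (m := m + 1)
    (F := fun η => ((1 + η ^ 2) ^ (-s / 2) : ℝ) * g η) (by fun_prop)
    (((Lp.memLp g).integrable_mul hM).congr (.of_forall fun η => by
      simp only [Pi.mul_apply]; ring))
    fun χ hχ => by rw [← sobolevPairing_apply, h χ hχ]
  refine Lp.ext ?_
  filter_upwards [hz, Lp.coeFn_zero ℂ 2 (volume : Measure ℝ)] with η h1 h2
  rw [h2, Pi.zero_apply]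
  have hne : (((1 + η ^ 2) ^ (-s / 2) : ℝ) : ℂ) ≠ 0 := by
    have : (0 : ℝ) < (1 + η ^ 2) ^ (-s / 2) := by positivity
    exact_mod_cast this.ne'
  exact (mul_eq_zero.mp h1).resolve_left hne

theorem integral_osc_slice {f : ℝ × ℝ → ℂ} (hf : Integrable f) (t : ℝ) (χ : 𝓢(ℝ, ℂ)) :
    ∫ x, osc f (x, t) * χ x = ∫ ζ, f ζ * e2 (t * ζ.2) * (𝓕⁻ χ) ζ.1 := by
  have hi : Integrable (Function.uncurry fun (x : ℝ) (ζ : ℝ × ℝ) => e2 (dot (x, t) ζ) * f ζ * χ x)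
      (volume.prod volume) := by
    have h2 : AEStronglyMeasurable (fun z : ℝ × (ℝ × ℝ) => e2 (dot (z.1, t) z.2))
        (volume.prod volume) := Continuous.aestronglyMeasurable (by unfold dot; fun_prop)
    refine ((χ.integrable.mul_prod hf).bdd_mul (c := 1) h2 (.of_forall fun _ => (norm_e2 _).le)).congr
      (.of_forall fun z => ?_)
    simp only [Function.uncurry]; ring
  calc _ = ∫ x, ∫ ζ, e2 (dot (x, t) ζ) * f ζ * χ x := by
        simp_rw [integral_mul_const]; rfl
    _ = ∫ ζ, ∫ x, e2 (dot (x, t) ζ) * f ζ * χ x := integral_integral_swap hi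
    _ = _ := by
        refine integral_congr_ae (.of_forall fun ζ => ?_)
        simp only
        rw [SchwartzMap.fourierInv_coe, fourierInv_eq_e2, ← integral_const_mul]
        refine integral_congr_ae (.of_forall fun x => ?_)
        simp only [dot]
        rw [e2_add, mul_comm x]; ring

namespace FlowOps

variable {α β s b b' : ℝ} (F : FlowOps α β s b b')

/-- For integrable coefficients the trace operator is true restriction to time t, by Fubini; other
coefficients are reached in the limit. -/
theorem integral_osc_slice_eq_pairing {h : L2P} (hi : Integrable (coef (phase α β) s b h)) (t : ℝ)
    (χ : 𝓢(ℝ, ℂ)) :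
    ∫ x, osc (coef (phase α β) s b h) (x, t) * χ x = sobolevPairing s χ (F.ev t h) := by
  rw [integral_osc_slice hi, sobolevPairing_apply]
  obtain ⟨C, hC⟩ : ∃ C, ∀ η, ‖(𝓕⁻ χ) η‖ ≤ C :=
    ⟨_, fun η => (𝓕⁻ χ).toBoundedContinuousFunction.norm_coe_le_norm η⟩
  have hc := (𝓕⁻ χ).continuous
  have hint : Integrable fun ζ : ℝ × ℝ => coef (phase α β) s b h ζ * e2 (t * ζ.2) * (𝓕⁻ χ) ζ.1 := by
    refine (hi.mul_bdd (c := 1) (Continuous.aestronglyMeasurable (by fun_prop))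
      (.of_forall fun _ => (norm_e2 _).le)).mul_bdd (c := C)
      (Continuous.aestronglyMeasurable (by fun_prop)) (.of_forall fun _ => hC _)
  refine (integral_prod (μ := (volume : Measure ℝ)) (ν := (volume : Measure ℝ)) _ hint).trans ?_
  refine integral_congr_ae ?_
  filter_upwards [F.ev_ae t h] with η hη
  rw [hη, ← integral_const_mul, ← integral_mul_const]
  refine integral_congr_ae (.of_forall fun τ => ?_)
  simp only
  have e : (wt (phase α β) (-s) (-b) (η, τ)) = (1 + η ^ 2) ^ (-s / 2) * mdl (phase α β) (-b) (η, τ) := rfl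
  rw [coef_eq_mul, e]
  push_cast
  ring

end FlowOps

/-! ### The function on space-time with a given weighted Fourier coefficient -/

theorem lintegral_gauMeasure_prod {f : ℝ × ℝ → ℝ≥0∞} (hf : Measurable f) :
    ∫⁻ q, f q ∂gauMeasure = ∫⁻ t, ∫⁻ x, ENNReal.ofReal (gau (x, t)) ^ 2 * f (x, t) := by
  rw [lintegral_gauMeasure, Measure.volume_eq_prod, lintegral_prod_symm _ (by fun_prop)]

theorem exists_norm_le_gau_slice {χ : 𝓢(ℝ, ℂ)} (hχ : HasCompactSupport χ) (t : ℝ) : ∃ C : ℝ, 0 ≤ C ∧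
    ∀ x, ‖χ x‖ ≤ C * gau (x, t) ^ 2 := by
  have hc : Continuous fun x : ℝ => (((gau (x, t) ^ 2)⁻¹ : ℝ) : ℂ) * χ x := by
    have := χ.continuous
    have h1 : Continuous fun x : ℝ => gau (x, t) ^ 2 := by fun_prop
    exact (Complex.continuous_ofReal.comp (h1.inv₀ fun x => (pow_pos (gau_pos _) 2).ne')).mul this
  obtain ⟨C, hC⟩ := (hχ.mul_left
    (f := fun x : ℝ => (((gau (x, t) ^ 2)⁻¹ : ℝ) : ℂ))).exists_bound_of_continuous hc
  refine ⟨C, (norm_nonneg _).trans (hC 0), fun x => ?_⟩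
  have h := hC x
  have hg := gau_pos (x, t)
  rw [Pi.mul_apply, norm_mul, Complex.norm_real, Real.norm_of_nonneg (by positivity),
    inv_mul_le_iff₀ (by positivity)] at h
  rw [mul_comm]; exact h

/-- On a compact set the Gaussian density is bounded below, so weighted L⁴ gives L⁴ and hence L³
there. -/
theorem memLp_three_of_gauMeasure {v : ℝ × ℝ → ℂ} (hv : Measurable v) (hv4 : MemLp v 4 gauMeasure)
    {K : Set Plane} (hK : IsCompact K) :
    MemLp (fun p : Plane => v (p 0, p 1)) 3 (volume.restrict K) := by
  have hpe : Measurable fun p : Plane => (p 0, p 1) := planeEquiv.measurable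
  have : IsFiniteMeasure (volume.restrict K) := ⟨by
    rw [Measure.restrict_apply_univ]; exact hK.measure_lt_top⟩
  suffices MemLp (fun p : Plane => v (p 0, p 1)) 4 (volume.restrict K) from
    this.mono_exponent (by norm_num)
  refine ⟨(hv.comp hpe).aestronglyMeasurable, ?_⟩
  obtain ⟨c, hc0, hc⟩ : ∃ c : ℝ, 0 < c ∧ ∀ p ∈ K, c ≤ gau (p 0, p 1) := by
    rcases K.eq_empty_or_nonempty with rfl | hne
    · exact ⟨1, one_pos, by simp⟩
    · obtain ⟨p₀, -, h0⟩ := hK.exists_isMinOn hne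
        (f := fun p : Plane => gau (p 0, p 1)) (Continuous.continuousOn (by fun_prop))
      exact ⟨_, gau_pos _, fun p hp => h0 hp⟩
  have hfin : ∫⁻ p in K, ‖v (p 0, p 1)‖ₑ ^ 4 < ∞ := by
    have h1 : ENNReal.ofReal c ^ 2 * ∫⁻ p in K, ‖v (p 0, p 1)‖ₑ ^ 4 ≤
        ∫⁻ q, ‖v q‖ₑ ^ 4 ∂gauMeasure := by
      rw [lintegral_gauMeasure, ← lintegral_const_mul' _ _ (by finiteness)]
      calc _ ≤ ∫⁻ p in K, ENNReal.ofReal (gau (p 0, p 1)) ^ 2 * ‖v (p 0, p 1)‖ₑ ^ 4 := by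
            refine setLIntegral_mono' hK.measurableSet fun p hp => ?_
            gcongr
            exact hc p hp
        _ ≤ ∫⁻ p : Plane, ENNReal.ofReal (gau (p 0, p 1)) ^ 2 * ‖v (p 0, p 1)‖ₑ ^ 4 :=
            setLIntegral_le_lintegral _ _
        _ = _ := (measurePreserving_planeEquiv.lintegral_comp
            (f := fun q => ENNReal.ofReal (gau q) ^ 2 * ‖v q‖ₑ ^ 4) (by fun_prop))
    rw [← eLpNorm_four_pow v] at h1
    have h2 : ENNReal.ofReal c ^ 2 * ∫⁻ p in K, ‖v (p 0, p 1)‖ₑ ^ 4 ≠ ∞ := by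
      have := hv4.2
      exact (h1.trans_lt (by finiteness)).ne
    have h3 : ENNReal.ofReal c ^ 2 ≠ 0 := by simp [hc0]
    by_contra hcon
    rw [not_lt, top_le_iff] at hcon
    rw [hcon, ENNReal.mul_top h3] at h2
    exact h2 rfl
  rw [← eLpNorm_four_pow] at hfin
  by_contra hcon
  rw [not_lt, top_le_iff] at hcon
  simp [hcon] at hfin

namespace FlowOps

variable {α β s b b' : ℝ} (F : FlowOps α β s b b')

theorem pairing_eq_integral_osc {h : L2P} (hi : Integrable (coef (phase α β) s b h))
    (φ : 𝓢(Plane, ℂ)) :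
    pairing α β s b φ h = ∫ q, osc (coef (phase α β) s b h) q * flat φ q := by
  rw [pairing_apply, integral_osc_mul hi (integrable_flat φ)]
  simp_rw [osc_flat]

theorem pairing_cubic_eq_integral_osc {h : L2P} (hi : Integrable (coef (phase α β) s b h))
    (φ : 𝓢(Plane, ℂ)) : pairing α β s b' φ (F.cubic h) =
      ∫ q, ((‖osc (coef (phase α β) s b h) q‖ : ℂ) ^ 2 * osc (coef (phase α β) s b h) q) *
        flat φ q := by
  have hm := measurable_coef (measurable_phase α β) s b (measurable_lp h)
  simp_rw [← osc_cubicInt hm hi]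
  rw [pairing_apply, integral_osc_mul (integrable_cubicInt hm hi) (integrable_flat φ)]
  simp_rw [osc_flat]
  refine integral_congr_ae ?_
  filter_upwards [F.cubic_ae h] with ζ hζ
  rw [coef, hζ, mul_div_cancel_left₀]
  exact_mod_cast wt_ne_zero _ _ _ _

/-- The function with weighted Fourier coefficient `h`, its cube, and its traces. -/
theorem exists_physical (hβ : β ≠ 0) (hs : -(1 / 4) < s) (hb : 1 / 2 < b) (h : L2P) :
    ∃ v : Plane → ℂ, (∀ K, IsCompact K → MemLp v 3 (volume.restrict K)) ∧
      (∀ φ : 𝓢(Plane, ℂ), HasCompactSupport φ → pairing α β s b φ h = ∫ p, v p * φ p) ∧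
      (∀ φ : 𝓢(Plane, ℂ), HasCompactSupport φ →
        pairing α β s b' φ (F.cubic h) = ∫ p, ((‖v p‖ : ℂ) ^ 2 * v p) * φ p) ∧
      ∀ᵐ t : ℝ, ∀ χ : 𝓢(ℝ, ℂ), HasCompactSupport χ →
        sobolevPairing s χ (F.ev t h) = ∫ x : ℝ, v !₂[x, t] * χ x := by
  obtain ⟨g, v, hg, hgi, hvm, hv4, hgv⟩ := exists_osc_limit α hβ hs hb h
  set u : ℕ → ℝ × ℝ → ℂ := fun n => osc (coef (phase α β) s b (g n)) with hu
  have huc : ∀ n, Continuous (u n) := fun n => continuous_osc (hgi n)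
  have hpow : ∀ n, ∫⁻ q, ‖u n q - v q‖ₑ ^ 4 ∂gauMeasure ≤ 2⁻¹ ^ n := fun n => by
    rw [← eLpNorm_four_pow (fun q => u n q - v q)]
    refine (pow_le_of_le_one zero_le ((hgv n).trans ?_) (by norm_num)).trans (hgv n)
    exact pow_le_one₀ zero_le (by norm_num)
  have htend : Filter.Tendsto (fun n => ∫⁻ q, ‖u n q - v q‖ₑ ^ 4 ∂gauMeasure) Filter.atTop (nhds 0) :=
    tendsto_of_tendsto_of_tendsto_of_le_of_le tendsto_const_nhds
      (ENNReal.tendsto_pow_atTop_nhds_zero_of_lt_one (by norm_num)) (fun _ => zero_le) hpow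
  have hum : ∀ n, AEStronglyMeasurable (u n) gauMeasure := fun n => (huc n).aestronglyMeasurable
  have hweight : ∀ φ : 𝓢(Plane, ℂ), HasCompactSupport φ → ∀ d : ℕ → ℝ × ℝ → ℂ,
      Filter.Tendsto (fun n => ∫⁻ q, ‖d n q‖ₑ ∂gauMeasure) Filter.atTop (nhds 0) →
      Filter.Tendsto (fun n => ∫⁻ q, ‖d n q‖ₑ * ‖flat φ q‖ₑ) Filter.atTop (nhds 0) := by
    intro φ hφ d hd
    obtain ⟨C, hC, hb⟩ := exists_norm_flat_le hφ
    have h1 := ENNReal.Tendsto.const_mul (a := ENNReal.ofReal C) hd (Or.inr (by finiteness))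
    rw [mul_zero] at h1
    refine tendsto_of_tendsto_of_tendsto_of_le_of_le tendsto_const_nhds h1 (fun _ => zero_le)
      fun n => ?_
    simp only
    rw [lintegral_gauMeasure, ← lintegral_const_mul' _ _ (by finiteness)]
    refine lintegral_mono fun q => ?_
    have h2 := ENNReal.ofReal_le_ofReal (hb q)
    rw [ofReal_norm, ENNReal.ofReal_mul hC, ENNReal.ofReal_pow (gau_pos q).le] at h2
    calc _ ≤ ‖d n q‖ₑ * (ENNReal.ofReal C * ENNReal.ofReal (gau q) ^ 2) := by gcongr
      _ = _ := by ring
  have hbdd : ∀ n, ∃ B, ∀ q, ‖u n q‖ ≤ B := fun n => ⟨_, fun q => norm_osc_le _ q⟩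
  refine ⟨fun p => v (p 0, p 1), fun K hK => memLp_three_of_gauMeasure hvm hv4 hK,
    fun φ hφ => ?_, fun φ hφ => ?_, ?_⟩
  · have hfm := (continuous_flat φ).measurable
    obtain ⟨-, hl⟩ := tendsto_integral_mul (μ := volume) (u := u) (v := v) (χ := flat φ)
      (fun n => by
        obtain ⟨B, hB⟩ := hbdd n
        exact (integrable_flat φ).bdd_mul (c := B) (huc n).aestronglyMeasurable (.of_forall hB))
      (by fun_prop) (hweight φ hφ (fun n q => u n q - v q) (tendsto_lintegral_sub hum hv4.1 htend))
    rw [integral_plane]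
    refine tendsto_nhds_unique ?_ hl
    simp_rw [hu, ← pairing_eq_integral_osc (hgi _)]
    exact ((pairing α β s b φ).continuous.tendsto h).comp hg
  · have hfm := (continuous_flat φ).measurable
    obtain ⟨-, hl⟩ := tendsto_integral_mul (μ := volume) (u := fun n q => (‖u n q‖ : ℂ) ^ 2 * u n q)
      (v := fun q => (‖v q‖ : ℂ) ^ 2 * v q) (χ := flat φ)
      (fun n => by
        obtain ⟨B, hB⟩ := hbdd n
        have := huc n
        refine (integrable_flat φ).bdd_mul (c := B ^ 2 * B)
          (Continuous.aestronglyMeasurable (by fun_prop)) (.of_forall fun q => ?_)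
        rw [norm_mul, norm_pow, Complex.norm_real, norm_norm]
        have := (norm_nonneg _).trans (hB q)
        gcongr <;> exact hB q)
      (by fun_prop) (hweight φ hφ _ (tendsto_lintegral_cube_sub hum hv4 htend))
    rw [integral_plane]
    refine tendsto_nhds_unique ?_ hl
    simp_rw [hu, ← F.pairing_cubic_eq_integral_osc (hgi _)]
    exact ((pairing α β s b' φ).continuous.tendsto _).comp ((F.continuous_cubic.tendsto h).comp hg)
  -- The error on the slice at time t, in the fourth power of the weighted L⁴ norm.
  · set D : ℕ → ℝ → ℝ≥0∞ := fun n t =>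
      ∫⁻ x, ENNReal.ofReal (gau (x, t)) ^ 2 * ‖u n (x, t) - v (x, t)‖ₑ ^ 4 with hD
    have hDm : ∀ n, Measurable (D n) := fun n => by
      have := (huc n).measurable
      have hm : Measurable fun z : ℝ × ℝ => ENNReal.ofReal (gau (z.2, z.1)) ^ 2 *
        ‖u n (z.2, z.1) - v (z.2, z.1)‖ₑ ^ 4 := by fun_prop
      exact hm.lintegral_prod_right'
    have hDi : ∀ n, ∫⁻ t, D n t ≤ 2⁻¹ ^ n := fun n => by
      have := (huc n).measurable
      refine le_trans (le_of_eq ?_) (hpow n)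
      rw [lintegral_gauMeasure_prod (by fun_prop)]
    -- The integrals of the slice errors are summable, so for almost every t the errors themselves
    -- are summable and tend to 0.
    have hsum : ∀ᵐ t, Filter.Tendsto (fun n => D n t) Filter.atTop (nhds 0) := by
      have h1 : ∫⁻ t, ∑' n, D n t ≠ ∞ := by
        rw [lintegral_tsum fun n => (hDm n).aemeasurable]
        refine ne_top_of_le_ne_top ?_ (ENNReal.tsum_le_tsum hDi)
        rw [ENNReal.tsum_geometric]
        norm_num
      filter_upwards [ae_lt_top (Measurable.tsum hDm) h1] with t ht
      exact ENNReal.tendsto_atTop_zero_of_tsum_ne_top ht.ne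
    filter_upwards [hsum] with t ht χ hχ
    obtain ⟨C, hC, hb⟩ := exists_norm_le_gau_slice hχ t
    set ν : Measure ℝ := volume.withDensity fun x => ENNReal.ofReal (gau (x, t)) ^ 2 with hν
    have hνi : ∀ f : ℝ → ℝ≥0∞, ∫⁻ x, f x ∂ν = ∫⁻ x, ENNReal.ofReal (gau (x, t)) ^ 2 * f x :=
      fun f => by
        rw [hν, lintegral_withDensity_eq_lintegral_mul_non_measurable _ (by fun_prop)
          (.of_forall fun q => by finiteness)]
        rfl
    have hfin : IsFiniteMeasure ν := by
      refine ⟨?_⟩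
      rw [← lintegral_one, hνi]
      have h0 : Integrable fun x : ℝ => Real.exp (-Real.pi * x ^ 2) :=
        integrable_exp_neg_mul_sq Real.pi_pos
      refine lt_of_le_of_lt (lintegral_mono fun x => ?_) h0.lintegral_lt_top
      rw [mul_one]
      refine (pow_le_of_le_one zero_le (ENNReal.ofReal_le_one.mpr (gau_le_one _)) two_ne_zero).trans ?_
      refine ENNReal.ofReal_le_ofReal ?_
      refine mul_le_of_le_one_right (Real.exp_pos _).le (Real.exp_le_one_iff.mpr ?_)
      have := Real.pi_pos
      simp only
      nlinarith [sq_nonneg t]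
    have huct : ∀ n, Continuous fun x => u n (x, t) := fun n => (huc n).comp (by fun_prop)
    have hvmt : Measurable fun x => v (x, t) := hvm.comp (by fun_prop)
    have hχc := χ.continuous
    have h1 : Filter.Tendsto (fun n => ∫⁻ x, ‖u n (x, t) - v (x, t)‖ₑ ∂ν) Filter.atTop (nhds 0) := by
      refine tendsto_lintegral_sub (fun n => (huct n).aestronglyMeasurable)
        hvmt.aestronglyMeasurable ?_
      simp_rw [hνi]
      exact ht
    have h2 : Filter.Tendsto (fun n => ∫⁻ x, ‖u n (x, t) - v (x, t)‖ₑ * ‖χ x‖ₑ) Filter.atTop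
        (nhds 0) := by
      have h1 := ENNReal.Tendsto.const_mul (a := ENNReal.ofReal C) h1 (Or.inr (by finiteness))
      rw [mul_zero] at h1
      refine tendsto_of_tendsto_of_tendsto_of_le_of_le tendsto_const_nhds h1 (fun _ => zero_le)
        fun n => ?_
      simp only
      rw [hνi, ← lintegral_const_mul' _ _ (by finiteness)]
      refine lintegral_mono fun x => ?_
      have h2 := ENNReal.ofReal_le_ofReal (hb x)
      rw [ofReal_norm, ENNReal.ofReal_mul hC, ENNReal.ofReal_pow (gau_pos _).le] at h2
      calc _ ≤ ‖u n (x, t) - v (x, t)‖ₑ * (ENNReal.ofReal C * ENNReal.ofReal (gau (x, t)) ^ 2) := by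
            gcongr
        _ = _ := by ring
    obtain ⟨-, hl⟩ := tendsto_integral_mul (μ := volume) (u := fun n x => u n (x, t))
      (v := fun x => v (x, t)) (χ := χ)
      (fun n => by
        obtain ⟨B, hB⟩ := hbdd n
        exact χ.integrable.bdd_mul (c := B) (huct n).aestronglyMeasurable (.of_forall fun x => hB _))
      (by have := hχc.measurable; fun_prop) h2
    refine tendsto_nhds_unique ?_ hl
    simp_rw [hu, F.integral_osc_slice_eq_pairing (hgi _)]
    exact (((sobolevPairing s χ).comp (F.ev t)).continuous.tendsto h).comp hg

end FlowOps

/-! ### The weak linear equation and uniqueness of its traces. -/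

/-! ### The equations solved by the free evolution and the Duhamel integral -/

theorem ae_integrable_of_triple {J : (ℝ × ℝ) × ℝ → ℂ} (hJ : Integrable J (volume.prod volume)) :
    (∀ᵐ η, Integrable (fun z : ℝ × ℝ => J ((η, z.1), z.2)) (volume.prod volume)) ∧
    ∫ ζ, ∫ τ', J (ζ, τ') = ∫ η, ∫ τ', ∫ τ, J ((η, τ), τ') := by
  have hmp : MeasurePreserving (MeasurableEquiv.prodAssoc.symm : ℝ × ℝ × ℝ ≃ᵐ (ℝ × ℝ) × ℝ)
      (volume.prod (volume.prod volume)) ((volume.prod volume).prod volume) :=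
    (measurePreserving_prodAssoc _ _ _).symm
  have h1 : Integrable (fun x : ℝ × ℝ × ℝ => J ((x.1, x.2.1), x.2.2))
      (volume.prod (volume.prod volume)) :=
    (hmp.integrable_comp_emb (MeasurableEquiv.measurableEmbedding _)).mpr hJ
  refine ⟨h1.prod_right_ae, ?_⟩
  calc _ = ∫ q, J q ∂(volume.prod volume) := (integral_prod _ hJ).symm
    _ = ∫ x : ℝ × ℝ × ℝ, J ((x.1, x.2.1), x.2.2) ∂(volume.prod (volume.prod volume)) :=
        (hmp.integral_comp' _).symm
    _ = ∫ η, ∫ z : ℝ × ℝ, J ((η, z.1), z.2) ∂(volume.prod volume) := integral_prod _ h1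
    _ = _ := by
        refine integral_congr_ae ?_
        filter_upwards [h1.prod_right_ae] with η hη
        exact integral_prod_symm _ hη

theorem IsTestOn.mono {T T' : ℝ} (h : T ≤ T') {φ : 𝓢(Plane, ℂ)} (hφ : IsTestOn T φ) :
    IsTestOn T' φ :=
  ⟨hφ.1, hφ.2.trans fun p hp => ⟨by linarith [hp.1], by linarith [hp.2]⟩⟩

theorem integral_cutoffHat_scaled {T : ℝ} (hT : 0 < T) (q : ℝ) :
    ∫ τ, (T : ℂ) * cutoffHat (T * (τ - q)) = 1 := by
  have := integral_e2_mul_cutoffHat_scaled hT 0 q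
  simp only [zero_mul, e2_zero, one_mul, zero_div] at this
  rw [this, cutoff_eq_one (by simp)]

theorem duhK_cutoffHat_eq (T σ τ p : ℝ) : duhK cutoffHat T (σ - p) (τ - p) =
    ((T * cutoffHat (T * (σ - τ))) - T * cutoffHat (T * (σ - p))) /
      (2 * Real.pi * Complex.I * (τ - p : ℝ)) := by
  rw [duhK, show σ - p - (τ - p) = σ - τ by ring]; ring

/-- Integration in τ is evaluation at time 0. Both dilates of the transformed cutoff have integral
`cutoff 0 = 1`, so the Duhamel integral vanishes initially. -/
theorem integral_duhK {T : ℝ} (hT : 0 < T) (τ' p : ℝ) :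
    ∫ τ, duhK cutoffHat T (τ - p) (τ' - p) = 0 := by
  simp_rw [duhK_cutoffHat_eq]
  rw [integral_div, integral_sub (integrable_cutoffHat_scaled hT _)
    (integrable_cutoffHat_scaled hT _), integral_cutoffHat_scaled hT, integral_cutoffHat_scaled hT,
    sub_self, zero_div]

theorem integrable_cutoffHat_mul_hat {T : ℝ} (hT : 0 < T) (φ : 𝓢(Plane, ℂ)) (η q : ℝ) :
    Integrable fun τ => ((T : ℂ) * cutoffHat (T * (τ - q))) * hat φ (η, τ) := by
  refine (integrable_cutoffHat_scaled hT q).mul_bdd (c := decayConst 0 (𝓕⁻ φ))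
    (Continuous.aestronglyMeasurable ((continuous_hat φ).comp (by fun_prop)))
    (.of_forall fun τ => ?_)
  have := norm_hat_le 0 φ (η, τ)
  simpa using this

/-- The Duhamel operator inverts the linear equation. The reproducing formula evaluates the
transformed adjoint at τ' and at the phase: the first value cancels the denominator of the kernel,
the second vanishes. -/
theorem integral_duhK_mul_hat_adjointOp {α β T : ℝ} (hT : 0 < T) {φ : 𝓢(Plane, ℂ)}
    (hφ : IsTestOn T φ) {η τ' : ℝ} (h : τ' ≠ phase α β η) :
    ∫ τ, duhK cutoffHat T (τ - phase α β η) (τ' - phase α β η) * hat (adjointOp α β φ) (η, τ) =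
      hat φ (η, τ') := by
  have hψ := hφ.adjointOp α β
  have e : ∀ τ, duhK cutoffHat T (τ - phase α β η) (τ' - phase α β η) *
      hat (adjointOp α β φ) (η, τ) =
      ((T * cutoffHat (T * (τ - τ'))) * hat (adjointOp α β φ) (η, τ) -
        (T * cutoffHat (T * (τ - phase α β η))) * hat (adjointOp α β φ) (η, τ)) /
        (2 * Real.pi * Complex.I * (τ' - phase α β η : ℝ)) := fun τ => by
    rw [duhK_cutoffHat_eq]; ring
  simp_rw [e]
  rw [integral_div, integral_sub (integrable_cutoffHat_mul_hat hT _ _ _)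
    (integrable_cutoffHat_mul_hat hT _ _ _), integral_cutoffHat_mul_hat hT hψ,
    integral_cutoffHat_mul_hat hT hψ, hat_adjointOp, hat_adjointOp]
  have h1 : ((τ' - phase α β η : ℝ) : ℂ) ≠ 0 := by exact_mod_cast sub_ne_zero.mpr h
  have h2 : (Real.pi : ℂ) ≠ 0 := by exact_mod_cast Real.pi_ne_zero
  have h3 := Complex.I_ne_zero
  simp only [sub_self, Complex.ofReal_zero, mul_zero, zero_mul, sub_zero]
  field_simp

theorem memLp_mdl_mul_bracket_inv {p : ℝ → ℝ} (hp : Measurable p) {b : ℝ} (hb : 1 / 2 < b) :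
    MemLp (fun ζ : ℝ × ℝ => (mdl p (-b) ζ : ℂ) * ((1 + |ζ.1|)⁻¹ : ℝ)) 2 volume := by
  have hm := measurable_mdl hp (-b)
  refine ⟨by fun_prop, ?_⟩
  have h1 := eLpNorm_two_sq (μ := volume) fun ζ : ℝ × ℝ => (mdl p (-b) ζ : ℂ) * ((1 + |ζ.1|)⁻¹ : ℝ)
  have e : ∀ ζ : ℝ × ℝ, ‖(mdl p (-b) ζ : ℂ) * ((1 + |ζ.1|)⁻¹ : ℝ)‖ₑ =
      jpow (-b) (ζ.2 - p ζ.1) * jpow (-1) ζ.1 := fun ζ => by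
    have := bracket_pos ζ.1
    rw [enorm_mul, enorm_mdl]
    congr 1
    rw [← ofReal_norm, Complex.norm_real, Real.norm_of_nonneg (by positivity), jpow,
      Real.rpow_neg_one]
  have hj := measurable_jpow
  simp_rw [e] at h1
  rw [lintegral_fst_snd (by fun_prop)] at h1
  have h2 : ∫⁻ η, ∫⁻ τ, (jpow (-b) (τ - p η) * jpow (-1) η) ^ 2 =
      (∫⁻ η, jpow (-2) η) * ∫⁻ τ, jpow (-(2 * b)) τ := by
    rw [← lintegral_mul_const _ (by fun_prop)]
    refine lintegral_congr fun η => ?_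
    simp_rw [mul_pow, jpow_sq]
    rw [lintegral_mul_const _ (by fun_prop), lintegral_sub_right_eq_self (fun τ => jpow (2 * -b) τ),
      mul_comm]
    norm_num
  rw [h2] at h1
  have h3 := lintegral_jpow_lt_top (e := 2) (by norm_num)
  have h4 := lintegral_jpow_lt_top (e := 2 * b) (by linarith)
  have h5 : eLpNorm (fun ζ : ℝ × ℝ => (mdl p (-b) ζ : ℂ) * ((1 + |ζ.1|)⁻¹ : ℝ)) 2 volume ^ 2 < ∞ := by
    rw [h1]; exact ENNReal.mul_lt_top h3 h4
  by_contra hcon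
  rw [not_lt, top_le_iff] at hcon
  rw [hcon] at h5
  simp at h5

theorem mdl_mul_mdl_neg (p : ℝ → ℝ) (b : ℝ) (ζ : ℝ × ℝ) :
    (mdl p (-b) ζ : ℂ) * mdl p b ζ = 1 := by
  rw [← Complex.ofReal_mul, mdl, mdl, ← Real.rpow_add (bracket_pos _)]
  simp

theorem wt_neg_eq (p : ℝ → ℝ) (s b : ℝ) (ζ : ℝ × ℝ) :
    (wt p (-s) (-b) ζ : ℂ) = ((1 + ζ.1 ^ 2) ^ (-s / 2) : ℝ) * (mdl p (-b) ζ : ℂ) := by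
  rw [wt_eq_mul_mdl]; push_cast; rfl

namespace FlowOps

variable {α β s b b' : ℝ} (F : FlowOps α β s b b')

/-- By the reproducing formula the transformed adjoint is evaluated on the characteristic curve,
where its multiplier is zero. -/
theorem pairing_free {T : ℝ} (hT1 : T ≤ 1) {φ : 𝓢(Plane, ℂ)} (hφ : IsTestOn T φ)
    (g : L2L) : pairing α β s b (adjointOp α β φ) (F.free g) = 0 := by
  have hψ := (hφ.mono hT1).adjointOp α β
  have hi := integrable_coef_mul_hat α β s b (F.free g) (adjointOp α β φ)
  rw [pairing_apply]
  have e : (fun ζ => coef (phase α β) s b (F.free g) ζ * hat (adjointOp α β φ) ζ) =ᵐ[volume]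
      fun ζ => (((1 + ζ.1 ^ 2) ^ (-s / 2) : ℝ) * g ζ.1) * ((((1 : ℝ) : ℂ) *
        cutoffHat (1 * (ζ.2 - phase α β ζ.1))) * hat (adjointOp α β φ) ζ) := by
    filter_upwards [F.free_ae g] with ζ hζ
    rw [coef_eq_mul, hζ, wt_neg_eq, one_mul, Complex.ofReal_one]
    linear_combination (((1 + ζ.1 ^ 2) ^ (-s / 2) : ℝ) * g ζ.1 * cutoffHat (ζ.2 - phase α β ζ.1) *
      hat (adjointOp α β φ) ζ) * mdl_mul_mdl_neg (phase α β) b ζ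
  rw [integral_congr_ae e]
  refine (integral_prod (μ := (volume : Measure ℝ)) (ν := (volume : Measure ℝ)) _
    (hi.congr e)).trans ?_
  have : ∀ η, ∫ τ, (((1 + η ^ 2) ^ (-s / 2) : ℝ) * g η) * ((((1 : ℝ) : ℂ) *
      cutoffHat (1 * (τ - phase α β η))) * hat (adjointOp α β φ) (η, τ)) = 0 := fun η => by
    rw [integral_const_mul, integral_cutoffHat_mul_hat one_pos hψ, hat_adjointOp]
    simp
  simp only [this, integral_zero]

theorem ev_zero_free (g : L2L) : F.ev 0 (F.free g) = g := by
  refine Lp.ext ?_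
  have h2 : ∀ᵐ η, ∀ᵐ τ, (F.free g) (η, τ) = (mdl (phase α β) b (η, τ) : ℂ) *
      cutoffHat (τ - phase α β η) * g η := Measure.ae_ae_of_ae_prod (F.free_ae g)
  filter_upwards [F.ev_ae 0 (F.free g), h2] with η h1 h2
  rw [h1]
  have h3 := integral_cutoffHat_scaled one_pos (phase α β η)
  calc _ = ∫ τ, g η * (((1 : ℝ) : ℂ) * cutoffHat (1 * (τ - phase α β η))) := by
        refine integral_congr_ae ?_
        filter_upwards [h2] with τ hτ
        rw [hτ, zero_mul, e2_zero]
        push_cast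
        rw [one_mul, one_mul]
        linear_combination (g η * cutoffHat (τ - phase α β η)) *
          mdl_mul_mdl_neg (phase α β) b (η, τ)
    _ = _ := by rw [integral_const_mul, h3, mul_one]

/-- After exchanging the integrals, the inner one in τ is the inversion formula for the kernel; the
weights of order b cancel and those of order b' remain. -/
theorem pairing_duh {T : ℝ} (hT : 0 < T) (hT1 : T ≤ 1) {φ : 𝓢(Plane, ℂ)} (hφ : IsTestOn T φ)
    (h : L2P) : pairing α β s b (adjointOp α β φ) (F.duh T h) = pairing α β s b' φ h := by
  have hi := F.integrable_duh T hT hT1 h _ (memLp_wt_mul_hat α β (-s) (-b) (adjointOp α β φ))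
  have h1 := (ae_integrable_of_triple hi).2
  have hi2 := integrable_coef_mul_hat α β s b' h φ
  rw [pairing_apply, pairing_apply]
  calc _ = _ := ?_
    _ = _ := h1
    _ = _ := ?_
    _ = _ := (integral_prod (μ := (volume : Measure ℝ)) (ν := (volume : Measure ℝ)) _ hi2).symm
  · refine integral_congr_ae ?_
    filter_upwards [F.duh_ae T hT hT1 h] with ζ hζ
    rw [integral_const_mul, coef_eq_mul, hζ]; ring
  · refine integral_congr_ae (.of_forall fun η => ?_)
    refine integral_congr_ae ?_
    -- On the characteristic curve the kernel has its default value and the inversion formula is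
    -- unavailable, but that is a single point for each η.
    have hne : ∀ᵐ τ' : ℝ, τ' ≠ phase α β η := by
      simp [ae_iff]
    filter_upwards [hne] with τ' hτ'
    have e : ∀ τ, (wt (phase α β) (-s) (-b) (η, τ) : ℂ) * hat (adjointOp α β φ) (η, τ) *
        ((mdl (phase α β) b (η, τ) : ℂ) * duhK cutoffHat T (τ - phase α β η) (τ' - phase α β η) *
        (mdl (phase α β) (-b') (η, τ') : ℂ) * h (η, τ')) =
        (((1 + η ^ 2) ^ (-s / 2) : ℝ) * (mdl (phase α β) (-b') (η, τ') : ℂ) * h (η, τ')) *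
        (duhK cutoffHat T (τ - phase α β η) (τ' - phase α β η) * hat (adjointOp α β φ) (η, τ)) :=
      fun τ => by
        rw [wt_neg_eq]
        linear_combination (((1 + η ^ 2) ^ (-s / 2) : ℝ) * hat (adjointOp α β φ) (η, τ) *
          duhK cutoffHat T (τ - phase α β η) (τ' - phase α β η) *
          (mdl (phase α β) (-b') (η, τ') : ℂ) * h (η, τ')) *
          mdl_mul_mdl_neg (phase α β) b (η, τ)
    simp only [e]
    rw [integral_const_mul, integral_duhK_mul_hat_adjointOp hT hφ hτ', coef_eq_mul, wt_neg_eq]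
    ring

theorem ev_zero_duh (hb : 1 / 2 < b) {T : ℝ} (hT : 0 < T) (hT1 : T ≤ 1) (h : L2P) :
    F.ev 0 (F.duh T h) = 0 := by
  -- The factor (1 + |η|)⁻¹ only makes the test weight square integrable in η; it is divided out
  -- again for each η.
  have hi := F.integrable_duh T hT hT1 h _ (memLp_mdl_mul_bracket_inv (measurable_phase α β) hb)
  have h1 := (ae_integrable_of_triple hi).1
  refine Lp.ext ?_
  have h2 : ∀ᵐ η, ∀ᵐ τ, (F.duh T h) (η, τ) = ∫ τ', ((mdl (phase α β) b (η, τ) : ℂ) *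
      duhK cutoffHat T (τ - phase α β η) (τ' - phase α β η) *
        (mdl (phase α β) (-b') (η, τ') : ℂ)) * h (η, τ') :=
    Measure.ae_ae_of_ae_prod (F.duh_ae T hT hT1 h)
  filter_upwards [F.ev_ae 0 (F.duh T h), h1, h2, Lp.coeFn_zero ℂ 2 (volume : Measure ℝ)]
    with η h3 h4 h5 h6
  rw [h3, h6, Pi.zero_apply]
  have hbr : (((1 + |η|)⁻¹ : ℝ) : ℂ) ≠ 0 := by
    exact_mod_cast inv_ne_zero (bracket_pos η).ne'
  refine (mul_eq_zero.mp ?_).resolve_left hbr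
  rw [← integral_const_mul]
  have e : ∀ τ τ', (mdl (phase α β) (-b) (η, τ) : ℂ) * ((1 + |η|)⁻¹ : ℝ) *
      ((mdl (phase α β) b (η, τ) : ℂ) * duhK cutoffHat T (τ - phase α β η) (τ' - phase α β η) *
        (mdl (phase α β) (-b') (η, τ') : ℂ) * h (η, τ')) =
      (((1 + |η|)⁻¹ : ℝ) * (mdl (phase α β) (-b') (η, τ') : ℂ) * h (η, τ')) *
        duhK cutoffHat T (τ - phase α β η) (τ' - phase α β η) := fun τ τ' => by
    linear_combination (((1 + |η|)⁻¹ : ℝ) * duhK cutoffHat T (τ - phase α β η) (τ' - phase α β η) *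
        (mdl (phase α β) (-b') (η, τ') : ℂ) * h (η, τ')) * mdl_mul_mdl_neg (phase α β) b (η, τ)
  calc _ = ∫ τ, ∫ τ', (mdl (phase α β) (-b) (η, τ) : ℂ) * ((1 + |η|)⁻¹ : ℝ) *
      ((mdl (phase α β) b (η, τ) : ℂ) * duhK cutoffHat T (τ - phase α β η) (τ' - phase α β η) *
        (mdl (phase α β) (-b') (η, τ') : ℂ) * h (η, τ')) := by
        refine integral_congr_ae ?_
        filter_upwards [h5] with τ hτ
        rw [integral_const_mul, hτ, zero_mul, e2_zero]
        ring
    _ = ∫ τ', ∫ τ, (mdl (phase α β) (-b) (η, τ) : ℂ) * ((1 + |η|)⁻¹ : ℝ) *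
      ((mdl (phase α β) b (η, τ) : ℂ) * duhK cutoffHat T (τ - phase α β η) (τ' - phase α β η) *
        (mdl (phase α β) (-b') (η, τ') : ℂ) * h (η, τ')) := integral_integral_swap h4
    _ = 0 := by
        simp_rw [e, integral_const_mul, integral_duhK hT]
        simp

end FlowOps

/-! ### Traces of solutions of the free equation -/

/-- An almost everywhere statement can be had simultaneously for countably many times only;
continuity then recovers all times. -/
theorem eq_zero_of_rat {H : ℝ → ℂ} (hH : Continuous H) {ε : ℝ} (h : ∀ c : ℚ, |(c : ℝ)| < ε → H c = 0)
    {c : ℝ} (hc : |c| < ε) : H c = 0 := by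
  have hcl : IsClosed {c | H c = 0} := isClosed_eq hH continuous_const
  have hd := Rat.denseRange_cast (𝕜 := ℝ)
  have ho : IsOpen {c : ℝ | |c| < ε} := isOpen_lt continuous_abs continuous_const
  refine closure_minimal (fun x hx => ?_) hcl (hd.open_subset_closure_inter ho hc)
  obtain ⟨hx1, q, rfl⟩ := hx
  exact h q hx1

theorem hasDerivAt_e2_mul (a c : ℝ) :
    HasDerivAt (fun c : ℝ => e2 (c * a)) (2 * Real.pi * Complex.I * a * e2 (c * a)) c := by
  unfold e2
  have h1 : HasDerivAt (fun c : ℝ => (2 * Real.pi * ((c * a : ℝ) : ℂ) * Complex.I))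
      (2 * Real.pi * Complex.I * a) c := by
    have h0 : HasDerivAt (fun c : ℝ => (c : ℂ)) 1 c := Complex.ofRealCLM.hasDerivAt
    have := h0.const_mul (2 * Real.pi * Complex.I * a)
    rw [mul_one] at this
    refine this.congr_of_eventuallyEq (.of_forall fun x => ?_)
    push_cast; ring
  have := h1.cexp
  convert this using 1
  ring

/-- The derivative in c is a multiple of the moment against τ - p, which vanishes on the interval;
the integral therefore keeps its value at c = 0. -/
theorem integral_mul_e2_const {g : ℝ → ℂ} {p ε : ℝ} (hg : Integrable g)
    (hg' : Integrable fun τ => ((τ - p : ℝ) : ℂ) * g τ)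
    (h : ∀ c : ℚ, |(c : ℝ)| < ε → ∫ τ, (((τ - p : ℝ) : ℂ) * g τ) * e2 (c * (τ - p)) = 0)
    {c : ℝ} (hc : |c| < ε) : ∫ τ, g τ * e2 (c * (τ - p)) = ∫ τ, g τ := by
  have hb : ∀ (f : ℝ → ℂ), Integrable f → ∀ c : ℝ, Integrable fun τ => f τ * e2 (c * (τ - p)) :=
    fun f hf c => hf.mul_bdd (c := 1) (Continuous.aestronglyMeasurable (by fun_prop))
      (.of_forall fun _ => (norm_e2 _).le)
  have hHc : Continuous fun c : ℝ => ∫ τ, (((τ - p : ℝ) : ℂ) * g τ) * e2 (c * (τ - p)) := by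
    refine continuous_of_dominated (bound := fun τ => ‖((τ - p : ℝ) : ℂ) * g τ‖)
      (fun c => (hb _ hg' c).aestronglyMeasurable)
      (fun c => .of_forall fun τ => by rw [norm_mul, norm_e2, mul_one]) hg'.norm
      (.of_forall fun τ => by fun_prop)
  have hH0 := fun c hc => eq_zero_of_rat hHc h (c := c) hc
  set G : ℝ → ℂ := fun c => ∫ τ, g τ * e2 (c * (τ - p)) with hG
  have hder : ∀ c, HasDerivAt G (2 * Real.pi * Complex.I *
      ∫ τ, (((τ - p : ℝ) : ℂ) * g τ) * e2 (c * (τ - p))) c := fun c => by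
    have := (hasDerivAt_integral_of_dominated_loc_of_deriv_le (μ := volume) (s := Set.univ)
      (F := fun c τ => g τ * e2 (c * (τ - p)))
      (F' := fun c τ => g τ * (2 * Real.pi * Complex.I * ((τ - p : ℝ) : ℂ) * e2 (c * (τ - p))))
      (x₀ := c) (bound := fun τ => (2 * Real.pi) * ‖((τ - p : ℝ) : ℂ) * g τ‖) Filter.univ_mem
      (.of_forall fun c => (hb g hg c).aestronglyMeasurable) (hb g hg c)
      (((hb _ hg' c).const_mul (2 * Real.pi * Complex.I)).aestronglyMeasurable.congr
        (.of_forall fun τ => by simp only; ring))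
      (.of_forall fun τ c _ => ?_) (hg'.norm.const_mul _)
      (.of_forall fun τ c _ => (hasDerivAt_e2_mul (τ - p) c).const_mul (g τ))).2
    · refine this.congr_deriv ?_
      rw [← integral_const_mul]
      refine integral_congr_ae (.of_forall fun τ => ?_)
      simp only; ring
    · simp only [norm_mul, norm_e2, Complex.norm_real, Complex.norm_I, Complex.norm_ofNat,
        Real.norm_of_nonneg Real.pi_pos.le]
      exact le_of_eq (by ring)
  have hε : 0 < ε := (abs_nonneg c).trans_lt hc
  have hconst := isOpen_Ioo.is_const_of_deriv_eq_zero (isPreconnected_Ioo (a := -ε) (b := ε))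
    (f := G) (fun x _ => (hder x).differentiableAt.differentiableWithinAt)
    (fun x hx => by rw [(hder x).deriv, hH0 x (abs_lt.mpr hx)]; simp)
    (abs_lt.mp hc) (show (0 : ℝ) ∈ Set.Ioo (-ε) ε by constructor <;> linarith)
  change G c = _
  rw [hconst]
  simp [hG, e2_zero]

theorem exists_norm_cutoffInv_le : ∃ C : ℝ, 0 < C ∧ ∀ x, ‖cutoffInv x‖ ≤ C ∧
    |x| * ‖cutoffInv x‖ ≤ C := by
  obtain ⟨C, hC, h⟩ := cutoffInv.exists_norm_le_bracket 1
  refine ⟨C, hC, fun x => ?_⟩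
  have hb := bracket_pos x
  have h1 : ‖cutoffInv x‖ * (1 + |x|) ≤ C := by
    have := h x
    rwa [pow_one, ← div_eq_mul_inv, le_div_iff₀ hb] at this
  constructor <;> nlinarith [abs_nonneg x, norm_nonneg (cutoffInv x)]

/-- An integrable function whose moments against `(τ - p) e^{2πicτ}` vanish for all small `c`, when
regularized at large `τ`, has the Fourier transform of a point mass near the origin. -/
theorem integral_mul_e2_of_regularized {f : ℝ → ℂ} {p δ : ℝ} (hf : Integrable f)
    (h : ∀ (n : ℕ) (c : ℚ), 0 < n → |(c : ℝ)| + 2 / n < δ →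
      ∫ τ, f τ * ((τ - p : ℝ) * (e2 (c * τ) * cutoffInv (τ / n))) = 0)
    {c : ℝ} (hc : |c| < δ) : ∫ τ, f τ * e2 (c * (τ - p)) = ∫ τ, f τ := by
  obtain ⟨C, hC, hCb⟩ := exists_norm_cutoffInv_le
  have hcc := cutoffInv.continuous
  -- The factor `cutoffInv (τ / n)` makes the moment against τ - p integrable. In time it is a bump
  -- with support of radius 2/n, hence the loss of 2/n in the admissible range of c.
  have hn : ∀ n : ℕ, 0 < n → |c| + 2 / n < δ →
      ∫ τ, (f τ * cutoffInv (τ / n)) * e2 (c * (τ - p)) = ∫ τ, f τ * cutoffInv (τ / n) := by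
    intro n hn hcn
    have hn' : (0 : ℝ) < n := by exact_mod_cast hn
    refine integral_mul_e2_const (ε := δ - 2 / n) ?_ ?_ (fun c' hc' => ?_) (by linarith)
    · exact hf.mul_bdd (c := C) (Continuous.aestronglyMeasurable (by fun_prop))
        (.of_forall fun τ => (hCb _).1)
    · have : Integrable fun τ => f τ * (((τ - p : ℝ) : ℂ) * cutoffInv (τ / n)) := by
        refine hf.mul_bdd (c := n * C + |p| * C) (Continuous.aestronglyMeasurable (by fun_prop))
          (.of_forall fun τ => ?_)
        rw [norm_mul, Complex.norm_real, Real.norm_eq_abs]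
        have h1 := (hCb (τ / n)).1
        have h2 := (hCb (τ / n)).2
        rw [abs_div, abs_of_pos hn', div_mul_eq_mul_div, div_le_iff₀ hn'] at h2
        calc |τ - p| * ‖cutoffInv (τ / n)‖ ≤ (|τ| + |p|) * ‖cutoffInv (τ / n)‖ := by
              gcongr; exact abs_sub τ p
          _ = |τ| * ‖cutoffInv (τ / n)‖ + |p| * ‖cutoffInv (τ / n)‖ := by ring
          _ ≤ _ := by rw [mul_comm (n : ℝ)]; gcongr
      refine this.congr (.of_forall fun τ => ?_)
      simp only; ring
    · have e : ∀ τ : ℝ, (((τ - p : ℝ) : ℂ) * (f τ * cutoffInv (τ / n))) * e2 (c' * (τ - p)) =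
          e2 (-(c' * p)) * (f τ * ((τ - p : ℝ) * (e2 (c' * τ) * cutoffInv (τ / n)))) := fun τ => by
        rw [show (c' : ℝ) * (τ - p) = -(c' * p) + c' * τ by ring, e2_add]; ring
      simp_rw [e]
      rw [integral_const_mul, h n c' hn (by linarith), mul_zero]
  have hlim : ∀ g : ℝ → ℂ, Integrable g → Filter.Tendsto
      (fun n : ℕ => ∫ τ, g τ * cutoffInv (τ / n)) Filter.atTop (nhds (∫ τ, g τ * cutoffInv 0)) := by
    intro g hg
    refine tendsto_integral_of_dominated_convergence (fun τ => ‖g τ‖ * C)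
      (fun n => hg.aestronglyMeasurable.mul (Continuous.aestronglyMeasurable (by fun_prop)))
      (hg.norm.mul_const _) (fun n => .of_forall fun τ => ?_) (.of_forall fun τ => ?_)
    · rw [norm_mul]; gcongr; exact (hCb _).1
    · have h1 : Filter.Tendsto (fun n : ℕ => τ / (n : ℝ)) Filter.atTop (nhds 0) :=
        tendsto_const_div_atTop_nhds_zero_nat τ
      exact ((hcc.tendsto 0).comp h1).const_mul _
  have hfe : Integrable fun τ => f τ * e2 (c * (τ - p)) :=
    hf.mul_bdd (c := 1) (Continuous.aestronglyMeasurable (by fun_prop))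
      (.of_forall fun _ => (norm_e2 _).le)
  have hev : ∀ᶠ n : ℕ in Filter.atTop, 0 < n ∧ |c| + 2 / (n : ℝ) < δ := by
    have h1 : Filter.Tendsto (fun n : ℕ => |c| + 2 / (n : ℝ)) Filter.atTop (nhds |c|) := by
      simpa using (tendsto_const_div_atTop_nhds_zero_nat (2 : ℝ)).const_add |c|
    exact (Filter.eventually_gt_atTop 0).and (h1.eventually (gt_mem_nhds hc))
  -- As n grows the regularizing factor tends to the nonzero constant `cutoffInv 0`, which is
  -- finally cancelled.
  have heq := tendsto_nhds_unique_of_eventuallyEq (hlim _ hfe) (hlim _ hf) (by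
    filter_upwards [hev] with n hn'
    rw [← hn n hn'.1 hn'.2]
    refine integral_congr_ae (.of_forall fun τ => ?_)
    simp only; ring)
  rw [integral_mul_const, integral_mul_const] at heq
  exact mul_right_cancel₀ cutoffInv_zero_ne_zero heq

/-! ### Tensor products of test functions -/

theorem isCompact_planeProd {A B : Set ℝ} (hA : IsCompact A) (hB : IsCompact B) :
    IsCompact ((fun ζ : ℝ × ℝ => (!₂[ζ.1, ζ.2] : Plane)) '' (A ×ˢ B)) :=
  (hA.prod hB).image continuous_planePoint

theorem tensor_eq_zero {χ θ : ℝ → ℂ} {x : Plane}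
    (hx : x ∉ (fun ζ : ℝ × ℝ => (!₂[ζ.1, ζ.2] : Plane)) '' (tsupport χ ×ˢ tsupport θ)) :
    χ (x 0) * θ (x 1) = 0 := by
  by_contra hcon
  obtain ⟨h1, h2⟩ := mul_ne_zero_iff.mp hcon
  refine hx ⟨(x 0, x 1), ⟨subset_tsupport _ h1, subset_tsupport _ h2⟩, ?_⟩
  ext i
  fin_cases i <;> rfl

theorem hasCompactSupport_tensor {χ θ : ℝ → ℂ} (hχ : HasCompactSupport χ)
    (hθ : HasCompactSupport θ) : HasCompactSupport fun x : Plane => χ (x 0) * θ (x 1) :=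
  HasCompactSupport.intro (isCompact_planeProd hχ.isCompact hθ.isCompact)
    fun _ hx => tensor_eq_zero hx

/-- The function `χ(x) θ(t)`. -/
def tensor {χ θ : 𝓢(ℝ, ℂ)} (hχ : HasCompactSupport χ) (hθ : HasCompactSupport θ) : 𝓢(Plane, ℂ) :=
  (hasCompactSupport_tensor hχ hθ).toSchwartzMap (by
    have h0 : ContDiff ℝ ((⊤ : ℕ∞) : WithTop ℕ∞) fun x : Plane => x 0 :=
      (EuclideanSpace.proj (𝕜 := ℝ) (0 : Fin 2)).contDiff
    have h1 : ContDiff ℝ ((⊤ : ℕ∞) : WithTop ℕ∞) fun x : Plane => x 1 :=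
      (EuclideanSpace.proj (𝕜 := ℝ) (1 : Fin 2)).contDiff
    exact ((χ.smooth ⊤).comp h0).mul ((θ.smooth ⊤).comp h1))

theorem tensor_apply {χ θ : 𝓢(ℝ, ℂ)} (hχ : HasCompactSupport χ) (hθ : HasCompactSupport θ)
    (x : Plane) : tensor hχ hθ x = χ (x 0) * θ (x 1) := rfl

theorem isTestOn_tensor {χ θ : 𝓢(ℝ, ℂ)} (hχ : HasCompactSupport χ) (hθ : HasCompactSupport θ)
    {T : ℝ} (h : tsupport θ ⊆ Set.Ioo (-T) T) : IsTestOn T (tensor hχ hθ) := by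
  refine ⟨hasCompactSupport_tensor hχ hθ, ?_⟩
  have hK := isCompact_planeProd hχ.isCompact hθ.isCompact
  refine (closure_minimal (fun x hx => ?_) hK.isClosed).trans ?_
  · by_contra hcon
    exact hx (tensor_eq_zero hcon)
  · rintro _ ⟨ζ, hζ, rfl⟩
    exact h hζ.2

theorem hat_tensor {χ θ : 𝓢(ℝ, ℂ)} (hχ : HasCompactSupport χ) (hθ : HasCompactSupport θ)
    (ζ : ℝ × ℝ) : hat (tensor hχ hθ) ζ = (𝓕⁻ χ) ζ.1 * (𝓕⁻ θ) ζ.2 := by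
  rw [hat_eq_integral, SchwartzMap.fourierInv_coe, SchwartzMap.fourierInv_coe, fourierInv_eq_e2,
    fourierInv_eq_e2, ← integral_prod_mul, ← Measure.volume_eq_prod]
  refine integral_congr_ae (.of_forall fun q => ?_)
  simp only [tensor_apply]
  rw [e2_add, mul_comm q.1, mul_comm q.2]
  simp only [Matrix.cons_val_zero, Matrix.cons_val_one]
  ring

theorem tsupport_modBump {ε : ℝ} (hε : 0 < ε) (a c : ℝ) {δ : ℝ} (h : |c| + 2 / ε < δ) :
    tsupport (modBump hε a c) ⊆ Set.Ioo (-δ) δ := by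
  refine (closure_minimal (fun x hx => ?_) (Metric.isClosed_closedBall (x := c) (ε := 2 / ε))).trans
    fun x hx => ?_
  · by_contra hcon
    rw [Metric.mem_closedBall, Real.dist_eq, not_le, div_lt_iff₀' hε] at hcon
    apply hx
    rw [modBump_apply, timeBump_eq_zero, Complex.ofReal_zero, mul_zero]
    rw [abs_mul, abs_of_pos hε]
    exact hcon.le
  · rw [Metric.mem_closedBall, Real.dist_eq] at hx
    rw [Set.mem_Ioo, ← abs_lt]
    calc |x| = |x - c + c| := by rw [sub_add_cancel]
      _ ≤ |x - c| + |c| := abs_add_le _ _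
      _ < δ := by linarith

/-! ### Weak solutions of the free equation and their traces -/

/-- The part of the Fourier coefficient at a fixed spatial frequency tested against `θ` after
applying the linear operator. -/
def modulatedMoment (α β s b : ℝ) (z : L2P) (θ : 𝓢(ℝ, ℂ)) (η : ℝ) : ℂ :=
  ∫ τ, coef (phase α β) s b z (η, τ) * ((τ - phase α β η : ℝ) * (𝓕⁻ θ) τ)

theorem measurable_modulatedMoment (α β s b : ℝ) (z : L2P) (θ : 𝓢(ℝ, ℂ)) :
    Measurable (modulatedMoment α β s b z θ) := by
  have h1 := measurable_coef (measurable_phase α β) s b (measurable_lp z)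
  have h2 := (𝓕⁻ θ).continuous.measurable
  have h3 := measurable_phase α β
  have hm : StronglyMeasurable (Function.uncurry fun (η τ : ℝ) =>
      coef (phase α β) s b z (η, τ) * ((τ - phase α β η : ℝ) * (𝓕⁻ θ) τ)) := by
    refine Measurable.stronglyMeasurable ?_
    unfold Function.uncurry
    fun_prop
  exact hm.integral_prod_right.measurable

theorem exists_integrable_modulatedMoment (α β s b : ℝ) (z : L2P) (θ : 𝓢(ℝ, ℂ)) : ∃ m : ℕ,
    Integrable fun η => modulatedMoment α β s b z θ η * (((1 + |η|) ^ m)⁻¹ : ℝ) := by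
  obtain ⟨m, hm⟩ := exists_integrable_coef_br α β s b z
  obtain ⟨C, hC, k, hk⟩ := exists_wt_le_br α β 0 1
  obtain ⟨D, hD, hθ⟩ := (𝓕⁻ θ).exists_norm_le_bracket (m + k)
  have h2 := (𝓕⁻ θ).continuous.measurable
  have h3 := measurable_phase α β
  have h4 := measurable_br
  refine ⟨m + k, ?_⟩
  have hi : Integrable fun ζ : ℝ × ℝ => (coef (phase α β) s b z ζ *
      ((ζ.2 - phase α β ζ.1 : ℝ) * (𝓕⁻ θ) ζ.2)) * (((1 + |ζ.1|) ^ (m + k))⁻¹ : ℝ) := by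
    have h5 : Integrable fun ζ : ℝ × ℝ => (coef (phase α β) s b z ζ * ((br ζ ^ m)⁻¹ : ℝ)) *
        ((br ζ ^ m : ℝ) * (((ζ.2 - phase α β ζ.1 : ℝ) * (𝓕⁻ θ) ζ.2) *
          (((1 + |ζ.1|) ^ (m + k))⁻¹ : ℝ))) := by
      refine hm.mul_bdd (c := C * D) (Measurable.aestronglyMeasurable (by fun_prop))
        (.of_forall fun ζ => ?_)
      have b0 := br_pos ζ
      have b1 := bracket_pos ζ.1
      have b2 := bracket_pos ζ.2
      rw [norm_mul, norm_mul, norm_mul, Complex.norm_real, Complex.norm_real, Complex.norm_real,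
        Real.norm_of_nonneg (by positivity), Real.norm_eq_abs,
        Real.norm_of_nonneg (by positivity)]
      have h6 : |ζ.2 - phase α β ζ.1| ≤ C * br ζ ^ k := by
        refine le_trans ?_ (hk ζ)
        simp [wt]
      calc _ ≤ br ζ ^ m * ((C * br ζ ^ k) * (D * ((1 + |ζ.2|) ^ (m + k))⁻¹) *
            ((1 + |ζ.1|) ^ (m + k))⁻¹) := by gcongr; exact hθ ζ.2
        _ = _ := by
            have : br ζ ^ m * br ζ ^ k = (1 + |ζ.1|) ^ (m + k) * (1 + |ζ.2|) ^ (m + k) := by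
              rw [← pow_add, br, mul_pow]
            calc _ = C * D * (br ζ ^ m * br ζ ^ k) * (((1 + |ζ.2|) ^ (m + k))⁻¹ *
                  ((1 + |ζ.1|) ^ (m + k))⁻¹) := by ring
              _ = _ := by rw [this]; field_simp
    refine h5.congr (.of_forall fun ζ => ?_)
    have : ((br ζ ^ m : ℝ) : ℂ) ≠ 0 := by
      exact_mod_cast (pow_pos (br_pos ζ) m).ne'
    simp only [Complex.ofReal_inv]
    field_simp
  refine (hi.integral_prod_left (μ := volume) (ν := volume)).congr (.of_forall fun η => ?_)
  simp only [modulatedMoment]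
  rw [← integral_mul_const]

theorem pairing_tensor (α β s b : ℝ) (z : L2P) {χ θ : 𝓢(ℝ, ℂ)} (hχ : HasCompactSupport χ)
    (hθ : HasCompactSupport θ) : pairing α β s b (adjointOp α β (tensor hχ hθ)) z =
      2 * Real.pi * Complex.I * ∫ η, modulatedMoment α β s b z θ η * (𝓕⁻ χ) η := by
  have hi := integrable_coef_mul_hat α β s b z (adjointOp α β (tensor hχ hθ))
  rw [pairing_apply]
  refine (integral_prod (μ := (volume : Measure ℝ)) (ν := (volume : Measure ℝ)) _ hi).trans ?_
  rw [← integral_const_mul]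
  refine integral_congr_ae (.of_forall fun η => ?_)
  simp only [hat_adjointOp, hat_tensor, modulatedMoment]
  rw [← integral_mul_const, ← integral_const_mul]
  refine integral_congr_ae (.of_forall fun τ => ?_)
  simp only
  ring

/-- Tensor products as test functions separate the variables. Since the spatial factor is arbitrary,
the equation holds frequency by frequency. -/
theorem ae_modulatedMoment_eq_zero {α β s b δ : ℝ} {z : L2P}
    (hz : ∀ φ, IsTestOn δ φ → pairing α β s b (adjointOp α β φ) z = 0) {θ : 𝓢(ℝ, ℂ)}
    (hθ : HasCompactSupport θ) (hθδ : tsupport θ ⊆ Set.Ioo (-δ) δ) :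
    ∀ᵐ η, modulatedMoment α β s b z θ η = 0 := by
  obtain ⟨m, hm⟩ := exists_integrable_modulatedMoment α β s b z θ
  refine ae_eq_zero_of_integral_mul_fourierInv_eq_zero (measurable_modulatedMoment α β s b z θ) hm
    fun χ hχ => ?_
  have h := hz _ (isTestOn_tensor hχ hθ hθδ)
  rw [pairing_tensor] at h
  refine (mul_eq_zero.mp h).resolve_left ?_
  simp [Real.pi_ne_zero]

namespace FlowOps

theorem ae_integrable_coef {α β s b b' : ℝ} (F : FlowOps α β s b b') (z : L2P) :
    ∀ᵐ η, Integrable fun τ => coef (phase α β) s b z (η, τ) := by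
  filter_upwards [F.integrable_ev 0 z] with η hη
  refine (hη.const_mul (((1 + η ^ 2) ^ (-s / 2) : ℝ) : ℂ)).congr (.of_forall fun τ => ?_)
  simp only [zero_mul, e2_zero]
  rw [coef_eq_mul, wt_neg_eq]; ring

variable {α β s b b' : ℝ} (F : FlowOps α β s b b')

theorem integral_coef_mul_e2 (z : L2P) (t : ℝ) :
    ∀ᵐ η, ∫ τ, coef (phase α β) s b z (η, τ) * e2 (t * τ) =
      ((1 + η ^ 2) ^ (-s / 2) : ℝ) * F.ev t z η := by
  filter_upwards [F.ev_ae t z] with η hη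
  rw [hη, ← integral_const_mul]
  refine integral_congr_ae (.of_forall fun τ => ?_)
  simp only
  rw [coef_eq_mul, wt_neg_eq]; ring

/-- For almost every η the weak free equation is an ordinary differential equation in time, whose
solutions are multiples of e^{2πi t p(η)}. The trace at time t is thus a phase times the trace at
time 0. Time test functions are modulated bumps centred at rational times. -/
theorem ev_eq_zero_of_pairing_eq_zero {δ : ℝ} {z : L2P}
    (hz : ∀ φ, IsTestOn δ φ → pairing α β s b (adjointOp α β φ) z = 0) (h0 : F.ev 0 z = 0)
    {t : ℝ} (ht : |t| < δ) : F.ev t z = 0 := by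
  have hmom : ∀ᵐ η, ∀ (n : ℕ) (c : ℚ), 0 < n → |(c : ℝ)| + 2 / n < δ →
      ∫ τ, coef (phase α β) s b z (η, τ) *
        ((τ - phase α β η : ℝ) * (e2 (c * τ) * cutoffInv (τ / n))) = 0 := by
    rw [ae_all_iff]; intro n
    rw [ae_all_iff]; intro c
    by_cases hn : 0 < n
    swap
    · exact .of_forall fun _ h => absurd h hn
    by_cases hc : |(c : ℝ)| + 2 / n < δ
    swap
    · exact .of_forall fun _ _ h => absurd h hc
    have hn' : (0 : ℝ) < n := by exact_mod_cast hn
    have hcs : HasCompactSupport (modBump hn' 0 c) := hasCompactSupport_modBump hn' 0 c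
    filter_upwards [ae_modulatedMoment_eq_zero hz hcs (tsupport_modBump hn' 0 c hc)] with η hη _ _
    rw [modulatedMoment] at hη
    have hne : (((n : ℝ)⁻¹ : ℝ) : ℂ) ≠ 0 := by exact_mod_cast inv_ne_zero hn'.ne'
    refine (mul_eq_zero.mp ?_).resolve_left hne
    rw [← integral_const_mul, ← hη]
    refine integral_congr_ae (.of_forall fun τ => ?_)
    simp only
    rw [fourierInv_modBump, sub_zero]; ring
  refine Lp.ext ?_
  have h00 : F.ev 0 z =ᵐ[volume] fun _ => 0 := by
    rw [h0]; exact Lp.coeFn_zero _ _ _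
  filter_upwards [hmom, F.ae_integrable_coef z, F.integral_coef_mul_e2 z t,
    F.integral_coef_mul_e2 z 0, h00, Lp.coeFn_zero ℂ 2 (volume : Measure ℝ)] with η h1 h2 h3 h4 h5 h6
  rw [h6, Pi.zero_apply]
  have h7 := integral_mul_e2_of_regularized h2 h1 ht
  simp only [zero_mul, e2_zero, mul_one] at h4
  rw [h4, h5, mul_zero] at h7
  have h8 : ∫ τ, coef (phase α β) s b z (η, τ) * e2 (t * τ) = 0 := by
    have e : ∀ τ, coef (phase α β) s b z (η, τ) * e2 (t * τ) =
        e2 (t * phase α β η) * (coef (phase α β) s b z (η, τ) * e2 (t * (τ - phase α β η))) :=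
      fun τ => by
        rw [show t * τ = t * phase α β η + t * (τ - phase α β η) by ring, e2_add]; ring
    simp_rw [e]
    rw [integral_const_mul, h7, mul_zero]
  rw [h8] at h3
  have hne : (((1 + η ^ 2) ^ (-s / 2) : ℝ) : ℂ) ≠ 0 := by
    have : (0 : ℝ) < (1 + η ^ 2) ^ (-s / 2) := by positivity
    exact_mod_cast this.ne'
  exact (mul_eq_zero.mp h3.symm).resolve_left hne

/-- The coefficient is integrable in τ for almost every η, so the pairing can be written as an
integral over time of the traces, and these vanish where the test function lives. -/
theorem pairing_eq_zero_of_ev_eq_zero {δ : ℝ} {z : L2P} (hz : ∀ t, |t| < δ → F.ev t z = 0)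
    {φ : 𝓢(Plane, ℂ)} (hφ : IsTestOn δ φ) : pairing α β s b φ z = 0 := by
  have hi := integrable_coef_mul_hat α β s b z φ
  rw [pairing_apply]
  refine (integral_prod (μ := (volume : Measure ℝ)) (ν := (volume : Measure ℝ)) _ hi).trans ?_
  have hrat : ∀ᵐ η, ∀ c : ℚ, |(c : ℝ)| < δ →
      ∫ τ, coef (phase α β) s b z (η, τ) * e2 (c * τ) = 0 := by
    rw [ae_all_iff]; intro c
    by_cases hc : |(c : ℝ)| < δ
    swap
    · exact .of_forall fun _ h => absurd h hc
    have h00 : F.ev c z =ᵐ[volume] fun _ => 0 := by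
      rw [hz c hc]; exact Lp.coeFn_zero _ _ _
    filter_upwards [F.integral_coef_mul_e2 z c, h00] with η h1 h2 _
    rw [h1, h2, mul_zero]
  refine integral_eq_zero_of_ae ?_
  filter_upwards [hrat, F.ae_integrable_coef z] with η h1 h2
  have hcont : Continuous fun t : ℝ => ∫ τ, coef (phase α β) s b z (η, τ) * e2 (t * τ) := by
    refine continuous_of_dominated (bound := fun τ => ‖coef (phase α β) s b z (η, τ)‖)
      (fun t => h2.aestronglyMeasurable.mul (Continuous.aestronglyMeasurable (by fun_prop)))
      (fun t => .of_forall fun τ => by rw [norm_mul, norm_e2, mul_one]) h2.norm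
      (.of_forall fun τ => by fun_prop)
  have h3 := fun t ht => eq_zero_of_rat hcont h1 (c := t) ht
  have hI : Integrable (Function.uncurry fun (τ : ℝ) (q : ℝ × ℝ) =>
      coef (phase α β) s b z (η, τ) * (e2 (q.1 * η + q.2 * τ) * φ !₂[q.1, q.2]))
      (volume.prod volume) := by
    have h4 := h2.mul_prod (integrable_testFunction φ)
    have h5 : AEStronglyMeasurable (fun x : ℝ × ℝ × ℝ => e2 (x.2.1 * η + x.2.2 * x.1))
      (volume.prod volume) := Continuous.aestronglyMeasurable (by fun_prop)
    refine (h4.bdd_mul (c := 1) h5 (.of_forall fun _ => (norm_e2 _).le)).congr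
      (.of_forall fun x => ?_)
    simp only [Function.uncurry]; ring
  calc _ = ∫ τ, ∫ q : ℝ × ℝ, coef (phase α β) s b z (η, τ) *
        (e2 (q.1 * η + q.2 * τ) * φ !₂[q.1, q.2]) := by
        refine integral_congr_ae (.of_forall fun τ => ?_)
        simp only [hat_eq_integral]
        rw [integral_const_mul]
    _ = ∫ q : ℝ × ℝ, ∫ τ, coef (phase α β) s b z (η, τ) *
        (e2 (q.1 * η + q.2 * τ) * φ !₂[q.1, q.2]) := integral_integral_swap hI
    _ = 0 := by
        have : ∀ q : ℝ × ℝ, ∫ τ, coef (phase α β) s b z (η, τ) *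
            (e2 (q.1 * η + q.2 * τ) * φ !₂[q.1, q.2]) = 0 := fun q => by
          have e : ∀ τ, coef (phase α β) s b z (η, τ) *
              (e2 (q.1 * η + q.2 * τ) * φ !₂[q.1, q.2]) =
              (e2 (q.1 * η) * φ !₂[q.1, q.2]) *
                (coef (phase α β) s b z (η, τ) * e2 (q.2 * τ)) := fun τ => by
            rw [e2_add]; ring
          simp_rw [e]
          rw [integral_const_mul]
          by_cases hq : |q.2| < δ
          · rw [h3 _ hq, mul_zero]
          · rw [hφ.eq_zero (not_lt.mp hq)]; ring
        simp [this]

end FlowOps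

/-! ### Uniqueness of weak solutions and return to the original problem. -/

/-! ### Locally cube integrable functions on a slab -/

theorem isOpen_slab (T : ℝ) : IsOpen (slab T) := by
  have h1 : Continuous fun p : Plane => p 1 := by fun_prop
  exact (isOpen_lt continuous_const h1).inter (isOpen_lt h1 continuous_const)

theorem integrable_mul_of_integrableOn {f : Plane → ℂ} {φ : 𝓢(Plane, ℂ)}
    (hf : IntegrableOn f (tsupport φ)) : Integrable fun p => f p * φ p := by
  obtain ⟨C, hC⟩ : ∃ C, ∀ p, ‖φ p‖ ≤ C :=
    ⟨_, fun p => φ.toBoundedContinuousFunction.norm_coe_le_norm p⟩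
  have h1 : IntegrableOn (fun p => f p * φ p) (tsupport φ) :=
    Integrable.mul_bdd (c := C) hf φ.continuous.aestronglyMeasurable (.of_forall hC)
  refine (integrableOn_iff_integrable_of_support_subset fun p hp => ?_).mp h1
  exact subset_tsupport _ (right_ne_zero_of_mul hp)

theorem LocL3.integrableOn {T : ℝ} {v : Plane → ℂ} (hv : LocL3 T v) {K : Set Plane}
    (hK : IsCompact K) (hKT : K ⊆ slab T) : IntegrableOn v K := by
  have : IsFiniteMeasure (volume.restrict K) := ⟨by
    rw [Measure.restrict_apply_univ]; exact hK.measure_lt_top⟩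
  exact (hv K hK hKT).integrable (by norm_num)

theorem LocL3.integrableOn_cube {T : ℝ} {v : Plane → ℂ} (hv : LocL3 T v) {K : Set Plane}
    (hK : IsCompact K) (hKT : K ⊆ slab T) : IntegrableOn (fun p => (‖v p‖ : ℂ) ^ 2 * v p) K := by
  have h1 := hv K hK hKT
  have h2 : Integrable (fun p => ‖v p‖ ^ 3) (volume.restrict K) :=
    MemLp.integrable_norm_pow (p := 3) h1 (by norm_num)
  have hn : AEStronglyMeasurable (fun p => (‖v p‖ : ℂ)) (volume.restrict K) :=
    Complex.continuous_ofReal.comp_aestronglyMeasurable h1.1.norm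
  refine h2.mono' ((hn.pow 2).mul h1.1) (.of_forall fun p => le_of_eq ?_)
  rw [norm_mul, norm_pow, Complex.norm_real, norm_norm]; ring

theorem LocL3.ae_eq {T : ℝ} {v w : Plane → ℂ} (hv : LocL3 T v) (hw : LocL3 T w)
    (h : ∀ φ, IsTestOn T φ → ∫ p, v p * φ p = ∫ p, w p * φ p) :
    ∀ᵐ p, p ∈ slab T → v p = w p := by
  have hloc : LocallyIntegrableOn (fun p => v p - w p) (slab T) := by
    rw [locallyIntegrableOn_iff (isOpen_slab T).isLocallyClosed]
    exact fun K hKT hK => (hv.integrableOn hK hKT).sub (hw.integrableOn hK hKT)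
  have := (isOpen_slab T).ae_eq_zero_of_integral_contDiff_smul_eq_zero hloc
    fun g hg hgc hgT => by
      have hc : HasCompactSupport fun p => (g p : ℂ) :=
        hgc.comp_left (g := fun x : ℝ => (x : ℂ)) Complex.ofReal_zero
      have hs : ContDiff ℝ ((⊤ : ℕ∞) : WithTop ℕ∞) fun p => (g p : ℂ) :=
        Complex.ofRealCLM.contDiff.comp hg
      set φ : 𝓢(Plane, ℂ) := hc.toSchwartzMap hs with hφ
      have hts : tsupport φ ⊆ tsupport g :=
        closure_mono fun p hp => by
          intro hcon
          apply hp
          change (g p : ℂ) = 0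
          rw [hcon, Complex.ofReal_zero]
      have ht : IsTestOn T φ := ⟨hc, hts.trans hgT⟩
      have h1 := h φ ht
      have h2 := integrable_mul_of_integrableOn (hv.integrableOn ht.1 ht.2)
      have h3 := integrable_mul_of_integrableOn (hw.integrableOn ht.1 ht.2)
      have e : ∀ p, g p • (v p - w p) = v p * φ p - w p * φ p := fun p => by
        have : φ p = g p := rfl
        rw [Complex.real_smul, this]; ring
      simp_rw [e]
      rw [integral_sub h2 h3, h1, sub_self]
  filter_upwards [this] with p hp hpT
  exact sub_eq_zero.mp (hp hpT)

theorem integral_congr_slab {T : ℝ} {f g : Plane → ℂ} (h : ∀ᵐ p, p ∈ slab T → f p = g p)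
    {φ : 𝓢(Plane, ℂ)} (hφ : IsTestOn T φ) : ∫ p, f p * φ p = ∫ p, g p * φ p := by
  refine integral_congr_ae ?_
  filter_upwards [h] with p hp
  by_cases hps : p ∈ tsupport φ
  · rw [hp (hφ.2 hps)]
  · rw [image_eq_zero_of_notMem_tsupport hps, mul_zero, mul_zero]

/-! ### Weak solutions in terms of weighted Fourier coefficients -/

/-- Translation of a test function in time. -/
def timeShift (r : ℝ) (φ : 𝓢(Plane, ℂ)) : 𝓢(Plane, ℂ) := φ.compSubConstCLM ℂ !₂[0, r]

theorem hat_timeShift (r : ℝ) (φ : 𝓢(Plane, ℂ)) (ζ : ℝ × ℝ) :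
    hat (timeShift r φ) ζ = e2 (r * ζ.2) * hat φ ζ := by
  rw [hat_eq_integral, hat_eq_integral, ← integral_const_mul,
    ← integral_add_right_eq_self _ ((0, r) : ℝ × ℝ)]
  refine integral_congr_ae (.of_forall fun q => ?_)
  have : timeShift r φ !₂[(q + (0, r)).1, (q + (0, r)).2] = φ !₂[q.1, q.2] := by
    rw [timeShift, SchwartzMap.compSubConstCLM_apply]
    congr 1
    ext i
    fin_cases i <;> simp
  simp only
  rw [this, ← mul_assoc, ← e2_add]
  congr 2
  simp only [Prod.fst_add, Prod.snd_add]; ring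

theorem IsTestOn.timeShift {T T' r : ℝ} (h : T' + |r| ≤ T) {φ : 𝓢(Plane, ℂ)} (hφ : IsTestOn T' φ) :
    IsTestOn T (timeShift r φ) := by
  set a : Plane := !₂[0, r] with ha
  have hs : tsupport (_root_.timeShift r φ) ⊆ (fun x => x + a) '' tsupport φ := by
    refine closure_minimal (fun x hx => ⟨x - a, subset_tsupport _ hx, sub_add_cancel _ _⟩) ?_
    exact (hφ.1.isCompact.image (by fun_prop)).isClosed
  refine ⟨(hφ.1.isCompact.image (by fun_prop : Continuous fun x => x + a)).of_isClosed_subset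
    (isClosed_tsupport _) hs, hs.trans ?_⟩
  rintro _ ⟨x, hx, rfl⟩
  obtain ⟨h1, h2⟩ := hφ.2 hx
  have h3 : (x + a) 1 = x 1 + r := by simp [ha]
  have := neg_abs_le r
  have := le_abs_self r
  change -T < (x + a) 1 ∧ (x + a) 1 < T
  rw [h3]
  constructor <;> linarith

theorem exists_modulated (r : ℝ) (h : L2P) : ∃ k : L2P, k =ᵐ[volume] fun ζ => e2 (r * ζ.2) * h ζ := by
  have hm : MemLp (fun ζ : ℝ × ℝ => e2 (r * ζ.2) * h ζ) 2 volume := by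
    have hk := measurable_lp h
    refine (Lp.memLp h).of_le (by fun_prop) (.of_forall fun ζ => ?_)
    rw [norm_mul, norm_e2, one_mul]
  exact ⟨hm.toLp _, hm.coeFn_toLp⟩

/-- Multiplication of a coefficient by e^{2πi r τ} is translation in time. The nonlinearity commutes
with it because the phases at x, y and ζ - x + y combine, with signs 1, -1, 1, to the phase at ζ. -/
theorem cubicInt_modulated (r : ℝ) (f : ℝ × ℝ → ℂ) (ζ : ℝ × ℝ) :
    cubicInt (fun z => e2 (r * z.2) * f z) ζ = e2 (r * ζ.2) * cubicInt f ζ := by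
  unfold cubicInt
  rw [← integral_const_mul]
  refine integral_congr_ae (.of_forall fun q => ?_)
  simp only [cubicIntegrand, map_mul, conj_e2, Prod.snd_add, Prod.snd_sub]
  rw [show r * ζ.2 = r * q.1.2 + -(r * q.2.2) + r * (ζ.2 - q.1.2 + q.2.2) by ring, e2_add, e2_add]
  ring

theorem pairing_modulated {α β s b r : ℝ} {h k : L2P}
    (e : k =ᵐ[volume] fun ζ => e2 (r * ζ.2) * h ζ) {φ ψ : 𝓢(Plane, ℂ)}
    (hψ : ∀ ζ, hat ψ ζ = e2 (r * ζ.2) * hat φ ζ) :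
    pairing α β s b φ k = pairing α β s b ψ h := by
  rw [pairing_apply, pairing_apply]
  refine integral_congr_ae ?_
  filter_upwards [e] with ζ hζ
  rw [coef, coef, hζ, hψ]; ring

namespace FlowOps

variable {α β s b b' : ℝ} (F : FlowOps α β s b b')

theorem ev_modulated {r : ℝ} {h k : L2P} (e : k =ᵐ[volume] fun ζ => e2 (r * ζ.2) * h ζ) (t : ℝ) :
    F.ev t k = F.ev (t + r) h := by
  refine Lp.ext ?_
  have h2 : ∀ᵐ η, ∀ᵐ τ, k (η, τ) = e2 (r * τ) * h (η, τ) := Measure.ae_ae_of_ae_prod e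
  filter_upwards [F.ev_ae t k, F.ev_ae (t + r) h, h2] with η h3 h4 h5
  rw [h3, h4]
  refine integral_congr_ae ?_
  filter_upwards [h5] with τ hτ
  rw [hτ, add_mul, e2_add]; ring

theorem cubic_modulated {r : ℝ} {h k : L2P} (e : k =ᵐ[volume] fun ζ => e2 (r * ζ.2) * h ζ) :
    F.cubic k =ᵐ[volume] fun ζ => e2 (r * ζ.2) * F.cubic h ζ := by
  filter_upwards [F.cubic_ae k, F.cubic_ae h] with ζ h1 h2
  have h3 : coef (phase α β) s b k =ᵐ[volume] fun z => e2 (r * z.2) * coef (phase α β) s b h z := by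
    filter_upwards [e] with z hz
    rw [coef, coef, hz]; ring
  rw [h1, h2, cubicInt_congr h3, cubicInt_modulated]; ring

/-- The function with weighted Fourier coefficient `h` solves the equation for times less than
`T`. -/
def SolvesWeak (γ : ℂ) (T : ℝ) (h : L2P) : Prop :=
  ∀ φ, IsTestOn T φ → pairing α β s b (adjointOp α β φ) h +
    Complex.I * γ * pairing α β s b' φ (F.cubic h) = 0

theorem SolvesWeak.mono {γ : ℂ} {T T' : ℝ} {h : L2P} (hT : T' ≤ T) (hh : F.SolvesWeak γ T h) :
    F.SolvesWeak γ T' h := fun φ hφ => hh φ (hφ.mono hT)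

theorem SolvesWeak.modulated {γ : ℂ} {T T' r : ℝ} {h k : L2P}
    (e : k =ᵐ[volume] fun ζ => e2 (r * ζ.2) * h ζ) (hT : T' + |r| ≤ T) (hh : F.SolvesWeak γ T h) :
    F.SolvesWeak γ T' k := fun φ hφ => by
  rw [← hh _ (hφ.timeShift (r := r) hT), pairing_modulated (F.cubic_modulated e) (hat_timeShift r φ),
    pairing_modulated e (ψ := adjointOp α β (timeShift r φ))]
  intro ζ
  rw [hat_adjointOp, hat_adjointOp, hat_timeShift]; ring

/-- Locality of the cube is invisible in the convolution integral. It is read off from the functions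
given by `exists_physical`, which agree almost everywhere on the slab. -/
theorem pairing_cubic_congr (hβ : β ≠ 0) (hs : -(1 / 4) < s) (hb : 1 / 2 < b) {T : ℝ} {h k : L2P}
    (hhk : ∀ φ, IsTestOn T φ → pairing α β s b φ h = pairing α β s b φ k) {φ : 𝓢(Plane, ℂ)}
    (hφ : IsTestOn T φ) :
    pairing α β s b' φ (F.cubic h) = pairing α β s b' φ (F.cubic k) := by
  obtain ⟨v, hv1, hv2, hv3, -⟩ := F.exists_physical hβ hs hb h
  obtain ⟨w, hw1, hw2, hw3, -⟩ := F.exists_physical hβ hs hb k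
  have hae := LocL3.ae_eq (T := T) (v := v) (w := w) (fun K hK _ => hv1 K hK) (fun K hK _ => hw1 K hK)
    fun ψ hψ => by rw [← hv2 ψ hψ.1, ← hw2 ψ hψ.1, hhk ψ hψ]
  rw [hv3 φ hφ.1, hw3 φ hφ.1]
  refine integral_congr_slab ?_ hφ
  filter_upwards [hae] with p hp hpT
  rw [hp hpT]

/-- The Picard map with the solution's own initial trace changes the solution by something that
satisfies the free equation on the slab and vanishes at time 0. The traces are therefore unchanged,
and so, by locality of the cube, is the equation. -/
theorem solvesWeak_picard (hβ : β ≠ 0) (hs : -(1 / 4) < s) (hb : 1 / 2 < b) {γ : ℂ} {T : ℝ}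
    (hT : 0 < T) (hT1 : T ≤ 1) {h : L2P} (hh : F.SolvesWeak γ T h) :
    (∀ t, |t| < T → F.ev t (F.picard γ T (F.ev 0 h) h) = F.ev t h) ∧
      F.SolvesWeak γ T (F.picard γ T (F.ev 0 h) h) := by
  set k := F.picard γ T (F.ev 0 h) h with hk
  have hpair : ∀ φ, IsTestOn T φ → pairing α β s b (adjointOp α β φ) k =
      pairing α β s b (adjointOp α β φ) h := fun φ hφ => by
    have h1 := hh φ hφ
    rw [hk, picard, map_sub, map_smul, F.pairing_free hT1 hφ, F.pairing_duh hT hT1 hφ, smul_eq_mul]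
    linear_combination -h1
  have hev : ∀ t, |t| < T → F.ev t (k - h) = 0 := fun t ht => by
    refine F.ev_eq_zero_of_pairing_eq_zero (δ := T) (fun φ hφ => ?_) ?_ ht
    · rw [map_sub, hpair φ hφ, sub_self]
    · rw [map_sub, hk, picard, map_sub, map_smul, F.ev_zero_free, F.ev_zero_duh hb hT hT1,
        smul_zero, sub_zero, sub_self]
  refine ⟨fun t ht => ?_, fun φ hφ => ?_⟩
  · have := hev t ht
    rwa [map_sub, sub_eq_zero] at this
  · rw [hpair φ hφ, F.pairing_cubic_congr hβ hs hb (fun ψ hψ => ?_) hφ]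
    · exact hh φ hφ
    · have := F.pairing_eq_zero_of_ev_eq_zero hev hψ
      rwa [map_sub, sub_eq_zero] at this

theorem solvesWeak_iterate (hβ : β ≠ 0) (hs : -(1 / 4) < s) (hb : 1 / 2 < b) {γ : ℂ} {T : ℝ}
    (hT : 0 < T) (hT1 : T ≤ 1) {h : L2P} (hh : F.SolvesWeak γ T h) (n : ℕ) :
    (∀ t, |t| < T → F.ev t ((F.picard γ T (F.ev 0 h))^[n] h) = F.ev t h) ∧
      F.SolvesWeak γ T ((F.picard γ T (F.ev 0 h))^[n] h) := by
  induction n with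
  | zero => exact ⟨fun _ _ => rfl, hh⟩
  | succ n ih =>
    obtain ⟨h1, h2⟩ := ih
    have h3 := F.solvesWeak_picard hβ hs hb hT hT1 h2
    rw [h1 0 (by simpa using hT)] at h3
    rw [Function.iterate_succ_apply']
    exact ⟨fun t ht => (h3.1 t ht).trans (h1 t ht), h3.2⟩

/-- No smallness of the solutions on a short slab is required. The Picard iterates started at either
solution keep its traces near time 0, and both sequences converge to the one fixed point in a ball
that contains both starting points. -/
theorem exists_ev_eq_near_zero (hβ : β ≠ 0) (hs : -(1 / 4) < s) (hb : 1 / 2 < b)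
    (hbb' : b - 1 < b') {γ : ℂ} {T : ℝ} (hT : 0 < T) {h k : L2P} (hh : F.SolvesWeak γ T h)
    (hk : F.SolvesWeak γ T k) (h0 : F.ev 0 h = F.ev 0 k) :
    ∃ δ : ℝ, 0 < δ ∧ ∀ t, |t| < δ → F.ev t h = F.ev t k := by
  set g := F.ev 0 h with hg
  -- Large enough for the ball to contain `h` and `k` and for the image of 0, which is `F.free g`,
  -- to lie in the ball of half the radius.
  set r := 2 * ‖F.free g‖ + ‖h‖ + ‖k‖ with hr
  have n1 := norm_nonneg (F.free g)
  have n2 := norm_nonneg h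
  have n3 := norm_nonneg k
  obtain ⟨T₀, hT₀, hT₀1, hcon⟩ := F.exists_time hbb' γ r
  set δ := min T T₀ with hδ
  have hδ0 : 0 < δ := lt_min hT hT₀
  have hδ1 : δ ≤ 1 := (min_le_right _ _).trans hT₀1
  have hlip := hcon δ hδ0 (min_le_right _ _) g
  have hΦ0 : ‖F.picard γ δ g 0‖ ≤ r / 2 := by
    rw [picard, F.cubic_zero, map_zero, smul_zero, sub_zero]; linarith
  obtain ⟨y, hy, hyfix, hylim⟩ := exists_fixedPoint_closedBall hΦ0 hlip (x := h) (by linarith)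
  obtain ⟨z, hz, hzfix, hzlim⟩ := exists_fixedPoint_closedBall hΦ0 hlip (x := k) (by linarith)
  have hyz : y = z := by
    have := hlip y z hy hz
    rw [hyfix, hzfix] at this
    have h2 := norm_nonneg (y - z)
    exact sub_eq_zero.mp (norm_eq_zero.mp (by linarith))
  have hevy : ∀ t, |t| < δ → F.ev t y = F.ev t h := fun t ht => by
    refine tendsto_nhds_unique (((F.ev t).continuous.tendsto y).comp hylim) ?_
    refine tendsto_const_nhds.congr fun n => ?_
    exact ((F.solvesWeak_iterate hβ hs hb hδ0 hδ1 (hh.mono F (min_le_left _ _)) n).1 t ht).symm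
  have hevz : ∀ t, |t| < δ → F.ev t z = F.ev t k := fun t ht => by
    refine tendsto_nhds_unique (((F.ev t).continuous.tendsto z).comp hzlim) ?_
    refine tendsto_const_nhds.congr fun n => ?_
    have := (F.solvesWeak_iterate hβ hs hb hδ0 hδ1 (hk.mono F (min_le_left _ _)) n).1 t ht
    rw [← h0] at this
    exact this.symm
  exact ⟨δ, hδ0, fun t ht => by rw [← hevy t ht, hyz, hevz t ht]⟩

/-- The set of times of agreement is closed by continuity of traces. After translation of such a
time to 0, the local result shows that it is an interior point, and connectedness of the interval
finishes. -/
theorem ev_eq_of_solvesWeak (hβ : β ≠ 0) (hs : -(1 / 4) < s) (hb : 1 / 2 < b)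
    (hbb' : b - 1 < b') {γ : ℂ} {T : ℝ} (hT : 0 < T) {h k : L2P} (hh : F.SolvesWeak γ T h)
    (hk : F.SolvesWeak γ T k) (h0 : F.ev 0 h = F.ev 0 k) :
    ∀ t ∈ Set.Ioo (-T) T, F.ev t h = F.ev t k := by
  have hloc : ∀ r ∈ Set.Ioo (-T) T, F.ev r h = F.ev r k →
      r ∈ interior {t | F.ev t h = F.ev t k} := by
    intro r hr hrr
    have hr' := abs_lt.mpr hr
    obtain ⟨h', eh⟩ := exists_modulated r h
    obtain ⟨k', ek⟩ := exists_modulated r k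
    obtain ⟨δ, hδ, H⟩ := F.exists_ev_eq_near_zero hβ hs hb hbb' (T := T - |r|) (by linarith)
      (SolvesWeak.modulated F eh (by linarith) hh) (SolvesWeak.modulated F ek (by linarith) hk)
      (by rw [F.ev_modulated eh, F.ev_modulated ek, zero_add, hrr])
    rw [mem_interior_iff_mem_nhds, Metric.mem_nhds_iff]
    refine ⟨δ, hδ, fun t ht => ?_⟩
    rw [Metric.mem_ball, Real.dist_eq] at ht
    have := H (t - r) ht
    rwa [F.ev_modulated eh, F.ev_modulated ek, sub_add_cancel] at this
  have hcl : IsClosed {t | F.ev t h = F.ev t k} := isClosed_eq (F.continuous_ev h) (F.continuous_ev k)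
  have h0T : (0 : ℝ) ∈ Set.Ioo (-T) T := ⟨by linarith, hT⟩
  have := (isPreconnected_Ioo (a := -T) (b := T)).subset_of_closure_inter_subset isOpen_interior
    ⟨0, h0T, hloc 0 h0T h0⟩ fun r hr =>
      hloc r hr.2 (hcl.closure_subset_iff.mpr interior_subset hr.1)
  intro t ht
  have ht' : t ∈ {t | F.ev t h = F.ev t k} := interior_subset (this ht)
  exact ht'

end FlowOps

/-! ### From weighted Fourier coefficients to solutions and back -/

theorem ae_slice_of_ae_slab {T : ℝ} {v w : Plane → ℂ} (h : ∀ᵐ p, p ∈ slab T → v p = w p) :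
    ∀ᵐ t : ℝ, t ∈ Set.Ioo (-T) T → ∀ᵐ x : ℝ, v !₂[x, t] = w !₂[x, t] := by
  have h1 : ∀ᵐ ζ : ℝ × ℝ, ζ.2 ∈ Set.Ioo (-T) T → v !₂[ζ.1, ζ.2] = w !₂[ζ.1, ζ.2] :=
    measurePreserving_planeEquiv_symm.quasiMeasurePreserving.ae h
  have h2 : ∀ᵐ ζ : ℝ × ℝ ∂(volume.prod volume),
      ζ.1 ∈ Set.Ioo (-T) T → v !₂[ζ.2, ζ.1] = w !₂[ζ.2, ζ.1] :=
    (Measure.measurePreserving_swap (μ := (volume : Measure ℝ))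
      (ν := (volume : Measure ℝ))).quasiMeasurePreserving.ae h1
  filter_upwards [Measure.ae_ae_of_ae_prod h2] with t ht htT
  filter_upwards [ht] with x hx
  exact hx htT

namespace FlowOps

variable {α β s b b' : ℝ} (F : FlowOps α β s b b')

theorem solvesEquation_iff {γ : ℂ} {T : ℝ} {v : Plane → ℂ} {h : L2P} (hv : LocL3 T v)
    (h1 : ∀ φ, IsTestOn T φ → pairing α β s b φ h = ∫ p, v p * φ p)
    (h2 : ∀ φ, IsTestOn T φ →
      pairing α β s b' φ (F.cubic h) = ∫ p, ((‖v p‖ : ℂ) ^ 2 * v p) * φ p) :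
    SolvesEquation α β γ T v ↔ F.SolvesWeak γ T h := by
  refine forall_congr' fun φ => forall_congr' fun hφ => ?_
  have hψ := hφ.adjointOp α β
  have i1 := integrable_mul_of_integrableOn (hv.integrableOn hψ.1 hψ.2)
  have i2 := integrable_mul_of_integrableOn (hv.integrableOn_cube hφ.1 hφ.2)
  rw [h1 _ hψ, h2 _ hφ, ← integral_const_mul, ← integral_add i1 (i2.const_mul _)]
  refine Eq.congr (integral_congr_ae (.of_forall fun p => ?_)) rfl
  simp only [adjointOp_apply]
  ring

/-- Any extension in `X^{s,b}` supplies a coefficient. The given function and the one built from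
that coefficient agree almost everywhere on the slab, so they have the same cube there and the same
slices at almost every time. -/
theorem exists_coef_of_isIVPSolution (hβ : β ≠ 0) (hs : -(1 / 4) < s) (hb : 1 / 2 < b) {γ : ℂ}
    {T : ℝ} (hT : 0 < T) {u₀ : Hs s} {u : C(Set.Icc (-T) T, Hs s)}
    (hu : IsIVPSolution α β γ s b T u₀ u) : ∃ h : L2P, F.SolvesWeak γ T h ∧
      ∀ t (ht : t ∈ Set.Icc (-T) T), sobolevIso s (u ⟨t, ht⟩) = F.ev t h := by
  obtain ⟨-, v, hv, hrep, ⟨U, hU, hUv⟩, hsol⟩ := hu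
  obtain ⟨h, hh⟩ := hU.exists_coef
  obtain ⟨w, hw1, hw2, hw3, hw4⟩ := F.exists_physical hβ hs hb h
  have hw : LocL3 T w := fun K hK _ => hw1 K hK
  have hae : ∀ᵐ p, p ∈ slab T → v p = w p :=
    hv.ae_eq hw fun φ hφ => by rw [← hUv φ hφ, hh, hw2 φ hφ.1]
  refine ⟨h, (F.solvesEquation_iff hv (fun φ hφ => by rw [← hUv φ hφ, hh]) fun φ hφ => ?_).mp hsol,
    ?_⟩
  · rw [hw3 φ hφ.1]
    refine integral_congr_slab ?_ hφ
    filter_upwards [hae] with p hp hpT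
    rw [hp hpT]
  · have hle : -T ≤ T := by linarith
    set f : ℝ → L2L := Set.IccExtend hle fun t => sobolevIso s (u t) with hf
    have hfc : Continuous f :=
      ((sobolevIso s).continuous.comp u.continuous).Icc_extend'
    have hfae : f =ᵐ[volume.restrict (Set.Icc (-T) T)] fun t => F.ev t h := by
      rw [← Measure.restrict_congr_set (Ioo_ae_eq_Icc (μ := volume) (a := -T) (b := T)),
        Filter.EventuallyEq, ae_restrict_iff' measurableSet_Ioo]
      filter_upwards [hrep, hw4, ae_slice_of_ae_slab hae] with t h1 h2 h3 ht
      have ht' := Set.Ioo_subset_Icc_self ht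
      rw [hf, Set.IccExtend_of_mem hle _ ht', ← sub_eq_zero]
      refine eq_zero_of_sobolevPairing_eq_zero (s := s) fun χ hχ => ?_
      rw [map_sub, ← sobolevIso_symm_eq_pairing, LinearIsometryEquiv.symm_apply_apply,
        h1 ht' χ hχ, h2 χ hχ, sub_eq_zero]
      refine integral_congr_ae ?_
      filter_upwards [h3 ht] with x hx
      rw [hx]
    -- The slices identify the two curves only for almost every time; as both are continuous they
    -- agree at every time, including 0 and the endpoints.
    have := Measure.eqOn_Icc_of_ae_eq volume (by linarith : -T ≠ T) hfae hfc.continuousOn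
      (F.continuous_ev h).continuousOn
    intro t ht
    have h1 : f t = F.ev t h := this ht
    rw [← h1, hf, Set.IccExtend_of_mem hle _ ht]

/-- The curve in `H^s` traced by the function with weighted Fourier coefficient `h`. -/
def curve (T : ℝ) (h : L2P) : C(Set.Icc (-T) T, Hs s) where
  toFun t := (sobolevIso s).symm (F.ev t h)
  continuous_toFun := (sobolevIso s).symm.continuous.comp
    ((F.continuous_ev h).comp continuous_subtype_val)

theorem curve_apply (T : ℝ) (h : L2P) (t : Set.Icc (-T) T) :
    F.curve T h t = (sobolevIso s).symm (F.ev t h) := rfl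

theorem isIVPSolution_curve (hβ : β ≠ 0) (hs : -(1 / 4) < s) (hb : 1 / 2 < b) {γ : ℂ} {T : ℝ}
    {u₀ : Hs s} {h : L2P} (h0 : F.ev 0 h = sobolevIso s u₀) (hh : F.SolvesWeak γ T h) :
    IsIVPSolution α β γ s b T u₀ (F.curve T h) := by
  obtain ⟨v, hv1, hv2, hv3, hv4⟩ := F.exists_physical hβ hs hb h
  obtain ⟨U, hU, hUh⟩ := exists_memBourgain α β s b h
  have hv : LocL3 T v := fun K hK _ => hv1 K hK
  refine ⟨fun _ => ?_, v, hv, ?_, ⟨U, hU, fun φ hφ => by rw [hUh, hv2 φ hφ.1]⟩,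
    (F.solvesEquation_iff hv (fun φ hφ => hv2 φ hφ.1) fun φ hφ => hv3 φ hφ.1).mpr hh⟩
  · rw [curve_apply, h0, LinearIsometryEquiv.symm_apply_apply]
  · filter_upwards [hv4] with t ht _ χ hχ
    rw [curve_apply, sobolevIso_symm_eq_pairing, ht χ hχ]

theorem solvesWeak_of_fixedPoint {γ : ℂ} {T : ℝ} (hT : 0 < T) (hT1 : T ≤ 1) {g : L2L} {h : L2P}
    (hh : F.picard γ T g h = h) : F.SolvesWeak γ T h := fun φ hφ => by
  nth_rewrite 1 [← hh]
  rw [picard, map_sub, map_smul, F.pairing_free hT1 hφ, F.pairing_duh hT hT1 hφ, smul_eq_mul]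
  ring

theorem ev_zero_of_fixedPoint (hb : 1 / 2 < b) {γ : ℂ} {T : ℝ} (hT : 0 < T) (hT1 : T ≤ 1) {g : L2L}
    {h : L2P} (hh : F.picard γ T g h = h) : F.ev 0 h = g := by
  rw [← hh, picard, map_sub, map_smul, F.ev_zero_free, F.ev_zero_duh hb hT hT1, smul_zero, sub_zero]

theorem dist_curve_le (T : ℝ) (h k : L2P) :
    dist (F.curve T h) (F.curve T k) ≤ |F.evBound| * ‖h - k‖ := by
  rw [ContinuousMap.dist_le (by positivity)]
  intro t
  rw [curve_apply, curve_apply, LinearIsometryEquiv.dist_map, dist_eq_norm, ← map_sub]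
  refine (F.norm_ev_le _ _).trans ?_
  gcongr
  exact le_abs_self _

theorem exists_solutionMap {b' : ℝ} (F : FlowOps α β s b b') (hβ : β ≠ 0)
    (hs : -(1 / 4) < s) (hb : 1 / 2 < b) (hbb' : b - 1 < b')
    (γ : ℂ) (R : ℝ) : ∃ T : ℝ, 0 < T ∧ ∃ S : Hs s → C(Set.Icc (-T) T, Hs s),
      ContinuousOn S (Metric.closedBall 0 R) ∧
      ∀ u₀ ∈ Metric.closedBall (0 : Hs s) R, IsIVPSolution α β γ s b T u₀ (S u₀) := by
  -- The image of 0 is the free evolution of the data, of norm at most `‖F.free‖ * R`, half the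
  -- radius; the time furnished by `exists_time` thus depends on R only.
  set r := 2 * (‖F.free‖ * R) with hr
  obtain ⟨T, hT, hT1, hcon⟩ := F.exists_time hbb' γ r
  have hfix : ∀ u : Hs s, ∃ h : L2P, ‖u‖ ≤ R → ‖h‖ ≤ r ∧ F.picard γ T (sobolevIso s u) h = h := by
    intro u
    by_cases hu : ‖u‖ ≤ R
    swap
    · exact ⟨0, fun h => absurd h hu⟩
    have hR : 0 ≤ R := (norm_nonneg u).trans hu
    obtain ⟨h, hh1, hh2, -⟩ := exists_fixedPoint_closedBall (E := L2P)
      (Φ := F.picard γ T (sobolevIso s u)) (r := r) (by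
        rw [picard, F.cubic_zero, map_zero, smul_zero, sub_zero, hr,
          mul_div_cancel_left₀ _ two_ne_zero]
        refine (F.free.le_opNorm _).trans ?_
        rw [LinearIsometryEquiv.norm_map]
        gcongr) (hcon T hT le_rfl _) (x := 0) (by rw [norm_zero]; positivity)
    exact ⟨h, fun _ => ⟨hh1, hh2⟩⟩
  choose H hH using hfix
  refine ⟨T, hT, fun u => F.curve T (H u), ?_, fun u hu => ?_⟩
  · have hlip : LipschitzOnWith (Real.toNNReal (|F.evBound| * (2 * ‖F.free‖)))
        (fun u => F.curve T (H u)) (Metric.closedBall 0 R) := by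
      refine LipschitzOnWith.of_dist_le_mul fun u hu w hw => ?_
      rw [mem_closedBall_zero_iff] at hu hw
      obtain ⟨hu1, hu2⟩ := hH u hu
      obtain ⟨hw1, hw2⟩ := hH w hw
      rw [Real.coe_toNNReal _ (by positivity)]
      refine (F.dist_curve_le T _ _).trans ?_
      rw [mul_assoc]
      gcongr
      -- The difference of the fixed points is the free evolution of the difference of the data plus
      -- a Picard difference with common data. The latter is at most half of the left side, whence a
      -- Lipschitz bound with constant `2 * ‖F.free‖`.
      have e : H u - H w = F.free (sobolevIso s (u - w)) +
          (F.picard γ T (sobolevIso s w) (H u) - F.picard γ T (sobolevIso s w) (H w)) := by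
        rw [hw2]
        nth_rewrite 1 [← hu2]
        simp only [picard, map_sub]
        abel
      have h1 := hcon T hT le_rfl (sobolevIso s w) _ _ hu1 hw1
      have h2 := F.free.le_opNorm (sobolevIso s (u - w))
      rw [LinearIsometryEquiv.norm_map] at h2
      have h3 := norm_add_le (F.free (sobolevIso s (u - w)))
        (F.picard γ T (sobolevIso s w) (H u) - F.picard γ T (sobolevIso s w) (H w))
      rw [← e] at h3
      rw [dist_eq_norm]
      linarith
    exact hlip.continuousOn
  · rw [mem_closedBall_zero_iff] at hu
    have hfp := (hH u hu).2
    exact F.isIVPSolution_curve hβ hs hb (F.ev_zero_of_fixedPoint hb hT hT1 hfp)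
      (F.solvesWeak_of_fixedPoint hT hT1 hfp)

theorem isIVPSolution_unique {b' : ℝ} (F : FlowOps α β s b b') (hβ : β ≠ 0)
    (hs : -(1 / 4) < s) (hb : 1 / 2 < b) (hbb' : b - 1 < b')
    {γ : ℂ} {T : ℝ} (hT : 0 < T) {u₀ : Hs s} {u₁ u₂ : C(Set.Icc (-T) T, Hs s)}
    (h₁ : IsIVPSolution α β γ s b T u₀ u₁) (h₂ : IsIVPSolution α β γ s b T u₀ u₂) : u₁ = u₂ := by
  obtain ⟨h, hh, hev⟩ := F.exists_coef_of_isIVPSolution hβ hs hb hT h₁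
  obtain ⟨k, hk, kev⟩ := F.exists_coef_of_isIVPSolution hβ hs hb hT h₂
  have h0T : (0 : ℝ) ∈ Set.Icc (-T) T := ⟨by linarith, hT.le⟩
  have h0 : F.ev 0 h = F.ev 0 k := by
    rw [← hev 0 h0T, ← kev 0 h0T, h₁.1 h0T, h₂.1 h0T]
  have hIoo := F.ev_eq_of_solvesWeak hβ hs hb hbb' hT hh hk h0
  have hcl : IsClosed {t | F.ev t h = F.ev t k} := isClosed_eq (F.continuous_ev h) (F.continuous_ev k)
  -- Weak solutions are controlled only in the open slab; continuity of the traces adds the two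
  -- endpoints.
  have hIcc : Set.Icc (-T) T ⊆ {t | F.ev t h = F.ev t k} := by
    rw [← closure_Ioo (by linarith : -T ≠ T)]
    exact closure_minimal hIoo hcl
  ext1 t
  apply (sobolevIso s).injective
  have ht : F.ev t h = F.ev t k := hIcc t.2
  rw [hev t t.2, kev t t.2, ht]

end FlowOps

end

theorem theorem2 (α β : ℝ) (γ : ℂ) (hβ : β ≠ 0) (s : ℝ) (hs : -(1 / 4 : ℝ) < s)
    (b : ℝ) (hb : (7 / 12 : ℝ) < b) (hb' : b < (11 / 12 : ℝ)) :
    -- existence and persistence on a time interval that depends only on the size of the data,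
    -- and continuous dependence on the data
    (∀ R : ℝ, 0 < R → ∃ T : ℝ, 0 < T ∧ ∃ S : Hs s → C(Set.Icc (-T) T, Hs s),
      ContinuousOn S (Metric.closedBall 0 R) ∧
      ∀ u₀ ∈ Metric.closedBall (0 : Hs s) R, IsIVPSolution α β γ s b T u₀ (S u₀)) ∧
    -- uniqueness
    (∀ T : ℝ, 0 < T → ∀ (u₀ : Hs s) (u₁ u₂ : C(Set.Icc (-T) T, Hs s)),
      IsIVPSolution α β γ s b T u₀ u₁ → IsIVPSolution α β γ s b T u₀ u₂ → u₁ = u₂) := by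
  -- The choice b' = -1/12 is the largest value admitted by the trilinear estimate, and with it b <
  -- 11/12 becomes b - 1 < b', the positivity of the exponent of T.
  obtain ⟨F⟩ := nonempty_flowOps α hβ (b' := -(1 / 12)) hs hb hb' le_rfl (by linarith)
  have hb2 : 1 / 2 < b := by linarith
  have hbb' : b - 1 < -(1 / 12) := by linarith
  exact ⟨fun R _ => F.exists_solutionMap hβ hs hb2 hbb' γ R,
    fun T hT u₀ u₁ u₂ h₁ h₂ => F.isIVPSolution_unique hβ hs hb2 hbb' hT h₁ h₂⟩
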